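/- **Conventions.** For every $N$ let $\Omega_N$ be a probability space. A random matrix $A_N$ is an $N\times N$ complex random matrix on $\Omega_N$; in items 1–3, 4 and 6 its entries have moments of any order. Put $\Phi_N(M)=\mathbb E\big[\frac1N\mathrm{Tr}\,M\big]$, let $\circ$ be the entrywise product, $\kappa_N(M_1,M_2)=\Phi_N(M_1\circ M_2)-\Phi_N(M_1)\Phi_N(M_2)$ and $\kappa(A_1,A_2)=\lim_N\kappa_N(A_1,A_2)$ when the limit exists. *Asymptotic $*$-freeness.* Families $\mathbf A_i=(A_{i,k})_{k}$ are asymptotically $*$-free if $\Phi_N(P(\mathbf A_1,\mathbf A_2,\dots))$ converges for every noncommutative $*$-polynomial $P$, and $\Phi_N\big(P_1(\mathbf A_{i_1})\cdots P_n(\mathbf A_{i_n})\big)\to0$ whenever $n\ge1$, $i_j\ne i_{j+1}$ and $\Phi_N(P_j(\mathbf A_{i_j}))\to0$ for all $j$. *Traffics.* A $*$-test graph $T$ in variables $x_j$ is a finite connected non-empty directed multigraph $(V,E)$ (loops allowed) with edges $e$ labelled $x_{\gamma(e)}^{\varepsilon(e)}$, $\varepsilon(e)\in\{1,*\}$; put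 $\mathrm{Tr}[T(\mathbf A)]=\sum_{\phi:V\to[N]}\prod_{e=(v,w)\in E}A_{\gamma(e)}^{\varepsilon(e)}(\phi(v),\phi(w))$. For a function $\tau$ of test graphs, $\tau^0$ is defined by $\tau[T]=\sum_{\pi}\tau^0[T^\pi]$, the sum being over the partitions $\pi$ of $V$, where $T^\pi$ identifies the vertices in a same block. If the variables are split into families, the colored components of $T$ are the connected components of the subgraphs formed by the edges labelled in a same family, and $T$ is a free product if the bipartite graph $\bar T$, whose vertices are the colored components and the vertices of $T$ lying in at least two of them, with edges given by membership, is a tree (the edgeless test graph counts as a free product). The families are asymptotically traffic-free if $\tau[T]=\lim_N\mathbb E[\frac1N\mathrm{Tr}\,T]$ exists for every $*$-test graph $T$ and $\tau^0[T]$ is the product of $\tau^0$ over the colored components of $T$ if $T$ is a free product, and $0$ otherwise. *Limiting spectral distribution.* A probability measure $\mu$ on $\mathbb C$ with all moments is a limiting empirical eigenvalue distribution of $D_N$ if $\mathbb E[\frac1N\sum_{i=1}^N\lambda_i^k\bar\lambda_i^l]\to\int z^k\bar z^l\,d\mu$ for all $k,l\ge0$, the $\lambda_i$ being the eigenvalues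 of $D_N$. *Local convergence.* A $\{0,1\}$-matrix is the adjacency matrix of a directed graph, possibly with loops, and is rooted at a uniform vertex independent of the matrix. It converges locally weakly to a random rooted graph $(G,\rho)$ if for every radius $p$ and every finite rooted digraph $H$ the probability that the ball of radius $p$ around the root is isomorphic to $H$ converges to the same probability for $(G,\rho)$. A digraph is $d$-regular if all in-degrees and out-degrees equal $d$. **Corollary.** 1. Let $\mathbf A_N=(A_1,A_2)$ and $\mathbf B_N=(B_1,B_2)$ be asymptotically traffic-free pairs of random matrices. If $\kappa(A_1,A_2)$ and $\kappa(B_1,B_2)$ exist and are nonzero, then $\mathbf A_N$ and $\mathbf B_N$ are not asymptotically $*$-free. 2. Let $A_N$ be asymptotically traffic-free from a diagonal random matrix $D_N$. If $\kappa(P(A_N),Q(A_N))\ne0$ for some $*$-polynomials $P,Q$, and $D_N$ has a limiting empirical eigenvalue distribution which is not a Dirac mass, then $A_N$ and $D_N$ are not asymptotically $*$-free. 3. Let $A_N$ satisfy the decorrelation property $\mathbb E\big[\prod_{k=1}^K\frac1N\mathrm{Tr}[T_k(A_N)]\big]-\prod_{k=1}^K\mathbb E\big[\frac1N\mathrm{Tr}[T_k(A_N)]\big]\to0$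 for all $K$ and all $*$-test graphs $T_1,\dots,T_K$. If $\kappa(P(A_N),Q(A_N))\ne0$ for some $*$-polynomials $P,Q$, then $A_N$ is not asymptotically $*$-free from $U_N\tilde A_NU_N^*$, where $\tilde A_N$ has the law of $A_N$, $U_N$ is a uniform permutation matrix, and $A_N,\tilde A_N,U_N$ are independent. 4. Let $N\ge3$ and let $A_N$ have null diagonal. Then $$\kappa_N(A_NA_N^*,A_NA_N^*)=(N^2-3N+2)\,\mathrm{Cov}\big(|A_{i,j}|^2,|A_{i,k}|^2\big)+(N-1)\,\mathrm{Var}\big(|A_{i,j}|^2\big),$$ where $(i,j,k)$ is uniform among the triples of distinct elements of $[N]$ and independent of $A_N$. 5. For each $N$ let $A_N$ be an $N\times N$ Wigner matrix: Hermitian, with independent entries on and below the diagonal, the diagonal entries of $\sqrt NA_N$ having law $\nu_N$ and those below the diagonal having law $\mu_N$ (real case) or the law of $(x+iy)/\sqrt2$ with $x,y$ independent of law $\mu_N$ (complex case), where $\mu_N,\nu_N$ are probability measures on $\mathbb R$ with all moments, which may depend on $N$, and $\mu_N$ has mean $0$ and variance $1$. Assume $\mathbb E[N|A_{i,j}|^4]\to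 a>0$ for $i\ne j$. Then $A_N$ is not asymptotically $*$-free from $U_N\tilde A_NU_N^*$, where $\tilde A_N$ has the law of $A_N$, $U_N$ is any random permutation matrix (e.g. the identity, or a uniform one) and $A_N,\tilde A_N,U_N$ are independent; and $A_N$ is not asymptotically $*$-free from any diagonal random matrix $D_N$ with all moments, independent of $A_N$, which has a limiting empirical eigenvalue distribution that is not a Dirac mass. 6. Let $A_N$ and $B_N$ be asymptotically traffic-free random matrices with entries in $\{0,1\}$ such that the number of ones in each row and column is bounded uniformly in $N$ and in the randomness. Suppose they are asymptotically $*$-free. If $B_N$ is not asymptotically scalar (that is, there is no constant $c$ with $\Phi_N((B_N-c)(B_N-c)^*)\to0$), then the graph of $A_N$ converges locally weakly to a random rooted graph that is almost surely $d$-regular for some deterministic $d$; likewise, with some deterministic $d'$, for $B_N$ if $A_N$ is not asymptotically scalar. In particular, both conclusions hold if neither matrix is asymptotically scalar. -/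

import Mathlib

open MeasureTheory ProbabilityTheory Filter Topology
open scoped Matrix ComplexConjugate

noncomputable section

namespace Traffic

/-! ### Random matrices, `*`-polynomials, asymptotic `*`-freeness -/

/-- A sequence of square random matrices: the `N`-th one has size `N` and lives on the
probability space `Ω N`. -/
abbrev MatrixSeq (Ω : ℕ → Type*) := ∀ N : ℕ, Ω N → Matrix (Fin N) (Fin N) ℂ

/-- Matrices carry the product `σ`-algebra of their entries. -/
instance matrixMeasurableSpace (m n : Type*) : MeasurableSpace (Matrix m n ℂ) :=
  inferInstanceAs (MeasurableSpace (m → n → ℂ))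

section Basic

/-- The entries of the random matrix `M` are random variables with moments of any order. -/
def HasAllMoments {Ω : Type*} [MeasurableSpace Ω] {N : ℕ} (P : Measure Ω)
    (M : Ω → Matrix (Fin N) (Fin N) ℂ) : Prop :=
  ∀ (i j : Fin N) (p : ℕ), MemLp (fun ω => M ω i j) p P

/-- `Φ_N(M) = 𝔼[(1/N) Tr M]`. -/
def meanTrace {Ω : Type*} [MeasurableSpace Ω] {N : ℕ} (P : Measure Ω)
    (M : Ω → Matrix (Fin N) (Fin N) ℂ) : ℂ :=
  ∫ ω, (M ω).trace / (N : ℂ) ∂P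

/-- The matrix `M` if `s = false`, its conjugate transpose if `s = true`. -/
def starIf {N : ℕ} (s : Bool) (M : Matrix (Fin N) (Fin N) ℂ) : Matrix (Fin N) (Fin N) ℂ :=
  if s then Mᴴ else M

/-- Noncommutative `*`-polynomials in the indeterminates `x_j`, `j ∈ J`:
the generator `(j, false)` is `x_j` and the generator `(j, true)` is `x_j^*`. -/
abbrev StarPoly (J : Type*) := FreeAlgebra ℂ (J × Bool)

/-- Evaluation of a `*`-polynomial in a family of matrices. -/
def StarPoly.eval {J : Type*} {N : ℕ} (p : StarPoly J) (A : J → Matrix (Fin N) (Fin N) ℂ) :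
    Matrix (Fin N) (Fin N) ℂ :=
  FreeAlgebra.lift ℂ (fun x : J × Bool => starIf x.2 (A x.1)) p

/-- The sequence of random matrices `P(A_N)` for a `*`-polynomial in one indeterminate. -/
def polySeq {Ω : ℕ → Type*} (p : StarPoly Unit) (A : MatrixSeq Ω) : MatrixSeq Ω :=
  fun N ω => p.eval (fun _ => A N ω)

/-- `κ_N(M₁, M₂) = Φ_N(M₁ ∘ M₂) - Φ_N(M₁) Φ_N(M₂)`, where `∘` is the Hadamard product. -/
def kappaN {Ω : Type*} [MeasurableSpace Ω] {N : ℕ} (P : Measure Ω)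
    (M₁ M₂ : Ω → Matrix (Fin N) (Fin N) ℂ) : ℂ :=
  meanTrace P (fun ω => M₁ ω ⊙ M₂ ω) - meanTrace P M₁ * meanTrace P M₂

/-- `κ(A₁, A₂) = lim κ_N(A₁, A₂)` exists and equals `k`. -/
def HasKappa {Ω : ℕ → Type*} [∀ N, MeasurableSpace (Ω N)] (P : ∀ N, Measure (Ω N))
    (A₁ A₂ : MatrixSeq Ω) (k : ℂ) : Prop :=
  Tendsto (fun N => kappaN (P N) (A₁ N) (A₂ N)) atTop (𝓝 k)

/-- Asymptotic `*`-freeness of the families `(A i k)_{k ∈ K i}`, `i ∈ ι`: the joint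
`*`-distribution converges, and the limit of `Φ_N(P₁(A_{i₁}) ⋯ P_n(A_{i_n}))`, `n ≥ 1`, vanishes
whenever neighbouring indices `i_j` are distinct and every `P_j(A_{i_j})` is asymptotically
centered. A word `(i₁, P₁), …, (i_n, P_n)` is encoded as a list. -/
def AsympStarFree {Ω : ℕ → Type*} [∀ N, MeasurableSpace (Ω N)] (P : ∀ N, Measure (Ω N))
    {ι : Type*} {K : ι → Type*} (A : ∀ i, K i → MatrixSeq Ω) : Prop :=
  (∀ p : StarPoly (Σ i, K i), ∃ l : ℂ, Tendsto
    (fun N => meanTrace (P N) (fun ω => p.eval (fun x => A x.1 x.2 N ω))) atTop (𝓝 l)) ∧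
  ∀ w : List (Σ i, StarPoly (K i)), w ≠ [] → w.IsChain (fun a b => a.1 ≠ b.1) →
    (∀ a ∈ w, Tendsto
      (fun N => meanTrace (P N) (fun ω => a.2.eval (fun k => A a.1 k N ω))) atTop (𝓝 0)) →
    Tendsto (fun N => meanTrace (P N)
      (fun ω => (w.map (fun a => a.2.eval (fun k => A a.1 k N ω))).prod)) atTop (𝓝 0)

end Basic

/-! ### `*`-test graphs and distributions of traffics -/

/-- A finite `*`-graph with edges labelled by the indeterminates `x_j^ε`, `j ∈ J`: loops and
multiple edges are allowed, and `star e = true` means that `e` carries the label `x_j^*`. -/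
structure StarGraph (J : Type*) where
  V : Type
  E : Type
  [fintypeV : Fintype V]
  [fintypeE : Fintype E]
  src : E → V
  tgt : E → V
  label : E → J
  star : E → Bool

attribute [instance] StarGraph.fintypeV StarGraph.fintypeE

namespace StarGraph

variable {J : Type*}

/-- The `*`-graph is non-empty and connected, that is, it is a `*`-test graph. -/
def Connected (T : StarGraph J) : Prop :=
  Nonempty T.V ∧
    ∀ v w : T.V, Relation.EqvGen (fun a b => ∃ e, T.src e = a ∧ T.tgt e = b) v w

open Classical in
/-- `Tr[T(A)]`, the sum over all maps `φ : V → [N]` of the products of the entries `A(φ(e))`. -/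
def trace (T : StarGraph J) {N : ℕ} (A : J → Matrix (Fin N) (Fin N) ℂ) : ℂ :=
  ∑ φ : T.V → Fin N, ∏ e : T.E, starIf (T.star e) (A (T.label e)) (φ (T.src e)) (φ (T.tgt e))

open Classical in
/-- `T^π`: the vertices in a same block of the partition `π` are identified. -/
def quot (T : StarGraph J) (π : Setoid T.V) : StarGraph J where
  V := Quotient π
  E := T.E
  src e := Quotient.mk π (T.src e)
  tgt e := Quotient.mk π (T.tgt e)
  label := T.label
  star := T.star

end StarGraph

instance finiteSetoid (V : Type*) [Finite V] : Finite (Setoid V) :=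
  Finite.of_injective (fun s : Setoid V => fun a b => s a b)
    (fun s t h => Setoid.ext fun a b => by
      have := congrFun (congrFun h a) b
      simp only at this
      rw [this])

instance fintypeSetoid (V : Type*) [Finite V] : Fintype (Setoid V) := Fintype.ofFinite _

theorem card_quot_lt {V : Type*} [Fintype V] (π : Setoid V) [Fintype (Quotient π)]
    (h : π ≠ ⊥) : Fintype.card (Quotient π) < Fintype.card V := by
  refine Fintype.card_lt_of_surjective_not_injective (Quotient.mk π) Quotient.mk_surjective ?_
  intro hinj
  apply h
  ext a b
  constructor
  · intro hab
    exact hinj (Quotient.sound hab)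
  · intro hab
    have hab' : a = b := hab
    subst hab'
    exact π.refl' a

open Classical in
/-- The injective version `τ⁰` of a map `τ` on `*`-test graphs, determined by
`τ[T] = ∑_{π ∈ 𝒫(V)} τ⁰[T^π]`; the finest partition `⊥` contributes `τ⁰[T]` itself. -/
def injState {J : Type*} (τ : StarGraph J → ℂ) (T : StarGraph J) : ℂ :=
  τ T - ∑ π : Setoid T.V, if _h : π = ⊥ then 0 else injState τ (T.quot π)
termination_by Fintype.card T.V
decreasing_by exact card_quot_lt π _h

/-! ### Traffic-freeness -/

namespace StarGraph

variable {ι : Type*} {K : ι → Type*}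

/-- The vertex `v` is an end of the edge `e`. -/
def Touches {J : Type*} (T : StarGraph J) (e : T.E) (v : T.V) : Prop :=
  T.src e = v ∨ T.tgt e = v

/-- Two edges lie in the same colored component if they are linked by a chain of edges labelled
in a same family, in which consecutive edges share a vertex. -/
def sameComp (T : StarGraph (Σ i, K i)) : Setoid T.E :=
  Relation.EqvGen.setoid
    (fun e f => (T.label e).1 = (T.label f).1 ∧ ∃ v, T.Touches e v ∧ T.Touches f v)

/-- The connected components of `T` that are labelled with variables in a same family. -/
abbrev Comp (T : StarGraph (Σ i, K i)) : Type := Quotient T.sameComp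

/-- The vertex `v` belongs to the colored component `c`. -/
def MemComp (T : StarGraph (Σ i, K i)) (v : T.V) (c : T.Comp) : Prop :=
  ∃ e : T.E, (Quotient.mk T.sameComp e : T.Comp) = c ∧ T.Touches e v

open Classical in
/-- A colored component, as a `*`-graph. -/
def comp (T : StarGraph (Σ i, K i)) (c : T.Comp) : StarGraph (Σ i, K i) where
  V := {v : T.V // T.MemComp v c}
  E := {e : T.E // (Quotient.mk T.sameComp e : T.Comp) = c}
  src e := ⟨T.src e.1, e.1, e.2, Or.inl rfl⟩
  tgt e := ⟨T.tgt e.1, e.1, e.2, Or.inr rfl⟩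
  label e := T.label e.1
  star e := T.star e.1

/-- The vertices of `T` that are common to several colored components. -/
abbrev Shared (T : StarGraph (Σ i, K i)) : Type :=
  {v : T.V // ∃ c c' : T.Comp, c ≠ c' ∧ T.MemComp v c ∧ T.MemComp v c'}

/-- The bipartite graph `T̄` on the colored components and the shared vertices, with an edge
between a component and each of the shared vertices that it contains. -/
def bar (T : StarGraph (Σ i, K i)) : SimpleGraph (T.Comp ⊕ T.Shared) :=
  SimpleGraph.fromRel fun x y =>
    ∃ (c : T.Comp) (v : T.Shared), x = Sum.inl c ∧ y = Sum.inr v ∧ T.MemComp v.1 c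

/-- `T` is a free product in the families of variables: `T̄` is a tree.
(The `*`-test graph without edges, for which `T̄` is empty, is a free product.) -/
def IsFreeProduct (T : StarGraph (Σ i, K i)) : Prop :=
  IsEmpty T.E ∨ T.bar.IsTree

end StarGraph

section AsymptoticTraffic

variable {Ω : ℕ → Type*} [∀ N, MeasurableSpace (Ω N)] (P : ∀ N, Measure (Ω N))

open Classical in
/-- Asymptotic traffic-freeness of the families `(A i k)_{k ∈ K i}`, `i ∈ ι`: the joint
distribution of traffics converges pointwise on `*`-test graphs, and the injective version of its
limit `τ` factorizes over the colored components of free products and vanishes on the other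
`*`-test graphs. (The values of `τ` off the connected graphs play no role.) -/
def AsympTrafficFree {ι : Type*} {K : ι → Type*} (A : ∀ i, K i → MatrixSeq Ω) : Prop :=
  ∃ τ : StarGraph (Σ i, K i) → ℂ,
    (∀ T : StarGraph (Σ i, K i), T.Connected → Tendsto
      (fun N => ∫ ω, T.trace (fun x => A x.1 x.2 N ω) / (N : ℂ) ∂(P N)) atTop (𝓝 (τ T))) ∧
    ∀ T : StarGraph (Σ i, K i), T.Connected →
      injState τ T = if T.IsFreeProduct then ∏ c : T.Comp, injState τ (T.comp c) else 0

/-- The decorrelation property of a sequence of random matrices: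
`𝔼[∏ₖ (1/N) Tr Tₖ(A_N)] - ∏ₖ 𝔼[(1/N) Tr Tₖ(A_N)] → 0` for all `*`-test graphs `T₁, …, T_n`. -/
def Decorrelation (A : MatrixSeq Ω) : Prop :=
  ∀ l : List (StarGraph Unit), (∀ T ∈ l, T.Connected) → Tendsto
    (fun N => ∫ ω, (l.map fun T => T.trace (fun _ => A N ω) / (N : ℂ)).prod ∂(P N) -
      (l.map fun T => ∫ ω, T.trace (fun _ => A N ω) / (N : ℂ) ∂(P N)).prod) atTop (𝓝 0)

end AsymptoticTraffic

/-! ### Spectra, permutation matrices, Wigner matrices -/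

/-- The probability measure `μ` on `ℂ` is the limit, in moments, of the mean empirical eigenvalue
distributions of `D_N`. Eigenvalues are counted with their algebraic multiplicities. -/
def HasLimitingEED {Ω : ℕ → Type*} [∀ N, MeasurableSpace (Ω N)] (P : ∀ N, Measure (Ω N))
    (D : MatrixSeq Ω) (μ : Measure ℂ) : Prop :=
  IsProbabilityMeasure μ ∧ ∀ k l : ℕ, Integrable (fun z : ℂ => z ^ k * conj z ^ l) μ ∧
    Tendsto (fun N => ∫ ω,
        ((D N ω).charpoly.roots.map (fun z : ℂ => z ^ k * conj z ^ l)).sum / (N : ℂ) ∂(P N))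
      atTop (𝓝 (∫ z, z ^ k * conj z ^ l ∂μ))

section OneMatrix

variable {Ω : Type*} [MeasurableSpace Ω] {N : ℕ}

/-- Almost surely, `U` is a permutation matrix. -/
def IsRandomPermMatrix (P : Measure Ω) (U : Ω → Matrix (Fin N) (Fin N) ℂ) : Prop :=
  AEMeasurable U P ∧ ∀ᵐ ω ∂P, ∃ s : Equiv.Perm (Fin N), U ω = s.permMatrix ℂ

/-- `U` is a uniform permutation matrix. -/
def IsUniformPermMatrix (P : Measure Ω) (U : Ω → Matrix (Fin N) (Fin N) ℂ) : Prop :=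
  AEMeasurable U P ∧
    ∀ s : Equiv.Perm (Fin N), P {ω | U ω = s.permMatrix ℂ} = 1 / (N.factorial : ENNReal)

/-- `A` is a real or complex `N × N` Wigner matrix: a Hermitian matrix with independent entries
on and below the diagonal, such that the diagonal entries of `√N A` have law `ν` and its entries
below the diagonal have law `μ` (real case) or the law of `(x + i y) / √2` with `x`, `y`
independent of law `μ` (complex case), where `μ` and `ν` are probability measures on `ℝ` with
moments of any order and `μ` has mean `0` and variance `1`. -/
def IsWigner (P : Measure Ω) (A : Ω → Matrix (Fin N) (Fin N) ℂ) : Prop :=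
  ∃ μ ν : Measure ℝ, IsProbabilityMeasure μ ∧ IsProbabilityMeasure ν ∧
    (∀ p : ℕ, MemLp (fun t : ℝ => t) p μ) ∧ (∀ p : ℕ, MemLp (fun t : ℝ => t) p ν) ∧
    ∫ t, t ∂μ = 0 ∧ ∫ t, t ^ 2 ∂μ = 1 ∧
    (∀ᵐ ω ∂P, (A ω).IsHermitian) ∧
    iIndepFun (fun (q : {q : Fin N × Fin N // q.2 ≤ q.1}) (ω : Ω) => A ω q.1.1 q.1.2) P ∧
    (∀ i, HasLaw (fun ω => (√(N : ℝ) : ℂ) * A ω i i) (ν.map fun t : ℝ => (t : ℂ)) P) ∧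
    ((∀ i j, j < i →
        HasLaw (fun ω => (√(N : ℝ) : ℂ) * A ω i j) (μ.map fun t : ℝ => (t : ℂ)) P) ∨
      ∀ i j, j < i → HasLaw (fun ω => (√(N : ℝ) : ℂ) * A ω i j)
        ((μ.prod μ).map fun t : ℝ × ℝ => ((t.1 : ℂ) + Complex.I * (t.2 : ℂ)) / (√(2 : ℝ) : ℂ)) P)

end OneMatrix

/-! ### Local weak convergence -/

/-- A rooted directed graph, possibly with loops. -/
structure RootedDigraph where
  V : Type
  adj : V → V → Prop
  root : V

namespace RootedDigraph

/-- The vertex `v` is at distance at most `p` from the root, orientations being forgotten. -/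
def Within (G : RootedDigraph) : ℕ → G.V → Prop
  | 0, v => v = G.root
  | p + 1, v => Within G p v ∨ ∃ w, Within G p w ∧ (G.adj w v ∨ G.adj v w)

theorem within_root (G : RootedDigraph) : ∀ p : ℕ, G.Within p G.root
  | 0 => rfl
  | p + 1 => Or.inl (within_root G p)

/-- The rooted subgraph induced by the vertices at distance at most `p` from the root. -/
def ball (G : RootedDigraph) (p : ℕ) : RootedDigraph where
  V := {v : G.V // G.Within p v}
  adj v w := G.adj v.1 w.1
  root := ⟨G.root, G.within_root p⟩

/-- Isomorphism of rooted directed graphs. -/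
def Isomorphic (G H : RootedDigraph) : Prop :=
  ∃ e : G.V ≃ H.V, e G.root = H.root ∧ ∀ v w, G.adj v w ↔ H.adj (e v) (e w)

/-- Every vertex has exactly `d` outgoing and exactly `d` incoming edges. -/
def IsRegular (G : RootedDigraph) (d : ℕ) : Prop :=
  ∀ v : G.V, {w | G.adj v w}.encard = d ∧ {w | G.adj w v}.encard = d

/-- The graph with adjacency matrix `M` (a matrix with entries in `{0, 1}`), rooted at `i`. -/
def ofMatrix {N : ℕ} (M : Matrix (Fin N) (Fin N) ℂ) (i : Fin N) : RootedDigraph where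
  V := Fin N
  adj v w := M v w = 1
  root := i

end RootedDigraph

/-- The random graphs with adjacency matrices `A_N`, rooted at a vertex chosen uniformly in `[N]`
independently of `A_N`, converge in the local weak topology to a random rooted graph that is
almost surely `d`-regular for a deterministic number `d`. -/
def ConvergesLocallyToRegular {Ω : ℕ → Type*} [∀ N, MeasurableSpace (Ω N)]
    (P : ∀ N, Measure (Ω N)) (A : MatrixSeq Ω) : Prop :=
  ∃ (d : ℕ) (Ω' : Type) (_ : MeasurableSpace Ω') (Q : Measure Ω') (G : Ω' → RootedDigraph),
    IsProbabilityMeasure Q ∧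
    (∀ (p : ℕ) (H : RootedDigraph), Finite H.V →
      MeasurableSet {ω | ((G ω).ball p).Isomorphic H}) ∧
    (∀ᵐ ω ∂Q, (G ω).IsRegular d) ∧
    ∀ (p : ℕ) (H : RootedDigraph), Finite H.V → Tendsto
      (fun N => (∑ i : Fin N,
        (P N).real {ω | ((RootedDigraph.ofMatrix (A N ω) i).ball p).Isomorphic H}) / (N : ℝ))
      atTop (𝓝 (Q.real {ω | ((G ω).ball p).Isomorphic H}))

/-- Entries in `{0, 1}`, with a number of ones in each row and column bounded uniformly in `N`
and in the randomness. -/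
def IsBoundedZeroOne {Ω : ℕ → Type*} [∀ N, MeasurableSpace (Ω N)]
    (P : ∀ N, Measure (Ω N)) (A : MatrixSeq Ω) : Prop :=
  ∃ C : ℕ, ∀ N, ∀ᵐ ω ∂(P N), (∀ i j, A N ω i j = 0 ∨ A N ω i j = 1) ∧
    (∀ i, {j | A N ω i j = 1}.ncard ≤ C) ∧ ∀ j, {i | A N ω i j = 1}.ncard ≤ C

/-- `A_N` is asymptotically a multiple of the identity:
`Φ_N((A_N - c)(A_N - c)^*) → 0` for some constant `c`. -/
def AsympScalar {Ω : ℕ → Type*} [∀ N, MeasurableSpace (Ω N)]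
    (P : ∀ N, Measure (Ω N)) (A : MatrixSeq Ω) : Prop :=
  ∃ c : ℂ, Tendsto (fun N => meanTrace (P N)
    (fun ω => (A N ω - c • (1 : Matrix (Fin N) (Fin N) ℂ)) *
      (A N ω - c • (1 : Matrix (Fin N) (Fin N) ℂ))ᴴ)) atTop (𝓝 0)

/-- Two families of random matrices, as a family of families. -/
def two {Ω : ℕ → Type*} {K : Type*} (A B : K → MatrixSeq Ω) : Bool → K → MatrixSeq Ω
  | false => A
  | true => B

/-- A random matrix, as a family with one element. -/
def single {Ω : ℕ → Type*} (A : MatrixSeq Ω) : Unit → MatrixSeq Ω := fun _ => A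

end Traffic

end

open Traffic

noncomputable section

open Finset (sum_congr univ mem_univ mul_sum mem_filter sum_comm sum_le_sum sum_add_distrib
  sum_eq_zero sum_const card_univ sum_filter sum_eq_single sum_ite_eq sum_mul_sum sum_ite_eq'
  sum_div sum_boole sum_nonneg mem_product ne_of_mem_erase sum_sub_distrib sum_mul prod_congr
  single_le_sum measurable_sum mem_singleton disjoint_singleton)
open Matrix (mul_apply diag_apply conjTranspose_apply hadamard_apply trace_add conjTranspose_mul
  trace_smul submatrix_apply conjTranspose_conjTranspose one_apply_ne trace_mul_comm trace_sub
  one_apply_eq)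
open Complex (normSq_eq_norm_sq ofReal_re ofReal_sum ofReal_natCast add_re ofReal_mul ofReal_div
  norm_real mul_conj)
open Function (update Injective Bijective)
open Relation (EqvGen ReflTransGen)
open Fintype (card_fin sum_equiv sum_prod_type sum_prod_type' ofFinite)
open Quotient (inductionOn sound)
open Equiv (Perm)
open Sum (inl inr)
open Set (disjoint_left ncard_eq_toFinset_card' toFinite)
open scoped Classical

namespace Traffic

/-- Complex matrices of size `N`. -/
notation "Mat[" N "]" => Matrix (Fin N) (Fin N) ℂ

/-- The kernel of a map. -/
notation "ker" => Setoid.ker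

variable {Ω : ℕ → Type*} [∀ N, MeasurableSpace (Ω N)] {P : ∀ N, Measure (Ω N)}
variable {ι : Type*} {K : ι → Type*} {J : Type*}

/-- Every matrix of the sequence has all moments. -/
abbrev Moments (P : ∀ N, Measure (Ω N)) (M : MatrixSeq Ω) : Prop :=
  ∀ N, HasAllMoments (P N) (M N)

/-! ### Random variables with all moments -/

section Moments

variable {Ω : Type*} [MeasurableSpace Ω] {P : Measure Ω}

/-- The random variable `f` has moments of any order. -/
def AllMom (P : Measure Ω) (f : Ω → ℂ) : Prop := ∀ p : ℕ, MemLp f p P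

theorem AllMom.mul {f g : Ω → ℂ} (hf : AllMom P f) (hg : AllMom P g) :
    AllMom P (fun ω => f ω * g ω) := by
  intro p
  have h : ENNReal.HolderTriple ((2 * p : ℕ) : ENNReal) ((2 * p : ℕ) : ENNReal) (p : ENNReal) := by
    constructor
    rcases Nat.eq_zero_or_pos p with rfl | hp
    · simp
    · have : ((2 * p : ℕ) : ENNReal) = 2 * (p : ENNReal) := by push_cast; rfl
      rw [this, ENNReal.mul_inv (Or.inl (by simp)) (Or.inl (by simp)), ← add_mul,
        ENNReal.inv_two_add_inv_two, one_mul]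
  exact MemLp.mul' (hg (2 * p)) (hf (2 * p))

theorem AllMom.add {f g : Ω → ℂ} (hf : AllMom P f) (hg : AllMom P g) :
    AllMom P (fun ω => f ω + g ω) := fun p => (hf p).add (hg p)

theorem AllMom.sub {f g : Ω → ℂ} (hf : AllMom P f) (hg : AllMom P g) :
    AllMom P (fun ω => f ω - g ω) := fun p => (hf p).sub (hg p)

theorem allMom_const [IsFiniteMeasure P] (c : ℂ) : AllMom P (fun _ => c) := fun _ => memLp_const c

theorem AllMom.star {f : Ω → ℂ} (hf : AllMom P f) : AllMom P (fun ω => star (f ω)) :=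
  fun p => (hf p).star

theorem AllMom.div_const {f : Ω → ℂ} (hf : AllMom P f) (c : ℂ) :
    AllMom P (fun ω => f ω / c) := by
  intro p
  simpa [div_eq_mul_inv] using (hf p).mul_const c⁻¹

theorem AllMom.const_mul {f : Ω → ℂ} (hf : AllMom P f) (c : ℂ) :
    AllMom P (fun ω => c * f ω) := fun p => (hf p).const_mul c

theorem AllMom.sum {ι : Type*} (s : Finset ι) {f : ι → Ω → ℂ} (hf : ∀ i ∈ s, AllMom P (f i)) :
    AllMom P (fun ω => ∑ i ∈ s, f i ω) := fun p => memLp_finsetSum s fun i hi => hf i hi p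

theorem AllMom.prod [IsFiniteMeasure P] {ι : Type*} (s : Finset ι) {f : ι → Ω → ℂ}
    (hf : ∀ i ∈ s, AllMom P (f i)) : AllMom P (fun ω => ∏ i ∈ s, f i ω) := by
  induction s using Finset.induction_on with
  | empty => simpa using allMom_const 1
  | insert a s ha ih =>
    simp only [Finset.prod_insert ha]
    exact (hf a (Finset.mem_insert_self _ _)).mul
      (ih fun i hi => hf i (Finset.mem_insert_of_mem hi))

theorem AllMom.integrable {f : Ω → ℂ} (hf : AllMom P f) : Integrable f P := by
  have := hf 1
  rwa [Nat.cast_one, memLp_one_iff_integrable] at this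

theorem AllMom.congr {f g : Ω → ℂ} (hf : AllMom P f) (h : f =ᵐ[P] g) : AllMom P g :=
  fun p => (memLp_congr_ae h).1 (hf p)

variable {N : ℕ}

theorem HasAllMoments.entry {M : Ω → Mat[N]} (h : HasAllMoments P M)
    (i j : Fin N) : AllMom P (fun ω => M ω i j) := h i j

theorem HasAllMoments.mul {M L : Ω → Mat[N]} (hM : HasAllMoments P M)
    (hL : HasAllMoments P L) : HasAllMoments P (fun ω => M ω * L ω) := by
  intro i j
  simp only [mul_apply]
  exact AllMom.sum _ fun k _ => (hM.entry i k).mul (hL.entry k j)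

theorem HasAllMoments.hadamard {M L : Ω → Mat[N]} (hM : HasAllMoments P M)
    (hL : HasAllMoments P L) : HasAllMoments P (fun ω => M ω ⊙ L ω) := by
  intro i j
  simp only [hadamard_apply]
  exact (hM.entry i j).mul (hL.entry i j)

theorem HasAllMoments.add {M L : Ω → Mat[N]} (hM : HasAllMoments P M)
    (hL : HasAllMoments P L) : HasAllMoments P (fun ω => M ω + L ω) :=
  fun i j => (hM.entry i j).add (hL.entry i j)

theorem HasAllMoments.conjTranspose {M : Ω → Mat[N]}
    (hM : HasAllMoments P M) : HasAllMoments P (fun ω => (M ω)ᴴ) :=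
  fun i j => (hM.entry j i).star

theorem HasAllMoments.starIf {M : Ω → Mat[N]}
    (hM : HasAllMoments P M) (s : Bool) : HasAllMoments P (fun ω => starIf s (M ω)) := by
  cases s
  · simpa [Traffic.starIf] using hM
  · simpa [Traffic.starIf] using hM.conjTranspose

theorem hasAllMoments_const [IsFiniteMeasure P] (M : Mat[N]) :
    HasAllMoments P (fun _ => M) := fun i j => allMom_const (M i j)

theorem HasAllMoments.polyEval [IsFiniteMeasure P] {J : Type*}
    {A : J → Ω → Mat[N]}
    (hA : ∀ k, HasAllMoments P (A k)) (p : StarPoly J) :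
    HasAllMoments P (fun ω => p.eval fun k => A k ω) := by
  induction p using FreeAlgebra.induction with
  | grade0 c =>
    simp only [StarPoly.eval, AlgHom.commutes]
    exact hasAllMoments_const _
  | grade1 x =>
    simp only [StarPoly.eval, FreeAlgebra.lift_ι_apply]
    exact (hA x.1).starIf x.2
  | mul a b ha hb =>
    simp only [StarPoly.eval, map_mul] at ha hb ⊢
    exact ha.mul hb
  | add a b ha hb =>
    simp only [StarPoly.eval, map_add] at ha hb ⊢
    exact ha.add hb

theorem HasAllMoments.eval [IsFiniteMeasure P] {A : Ω → Mat[N]} (hA : HasAllMoments P A)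
    (p : StarPoly Unit) : HasAllMoments P (fun ω => p.eval fun _ => A ω) :=
  HasAllMoments.polyEval (fun _ => hA) p

theorem HasAllMoments.trace {M : Ω → Mat[N]} (hM : HasAllMoments P M) :
    AllMom P (fun ω => (M ω).trace) := by
  simp only [Matrix.trace, diag_apply]
  exact AllMom.sum _ fun i _ => hM.entry i i

theorem meanTrace_add {M L : Ω → Mat[N]} (hM : HasAllMoments P M)
    (hL : HasAllMoments P L) :
    meanTrace P (fun ω => M ω + L ω) = meanTrace P M + meanTrace P L := by
  simp only [meanTrace, trace_add, add_div]
  exact integral_add (hM.trace.div_const _).integrable (hL.trace.div_const _).integrable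

theorem meanTrace_smul (c : ℂ) (M : Ω → Mat[N]) :
    meanTrace P (fun ω => c • M ω) = c * meanTrace P M := by
  simp only [meanTrace, trace_smul, smul_eq_mul, mul_div_assoc]
  exact integral_const_mul _ _

end Moments

/-! ### Injective traces -/

namespace StarGraph

/-- The product of the entries `A(φ(e))` over the edges `e`. -/
def weight (T : StarGraph J) {N : ℕ} (A : J → Mat[N]) (φ : T.V → Fin N) : ℂ :=
  ∏ e : T.E, starIf (T.star e) (A (T.label e)) (φ (T.src e)) (φ (T.tgt e))

/-- The sum of the weights of the maps `φ` whose kernel lies in `S`. -/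
def traceOn (T : StarGraph J) (S : Set (Setoid T.V)) {N : ℕ}
    (A : J → Mat[N]) : ℂ :=
  ∑ φ : T.V → Fin N, if ker φ ∈ S then T.weight A φ else 0

theorem traceOn_univ (T : StarGraph J) {N : ℕ} (A : J → Mat[N]) :
    T.traceOn Set.univ A = T.trace A := by
  simp only [traceOn, trace, weight, Set.mem_univ, if_true]

theorem traceOn_eq_sum (T : StarGraph J) (S : Set (Setoid T.V)) {N : ℕ}
    (A : J → Mat[N]) [DecidablePred (· ∈ S)] :
    T.traceOn S A = ∑ π : Setoid T.V, if π ∈ S then T.traceOn {π} A else 0 := by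
  have : ∀ π : Setoid T.V, (if π ∈ S then T.traceOn {π} A else 0) =
      ∑ φ : T.V → Fin N, if ker φ = π ∧ π ∈ S then T.weight A φ else 0 := by
    intro π
    by_cases h : π ∈ S
    · simp only [h, if_true, and_true, traceOn, Set.mem_singleton_iff]
    · simp [h]
  simp only [this]
  rw [sum_comm, traceOn]
  refine sum_congr rfl fun φ _ => ?_
  rw [sum_eq_single (ker φ)]
  · simp
  · intro π _ h
    rw [if_neg]
    exact fun h' => h h'.1.symm
  · intro h; exact absurd (mem_univ _) h

/-- Sums over the maps with kernel `π` are sums over the injective maps on the quotient. -/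
theorem traceOn_quot (T : StarGraph J) (π : Setoid T.V) {N : ℕ}
    (A : J → Mat[N]) :
    (T.quot π).traceOn {⊥} A = T.traceOn {π} A := by
  unfold traceOn
  refine (@sum_filter _ _ univ _ (fun ψ => ker ψ ∈ ({⊥} : Set _)) (_)
    (fun ψ => (T.quot π).weight A ψ)).symm.trans (Eq.trans ?_
      (@sum_filter _ _ univ _ (fun φ => ker φ ∈ ({π} : Set _)) (_)
    (fun φ => T.weight A φ)))
  refine Finset.sum_bij' (fun ψ _ => fun v => ψ (Quotient.mk π v))
    (fun φ h => Quotient.lift φ (by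
      intro a b hab
      have h1 : ker φ = π := by simpa using h
      have h2 : (ker φ) a b := by rw [h1]; exact hab
      exact h2)) ?_ ?_ ?_ ?_ ?_
  · intro ψ hψ
    have h1 : ker ψ = ⊥ := by simpa using hψ
    have hinj : Injective ψ := by
      intro a b hab
      have h2 : (ker ψ) a b := hab
      rw [h1] at h2
      exact h2
    simp only [mem_filter, mem_univ, true_and, Set.mem_singleton_iff]
    ext a b
    constructor
    · intro h
      exact Quotient.exact (hinj h)
    · intro h
      exact congrArg ψ (sound h)
  · intro φ h
    have h1 : ker φ = π := by simpa using h
    refine mem_filter.2 ⟨mem_univ _, ?_⟩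
    change ker _ = ⊥
    ext a b
    constructor
    · induction a using inductionOn
      induction b using inductionOn
      rename_i a b
      intro hab
      have h2 : (ker φ) a b := hab
      rw [h1] at h2
      exact sound h2
    · intro hab
      have hab' : a = b := hab
      subst hab'
      rfl
  · intro ψ _
    funext a
    induction a using inductionOn
    rfl
  · intro φ _
    rfl
  · intro ψ _
    rfl

theorem allMom_traceOn {Ω : Type*} [MeasurableSpace Ω] {P : Measure Ω} [IsFiniteMeasure P]
    (T : StarGraph J) (S : Set (Setoid T.V)) {N : ℕ} {A : J → Ω → Mat[N]}
    (hA : ∀ k, HasAllMoments P (A k)) :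
    AllMom P (fun ω => T.traceOn S (fun k => A k ω)) := by
  unfold traceOn
  refine AllMom.sum _ fun φ _ => ?_
  split_ifs
  · exact AllMom.prod _ fun e _ => ((hA _).starIf _).entry _ _
  · exact allMom_const 0

/-- Quotients of connected graphs are connected. -/
theorem Connected.quot {T : StarGraph J} (h : T.Connected) (π : Setoid T.V) :
    (T.quot π).Connected := by
  obtain ⟨⟨v⟩, h⟩ := h
  refine ⟨⟨Quotient.mk π v⟩, fun a b => ?_⟩
  induction a using inductionOn
  induction b using inductionOn
  rename_i a b
  have := h a b
  induction this with
  | rel x y hxy =>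
    obtain ⟨e, rfl, rfl⟩ := hxy
    exact EqvGen.rel _ _ ⟨e, rfl, rfl⟩
  | refl x => exact EqvGen.refl _
  | symm x y _ ih => exact EqvGen.symm _ _ ih
  | trans x y z _ _ ih1 ih2 => exact EqvGen.trans _ _ _ ih1 ih2

/-- Isomorphism of `*`-graphs. -/
structure Iso (T T' : StarGraph J) where
  onV : T.V ≃ T'.V
  onE : T.E ≃ T'.E
  src : ∀ e, T'.src (onE e) = onV (T.src e)
  tgt : ∀ e, T'.tgt (onE e) = onV (T.tgt e)
  label : ∀ e, T'.label (onE e) = T.label e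
  star : ∀ e, T'.star (onE e) = T.star e

theorem Iso.traceOn_bot {T T' : StarGraph J} (i : Iso T T') {N : ℕ}
    (A : J → Mat[N]) : T.traceOn {⊥} A = T'.traceOn {⊥} A := by
  unfold traceOn
  refine sum_equiv (Equiv.arrowCongr i.onV (Equiv.refl (Fin N))) _ _ fun φ => ?_
  have h1 : (ker φ ∈ ({⊥} : Set (Setoid T.V))) ↔
      (ker (Equiv.arrowCongr i.onV (Equiv.refl (Fin N)) φ) ∈ ({⊥} : Set (Setoid T'.V))) := by
    simp only [Set.mem_singleton_iff, ← Setoid.injective_iff_ker_bot]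
    constructor
    · intro h
      exact h.comp i.onV.symm.injective
    · intro h
      have := h.comp i.onV.injective
      simpa [Function.comp_def] using this
  simp only [h1]
  congr 1
  unfold weight
  refine Fintype.prod_equiv i.onE _ _ fun e => ?_
  simp [i.src, i.tgt, i.label, i.star]

theorem Iso.connected {T T' : StarGraph J} (i : Iso T T') (h : T.Connected) : T'.Connected := by
  obtain ⟨⟨v⟩, h⟩ := h
  refine ⟨⟨i.onV v⟩, fun a b => ?_⟩
  have := h (i.onV.symm a) (i.onV.symm b)
  have key : ∀ x y, EqvGen (fun a b => ∃ e, T.src e = a ∧ T.tgt e = b) x y →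
      EqvGen (fun a b => ∃ e, T'.src e = a ∧ T'.tgt e = b) (i.onV x) (i.onV y) := by
    intro x y hxy
    induction hxy with
    | rel x y hxy =>
      obtain ⟨e, rfl, rfl⟩ := hxy
      exact EqvGen.rel _ _ ⟨i.onE e, i.src e, i.tgt e⟩
    | refl x => exact EqvGen.refl _
    | symm x y _ ih => exact EqvGen.symm _ _ ih
    | trans x y z _ _ ih1 ih2 => exact EqvGen.trans _ _ _ ih1 ih2
  simpa using key _ _ this

end StarGraph

/-! ### Limits of injective traces -/

section Limits

variable (P) (A : J → MatrixSeq Ω)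

/-- The expected normalised sum of the weights of the maps with kernel in `S`. -/
def meanOn (T : StarGraph J) (S : Set (Setoid T.V)) (N : ℕ) : ℂ :=
  ∫ ω, T.traceOn S (fun x => A x N ω) / (N : ℂ) ∂(P N)

/-- `τ` is the limit of the mean normalised traces of the `*`-test graphs in `A_N`. -/
def TrafficLimit (τ : StarGraph J → ℂ) : Prop :=
  ∀ T : StarGraph J, T.Connected → Tendsto
    (fun N => ∫ ω, T.trace (fun x => A x N ω) / (N : ℂ) ∂(P N)) atTop (𝓝 (τ T))

variable {P A} [∀ N, IsProbabilityMeasure (P N)] (hA : ∀ k, Moments P (A k))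
include hA

theorem integrable_traceOn (T : StarGraph J) (S : Set (Setoid T.V)) (N : ℕ) :
    Integrable (fun ω => T.traceOn S (fun x => A x N ω) / (N : ℂ)) (P N) :=
  ((T.allMom_traceOn S fun k => hA k N).div_const _).integrable

theorem meanOn_eq_sum (T : StarGraph J) (S : Set (Setoid T.V)) [DecidablePred (· ∈ S)] (N : ℕ) :
    meanOn P A T S N = ∑ π : Setoid T.V, if π ∈ S then meanOn P A (T.quot π) {⊥} N else 0 := by
  unfold meanOn
  simp_rw [T.traceOn_eq_sum S, sum_div]
  rw [integral_finsetSum]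
  · refine sum_congr rfl fun π _ => ?_
    split_ifs
    · simp_rw [T.traceOn_quot π]
    · simp
  · intro π _
    split_ifs
    · exact integrable_traceOn hA T {π} N
    · simp

theorem tendsto_meanOn_bot {τ : StarGraph J → ℂ} (hτ : TrafficLimit P A τ) :
    ∀ (n : ℕ) (T : StarGraph J), Fintype.card T.V = n → T.Connected →
      Tendsto (meanOn P A T {⊥}) atTop (𝓝 (injState τ T)) := by
  intro n
  induction n using Nat.strong_induction_on with
  | _ n ih =>
    intro T hn hT
    have h1 := hτ T hT
    have h2 : ∀ N, meanOn P A T {⊥} N = (∫ ω, T.trace (fun x => A x N ω) / (N : ℂ) ∂(P N)) -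
        ∑ π : Setoid T.V, if π = ⊥ then 0 else meanOn P A (T.quot π) {⊥} N := by
      intro N
      have h3 := meanOn_eq_sum hA T Set.univ N
      have h4 : meanOn P A T Set.univ N = ∫ ω, T.trace (fun x => A x N ω) / (N : ℂ) ∂(P N) := by
        simp [meanOn, StarGraph.traceOn_univ]
      have h5 : meanOn P A (T.quot ⊥) {⊥} N = meanOn P A T {⊥} N := by
        simp only [meanOn, StarGraph.traceOn_quot]
      rw [← h4, h3, ← h5]
      simp only [Set.mem_univ, if_true]
      rw [eq_sub_iff_add_eq]
      have h6 : meanOn P A (T.quot ⊥) {⊥} N = ∑ π : Setoid T.V,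
          if π = ⊥ then meanOn P A (T.quot π) {⊥} N else 0 := by
        rw [sum_ite_eq' univ (⊥ : Setoid T.V)]
        simp
      rw [h6, ← sum_add_distrib]
      refine sum_congr rfl fun π _ => ?_
      split_ifs <;> simp
    rw [injState]
    refine Tendsto.congr (fun N => (h2 N).symm) (h1.sub (tendsto_finsetSum _ fun π _ => ?_))
    by_cases hπ : π = ⊥
    · simp [hπ]
    · simp only [hπ, if_false, dif_neg, not_false_eq_true]
      refine ih _ ?_ (T.quot π) rfl (hT.quot π)
      rw [← hn]
      exact card_quot_lt π hπ

theorem tendsto_meanOn {τ : StarGraph J → ℂ} (hτ : TrafficLimit P A τ) (T : StarGraph J)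
    (S : Set (Setoid T.V)) [DecidablePred (· ∈ S)] (hS : ∀ π ∈ S, (T.quot π).Connected) :
    Tendsto (meanOn P A T S) atTop
      (𝓝 (∑ π : Setoid T.V, if π ∈ S then injState τ (T.quot π) else 0)) := by
  refine Tendsto.congr (fun N => (meanOn_eq_sum hA T S N).symm) (tendsto_finsetSum _ fun π _ => ?_)
  split_ifs with h
  · exact tendsto_meanOn_bot hA hτ _ _ rfl (hS π h)
  · exact tendsto_const_nhds

theorem injState_iso {τ : StarGraph J → ℂ} (hτ : TrafficLimit P A τ) {T T' : StarGraph J}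
    (i : T.Iso T') (hT : T.Connected) : injState τ T = injState τ T' := by
  have h1 := tendsto_meanOn_bot hA hτ _ T rfl hT
  have h2 := tendsto_meanOn_bot hA hτ _ T' rfl (i.connected hT)
  refine tendsto_nhds_unique h1 (Tendsto.congr (fun N => ?_) h2)
  simp only [meanOn, i.traceOn_bot]

/-- The one-vertex graph without edges has injective state `1`. -/
theorem injState_point {τ : StarGraph J → ℂ} (hτ : TrafficLimit P A τ) {T : StarGraph J}
    (hT : T.Connected) [hE : IsEmpty T.E] [hV : Subsingleton T.V] : injState τ T = 1 := by
  have h1 := tendsto_meanOn_bot hA hτ _ T rfl hT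
  refine tendsto_nhds_unique h1 (Tendsto.congr' ?_ tendsto_const_nhds)
  filter_upwards [eventually_gt_atTop 0] with N hN
  obtain ⟨⟨v⟩, -⟩ := hT
  have : Unique T.V := ⟨⟨v⟩, fun a => Subsingleton.elim _ _⟩
  have h2 : ∀ φ : T.V → Fin N, ker φ = ⊥ := fun φ =>
    (Setoid.injective_iff_ker_bot φ).1 (Function.injective_of_subsingleton φ)
  have hN' : (N : ℂ) ≠ 0 := by exact_mod_cast hN.ne'
  simp [meanOn, StarGraph.traceOn, StarGraph.weight, h2, hN']

end Limits

/-! ### Free products and separation -/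

namespace StarGraph

section Linked

variable (T : StarGraph J)

/-- The vertices are joined by a walk along edges that satisfy `p`. -/
def Linked (p : T.E → Prop) : T.V → T.V → Prop :=
  ReflTransGen fun a b => ∃ e, p e ∧ ((T.src e = a ∧ T.tgt e = b) ∨ (T.src e = b ∧ T.tgt e = a))

variable {T} {p q : T.E → Prop}

theorem Linked.refl (v : T.V) : T.Linked p v v := ReflTransGen.refl

theorem Linked.trans {u v w : T.V} (h : T.Linked p u v) (h' : T.Linked p v w) : T.Linked p u w :=
  ReflTransGen.trans h h'

theorem Linked.symm {v w : T.V} (h : T.Linked p v w) : T.Linked p w v := by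
  have hs : Std.Symm fun a b => ∃ e, p e ∧
      ((T.src e = a ∧ T.tgt e = b) ∨ (T.src e = b ∧ T.tgt e = a)) :=
    ⟨fun a b ⟨e, he, h⟩ => ⟨e, he, h.symm⟩⟩
  exact (ReflTransGen.stdSymm (r := fun a b => ∃ e, p e ∧
      ((T.src e = a ∧ T.tgt e = b) ∨ (T.src e = b ∧ T.tgt e = a)))).symm _ _ h

theorem Linked.mono (hpq : ∀ e, p e → q e) {v w : T.V} (h : T.Linked p v w) : T.Linked q v w :=
  ReflTransGen.mono (fun _ _ ⟨e, he, h⟩ => ⟨e, hpq e he, h⟩) _ _ h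

theorem linked_of_touches {e : T.E} (he : p e) {v w : T.V} (hv : T.Touches e v)
    (hw : T.Touches e w) : T.Linked p v w := by
  rcases hv with rfl | rfl <;> rcases hw with rfl | rfl
  · exact Linked.refl _
  · exact ReflTransGen.single ⟨e, he, Or.inl ⟨rfl, rfl⟩⟩
  · exact ReflTransGen.single ⟨e, he, Or.inr ⟨rfl, rfl⟩⟩
  · exact Linked.refl _

/-- Induction along walks. -/
theorem Linked.induction {v : T.V} {motive : T.V → Prop} (h0 : motive v)
    (h1 : ∀ a b e, T.Linked p v a → motive a → p e → T.Touches e a → T.Touches e b → motive b)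
    {w : T.V} (h : T.Linked p v w) : motive w := by
  induction h with
  | refl => exact h0
  | tail hab hbc ih =>
    obtain ⟨e, he, h⟩ := hbc
    rcases h with ⟨ha, hb⟩ | ⟨ha, hb⟩
    · exact h1 _ _ e hab ih he (Or.inl ha) (Or.inr hb)
    · exact h1 _ _ e hab ih he (Or.inr hb) (Or.inl ha)

theorem linked_of_eqvGen {v w : T.V}
    (h : EqvGen (fun a b => ∃ e, T.src e = a ∧ T.tgt e = b) v w) :
    T.Linked (fun _ => True) v w := by
  induction h with
  | rel x y h =>
    obtain ⟨e, h1, h2⟩ := h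
    exact linked_of_touches (e := e) trivial (Or.inl h1) (Or.inr h2)
  | refl x => exact Linked.refl _
  | symm x y _ ih => exact ih.symm
  | trans x y z _ _ ih1 ih2 => exact ih1.trans ih2

theorem connected_iff : T.Connected ↔ Nonempty T.V ∧ ∀ v w, T.Linked (fun _ => True) v w := by
  refine and_congr_right fun _ => forall₂_congr fun v w => ⟨linked_of_eqvGen, fun h => ?_⟩
  induction h with
  | refl => exact EqvGen.refl _
  | tail hab hbc ih =>
    obtain ⟨e, -, h⟩ := hbc
    rcases h with ⟨ha, hb⟩ | ⟨ha, hb⟩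
    · exact ih.trans _ _ _ (EqvGen.rel _ _ ⟨e, ha, hb⟩)
    · exact ih.trans _ _ _ (EqvGen.symm _ _ (EqvGen.rel _ _ ⟨e, ha, hb⟩))

end Linked

variable {T : StarGraph (Σ i, K i)}

/-- The colored component of an edge. -/
def compOf (T : StarGraph (Σ i, K i)) (e : T.E) : T.Comp := Quotient.mk T.sameComp e

theorem compOf_eq_iff {e f : T.E} : T.compOf e = T.compOf f ↔ T.sameComp e f :=
  ⟨fun h => Quotient.exact h, fun h => sound h⟩

theorem compOf_eq_of_touches {e f : T.E} {v : T.V} (hc : (T.label e).1 = (T.label f).1)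
    (he : T.Touches e v) (hf : T.Touches f v) : T.compOf e = T.compOf f :=
  compOf_eq_iff.2 (EqvGen.rel _ _ ⟨hc, v, he, hf⟩)

theorem color_eq_of_compOf_eq {e f : T.E} (h : T.compOf e = T.compOf f) :
    (T.label e).1 = (T.label f).1 := by
  have h1 : EqvGen (fun e f => (T.label e).1 = (T.label f).1 ∧
      ∃ v, T.Touches e v ∧ T.Touches f v) e f := compOf_eq_iff.1 h
  clear h
  induction h1 with
  | rel x y h => exact h.1
  | refl x => rfl
  | symm x y _ ih => exact ih.symm
  | trans x y z _ _ ih1 ih2 => exact ih1.trans ih2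

theorem memComp_compOf {e : T.E} {v : T.V} (h : T.Touches e v) : T.MemComp v (T.compOf e) :=
  ⟨e, rfl, h⟩

/-- Distinct vertices of a colored component are never joined by a walk that avoids it. -/
def Sep (T : StarGraph (Σ i, K i)) : Prop :=
  ∀ (c : T.Comp) (v w : T.V), T.MemComp v c → T.MemComp w c →
    T.Linked (fun e => T.compOf e ≠ c) v w → v = w

theorem linked_of_memComp {c : T.Comp} {v w : T.V} (hv : T.MemComp v c) (hw : T.MemComp w c) :
    T.Linked (fun e => T.compOf e = c) v w := by
  obtain ⟨e, he, hev⟩ := hv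
  obtain ⟨f, hf, hfw⟩ := hw
  have hef : T.sameComp e f := compOf_eq_iff.1 (he.trans hf.symm)
  have key : ∀ e f, EqvGen
      (fun e f => (T.label e).1 = (T.label f).1 ∧ ∃ v, T.Touches e v ∧ T.Touches f v) e f →
      T.compOf e = c → T.compOf f = c → ∀ v w, T.Touches e v → T.Touches f w →
      T.Linked (fun e => T.compOf e = c) v w := by
    intro e f h
    induction h with
    | rel x y h =>
      intro hx hy v w hv hw
      obtain ⟨-, u, hu, hu'⟩ := h
      exact (linked_of_touches (e := x) hx hv hu).trans (linked_of_touches (e := y) hy hu' hw)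
    | refl x =>
      intro hx _ v w hv hw
      exact linked_of_touches (e := x) hx hv hw
    | symm x y _ ih =>
      intro hx hy v w hv hw
      exact (ih hy hx w v hw hv).symm
    | trans x y z hxy _ ih1 ih2 =>
      intro hx hz v w hv hw
      have hy : T.compOf y = c := by rw [← hx]; exact (compOf_eq_iff.2 hxy).symm
      exact (ih1 hx hy v (T.src y) hv (Or.inl rfl)).trans (ih2 hy hz _ w (Or.inl rfl) hw)
  exact key e f hef he hf v w hev hfw

theorem bar_adj_inl_inr {c : T.Comp} {v : T.Shared} :
    T.bar.Adj (inl c) (inr v) ↔ T.MemComp v.1 c := by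
  simp only [bar, SimpleGraph.fromRel_adj]
  constructor
  · rintro ⟨-, ⟨c', v', h1, h2, h3⟩ | ⟨c', v', h1, h2, h3⟩⟩
    · cases h1; cases h2; exact h3
    · cases h1
  · intro h
    exact ⟨by simp, Or.inl ⟨c, v, rfl, rfl, h⟩⟩

theorem not_bar_adj_inl_inl {c c' : T.Comp} : ¬ T.bar.Adj (inl c) (inl c') := by
  simp only [bar, SimpleGraph.fromRel_adj]
  rintro ⟨-, ⟨c', v', h1, h2, h3⟩ | ⟨c', v', h1, h2, h3⟩⟩
  · cases h2
  · cases h2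

theorem not_bar_adj_inr_inr {v v' : T.Shared} : ¬ T.bar.Adj (inr v) (inr v') := by
  simp only [bar, SimpleGraph.fromRel_adj]
  rintro ⟨-, ⟨c', v', h1, h2, h3⟩ | ⟨c', v', h1, h2, h3⟩⟩
  · cases h1
  · cases h1

theorem bar_reachable_of_touches {e f : T.E} {v : T.V} (he : T.Touches e v)
    (hf : T.Touches f v) : T.bar.Reachable (inl (T.compOf e)) (inl (T.compOf f)) := by
  by_cases h : T.compOf e = T.compOf f
  · rw [h]
  · let s : T.Shared := ⟨v, _, _, h, memComp_compOf he, memComp_compOf hf⟩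
    have h1 : T.bar.Adj (inl (T.compOf e)) (inr s) := bar_adj_inl_inr.2 (memComp_compOf he)
    have h2 : T.bar.Adj (inl (T.compOf f)) (inr s) := bar_adj_inl_inr.2 (memComp_compOf hf)
    exact h1.reachable.trans h2.symm.reachable

theorem bar_connected (hT : T.Connected) (hE : Nonempty T.E) : T.bar.Connected := by
  obtain ⟨e0⟩ := hE
  have key : ∀ e f : T.E, T.bar.Reachable (inl (T.compOf e)) (inl (T.compOf f)) := by
    intro e f
    have h := (connected_iff.1 hT).2 (T.src e) (T.src f)
    have : ∀ w, T.Linked (fun _ => True) (T.src e) w → ∀ f, T.Touches f w →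
        T.bar.Reachable (inl (T.compOf e)) (inl (T.compOf f)) := by
      intro w hw
      refine Linked.induction
        (motive := fun w => ∀ f, T.Touches f w →
          T.bar.Reachable (inl (T.compOf e)) (inl (T.compOf f))) ?_ ?_ hw
      · intro f hf
        exact bar_reachable_of_touches (Or.inl rfl) hf
      · intro a b g _ ih _ hga hgb f hf
        exact (ih g hga).trans (bar_reachable_of_touches hgb hf)
    exact this _ h f (Or.inl rfl)
  have key2 : ∀ x : T.Comp ⊕ T.Shared, T.bar.Reachable x (inl (T.compOf e0)) := by
    rintro (c | s)
    · induction c using inductionOn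
      exact key _ _
    · obtain ⟨c, c', -, hc, -⟩ := s.2
      have h1 : T.bar.Adj (inl c) (inr s) := bar_adj_inl_inr.2 hc
      refine h1.symm.reachable.trans ?_
      induction c using inductionOn
      exact key _ _
  have : Nonempty (T.Comp ⊕ T.Shared) := ⟨inl (T.compOf e0)⟩
  exact SimpleGraph.Connected.mk fun x y => (key2 x).trans (key2 y).symm

theorem not_reachable_of_sep (h : T.Sep) (c : T.Comp) (v : T.Shared) (hv : T.MemComp v.1 c) :
    ¬ (T.bar.deleteEdges {s(inl c, inr v)}).Reachable (inr v) (inl c) := by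
  intro hr
  rw [SimpleGraph.reachable_iff_reflTransGen] at hr
  let Q : T.Comp ⊕ T.Shared → Prop := fun x => match x with
    | inl c' => c' ≠ c ∧ ∀ w, T.MemComp w c' → T.Linked (fun e => T.compOf e ≠ c) v.1 w
    | inr w => T.Linked (fun e => T.compOf e ≠ c) v.1 w.1
  have hQ : ∀ y, ReflTransGen
      (T.bar.deleteEdges {s(inl c, inr v)}).Adj (inr v) y → Q y := by
    intro y hr
    induction hr with
    | refl => exact Linked.refl _
    | @tail x y _ hxy ih =>
      rw [SimpleGraph.deleteEdges_adj] at hxy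
      obtain ⟨hxy, hne⟩ := hxy
      rcases x with c1 | v1 <;> rcases y with c2 | v2
      · exact absurd hxy not_bar_adj_inl_inl
      · exact ih.2 _ (bar_adj_inl_inr.1 hxy)
      · have hm : T.MemComp v1.1 c2 := bar_adj_inl_inr.1 hxy.symm
        have hc2 : c2 ≠ c := by
          rintro rfl
          have : v = v1 := Subtype.ext (h c2 v.1 v1.1 hv hm ih)
          subst this
          exact hne (by simp [Sym2.eq_swap])
        refine ⟨hc2, fun w hw => Linked.trans ih ?_⟩
        exact (linked_of_memComp hm hw).mono fun e he => by rw [he]; exact hc2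
      · exact absurd hxy not_bar_adj_inr_inr
  exact (hQ _ hr).1 rfl

theorem sep_of_isTree (h : T.bar.IsAcyclic) : T.Sep := by
  intro c x y hx hy hxy
  by_contra hne
  have hx' : ∃ M : T.Comp, M ≠ c ∧ T.MemComp x M := by
    rcases ReflTransGen.cases_head hxy with h | ⟨z, ⟨e, he, h1⟩, -⟩
    · exact absurd h hne
    · refine ⟨_, he, memComp_compOf ?_⟩
      rcases h1 with h1 | h1
      · exact Or.inl h1.1
      · exact Or.inr h1.2
  obtain ⟨M0, hM0, hxM0⟩ := hx'
  let s : T.Shared := ⟨x, M0, c, hM0, hxM0, hx⟩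
  have hadj : T.bar.Adj (inl c) (inr s) := bar_adj_inl_inr.2 hx
  have hb := (SimpleGraph.isAcyclic_iff_forall_adj_isBridge.1 h) hadj
  rw [SimpleGraph.isBridge_iff] at hb
  set G := T.bar.deleteEdges {s(inl c, inr s)} with hG
  have hGadj : ∀ (M : T.Comp) (z : T.Shared), T.MemComp z.1 M → (M ≠ c ∨ z ≠ s) →
      G.Adj (inl M) (inr z) := by
    intro M z hz hne
    rw [hG, SimpleGraph.deleteEdges_adj]
    refine ⟨bar_adj_inl_inr.2 hz, ?_⟩
    simp only [Set.mem_singleton_iff, Sym2.eq_iff]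
    rintro (⟨h1, h2⟩ | ⟨h1, h2⟩)
    · rcases hne with h | h
      · exact h (Sum.inl_injective h1)
      · exact h (Sum.inr_injective h2)
    · cases h1
  have key : ∀ z, T.Linked (fun e => T.compOf e ≠ c) x z → ∀ M : T.Comp, M ≠ c → T.MemComp z M →
      G.Reachable (inr s) (inl M) := by
    intro z hz
    refine Linked.induction (motive := fun z => ∀ M : T.Comp, M ≠ c → T.MemComp z M →
      G.Reachable (inr s) (inl M)) ?_ ?_ hz
    · intro M hM hxM
      exact (hGadj M s hxM (Or.inl hM)).symm.reachable
    · intro a b e _ ih he ha hb M hM hbM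
      have h1 := ih _ he (memComp_compOf ha)
      by_cases hMe : T.compOf e = M
      · rwa [← hMe]
      · let t : T.Shared := ⟨b, _, _, hMe, memComp_compOf hb, hbM⟩
        have h2 := hGadj _ t (memComp_compOf hb) (Or.inl he)
        have h3 := hGadj _ t hbM (Or.inl hM)
        exact h1.trans (h2.reachable.trans h3.symm.reachable)
  rcases ReflTransGen.cases_tail hxy with h1 | ⟨z, hz, e, he, h1⟩
  · exact hne h1.symm
  · have hye : T.Touches e y := by
      rcases h1 with h1 | h1
      · exact Or.inr h1.2
      · exact Or.inl h1.1
    have h2 := key y hxy _ he (memComp_compOf hye)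
    let t : T.Shared := ⟨y, _, _, he, memComp_compOf hye, hy⟩
    have h3 := hGadj _ t (memComp_compOf hye) (Or.inl he)
    have h4 := hGadj c t hy (Or.inr fun h => hne (congrArg Subtype.val h).symm)
    exact hb (h2.trans (h3.reachable.trans h4.symm.reachable)).symm

theorem isFreeProduct_iff_sep (hT : T.Connected) : T.IsFreeProduct ↔ T.Sep := by
  constructor
  · rintro (h | h)
    · rintro c
      induction c using inductionOn
      exact h.elim (by assumption)
    · exact sep_of_isTree h.isAcyclic
  · intro h
    by_cases hE : IsEmpty T.E
    · exact Or.inl hE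
    · right
      refine ⟨bar_connected hT (not_isEmpty_iff.1 hE), ?_⟩
      rw [SimpleGraph.isAcyclic_iff_forall_adj_isBridge]
      rintro (c | v) (c' | v') hadj
      · exact absurd hadj not_bar_adj_inl_inl
      · rw [SimpleGraph.isBridge_iff]
        exact fun hr => not_reachable_of_sep h c v' (bar_adj_inl_inr.1 hadj) hr.symm
      · rw [SimpleGraph.isBridge_iff, Sym2.eq_swap]
        exact not_reachable_of_sep h c' v (bar_adj_inl_inr.1 hadj.symm)
      · exact absurd hadj not_bar_adj_inr_inr

end StarGraph

/-! ### Subgraphs and wedges -/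

namespace StarGraph

/-- An embedding of vertices and a map of edges that respect ends and labels. -/
structure Sub {J : Type*} (T' T : StarGraph J) where
  onV : T'.V → T.V
  onE : T'.E → T.E
  inj : Injective onV
  src : ∀ e, T.src (onE e) = onV (T'.src e)
  tgt : ∀ e, T.tgt (onE e) = onV (T'.tgt e)
  label : ∀ e, T.label (onE e) = T'.label e
  star : ∀ e, T.star (onE e) = T'.star e

theorem Sub.touches {J : Type*} {T' T : StarGraph J} (s : Sub T' T) {e : T'.E} {v : T'.V}
    (h : T'.Touches e v) : T.Touches (s.onE e) (s.onV v) := by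
  rcases h with rfl | rfl
  · exact Or.inl (s.src e)
  · exact Or.inr (s.tgt e)

theorem Sub.exists_of_touches {J : Type*} {T' T : StarGraph J} (s : Sub T' T) {e : T'.E} {x : T.V}
    (h : T.Touches (s.onE e) x) : ∃ v, s.onV v = x ∧ T'.Touches e v := by
  rcases h with rfl | rfl
  · exact ⟨_, (s.src e).symm, Or.inl rfl⟩
  · exact ⟨_, (s.tgt e).symm, Or.inr rfl⟩

theorem Sub.touches_iff {J : Type*} {T' T : StarGraph J} (s : Sub T' T) {e : T'.E} {v : T'.V} :
    T.Touches (s.onE e) (s.onV v) ↔ T'.Touches e v := by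
  refine ⟨fun h => ?_, s.touches⟩
  obtain ⟨w, hw, h⟩ := s.exists_of_touches h
  rwa [← s.inj hw]

theorem Sub.linked {J : Type*} {T' T : StarGraph J} (s : Sub T' T) {p : T'.E → Prop}
    {q : T.E → Prop} (hpq : ∀ e, p e → q (s.onE e)) {v w : T'.V} (h : T'.Linked p v w) :
    T.Linked q (s.onV v) (s.onV w) := by
  refine Linked.induction (motive := fun w => T.Linked q (s.onV v) (s.onV w)) (Linked.refl _) ?_ h
  intro a b e _ ih he ha hb
  exact ih.trans (linked_of_touches (e := s.onE e) (hpq e he) (s.touches ha) (s.touches hb))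

/-- The isomorphism given by an embedding that is bijective on vertices and edges. -/
def Iso.ofSub {J : Type*} {T' T : StarGraph J} (s : Sub T' T) (hV : Function.Surjective s.onV)
    (hE : Bijective s.onE) : Iso T' T where
  onV := Equiv.ofBijective s.onV ⟨s.inj, hV⟩
  onE := Equiv.ofBijective s.onE hE
  src e := s.src e
  tgt e := s.tgt e
  label e := s.label e
  star e := s.star e

variable {T T' : StarGraph (Σ i, K i)}

theorem Sub.compOf_eq (s : Sub T' T) {e f : T'.E} (h : T'.compOf e = T'.compOf f) :
    T.compOf (s.onE e) = T.compOf (s.onE f) := by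
  have h1 : EqvGen (fun e f => (T'.label e).1 = (T'.label f).1 ∧
      ∃ v, T'.Touches e v ∧ T'.Touches f v) e f := compOf_eq_iff.1 h
  clear h
  induction h1 with
  | rel x y h =>
    obtain ⟨h1, v, h2, h3⟩ := h
    exact compOf_eq_of_touches (by rw [s.label, s.label]; exact h1) (s.touches h2) (s.touches h3)
  | refl x => rfl
  | symm x y _ ih => exact ih.symm
  | trans x y z _ _ ih1 ih2 => exact ih1.trans ih2

/-- Subgraphs of graphs with the separation property have it. -/
theorem Sep.of_sub (s : Sub T' T) (h : T.Sep) : T'.Sep := by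
  rintro c x y ⟨e, he, hex⟩ ⟨f, hf, hfy⟩ hxy
  have hef : T.compOf (s.onE e) = T.compOf (s.onE f) := s.compOf_eq (he.trans hf.symm)
  have key : T.Linked (fun g => T.compOf g ≠ T.compOf (s.onE e)) (s.onV x) (s.onV y) := by
    refine Linked.induction (motive := fun w =>
      T.Linked (fun g => T.compOf g ≠ T.compOf (s.onE e)) (s.onV x) (s.onV w))
      (Linked.refl _) ?_ hxy
    intro a b g _ ih hg ha hb
    by_cases hge : T.compOf (s.onE g) = T.compOf (s.onE e)
    · exfalso
      have hax : x = a := s.inj (h _ _ _ (memComp_compOf (s.touches hex)) ⟨_, hge, s.touches ha⟩ ih)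
      subst hax
      have hcol := color_eq_of_compOf_eq hge
      rw [s.label, s.label] at hcol
      exact hg ((compOf_eq_of_touches hcol ha hex).trans he)
    · exact ih.trans (linked_of_touches (e := s.onE g) hge (s.touches ha) (s.touches hb))
  exact s.inj (h _ _ _ (memComp_compOf (s.touches hex)) ⟨_, hef.symm, s.touches hfy⟩ key)

theorem Connected.exists_touches {J : Type*} {T : StarGraph J} (hT : T.Connected) (e0 : T.E)
    (v : T.V) : ∃ e, T.Touches e v := by
  have h := (connected_iff.1 hT).2 (T.src e0) v
  rcases ReflTransGen.cases_tail h with h1 | ⟨z, hz, e, he, h1 | h1⟩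
  · exact ⟨e0, Or.inl h1.symm⟩
  · exact ⟨e, Or.inr h1.2⟩
  · exact ⟨e, Or.inl h1.1⟩

/-- A connected graph in the variables of one family has a single colored component. -/
theorem Connected.compOf_eq (hT : T.Connected) {i : ι} (hi : ∀ e, (T.label e).1 = i) (e f : T.E) :
    T.compOf e = T.compOf f := by
  have h := (connected_iff.1 hT).2 (T.src e) (T.src f)
  have : ∀ f, T.Touches f (T.src f) → T.compOf e = T.compOf f := by
    intro f _
    have h := (connected_iff.1 hT).2 (T.src e) (T.src f)
    refine Linked.induction (motive := fun w => ∀ f, T.Touches f w → T.compOf e = T.compOf f)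
      ?_ ?_ h f (Or.inl rfl)
    · intro f hf
      exact compOf_eq_of_touches ((hi e).trans (hi f).symm) (Or.inl rfl) hf
    · intro a b g _ ih _ ha hb f hf
      exact (ih g ha).trans (compOf_eq_of_touches ((hi g).trans (hi f).symm) hb hf)
  exact this f (Or.inl rfl)

/-- `T` is obtained by gluing `T₁` and `T₂` at one vertex. -/
structure Wedge {J : Type*} (T T₁ T₂ : StarGraph J) (v₁ : T₁.V) (v₂ : T₂.V) where
  s₁ : Sub T₁ T
  s₂ : Sub T₂ T
  onE : T₁.E ⊕ T₂.E ≃ T.E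
  onE_inl : ∀ e, onE (inl e) = s₁.onE e
  onE_inr : ∀ e, onE (inr e) = s₂.onE e
  cover : ∀ x, (∃ y, s₁.onV y = x) ∨ ∃ y, s₂.onV y = x
  glue : ∀ y z, s₁.onV y = s₂.onV z ↔ y = v₁ ∧ z = v₂

namespace Wedge

section

variable {T T₁ T₂ : StarGraph J} {v₁ : T₁.V} {v₂ : T₂.V} (W : Wedge T T₁ T₂ v₁ v₂)
include W

theorem edge_cases (e : T.E) : (∃ f, W.s₁.onE f = e) ∨ ∃ f, W.s₂.onE f = e := by
  obtain ⟨x, rfl⟩ := W.onE.surjective e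
  rcases x with f | f
  · exact Or.inl ⟨f, (W.onE_inl f).symm⟩
  · exact Or.inr ⟨f, (W.onE_inr f).symm⟩

theorem glue_point : W.s₁.onV v₁ = W.s₂.onV v₂ := (W.glue _ _).2 ⟨rfl, rfl⟩

theorem connected (h₁ : T₁.Connected) (h₂ : T₂.Connected) : T.Connected := by
  rw [connected_iff] at h₁ h₂ ⊢
  refine ⟨⟨W.s₁.onV v₁⟩, ?_⟩
  have key : ∀ x, T.Linked (fun _ => True) (W.s₁.onV v₁) x := by
    intro x
    rcases W.cover x with ⟨y, rfl⟩ | ⟨y, rfl⟩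
    · exact W.s₁.linked (fun _ _ => trivial) (h₁.2 v₁ y)
    · rw [W.glue_point]
      exact W.s₂.linked (fun _ _ => trivial) (h₂.2 v₂ y)
  exact fun v w => (key v).symm.trans (key w)

/-- The retraction on the first graph. -/
def proj (x : T.V) : T₁.V := if h : ∃ y, W.s₁.onV y = x then h.choose else v₁

theorem proj_left (y : T₁.V) : W.proj (W.s₁.onV y) = y := by
  have h : ∃ z, W.s₁.onV z = W.s₁.onV y := ⟨y, rfl⟩
  rw [proj, dif_pos h]
  exact W.s₁.inj h.choose_spec

theorem proj_right (z : T₂.V) : W.proj (W.s₂.onV z) = v₁ := by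
  by_cases h : ∃ y, W.s₁.onV y = W.s₂.onV z
  · rw [proj, dif_pos h]
    exact ((W.glue _ _).1 h.choose_spec).1
  · rw [proj, dif_neg h]

end

variable {T₁ T₂ : StarGraph (Σ i, K i)} {v₁ : T₁.V} {v₂ : T₂.V} (W : Wedge T T₁ T₂ v₁ v₂)
  {i : ι} (h₂ : T₂.Connected) (hi : ∀ e, (T₂.label e).1 = i)
  (hv : ∀ e, T₁.Touches e v₁ → (T₁.label e).1 ≠ i)

/-- The component of `T₁` of an edge of `T₁`, and `none` for the edges of `T₂`. -/
def kind (e : T.E) : Option T₁.Comp :=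
  Sum.elim (fun f => some (T₁.compOf f)) (fun _ => none) (W.onE.symm e)

theorem kind_left (f : T₁.E) : W.kind (W.s₁.onE f) = some (T₁.compOf f) := by
  rw [← W.onE_inl, kind, Equiv.symm_apply_apply]; rfl

theorem kind_right (f : T₂.E) : W.kind (W.s₂.onE f) = none := by
  rw [← W.onE_inr, kind, Equiv.symm_apply_apply]; rfl

include hi hv in
theorem kind_eq {e f : T.E} (h : T.compOf e = T.compOf f) : W.kind e = W.kind f := by
  have h1 : EqvGen (fun e f => (T.label e).1 = (T.label f).1 ∧
      ∃ v, T.Touches e v ∧ T.Touches f v) e f := compOf_eq_iff.1 h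
  clear h
  induction h1 with
  | rel x y h =>
    obtain ⟨h1, v, h2, h3⟩ := h
    rcases W.edge_cases x with ⟨a, rfl⟩ | ⟨a, rfl⟩ <;>
      rcases W.edge_cases y with ⟨b, rfl⟩ | ⟨b, rfl⟩
    · rw [W.kind_left, W.kind_left]
      obtain ⟨u, rfl, hu⟩ := W.s₁.exists_of_touches h2
      rw [W.s₁.touches_iff] at h3
      rw [W.s₁.label, W.s₁.label] at h1
      rw [compOf_eq_of_touches h1 hu h3]
    · exfalso
      obtain ⟨u, rfl, hu⟩ := W.s₁.exists_of_touches h2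
      obtain ⟨w, hw, hw'⟩ := W.s₂.exists_of_touches h3
      rw [W.s₁.label, W.s₂.label, hi] at h1
      obtain ⟨rfl, rfl⟩ := (W.glue _ _).1 hw.symm
      exact hv a hu h1
    · exfalso
      obtain ⟨u, rfl, hu⟩ := W.s₁.exists_of_touches h3
      obtain ⟨w, hw, hw'⟩ := W.s₂.exists_of_touches h2
      rw [W.s₁.label, W.s₂.label, hi] at h1
      obtain ⟨rfl, rfl⟩ := (W.glue _ _).1 hw.symm
      exact hv b hu h1.symm
    · rw [W.kind_right, W.kind_right]
  | refl x => rfl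
  | symm x y _ ih => exact ih.symm
  | trans x y z _ _ ih1 ih2 => exact ih1.trans ih2

include hi hv in
theorem compOf_left_iff {e f : T₁.E} :
    T.compOf (W.s₁.onE e) = T.compOf (W.s₁.onE f) ↔ T₁.compOf e = T₁.compOf f := by
  refine ⟨fun h => ?_, W.s₁.compOf_eq⟩
  have := W.kind_eq hi hv h
  rw [W.kind_left, W.kind_left] at this
  exact Option.some_injective _ this

include hi hv in
theorem compOf_left_ne_right {e : T₁.E} {f : T₂.E} :
    T.compOf (W.s₁.onE e) ≠ T.compOf (W.s₂.onE f) := by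
  intro h
  have := W.kind_eq hi hv h
  rw [W.kind_left, W.kind_right] at this
  cases this

include W h₂ hi hv in
theorem sep_iff : T.Sep ↔ T₁.Sep := by
  refine ⟨Sep.of_sub W.s₁, fun h => ?_⟩
  rintro c x y ⟨e, rfl, hex⟩ ⟨f, hf, hfy⟩ hxy
  change T.compOf f = T.compOf e at hf
  change T.Linked (fun g => T.compOf g ≠ T.compOf e) x y at hxy
  rcases W.edge_cases e with ⟨e, rfl⟩ | ⟨e, rfl⟩ <;>
    rcases W.edge_cases f with ⟨f, rfl⟩ | ⟨f, rfl⟩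
  · obtain ⟨x, rfl, hx⟩ := W.s₁.exists_of_touches hex
    obtain ⟨y, rfl, hy⟩ := W.s₁.exists_of_touches hfy
    rw [W.compOf_left_iff hi hv] at hf
    have key : T₁.Linked (fun g => T₁.compOf g ≠ T₁.compOf e) x (W.proj (W.s₁.onV y)) := by
      refine Linked.induction (motive := fun z =>
        T₁.Linked (fun g => T₁.compOf g ≠ T₁.compOf e) x (W.proj z)) ?_ ?_ hxy
      · rw [W.proj_left]
        exact Linked.refl _
      · intro a b g _ ih hg ha hb
        refine ih.trans ?_
        rcases W.edge_cases g with ⟨g, rfl⟩ | ⟨g, rfl⟩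
        · obtain ⟨a, rfl, ha'⟩ := W.s₁.exists_of_touches ha
          obtain ⟨b, rfl, hb'⟩ := W.s₁.exists_of_touches hb
          rw [W.proj_left, W.proj_left]
          refine linked_of_touches (e := g) ?_ ha' hb'
          intro h'
          exact hg ((W.compOf_left_iff hi hv).2 h')
        · obtain ⟨a, rfl, ha⟩ := W.s₂.exists_of_touches ha
          obtain ⟨b, rfl, hb⟩ := W.s₂.exists_of_touches hb
          rw [W.proj_right, W.proj_right]
          exact Linked.refl _
    rw [W.proj_left] at key
    rw [h _ x y (memComp_compOf hx) ⟨f, hf, hy⟩ key]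
  · exact absurd hf.symm (W.compOf_left_ne_right hi hv)
  · exact absurd hf (W.compOf_left_ne_right hi hv)
  · obtain ⟨x, rfl, hx⟩ := W.s₂.exists_of_touches hex
    obtain ⟨y, rfl, hy⟩ := W.s₂.exists_of_touches hfy
    have key : W.s₂.onV y = W.s₂.onV x ∨
        ((∃ u, W.s₁.onV u = W.s₂.onV x) ∧ ∃ u, W.s₁.onV u = W.s₂.onV y) := by
      refine Linked.induction (motive := fun z => z = W.s₂.onV x ∨
        ((∃ u, W.s₁.onV u = W.s₂.onV x) ∧ ∃ u, W.s₁.onV u = z)) (Or.inl rfl) ?_ hxy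
      intro a b g _ ih hg ha hb
      rcases W.edge_cases g with ⟨g, rfl⟩ | ⟨g, rfl⟩
      · obtain ⟨a, rfl, ha⟩ := W.s₁.exists_of_touches ha
        obtain ⟨b, rfl, hb⟩ := W.s₁.exists_of_touches hb
        right
        refine ⟨?_, b, rfl⟩
        rcases ih with ih | ih
        · exact ⟨a, ih⟩
        · exact ih.1
      · exact absurd (W.s₂.compOf_eq (h₂.compOf_eq hi g e)) hg
    rcases key with key | ⟨⟨u, hu⟩, ⟨w, hw⟩⟩
    · exact key.symm
    · rw [← hu, ← hw, ((W.glue _ _).1 hu).1, ((W.glue _ _).1 hw).1]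

/-- The colored components of a wedge. -/
def compMap (e0 : T₂.E) : Option T₁.Comp → T.Comp
  | none => T.compOf (W.s₂.onE e0)
  | some c => Quotient.liftOn c (fun e => T.compOf (W.s₁.onE e))
      fun _ _ h => W.s₁.compOf_eq (compOf_eq_iff.2 h)

include h₂ hi hv in
theorem compMap_bijective (e0 : T₂.E) : Bijective (W.compMap e0) := by
  constructor
  · rintro (_ | c) (_ | c') h
    · rfl
    · induction c' using inductionOn
      exact absurd h.symm (W.compOf_left_ne_right hi hv)
    · induction c using inductionOn
      exact absurd h (W.compOf_left_ne_right hi hv)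
    · induction c using inductionOn
      induction c' using inductionOn
      exact congrArg some ((W.compOf_left_iff hi hv).1 h)
  · intro c
    induction c using inductionOn
    rename_i e
    rcases W.edge_cases e with ⟨e, rfl⟩ | ⟨e, rfl⟩
    · exact ⟨some (T₁.compOf e), rfl⟩
    · exact ⟨none, W.s₂.compOf_eq (h₂.compOf_eq hi e0 e)⟩

include h₂ hi hv in
theorem iso_right (e0 : T₂.E) : Nonempty (Iso T₂ (T.comp (W.compMap e0 none))) := by
  have hc : ∀ e, T.compOf (W.s₂.onE e) = W.compMap e0 none := fun e =>
    W.s₂.compOf_eq (h₂.compOf_eq hi e e0)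
  have hinj : Injective W.s₂.onE := by
    intro a b hab
    rw [← W.onE_inr, ← W.onE_inr] at hab
    exact Sum.inr_injective (W.onE.injective hab)
  let s : Sub T₂ (T.comp (W.compMap e0 none)) :=
    { onV := fun z => ⟨W.s₂.onV z, by
        obtain ⟨e, he⟩ := h₂.exists_touches e0 z
        exact ⟨_, hc e, W.s₂.touches he⟩⟩
      onE := fun e => ⟨W.s₂.onE e, hc e⟩
      inj := fun a b hab => W.s₂.inj (congrArg Subtype.val hab)
      src := fun e => Subtype.ext (W.s₂.src e)
      tgt := fun e => Subtype.ext (W.s₂.tgt e)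
      label := fun e => W.s₂.label e
      star := fun e => W.s₂.star e }
  refine ⟨Iso.ofSub s ?_ ⟨?_, ?_⟩⟩
  · rintro ⟨x, e, he, hex⟩
    rcases W.edge_cases e with ⟨e, rfl⟩ | ⟨e, rfl⟩
    · exact absurd he (W.compOf_left_ne_right hi hv)
    · obtain ⟨z, rfl, -⟩ := W.s₂.exists_of_touches hex
      exact ⟨z, rfl⟩
  · intro a b hab
    exact hinj (congrArg Subtype.val hab)
  · rintro ⟨e, he⟩
    rcases W.edge_cases e with ⟨e, rfl⟩ | ⟨e, rfl⟩
    · exact absurd he (W.compOf_left_ne_right hi hv)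
    · exact ⟨e, rfl⟩

include hi hv in
theorem iso_left (e0 : T₂.E) (c : T₁.Comp) :
    Nonempty (Iso (T₁.comp c) (T.comp (W.compMap e0 (some c)))) := by
  obtain ⟨f, rfl⟩ : ∃ f, T₁.compOf f = c := Quotient.exists_rep c
  have hc : ∀ e, T₁.compOf e = T₁.compOf f →
      T.compOf (W.s₁.onE e) = W.compMap e0 (some (T₁.compOf f)) := fun e he => W.s₁.compOf_eq he
  have hinj : Injective W.s₁.onE := by
    intro a b hab
    rw [← W.onE_inl, ← W.onE_inl] at hab
    exact Sum.inl_injective (W.onE.injective hab)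
  let s : Sub (T₁.comp (T₁.compOf f)) (T.comp (W.compMap e0 (some (T₁.compOf f)))) :=
    { onV := fun z => ⟨W.s₁.onV z.1, by
        obtain ⟨e, he, hz⟩ := z.2
        exact ⟨_, hc e he, W.s₁.touches hz⟩⟩
      onE := fun e => ⟨W.s₁.onE e.1, hc e.1 e.2⟩
      inj := fun a b hab => Subtype.ext (W.s₁.inj (congrArg Subtype.val hab))
      src := fun e => Subtype.ext (W.s₁.src e.1)
      tgt := fun e => Subtype.ext (W.s₁.tgt e.1)
      label := fun e => W.s₁.label e.1
      star := fun e => W.s₁.star e.1 }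
  refine ⟨Iso.ofSub s ?_ ⟨?_, ?_⟩⟩
  · rintro ⟨x, e, he, hex⟩
    rcases W.edge_cases e with ⟨e, rfl⟩ | ⟨e, rfl⟩
    · obtain ⟨z, rfl, hz⟩ := W.s₁.exists_of_touches hex
      exact ⟨⟨z, e, (W.compOf_left_iff hi hv).1 he, hz⟩, rfl⟩
    · exact absurd he.symm (W.compOf_left_ne_right hi hv)
  · intro a b hab
    exact Subtype.ext (hinj (congrArg Subtype.val hab))
  · rintro ⟨e, he⟩
    rcases W.edge_cases e with ⟨e, rfl⟩ | ⟨e, rfl⟩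
    · exact ⟨⟨e, (W.compOf_left_iff hi hv).1 he⟩, rfl⟩
    · exact absurd he.symm (W.compOf_left_ne_right hi hv)

/-- A graph without edges adds nothing to a wedge. -/
theorem iso_of_isEmpty {J : Type*} {T T₁ T₂ : StarGraph J} {v₁ : T₁.V} {v₂ : T₂.V}
    (W : Wedge T T₁ T₂ v₁ v₂) [IsEmpty T₂.E] [Subsingleton T₂.V] : Nonempty (Iso T₁ T) := by
  refine ⟨Iso.ofSub W.s₁ ?_ ⟨?_, ?_⟩⟩
  · intro x
    rcases W.cover x with h | ⟨z, rfl⟩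
    · exact h
    · exact ⟨v₁, W.glue_point.trans (congrArg _ (Subsingleton.elim v₂ z))⟩
  · intro a b hab
    rw [← W.onE_inl, ← W.onE_inl] at hab
    exact Sum.inl_injective (W.onE.injective hab)
  · intro e
    rcases W.edge_cases e with h | ⟨f, -⟩
    · exact h
    · exact isEmptyElim f

end Wedge

theorem Connected.subsingleton_of_isEmpty {J : Type*} {T : StarGraph J} (hT : T.Connected)
    [IsEmpty T.E] : Subsingleton T.V := by
  refine ⟨fun v w => ?_⟩
  have h := (connected_iff.1 hT).2 v w
  rcases ReflTransGen.cases_tail h with h1 | ⟨z, hz, e, -⟩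
  · exact h1.symm
  · exact isEmptyElim e

end StarGraph

section FreeState

variable {A : (Σ i, K i) → MatrixSeq Ω}
  [∀ N, IsProbabilityMeasure (P N)]

/-- The injective version of `τ` factorizes over the colored components of free products and
vanishes on the other graphs. -/
def FreeState (τ : StarGraph (Σ i, K i) → ℂ) : Prop :=
  ∀ T : StarGraph (Σ i, K i), T.Connected →
    injState τ T = if T.IsFreeProduct then ∏ c : T.Comp, injState τ (T.comp c) else 0

theorem FreeState.eq_zero {τ : StarGraph (Σ i, K i) → ℂ} (hτ' : FreeState τ)
    {T : StarGraph (Σ i, K i)} (hT : T.Connected) (h : ¬ T.Sep) : injState τ T = 0 := by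
  rw [hτ' T hT, if_neg]
  rwa [StarGraph.isFreeProduct_iff_sep hT]

open StarGraph in
/-- The injective state of a wedge with a graph in the variables of one family. -/
theorem injState_wedge (hA : ∀ k, Moments P (A k))
    {τ : StarGraph (Σ i, K i) → ℂ} (hτ : TrafficLimit P A τ) (hτ' : FreeState τ)
    {T T₁ T₂ : StarGraph (Σ i, K i)} {v₁ : T₁.V} {v₂ : T₂.V} (W : Wedge T T₁ T₂ v₁ v₂)
    (h₁ : T₁.Connected) (h₂ : T₂.Connected) {i : ι} (hi : ∀ e, (T₂.label e).1 = i)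
    (hv : ∀ e, T₁.Touches e v₁ → (T₁.label e).1 ≠ i) :
    injState τ T = injState τ T₁ * injState τ T₂ := by
  have hT := W.connected h₁ h₂
  by_cases hE : IsEmpty T₂.E
  · have := h₂.subsingleton_of_isEmpty
    obtain ⟨j⟩ := W.iso_of_isEmpty
    rw [injState_point hA hτ h₂, mul_one, injState_iso hA hτ j h₁]
  · obtain ⟨e0⟩ := not_isEmpty_iff.1 hE
    have hcT₂ : ∀ c : T.Comp, c = W.compMap e0 none → injState τ (T.comp c) = injState τ T₂ := by
      rintro c rfl
      obtain ⟨j⟩ := W.iso_right h₂ hi hv e0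
      exact (injState_iso hA hτ j h₂).symm
    by_cases hs : T₁.Sep
    · have hs' := (W.sep_iff h₂ hi hv).2 hs
      rw [hτ' T hT, hτ' T₁ h₁, if_pos ((isFreeProduct_iff_sep hT).2 hs'),
        if_pos ((isFreeProduct_iff_sep h₁).2 hs)]
      have hb := W.compMap_bijective h₂ hi hv e0
      rw [← Fintype.prod_equiv (Equiv.ofBijective _ hb) (fun o => injState τ (T.comp (W.compMap e0 o)))
        (fun c => injState τ (T.comp c)) (fun o => rfl), Fintype.prod_option, hcT₂ _ rfl, mul_comm]
      congr 1
      refine prod_congr rfl fun c _ => ?_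
      obtain ⟨j⟩ := W.iso_left hi hv e0 c
      refine (injState_iso hA hτ j ?_).symm
      rw [connected_iff]
      obtain ⟨f, rfl⟩ : ∃ f, T₁.compOf f = c := Quotient.exists_rep c
      refine ⟨⟨⟨T₁.src f, memComp_compOf (Or.inl rfl)⟩⟩, ?_⟩
      have key : ∀ (v w : T₁.V) (hv : T₁.MemComp v (T₁.compOf f)),
          T₁.Linked (fun e => T₁.compOf e = T₁.compOf f) v w →
          ∃ hw : v = w ∨ T₁.MemComp w (T₁.compOf f),
            (T₁.comp (T₁.compOf f)).Linked (fun _ => True) ⟨v, hv⟩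
              ⟨w, by rcases hw with rfl | hw <;> assumption⟩ := by
        intro v w hv h
        refine Linked.induction (motive := fun w => ∃ hw : v = w ∨ T₁.MemComp w (T₁.compOf f),
            (T₁.comp (T₁.compOf f)).Linked (fun _ => True) ⟨v, hv⟩
              ⟨w, by rcases hw with rfl | hw <;> assumption⟩) ⟨Or.inl rfl, Linked.refl _⟩ ?_ h
        rintro a b e - ⟨ha, ih⟩ he hea heb
        refine ⟨Or.inr ⟨e, he, heb⟩, ih.trans ?_⟩
        refine linked_of_touches (T := T₁.comp (T₁.compOf f)) (e := ⟨e, he⟩) trivial ?_ ?_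
        · rcases hea with h | h
          · exact Or.inl (Subtype.ext h)
          · exact Or.inr (Subtype.ext h)
        · rcases heb with h | h
          · exact Or.inl (Subtype.ext h)
          · exact Or.inr (Subtype.ext h)
      rintro ⟨v, hv⟩ ⟨w, hw⟩
      exact (key v w hv (linked_of_memComp hv hw)).2
    · rw [hτ'.eq_zero h₁ hs, zero_mul, hτ'.eq_zero hT]
      rwa [W.sep_iff h₂ hi hv]

end FreeState

/-! ### Gluing sums at one vertex -/

namespace StarGraph

section Disj

variable (T₁ T₂ : StarGraph J)

/-- Disjoint union. -/
def disj : StarGraph J where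
  V := T₁.V ⊕ T₂.V
  E := T₁.E ⊕ T₂.E
  src := Sum.map T₁.src T₂.src
  tgt := Sum.map T₁.tgt T₂.tgt
  label := Sum.elim T₁.label T₂.label
  star := Sum.elim T₁.star T₂.star

variable {T₁ T₂}

/-- The partitions of a disjoint union that restrict to given partitions and identify two
vertices. -/
def gluings (S₁ : Set (Setoid T₁.V)) (S₂ : Set (Setoid T₂.V)) (v : T₁.V) (r : T₂.V) :
    Set (Setoid (T₁.disj T₂).V) :=
  {π | Setoid.comap inl π ∈ S₁ ∧ Setoid.comap inr π ∈ S₂ ∧ π (inl v) (inr r)}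

theorem traceOn_gluings (S₁ : Set (Setoid T₁.V)) (S₂ : Set (Setoid T₂.V)) (v : T₁.V) (r : T₂.V)
    {N : ℕ} (A : J → Mat[N]) :
    (T₁.disj T₂).traceOn (gluings S₁ S₂ v r) A =
      ∑ φ : T₁.V → Fin N, (if ker φ ∈ S₁ then T₁.weight A φ else 0) *
        ∑ ψ : T₂.V → Fin N, if ker ψ ∈ S₂ ∧ ψ r = φ v then T₂.weight A ψ else 0 := by
  simp_rw [mul_sum]
  refine Eq.trans ?_ (sum_prod_type' fun (φ : T₁.V → Fin N) (ψ : T₂.V → Fin N) =>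
    (if ker φ ∈ S₁ then T₁.weight A φ else 0) *
      if ker ψ ∈ S₂ ∧ ψ r = φ v then T₂.weight A ψ else 0)
  unfold traceOn
  let e : ((T₁.disj T₂).V → Fin N) ≃ (T₁.V → Fin N) × (T₂.V → Fin N) :=
    Equiv.sumArrowEquivProdArrow T₁.V T₂.V (Fin N)
  refine sum_equiv e
    (fun φ => if ker φ ∈ gluings S₁ S₂ v r then (T₁.disj T₂).weight A φ else 0) _ fun φ => ?_
  have hw : (T₁.disj T₂).weight A φ =
      T₁.weight A (fun v => φ (inl v)) * T₂.weight A (fun v => φ (inr v)) := by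
    unfold weight
    exact Fintype.prod_sum_type _
  have h1 : (ker φ ∈ gluings S₁ S₂ v r) ↔
      (ker (fun v => φ (inl v)) ∈ S₁ ∧ ker (fun v => φ (inr v)) ∈ S₂ ∧
        φ (inr r) = φ (inl v)) := by
    constructor
    · rintro ⟨h1, h2, h3⟩
      exact ⟨h1, h2, Eq.symm h3⟩
    · rintro ⟨h1, h2, h3⟩
      exact ⟨h1, h2, Eq.symm h3⟩
  simp only [h1, hw]
  change _ = (if ker (fun v => φ (inl v)) ∈ S₁ then
    T₁.weight A (fun v => φ (inl v)) else 0) *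
    (if ker (fun v => φ (inr v)) ∈ S₂ ∧ φ (inr r) = φ (inl v) then
      T₂.weight A (fun v => φ (inr v)) else 0)
  by_cases h2 : ker (fun v => φ (inl v)) ∈ S₁
  · simp only [h2, true_and, if_true]
    split_ifs <;> simp
  · simp only [h2, false_and, if_false, zero_mul]

/-- The first graph as a subgraph of a quotient of a disjoint union. -/
def subLeft (π : Setoid (T₁.disj T₂).V) :
    Sub (T₁.quot (Setoid.comap inl π)) ((T₁.disj T₂).quot π) where
  onV := Quotient.map' inl fun _ _ h => h
  onE := inl
  inj := by
    intro a b
    induction a using inductionOn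
    induction b using inductionOn
    rename_i a b
    intro h
    have h' : π (inl a) (inl b) := Quotient.exact h
    exact sound h'
  src _ := rfl
  tgt _ := rfl
  label _ := rfl
  star _ := rfl

/-- The second graph as a subgraph of a quotient of a disjoint union. -/
def subRight (π : Setoid (T₁.disj T₂).V) :
    Sub (T₂.quot (Setoid.comap inr π)) ((T₁.disj T₂).quot π) where
  onV := Quotient.map' inr fun _ _ h => h
  onE := inr
  inj := by
    intro a b
    induction a using inductionOn
    induction b using inductionOn
    rename_i a b
    intro h
    have h' : π (inr a) (inr b) := Quotient.exact h
    exact sound h'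
  src _ := rfl
  tgt _ := rfl
  label _ := rfl
  star _ := rfl

theorem connected_quot_disj {π : Setoid (T₁.disj T₂).V} {v : T₁.V} {r : T₂.V}
    (hvr : π (inl v) (inr r))
    (h₁ : (T₁.quot (Setoid.comap inl π)).Connected)
    (h₂ : (T₂.quot (Setoid.comap inr π)).Connected) :
    ((T₁.disj T₂).quot π).Connected := by
  have hp : (subLeft π).onV (Quotient.mk _ v) = (subRight π).onV (Quotient.mk _ r) := sound hvr
  rw [connected_iff] at h₁ h₂ ⊢
  refine ⟨⟨Quotient.mk _ (inl v)⟩, ?_⟩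
  have key : ∀ x, ((T₁.disj T₂).quot π).Linked (fun _ => True)
      ((subLeft π).onV (Quotient.mk _ v)) x := by
    intro x
    induction x using inductionOn
    rename_i x
    rcases x with x | x
    · exact (subLeft π).linked (q := fun _ => True) (fun _ _ => trivial) (h₁.2 _ (Quotient.mk _ x))
    · rw [hp]
      exact (subRight π).linked (q := fun _ => True) (fun _ _ => trivial) (h₂.2 _ (Quotient.mk _ x))
  exact fun v w => (key v).symm.trans (key w)

/-- The map whose kernel is `join`. -/
def joinMap {V₁ V₂ : Type} (π₁ : Setoid V₁) (π₂ : Setoid V₂) (v : V₁) (r : V₂) :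
    V₁ ⊕ V₂ → Quotient π₁ ⊕ Quotient π₂
  | inl a => inl (Quotient.mk π₁ a)
  | inr b => if π₂ b r then inl (Quotient.mk π₁ v) else inr (Quotient.mk π₂ b)

/-- The finest partition of `V₁ ⊕ V₂` that restricts to given partitions and identifies `v`
with `r`. -/
def join {V₁ V₂ : Type} (π₁ : Setoid V₁) (π₂ : Setoid V₂) (v : V₁) (r : V₂) :
    Setoid (V₁ ⊕ V₂) :=
  ker (joinMap π₁ π₂ v r)

section Join

variable {V₁ V₂ : Type} {π₁ : Setoid V₁} {π₂ : Setoid V₂} {v : V₁} {r : V₂}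

theorem join_inl_inl {a b : V₁} : join π₁ π₂ v r (inl a) (inl b) ↔ π₁ a b := by
  change joinMap π₁ π₂ v r _ = joinMap π₁ π₂ v r _ ↔ _
  simp only [joinMap, inl.injEq]
  exact Quotient.eq

theorem join_inl_inr {a : V₁} {b : V₂} :
    join π₁ π₂ v r (inl a) (inr b) ↔ π₁ a v ∧ π₂ b r := by
  change joinMap π₁ π₂ v r _ = joinMap π₁ π₂ v r _ ↔ _
  simp only [joinMap]
  by_cases h : π₂ b r
  · simp only [h, if_true, and_true, inl.injEq]
    exact Quotient.eq
  · simp [h]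

theorem join_inr_inr {a b : V₂} : join π₁ π₂ v r (inr a) (inr b) ↔ π₂ a b := by
  change joinMap π₁ π₂ v r _ = joinMap π₁ π₂ v r _ ↔ _
  simp only [joinMap]
  by_cases ha : π₂ a r <;> by_cases hb : π₂ b r
  · simp only [ha, hb, if_true, true_iff]
    exact π₂.trans' ha (π₂.symm' hb)
  · simp only [ha, hb, if_true, if_false, reduceCtorEq, false_iff]
    exact fun h => hb (π₂.trans' (π₂.symm' h) ha)
  · simp only [ha, hb, if_true, if_false, reduceCtorEq, false_iff]
    exact fun h => ha (π₂.trans' h hb)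
  · simp only [ha, hb, if_false, inr.injEq]
    exact Quotient.eq

theorem comap_inl_join : Setoid.comap inl (join π₁ π₂ v r) = π₁ := by
  ext a b
  exact join_inl_inl (π₂ := π₂) (v := v) (r := r)

theorem comap_inr_join : Setoid.comap inr (join π₁ π₂ v r) = π₂ := by
  ext a b
  exact join_inr_inr (π₁ := π₁) (v := v) (r := r)

theorem join_comap {π : Setoid (V₁ ⊕ V₂)} (hvr : π (inl v) (inr r))
    (hg : ∀ a b, π (inl a) (inr b) → π (inl a) (inl v)) :
    join (Setoid.comap inl π) (Setoid.comap inr π) v r = π := by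
  have key : ∀ a b, join (Setoid.comap inl π) (Setoid.comap inr π) v r
      (inl a) (inr b) ↔ π (inl a) (inr b) := by
    intro a b
    rw [join_inl_inr]
    constructor
    · rintro ⟨h1, h2⟩
      exact π.trans' h1 (π.trans' hvr (π.symm' h2))
    · intro h
      have h1 := hg a b h
      exact ⟨h1, π.trans' (π.symm' h) (π.trans' h1 hvr)⟩
  ext x y
  rcases x with a | a <;> rcases y with b | b
  · exact join_inl_inl
  · exact key a b
  · constructor
    · intro h
      exact π.symm' ((key b a).1 (Setoid.symm' _ h))
    · intro h
      exact Setoid.symm' _ ((key b a).2 (π.symm' h))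
  · exact join_inr_inr

end Join

/-- The quotient by a join is a wedge. -/
theorem wedge_join (π₁ : Setoid T₁.V) (π₂ : Setoid T₂.V) (v : T₁.V) (r : T₂.V) :
    Nonempty (Wedge ((T₁.disj T₂).quot (join π₁ π₂ v r)) (T₁.quot π₁) (T₂.quot π₂)
      (Quotient.mk _ v) (Quotient.mk _ r)) := by
  refine ⟨⟨⟨Quotient.map' inl fun _ _ h => join_inl_inl.2 h, inl, ?_, fun _ => rfl,
    fun _ => rfl, fun _ => rfl, fun _ => rfl⟩, ⟨Quotient.map' inr fun _ _ h => join_inr_inr.2 h,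
    inr, ?_, fun _ => rfl, fun _ => rfl, fun _ => rfl, fun _ => rfl⟩, Equiv.refl _,
    fun _ => rfl, fun _ => rfl, ?_, ?_⟩⟩
  · intro a b
    induction a using inductionOn
    induction b using inductionOn
    intro h
    exact sound (join_inl_inl.1 (Quotient.exact h))
  · intro a b
    induction a using inductionOn
    induction b using inductionOn
    intro h
    exact sound (join_inr_inr.1 (Quotient.exact h))
  · intro x
    induction x using inductionOn
    rename_i x
    rcases x with x | x
    · exact Or.inl ⟨Quotient.mk _ x, rfl⟩
    · exact Or.inr ⟨Quotient.mk _ x, rfl⟩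
  · intro a b
    induction a using inductionOn
    induction b using inductionOn
    rename_i a b
    constructor
    · intro h
      have h' := join_inl_inr.1 (Quotient.exact h)
      exact ⟨sound h'.1, sound h'.2⟩
    · rintro ⟨h1, h2⟩
      exact sound (join_inl_inr.2 ⟨Quotient.exact h1, Quotient.exact h2⟩)

end Disj

end StarGraph

section Glue

open StarGraph

variable {A : (Σ i, K i) → MatrixSeq Ω}
  [∀ N, IsProbabilityMeasure (P N)]

theorem not_sep_of_not_good {T₁ T₂ : StarGraph (Σ i, K i)} {π : Setoid (T₁.disj T₂).V} {v : T₁.V}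
    {r : T₂.V} (hvr : π (inl v) (inr r))
    (h₁ : (T₁.quot (Setoid.comap inl π)).Connected)
    (h₂ : (T₂.quot (Setoid.comap inr π)).Connected)
    {i : ι} (hi : ∀ e, (T₂.label e).1 = i)
    (hv : ∀ e, (T₁.quot (Setoid.comap inl π)).Touches e (Quotient.mk _ v) → (T₁.label e).1 ≠ i)
    (hg : ¬ ∀ a b, π (inl a) (inr b) → π (inl a) (inl v)) :
    ¬ ((T₁.disj T₂).quot π).Sep := by
  intro hs
  apply hg
  intro a b hab
  have hp : (subLeft π).onV (Quotient.mk _ v) = (subRight π).onV (Quotient.mk _ r) := sound hvr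
  by_cases hE : IsEmpty T₂.E
  · have : IsEmpty (T₂.quot (Setoid.comap inr π)).E := hE
    have hss := h₂.subsingleton_of_isEmpty
    have h1 : (Quotient.mk (Setoid.comap inr π) b) = Quotient.mk _ r := hss.elim _ _
    have h2 : Setoid.comap inr π b r := Quotient.exact h1
    exact π.trans' hab (π.trans' h2 (π.symm' hvr))
  · obtain ⟨e0⟩ := not_isEmpty_iff.1 hE
    have hK : ∀ z, ((T₁.disj T₂).quot π).MemComp ((subRight π).onV z)
        (compOf _ ((subRight π).onE e0)) := by
      intro z
      obtain ⟨e, he⟩ := h₂.exists_touches e0 z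
      exact ⟨_, (subRight π).compOf_eq (h₂.compOf_eq hi e e0), (subRight π).touches he⟩
    have key : ∀ z, ((T₁.disj T₂).quot π).Linked
        (fun e => compOf _ e ≠ compOf _ ((subRight π).onE e0))
        ((subLeft π).onV (Quotient.mk _ v)) ((subLeft π).onV z) := by
      intro z
      refine Linked.induction (motive := fun z => ((T₁.disj T₂).quot π).Linked
        (fun e => compOf _ e ≠ compOf _ ((subRight π).onE e0))
        ((subLeft π).onV (Quotient.mk _ v)) ((subLeft π).onV z)) (Linked.refl _) ?_
        ((connected_iff.1 h₁).2 (Quotient.mk _ v) z)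
      intro x y g _ ih _ hx hy
      by_cases hge : compOf ((T₁.disj T₂).quot π) ((subLeft π).onE g) =
          compOf _ ((subRight π).onE e0)
      · exfalso
        have h3 : (Quotient.mk _ v) = x := (subLeft π).inj
          (hs _ _ _ (by rw [hp]; exact hK _) ⟨_, hge, (subLeft π).touches hx⟩ ih)
        subst h3
        refine hv g hx ?_
        have := color_eq_of_compOf_eq hge
        exact this.trans (hi e0)
      · exact ih.trans (linked_of_touches (e := (subLeft π).onE g) hge ((subLeft π).touches hx)
          ((subLeft π).touches hy))
    have h4 : (subLeft π).onV (Quotient.mk _ a) = (subRight π).onV (Quotient.mk _ b) := sound hab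
    have h5 := hs _ _ _ (by rw [h4]; exact hK _) (by rw [hp]; exact hK _) (key (Quotient.mk _ a)).symm
    exact Quotient.exact h5

/-- Sums over gluings factorize. -/
theorem sum_injState_gluings (hA : ∀ k, Moments P (A k))
    {τ : StarGraph (Σ i, K i) → ℂ} (hτ : TrafficLimit P A τ) (hτ' : FreeState τ)
    {T₁ T₂ : StarGraph (Σ i, K i)} (S₁ : Set (Setoid T₁.V)) (S₂ : Set (Setoid T₂.V))
    [DecidablePred (· ∈ S₁)] [DecidablePred (· ∈ S₂)] (v : T₁.V) (r : T₂.V)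
    [DecidablePred (· ∈ gluings S₁ S₂ v r)]
    (h₁ : ∀ π ∈ S₁, (T₁.quot π).Connected) (h₂ : ∀ π ∈ S₂, (T₂.quot π).Connected)
    {i : ι} (hi : ∀ e, (T₂.label e).1 = i)
    (hv : ∀ π ∈ S₁, (T₁.quot π).Sep → ∀ e, (T₁.quot π).Touches e (Quotient.mk _ v) →
      (T₁.label e).1 ≠ i) :
    (∑ π, if π ∈ gluings S₁ S₂ v r then injState τ ((T₁.disj T₂).quot π) else 0) =
      (∑ π, if π ∈ S₁ then injState τ (T₁.quot π) else 0) *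
        ∑ π, if π ∈ S₂ then injState τ (T₂.quot π) else 0 := by
  have hval : ∀ π₁ ∈ S₁, ∀ π₂ ∈ S₂, injState τ ((T₁.disj T₂).quot (join π₁ π₂ v r)) =
      injState τ (T₁.quot π₁) * injState τ (T₂.quot π₂) := by
    intro π₁ hπ₁ π₂ hπ₂
    obtain ⟨W⟩ := wedge_join (T₁ := T₁) (T₂ := T₂) π₁ π₂ v r
    by_cases hs : (T₁.quot π₁).Sep
    · exact injState_wedge hA hτ hτ' W (h₁ _ hπ₁) (h₂ _ hπ₂) (i := i) hi (hv _ hπ₁ hs)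
    · rw [hτ'.eq_zero (h₁ _ hπ₁) hs, zero_mul, hτ'.eq_zero (W.connected (h₁ _ hπ₁) (h₂ _ hπ₂))]
      exact fun h => hs (Sep.of_sub W.s₁ h)
  rw [← sum_filter, ← sum_filter, ← sum_filter, sum_mul_sum, ← Finset.sum_product']
  symm
  refine Finset.sum_bij_ne_zero (fun p _ _ => join p.1 p.2 v r) ?_ ?_ ?_ ?_
  · rintro ⟨π₁, π₂⟩ hp _
    simp only [mem_product, mem_filter, mem_univ, true_and] at hp
    refine mem_filter.2 ⟨mem_univ _, ?_, ?_, join_inl_inr.2 ⟨π₁.refl' _, π₂.refl' _⟩⟩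
    · rw [comap_inl_join]; exact hp.1
    · rw [comap_inr_join]; exact hp.2
  · rintro ⟨π₁, π₂⟩ _ _ ⟨π₁', π₂'⟩ _ _ h
    simp only at h
    have h3 := congrArg (Setoid.comap inl) h
    have h4 := congrArg (Setoid.comap inr) h
    rw [comap_inl_join, comap_inl_join] at h3
    rw [comap_inr_join, comap_inr_join] at h4
    rw [h3, h4]
  · intro π hπ hne
    simp only [mem_filter, mem_univ, true_and] at hπ
    obtain ⟨hπ₁, hπ₂, hvr⟩ := hπ
    have hconn := connected_quot_disj hvr (h₁ _ hπ₁) (h₂ _ hπ₂)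
    have hs : ((T₁.disj T₂).quot π).Sep := by
      by_contra hs
      exact hne (hτ'.eq_zero hconn hs)
    have hs₁ : (T₁.quot (Setoid.comap inl π)).Sep := Sep.of_sub (subLeft π) hs
    have hg : ∀ a b, π (inl a) (inr b) → π (inl a) (inl v) := by
      by_contra hg
      exact not_sep_of_not_good hvr (h₁ _ hπ₁) (h₂ _ hπ₂) hi (hv _ hπ₁ hs₁) hg hs
    have hj := join_comap hvr hg
    refine ⟨(Setoid.comap inl π, Setoid.comap inr π), ?_, ?_, hj⟩
    · simp only [mem_product, mem_filter, mem_univ, true_and]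
      exact ⟨hπ₁, hπ₂⟩
    · simp only
      rw [← hval _ hπ₁ _ hπ₂]
      have : injState τ ((T₁.disj T₂).quot π) =
        injState τ ((T₁.disj T₂).quot (join (Setoid.comap inl π) (Setoid.comap inr π) v r)) :=
        congrArg (fun ρ => injState τ ((T₁.disj T₂).quot ρ)) hj.symm
      rwa [← this]
  · rintro ⟨π₁, π₂⟩ hp _
    simp only [mem_product, mem_filter, mem_univ, true_and] at hp
    exact (hval _ hp.1 _ hp.2).symm

theorem tendsto_meanOn_gluings (hA : ∀ k, Moments P (A k))
    {τ : StarGraph (Σ i, K i) → ℂ} (hτ : TrafficLimit P A τ) (hτ' : FreeState τ)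
    {T₁ T₂ : StarGraph (Σ i, K i)} (S₁ : Set (Setoid T₁.V)) (S₂ : Set (Setoid T₂.V))
    (v : T₁.V) (r : T₂.V)
    (h₁ : ∀ π ∈ S₁, (T₁.quot π).Connected) (h₂ : ∀ π ∈ S₂, (T₂.quot π).Connected)
    {i : ι} (hi : ∀ e, (T₂.label e).1 = i)
    (hv : ∀ π ∈ S₁, (T₁.quot π).Sep → ∀ e, (T₁.quot π).Touches e (Quotient.mk _ v) →
      (T₁.label e).1 ≠ i) :
    Tendsto (fun N => meanOn P A (T₁.disj T₂) (gluings S₁ S₂ v r) N -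
      meanOn P A T₁ S₁ N * meanOn P A T₂ S₂ N) atTop (𝓝 0) := by
  have t := tendsto_meanOn hA hτ (T₁.disj T₂) (gluings S₁ S₂ v r) fun π hπ =>
    connected_quot_disj hπ.2.2 (h₁ _ hπ.1) (h₂ _ hπ.2.1)
  have t₁ := tendsto_meanOn hA hτ T₁ S₁ h₁
  have t₂ := tendsto_meanOn hA hτ T₂ S₂ h₂
  have := t.sub (t₁.mul t₂)
  rwa [sum_injState_gluings hA hτ hτ' S₁ S₂ v r h₁ h₂ hi hv, sub_self] at this

end Glue

/-! ### Sums over the corners of a system of arms -/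

/-- Sum over the paths between two points. -/
theorem sum_path {α : Type*} {N : ℕ} (f : α → Mat[N]) (l : List α)
    (x y : Fin N) :
    (∑ φ : Fin (l.length + 1) → Fin N, if φ 0 = x ∧ φ (Fin.last _) = y then
      ∏ t : Fin l.length, f l[t] (φ t.castSucc) (φ t.succ) else 0) = (l.map f).prod x y := by
  induction l generalizing x with
  | nil =>
    change (∑ φ : Fin 1 → Fin N, if φ 0 = x ∧ φ 0 = y then
      ∏ t : Fin 0, f ([] : List α)[t] (φ t.castSucc) (φ t.succ) else 0) =
      (1 : Mat[N]) x y
    refine (sum_equiv (Equiv.funUnique (Fin 1) (Fin N)) _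
      (fun z => if z = x then (if x = y then 1 else 0) else 0) fun φ => ?_).trans ?_
    · change (if φ 0 = x ∧ φ 0 = y then _ else 0) = if φ 0 = x then (if x = y then 1 else 0) else 0
      by_cases hx : φ 0 = x
      · simp [hx]
      · simp [hx]
    · rw [sum_ite_eq' univ x]
      simp [Matrix.one_apply]
  | cons M l ih =>
    rw [List.map_cons, List.prod_cons, mul_apply]
    refine (sum_equiv (Fin.consEquiv (fun _ : Fin (l.length + 1 + 1) => Fin N)).symm _
      (fun q : Fin N × (Fin (l.length + 1) → Fin N) => if q.1 = x ∧ q.2 (Fin.last _) = y then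
        f M q.1 (q.2 0) * ∏ t : Fin l.length, f l[t] (q.2 t.castSucc) (q.2 t.succ) else 0)
      fun φ => ?_).trans ?_
    · have hp : (∏ t : Fin (M :: l).length, f (M :: l)[t] (φ t.castSucc) (φ t.succ)) =
          f M (φ 0) (φ 1) * ∏ t : Fin l.length, f l[t] (φ t.succ.castSucc) (φ t.succ.succ) :=
        Fin.prod_univ_succ (n := l.length) fun t => f (M :: l)[t] (φ t.castSucc) (φ t.succ)
      rw [hp]
      rfl
    · rw [sum_prod_type]
      rw [sum_eq_single x]
      · simp only [true_and]
        have h4 : ∀ z, f M x z * (l.map f).prod z y = ∑ φ : Fin (l.length + 1) → Fin N,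
            if φ 0 = z then (if φ (Fin.last _) = y then f M x (φ 0) *
              ∏ t : Fin l.length, f l[t] (φ t.castSucc) (φ t.succ) else 0) else 0 := by
          intro z
          rw [← ih z, mul_sum]
          refine sum_congr rfl fun φ _ => ?_
          by_cases h1 : φ 0 = z <;> by_cases h2 : φ (Fin.last _) = y <;> simp [h1, h2]
        simp_rw [h4]
        rw [sum_comm]
        refine sum_congr rfl fun φ _ => ?_
        rw [sum_ite_eq univ (φ 0)]
        simp
      · intro b _ hb
        simp [hb]
      · simp

/-- The value of a `*`-word in a family of matrices. -/
def wordMat {J : Type*} {N : ℕ} (A : J → Mat[N]) (w : List (J × Bool)) :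
    Mat[N] :=
  (w.map fun x => starIf x.2 (A x.1)).prod

section Arms

variable {I : Type} [Fintype I] {col : I → ι}

/-- A disjoint union of paths labelled by words. -/
def arms (w : ∀ s, List (K (col s) × Bool)) : StarGraph (Σ i, K i) where
  V := Σ s, Fin ((w s).length + 1)
  E := Σ s, Fin (w s).length
  src e := ⟨e.1, e.2.castSucc⟩
  tgt e := ⟨e.1, e.2.succ⟩
  label e := ⟨col e.1, ((w e.1)[e.2]).1⟩
  star e := ((w e.1)[e.2]).2

/-- The first vertex of a path. -/
def armStart (w : ∀ s, List (K (col s) × Bool)) (s : I) : (arms w).V := ⟨s, 0⟩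

/-- The last vertex of a path. -/
def armStop (w : ∀ s, List (K (col s) × Bool)) (s : I) : (arms w).V := ⟨s, Fin.last _⟩

/-- The partitions which attach the end of each path to the beginning of the next one, and
identify the beginnings according to some partition in `C`. -/
def armGlue (next : I → I) (C : Set (Setoid I)) (w : ∀ s, List (K (col s) × Bool)) :
    Set (Setoid (arms w).V) :=
  {π | (∀ s, π (armStop w s) (armStart w (next s))) ∧ Setoid.comap (armStart w) π ∈ C}

theorem sum_armGlue (next : I → I) (C : Set (Setoid I)) (w : ∀ s, List (K (col s) × Bool)) {N : ℕ}
    (A : (Σ i, K i) → Mat[N]) (F : (I → Fin N) → ℂ) :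
    (∑ φ : (arms w).V → Fin N, (if ker φ ∈ armGlue next C w then (arms w).weight A φ else 0)
      * F (fun s => φ (armStart w s))) =
    ∑ x : I → Fin N, if ker x ∈ C then
      (∏ s, wordMat (fun k => A ⟨col s, k⟩) (w s) (x s) (x (next s))) * F x else 0 := by
  have h1 : ∀ φ : (arms w).V → Fin N,
      (if ker φ ∈ armGlue next C w then (arms w).weight A φ else 0)
        * F (fun s => φ (armStart w s)) =
      ∑ x : I → Fin N, if (fun s => φ (armStart w s)) = x then
        (if ker x ∈ C then (if ∀ s, φ (armStop w s) = x (next s) then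
          (arms w).weight A φ else 0) * F x else 0) else 0 := by
    intro φ
    rw [sum_ite_eq univ (fun s => φ (armStart w s))]
    simp only [mem_univ, if_true]
    have : ker φ ∈ armGlue next C w ↔ (∀ s, φ (armStop w s) = φ (armStart w (next s))) ∧
      ker (fun s => φ (armStart w s)) ∈ C := Iff.rfl
    rw [this]
    by_cases h : ker (fun s => φ (armStart w s)) ∈ C
    · simp only [h, and_true, if_true]
    · simp only [h, and_false, if_false, zero_mul]
  simp_rw [h1]
  rw [sum_comm]
  refine sum_congr rfl fun x _ => ?_
  by_cases hC : ker x ∈ C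
  swap
  · simp [hC]
  simp only [hC, if_true]
  have h2 : ∀ φ : (arms w).V → Fin N, (if (fun s => φ (armStart w s)) = x then
        ((if ∀ s, φ (armStop w s) = x (next s) then (arms w).weight A φ else 0) * F x) else 0) =
      (∏ s, if φ (armStart w s) = x s ∧ φ (armStop w s) = x (next s) then
        ∏ t : Fin (w s).length, starIf ((w s)[t]).2 (A ⟨col s, ((w s)[t]).1⟩)
          (φ ⟨s, t.castSucc⟩) (φ ⟨s, t.succ⟩) else 0) * F x := by
    intro φ
    have hw : (arms w).weight A φ = ∏ s, ∏ t : Fin (w s).length,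
        starIf ((w s)[t]).2 (A ⟨col s, ((w s)[t]).1⟩) (φ ⟨s, t.castSucc⟩) (φ ⟨s, t.succ⟩) := by
      unfold StarGraph.weight
      exact Fintype.prod_sigma _
    rw [hw, Fintype.prod_ite_zero]
    by_cases ha : (fun s => φ (armStart w s)) = x
    · have ha' : ∀ s, φ (armStart w s) = x s := fun s => congrFun ha s
      simp only [ha, if_true]
      simp only [ha', true_and]
    · have ha' : ¬ ∀ s, φ (armStart w s) = x s ∧ φ (armStop w s) = x (next s) :=
        fun h => ha (funext fun s => (h s).1)
      simp only [ha, ha', if_false, zero_mul]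
  simp_rw [h2]
  rw [← sum_mul]
  congr 1
  let e : ((arms w).V → Fin N) ≃ (∀ s, Fin ((w s).length + 1) → Fin N) :=
    Equiv.piCurry (α := I) (β := fun s => Fin ((w s).length + 1)) (fun _ _ => Fin N)
  refine (sum_equiv e _ (fun ψ => ∏ s, if ψ s 0 = x s ∧ ψ s (Fin.last _) = x (next s) then
        ∏ t : Fin (w s).length, starIf ((w s)[t]).2 (A ⟨col s, ((w s)[t]).1⟩)
          (ψ s t.castSucc) (ψ s t.succ) else 0) fun φ => rfl).trans ?_
  have h3 := Finset.prod_univ_sum (fun s : I => (univ : Finset (Fin ((w s).length + 1) → Fin N)))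
    (fun s ψ => if ψ 0 = x s ∧ ψ (Fin.last _) = x (next s) then
        ∏ t : Fin (w s).length, starIf ((w s)[t]).2 (A ⟨col s, ((w s)[t]).1⟩)
          (ψ t.castSucc) (ψ t.succ) else 0)
  rw [Fintype.piFinset_univ] at h3
  refine h3.symm.trans (prod_congr rfl fun s _ => ?_)
  exact sum_path (fun y : K (col s) × Bool => starIf y.2 (A ⟨col s, y.1⟩)) (w s) (x s) (x (next s))

end Arms

/-! ### Polynomial arms -/

/-- The `*`-monomial with letters `w`. -/
def wordPoly {J : Type*} (w : List (J × Bool)) : StarPoly J := (w.map (FreeAlgebra.ι ℂ)).prod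

theorem wordPoly_eval {J : Type*} {N : ℕ} (A : J → Mat[N])
    (w : List (J × Bool)) : (wordPoly w).eval A = wordMat A w := by
  simp only [wordPoly, StarPoly.eval, wordMat, map_list_prod, List.map_map]
  congr 2
  funext x
  simp

theorem span_wordPoly (J : Type*) :
    Submodule.span ℂ (Set.range (wordPoly (J := J))) = ⊤ := by
  rw [eq_top_iff]
  rintro p -
  induction p using FreeAlgebra.induction with
  | grade0 c =>
    rw [Algebra.algebraMap_eq_smul_one]
    exact Submodule.smul_mem _ _ (Submodule.subset_span ⟨[], by simp [wordPoly]⟩)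
  | grade1 x => exact Submodule.subset_span ⟨[x], by simp [wordPoly]⟩
  | add a b ha hb => exact Submodule.add_mem _ ha hb
  | mul a b ha hb =>
    have h := Submodule.mul_mem_mul ha hb
    rw [Submodule.span_mul_span] at h
    refine Submodule.span_mono ?_ h
    rintro _ ⟨_, ⟨v, rfl⟩, _, ⟨w, rfl⟩, rfl⟩
    exact ⟨v ++ w, by simp [wordPoly]⟩

section

variable {I : Type} {col : I → ι}

section

variable [Fintype I]

/-- A multilinear statement on families of `*`-polynomials may be checked on words. -/
theorem starPoly_induction {Q : (∀ s, StarPoly (K (col s))) → Prop}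
    (hadd : ∀ p s x y, Q (update p s x) → Q (update p s y) → Q (update p s (x + y)))
    (hsmul : ∀ p s (c : ℂ) x, Q (update p s x) → Q (update p s (c • x)))
    (hw : ∀ w : ∀ s, List (K (col s) × Bool), Q fun s => wordPoly (w s)) (p) : Q p := by
  have key : ∀ F : Finset I, ∀ p : ∀ s, StarPoly (K (col s)),
      (∀ s ∉ F, ∃ w, p s = wordPoly w) → Q p := by
    intro F
    induction F using Finset.induction_on with
    | empty =>
      intro p hp
      choose w hw' using fun s => hp s (Finset.notMem_empty s)
      have : p = fun s => wordPoly (w s) := funext hw'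
      rw [this]
      exact hw w
    | insert a F _ ih =>
      intro p hp
      have hword : ∀ w, Q (update p a (wordPoly w)) := by
        intro w
        refine ih _ fun s hs => ?_
        by_cases h : s = a
        · subst h
          exact ⟨w, by simp⟩
        · rw [Function.update_of_ne h]
          exact hp s (by simp [h, hs])
      have h : ∀ x, x ∈ Submodule.span ℂ (Set.range (wordPoly (J := K (col a)))) →
          Q (update p a x) := by
        intro x hx
        induction hx using Submodule.span_induction with
        | mem x hx =>
          obtain ⟨w, rfl⟩ := hx
          exact hword w
        | zero =>
          have := hsmul p a 0 _ (hword [])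
          rwa [zero_smul] at this
        | add x y _ _ hx hy => exact hadd p a x y hx hy
        | smul c x _ hx => exact hsmul p a c x hx
      have h' := h (p a) (by rw [span_wordPoly]; trivial)
      rwa [Function.update_eq_self] at h'
  exact key univ p fun s hs => absurd (mem_univ s) hs

/-- The sum of the products of the entries `M_s(x_s, x_{next s})` over the families of indices `x`
with kernel in `C`. -/
def armSum (next : I → I) (C : Set (Setoid I)) {N : ℕ} (M : I → Mat[N]) : ℂ :=
  ∑ x : I → Fin N, if ker x ∈ C then ∏ s, M s (x s) (x (next s)) else 0

theorem armSum_update (next : I → I) (C : Set (Setoid I)) {N : ℕ}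
    (M : I → Mat[N]) (s : I) (X : Mat[N]) :
    armSum next C (update M s X) = ∑ x : I → Fin N, if ker x ∈ C then
      X (x s) (x (next s)) * ∏ r ∈ univ.erase s, M r (x r) (x (next r)) else 0 := by
  unfold armSum
  refine sum_congr rfl fun x _ => ?_
  refine if_congr Iff.rfl ?_ rfl
  rw [← Finset.mul_prod_erase univ _ (mem_univ s), Function.update_self]
  congr 1
  refine prod_congr rfl fun r hr => ?_
  rw [Function.update_of_ne (ne_of_mem_erase hr)]

theorem armSum_add (next : I → I) (C : Set (Setoid I)) {N : ℕ}
    (M : I → Mat[N]) (s : I) (X Y : Mat[N]) :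
    armSum next C (update M s (X + Y)) =
      armSum next C (update M s X) + armSum next C (update M s Y) := by
  simp only [armSum_update, ← sum_add_distrib, Matrix.add_apply]
  refine sum_congr rfl fun x _ => ?_
  split_ifs
  · ring
  · simp

theorem armSum_smul (next : I → I) (C : Set (Setoid I)) {N : ℕ}
    (M : I → Mat[N]) (s : I) (c : ℂ) (X : Mat[N]) :
    armSum next C (update M s (c • X)) = c * armSum next C (update M s X) := by
  simp only [armSum_update, mul_sum, Matrix.smul_apply, smul_eq_mul]
  refine sum_congr rfl fun x _ => ?_
  split_ifs
  · ring
  · simp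

end

/-- Keep the polynomials of `R` and replace the other ones by `1`. -/
def mask (R : Set I) (p : ∀ s, StarPoly (K (col s))) (s : I) : StarPoly (K (col s)) :=
  if s ∈ R then p s else 1

/-- Keep the words of `R` and replace the other ones by the empty word. -/
def maskWord (R : Set I) (w : ∀ s, List (K (col s) × Bool)) (s : I) : List (K (col s) × Bool) :=
  if s ∈ R then w s else []

theorem wordPoly_maskWord (R : Set I) (w : ∀ s, List (K (col s) × Bool)) :
    (fun s => wordPoly (maskWord R w s)) = mask R fun s => wordPoly (w s) := by
  funext s
  simp only [mask, maskWord]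
  split_ifs
  · rfl
  · simp [wordPoly]

theorem mask_update_of_mem {R : Set I} (p : ∀ s, StarPoly (K (col s))) {s : I}
    (hs : s ∈ R) (x) : mask R (update p s x) = update (mask R p) s x := by
  funext r
  by_cases h : r = s
  · subst h
    simp [mask, hs]
  · simp [mask, h]

theorem mask_update_of_notMem {R : Set I} (p : ∀ s, StarPoly (K (col s))) {s : I}
    (hs : s ∉ R) (x) : mask R (update p s x) = mask R p := by
  funext r
  by_cases h : r = s
  · subst h
    simp [mask, hs]
  · simp [mask, h]

end

/-! ### The vertices joined by an arm -/

namespace StarGraph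

/-- The vertices are equal or belong to a same colored component of color `i`. -/
def IsArm (G : StarGraph (Σ i, K i)) (i : ι) (u v : G.V) : Prop :=
  u = v ∨ ∃ e : G.E, (G.label e).1 = i ∧ G.MemComp u (G.compOf e) ∧ G.MemComp v (G.compOf e)

variable {G : StarGraph (Σ i, K i)} {i : ι} {u v : G.V}

theorem IsArm.symm (h : G.IsArm i u v) : G.IsArm i v u := by
  rcases h with rfl | ⟨e, he, h1, h2⟩
  · exact Or.inl rfl
  · exact Or.inr ⟨e, he, h2, h1⟩

theorem IsArm.linked_or (h : G.IsArm i u v) (c : G.Comp) :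
    G.Linked (fun e => G.compOf e ≠ c) u v ∨ (G.MemComp u c ∧ G.MemComp v c) := by
  rcases h with rfl | ⟨e, he, h1, h2⟩
  · exact Or.inl (Linked.refl _)
  · by_cases hc : G.compOf e = c
    · rw [hc] at h1 h2
      exact Or.inr ⟨h1, h2⟩
    · exact Or.inl ((linked_of_memComp h1 h2).mono fun f hf => by rwa [hf])

theorem IsArm.linked (h : G.IsArm i u v) {e : G.E} (he : (G.label e).1 ≠ i) :
    G.Linked (fun f => G.compOf f ≠ G.compOf e) u v := by
  rcases h with rfl | ⟨f, hf, h1, h2⟩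
  · exact Linked.refl _
  · refine (linked_of_memComp h1 h2).mono fun g hg (hge : G.compOf g = G.compOf e) => he ?_
    rw [← hf, color_eq_of_compOf_eq (hge.symm.trans hg)]

end StarGraph

open StarGraph

section

variable {I : Type} [Fintype I] {col : I → ι}
variable {w : ∀ s, List (K (col s) × Bool)} {π : Setoid (arms w).V}

theorem linked_arm {p : (arms w).E → Prop} {s : I} (hp : ∀ t, p ⟨s, t⟩)
    (t : Fin ((w s).length + 1)) :
    ((arms w).quot π).Linked p (Quotient.mk _ (armStart w s)) (Quotient.mk _ ⟨s, t⟩) := by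
  induction t using Fin.induction with
  | zero => exact Linked.refl _
  | succ t ih =>
    exact ih.trans (linked_of_touches (T := (arms w).quot π) (e := (⟨s, t⟩ : (arms w).E)) (hp t)
      (Or.inl rfl) (Or.inr rfl))

theorem arm_compOf (s : I) (t t' : Fin (w s).length) :
    ((arms w).quot π).compOf (⟨s, t⟩ : (arms w).E) =
      ((arms w).quot π).compOf (⟨s, t'⟩ : (arms w).E) := by
  have h0 : 0 < (w s).length := t.pos
  suffices h : ∀ n (hn : n < (w s).length),
      ((arms w).quot π).compOf (⟨s, ⟨n, hn⟩⟩ : (arms w).E) =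
      ((arms w).quot π).compOf (⟨s, ⟨0, h0⟩⟩ : (arms w).E) from
    (h t t.2).trans (h t' t'.2).symm
  intro n
  induction n with
  | zero => intro _; rfl
  | succ n ih =>
    intro hn
    refine Eq.trans ?_ (ih (by omega))
    refine compOf_eq_of_touches (T := (arms w).quot π)
      (v := Quotient.mk _ (⟨s, ⟨n + 1, by omega⟩⟩ : (arms w).V)) rfl (Or.inl rfl) (Or.inr rfl)

theorem arm_memComp (s : I) (t : Fin (w s).length) (t' : Fin ((w s).length + 1)) :
    ((arms w).quot π).MemComp (Quotient.mk _ (⟨s, t'⟩ : (arms w).V))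
      (((arms w).quot π).compOf (⟨s, t⟩ : (arms w).E)) := by
  have h0 : 0 < (w s).length := t.pos
  rcases Fin.eq_castSucc_or_eq_last t' with ⟨u, rfl⟩ | rfl
  · rw [arm_compOf s t u]
    exact memComp_compOf (T := (arms w).quot π) (Or.inl rfl)
  · rw [arm_compOf s t ⟨(w s).length - 1, by omega⟩]
    refine memComp_compOf (T := (arms w).quot π) (Or.inr ?_)
    refine congrArg (Quotient.mk π) (congrArg (Sigma.mk s) (Fin.ext ?_))
    simp
    omega

variable {next : I → I} {C : Set (Setoid I)}

theorem arm_memComp_start (s : I) (t : Fin (w s).length) :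
    ((arms w).quot π).MemComp (Quotient.mk _ (armStart w s))
      (((arms w).quot π).compOf (⟨s, t⟩ : (arms w).E)) := arm_memComp s t 0

theorem mk_armStop (hπ : π ∈ armGlue next C w) (s : I) :
    (Quotient.mk π (armStop w s)) = Quotient.mk π (armStart w (next s)) :=
  sound (hπ.1 s)

theorem arm_memComp_next (hπ : π ∈ armGlue next C w) (s : I) (t : Fin (w s).length) :
    ((arms w).quot π).MemComp (Quotient.mk _ (armStart w (next s)))
      (((arms w).quot π).compOf (⟨s, t⟩ : (arms w).E)) := by
  rw [← mk_armStop hπ]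
  exact arm_memComp s t (Fin.last _)

theorem isArm_armGlue (hπ : π ∈ armGlue next C w) (s : I) :
    ((arms w).quot π).IsArm (col s) (Quotient.mk _ (armStart w s))
      (Quotient.mk _ (armStart w (next s))) := by
  rcases Nat.eq_zero_or_pos (w s).length with h | h
  · left
    rw [← mk_armStop hπ]
    refine congrArg (Quotient.mk π) (congrArg (Sigma.mk s) (Fin.ext ?_))
    simp [h]
  · exact Or.inr ⟨(⟨s, ⟨0, h⟩⟩ : (arms w).E), rfl, arm_memComp_start s _, arm_memComp_next hπ s _⟩

/-- All the corners are linked by the arms and by the partition. -/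
def ArmConn (next : I → I) (C : Set (Setoid I)) : Prop :=
  ∀ ρ ∈ C, ∀ a b, EqvGen (fun a b => b = next a ∨ ρ a b) a b

theorem connected_armGlue [Nonempty I] (hC : ArmConn next C) (hπ : π ∈ armGlue next C w) :
    ((arms w).quot π).Connected := by
  rw [connected_iff]
  have key : ∀ a b, ((arms w).quot π).Linked (fun _ => True) (Quotient.mk _ (armStart w a))
      (Quotient.mk _ (armStart w b)) := by
    intro a b
    induction hC _ hπ.2 a b with
    | rel a b h =>
      rcases h with rfl | h
      · rw [← mk_armStop hπ]
        exact linked_arm (fun _ => trivial) _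
      · have : (Quotient.mk π (armStart w a)) = Quotient.mk π (armStart w b) := sound h
        rw [this]
        exact Linked.refl _
    | refl a => exact Linked.refl _
    | symm a b _ h => exact h.symm
    | trans a b c _ _ h1 h2 => exact h1.trans h2
  refine ⟨⟨Quotient.mk _ (armStart w (Classical.arbitrary I))⟩, fun x y => ?_⟩
  induction x using inductionOn
  induction y using inductionOn
  rename_i x y
  exact ((linked_arm (fun _ => trivial) x.2).symm.trans (key x.1 y.1)).trans
    (linked_arm (fun _ => trivial) y.2)

end

/-! ### Limits of polynomial arms -/

section

variable {I : Type} [Fintype I] {col : I → ι}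

/-- The mean normalised sum of the products of entries of `*`-polynomials along arms. -/
def armMean (P : ∀ N, Measure (Ω N)) (A : (Σ i, K i) → MatrixSeq Ω) (next : I → I)
    (C : Set (Setoid I)) (p : ∀ s, StarPoly (K (col s))) (N : ℕ) : ℂ :=
  ∫ ω, armSum next C (fun s => (p s).eval fun k => A ⟨col s, k⟩ N ω) / (N : ℂ) ∂(P N)

variable {A : (Σ i, K i) → MatrixSeq Ω}

theorem armMean_word (next : I → I) (C : Set (Setoid I)) (w : ∀ s, List (K (col s) × Bool)) :
    armMean P A next C (fun s => wordPoly (w s)) = meanOn P A (arms w) (armGlue next C w) := by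
  funext N
  unfold armMean meanOn
  congr 1; funext ω
  congr 1
  have h := sum_armGlue next C w (fun x => A x N ω) fun _ => 1
  simp only [mul_one] at h
  simp only [armSum, wordPoly_eval]
  exact h.symm

variable [∀ N, IsProbabilityMeasure (P N)] (hA : ∀ k, Moments P (A k)) {next : I → I} {C : Set (Setoid I)}
include hA

theorem integrable_armSum (p : ∀ s, StarPoly (K (col s))) (N : ℕ) :
    Integrable (fun ω => armSum next C (fun s => (p s).eval fun k => A ⟨col s, k⟩ N ω) / (N : ℂ))
      (P N) := by
  refine AllMom.integrable (AllMom.div_const ?_ _)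
  unfold armSum
  refine AllMom.sum _ fun x _ => ?_
  split_ifs
  · exact AllMom.prod _ fun s _ =>
      (HasAllMoments.polyEval (fun k => hA ⟨col s, k⟩ N) (p s)).entry _ _
  · exact allMom_const 0

theorem armMean_add (p : ∀ s, StarPoly (K (col s))) (s : I) (x y) (N : ℕ) :
    armMean P A next C (update p s (x + y)) N =
      armMean P A next C (update p s x) N + armMean P A next C (update p s y) N := by
  unfold armMean
  rw [← integral_add (integrable_armSum hA _ N) (integrable_armSum hA _ N)]
  congr 1; funext ω
  have h : ∀ z : StarPoly (K (col s)),
      (fun r => (update p s z r).eval fun k => A ⟨col r, k⟩ N ω) =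
        update (fun r => (p r).eval fun k => A ⟨col r, k⟩ N ω) s
          (z.eval fun k => A ⟨col s, k⟩ N ω) := fun z =>
    funext fun r => Function.apply_update
      (fun (r : I) (q : StarPoly (K (col r))) => q.eval fun k => A ⟨col r, k⟩ N ω) p s z r
  simp only [h]
  rw [← add_div, ← armSum_add]
  simp [StarPoly.eval]

omit hA [∀ N, IsProbabilityMeasure (P N)] in
theorem armMean_smul (p : ∀ s, StarPoly (K (col s))) (s : I) (c : ℂ) (x) (N : ℕ) :
    armMean P A next C (update p s (c • x)) N = c * armMean P A next C (update p s x) N := by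
  unfold armMean
  rw [← integral_const_mul]
  congr 1; funext ω
  have h : ∀ z : StarPoly (K (col s)),
      (fun r => (update p s z r).eval fun k => A ⟨col r, k⟩ N ω) =
        update (fun r => (p r).eval fun k => A ⟨col r, k⟩ N ω) s
          (z.eval fun k => A ⟨col s, k⟩ N ω) := fun z =>
    funext fun r => Function.apply_update
      (fun (r : I) (q : StarPoly (K (col r))) => q.eval fun k => A ⟨col r, k⟩ N ω) p s z r
  simp only [h]
  rw [← mul_div_assoc, ← armSum_smul]
  simp [StarPoly.eval]

variable [Nonempty I] {τ : StarGraph (Σ i, K i) → ℂ} (hτ : TrafficLimit P A τ)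
include hτ

theorem exists_tendsto_armMean (hC : ArmConn next C) (p : ∀ s, StarPoly (K (col s))) :
    ∃ l, Tendsto (armMean P A next C p) atTop (𝓝 l) := by
  refine starPoly_induction (Q := fun p => ∃ l, Tendsto (armMean P A next C p) atTop (𝓝 l))
    ?_ ?_ ?_ p
  · rintro p s x y ⟨l, hl⟩ ⟨l', hl'⟩
    exact ⟨l + l', (hl.add hl').congr fun N => (armMean_add hA p s x y N).symm⟩
  · rintro p s c x ⟨l, hl⟩
    exact ⟨c * l, (hl.const_mul c).congr fun N => (armMean_smul p s c x N).symm⟩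
  · intro w
    rw [armMean_word]
    exact ⟨_, tendsto_meanOn hA hτ _ _ fun π hπ => connected_armGlue hC hπ⟩

variable (hτ' : FreeState τ)
include hτ'

theorem tendsto_armMean_zero (hC : ArmConn next C)
    (hfree : ∀ (G : StarGraph (Σ i, K i)) (x : I → G.V), G.Sep → ker x ∈ C →
      (∀ s, G.IsArm (col s) (x s) (x (next s))) → False)
    (p : ∀ s, StarPoly (K (col s))) :
    Tendsto (armMean P A next C p) atTop (𝓝 0) := by
  refine starPoly_induction (Q := fun p => Tendsto (armMean P A next C p) atTop (𝓝 0)) ?_ ?_ ?_ p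
  · intro p s x y h1 h2
    simpa using (h1.add h2).congr fun N => (armMean_add hA p s x y N).symm
  · intro p s c x h
    simpa using (h.const_mul c).congr fun N => (armMean_smul p s c x N).symm
  · intro w
    rw [armMean_word]
    have h := tendsto_meanOn hA hτ (arms w) (armGlue next C w) fun π hπ => connected_armGlue hC hπ
    rwa [sum_eq_zero] at h
    intro π _
    split_ifs with hπ
    · refine hτ'.eq_zero (connected_armGlue hC hπ) fun hs => ?_
      refine hfree _ (fun s => Quotient.mk _ (armStart w s)) hs ?_ fun s => isArm_armGlue hπ s
      have : ker (fun s => Quotient.mk π (armStart w s)) = Setoid.comap (armStart w) π := by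
        ext a b
        exact Quotient.eq
      exact this ▸ hπ.2
    · rfl

end

open StarGraph

/-! ### Splitting off the closed arms of a corner -/

section

variable {I : Type} [Fintype I] {col : I → ι}

omit [Fintype I] in
theorem armConn_top : ArmConn (I := I) id {⊤} := by
  rintro ρ rfl a b
  exact EqvGen.rel _ _ (Or.inr trivial)

theorem sum_ker_top {N : ℕ} (r : I) (z : Fin N) (f : (I → Fin N) → ℂ) :
    (∑ y : I → Fin N, if ker y ∈ ({⊤} : Set (Setoid I)) then
      f y * (if y r = z then 1 else 0) else 0) = f fun _ => z := by
  rw [sum_eq_single fun _ => z]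
  · rw [if_pos, if_pos rfl, mul_one]
    exact Setoid.ext fun a b => ⟨fun _ => trivial, fun _ => rfl⟩
  · intro y _ hy
    split_ifs with h1 h2
    · refine absurd (funext fun s => ?_) hy
      have h3 : ker y = ⊤ := h1
      have h4 : ker y s r := by rw [h3]; trivial
      exact Eq.trans h4 h2
    · simp
    · rfl
  · simp

theorem traceOn_split {next : I → I} {C : Set (Setoid I)} {R : Set I} {r₀ : I}
    (hR : ∀ ρ ∈ C, ∀ r ∈ R, ρ r (next r) ∧ ρ r r₀) (w : ∀ s, List (K (col s) × Bool)) {N : ℕ}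
    (A : (Σ i, K i) → Mat[N]) :
    ((arms (maskWord Rᶜ w)).disj (arms (maskWord R w))).traceOn
      (gluings (armGlue next C (maskWord Rᶜ w)) (armGlue id {⊤} (maskWord R w))
        (armStart _ r₀) (armStart _ r₀)) A = (arms w).traceOn (armGlue next C w) A := by
  rw [traceOn_gluings]
  have h1 : ∀ z : Fin N, (∑ ψ : (arms (maskWord R w)).V → Fin N,
      if ker ψ ∈ armGlue id {⊤} (maskWord R w) ∧ ψ (armStart _ r₀) = z then
        (arms (maskWord R w)).weight A ψ else 0) =
      ∏ s, wordMat (fun k => A ⟨col s, k⟩) (maskWord R w s) z z := by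
    intro z
    have h := sum_armGlue id {⊤} (maskWord R w) A fun y => if y r₀ = z then 1 else 0
    have h' := h.trans ((sum_congr rfl fun x _ => by congr).trans
      (sum_ker_top r₀ z fun x => ∏ s, wordMat (fun k => A ⟨col s, k⟩) (maskWord R w s) (x s) (x (id s))))
    refine Eq.trans (sum_congr rfl fun ψ _ => ?_) h'
    by_cases h1 : ker ψ ∈ armGlue id {⊤} (maskWord R w) <;>
      by_cases h2 : ψ (armStart (maskWord R w) r₀) = z <;> simp [h1, h2]
  simp_rw [h1]
  rw [sum_armGlue next C (maskWord Rᶜ w) A fun x =>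
    ∏ s, wordMat (fun k => A ⟨col s, k⟩) (maskWord R w s) (x r₀) (x r₀)]
  have h2 := sum_armGlue next C w A fun _ => 1
  simp only [mul_one] at h2
  refine Eq.trans (sum_congr rfl fun x _ => ?_) h2.symm
  split_ifs with hx
  · rw [← Finset.prod_mul_distrib]
    refine prod_congr rfl fun s _ => ?_
    by_cases hs : s ∈ R
    · have h3 : x s = x (next s) := (hR _ hx s hs).1
      have h4 : x s = x r₀ := (hR _ hx s hs).2
      simp only [maskWord, Set.mem_compl_iff, hs, not_true_eq_false, if_true, if_false]
      rw [← h3, h4]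
      simp [wordMat]
    · simp only [maskWord, Set.mem_compl_iff, hs, not_false_eq_true, if_true, if_false]
      simp [wordMat]
  · rfl

variable
  {P : ∀ N, Measure (Ω N)} {A : (Σ i, K i) → MatrixSeq Ω} [∀ N, IsProbabilityMeasure (P N)]
  (hA : ∀ k, Moments P (A k)) {next : I → I} {C : Set (Setoid I)}
  {τ : StarGraph (Σ i, K i) → ℂ} (hτ : TrafficLimit P A τ) (hτ' : FreeState τ)
include hA hτ hτ'

theorem tendsto_armMean_split (hC : ArmConn next C) {R : Set I} {r₀ : I} {i : ι}
    (hR : ∀ ρ ∈ C, ∀ r ∈ R, ρ r (next r) ∧ ρ r r₀) (hcol : ∀ r ∈ R, col r = i)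
    (hfree : ∀ (G : StarGraph (Σ i, K i)) (x : I → G.V), G.Sep → ker x ∈ C →
      (∀ s, G.IsArm (col s) (x s) (x (next s))) → ∀ s ∉ R, col s = i → ∀ e : G.E,
        (G.label e).1 = i → G.MemComp (x r₀) (G.compOf e) → G.MemComp (x s) (G.compOf e) →
        G.MemComp (x (next s)) (G.compOf e) → False)
    (p : ∀ s, StarPoly (K (col s))) :
    Tendsto (fun N => armMean P A next C p N -
      armMean P A next C (mask Rᶜ p) N * armMean P A id {⊤} (mask R p) N) atTop (𝓝 0) := by
  have : Nonempty I := ⟨r₀⟩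
  refine starPoly_induction (Q := fun p => Tendsto (fun N => armMean P A next C p N -
      armMean P A next C (mask Rᶜ p) N * armMean P A id {⊤} (mask R p) N) atTop (𝓝 0))
    ?_ ?_ ?_ p
  · intro p s x y h1 h2
    have h3 := h1.add h2
    rw [add_zero] at h3
    refine h3.congr fun N => ?_
    by_cases hs : s ∈ R
    · have hs' : s ∉ Rᶜ := fun h => h hs
      simp only [mask_update_of_mem _ hs, mask_update_of_notMem _ hs', armMean_add hA]
      ring
    · have hs' : s ∈ Rᶜ := hs
      simp only [mask_update_of_mem _ hs', mask_update_of_notMem _ hs, armMean_add hA]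
      ring
  · intro p s c x h1
    have h3 := h1.const_mul c
    rw [mul_zero] at h3
    refine h3.congr fun N => ?_
    by_cases hs : s ∈ R
    · have hs' : s ∉ Rᶜ := fun h => h hs
      simp only [mask_update_of_mem _ hs, mask_update_of_notMem _ hs', armMean_smul]
      ring
    · have hs' : s ∈ Rᶜ := hs
      simp only [mask_update_of_mem _ hs', mask_update_of_notMem _ hs, armMean_smul]
      ring
  · intro w
    rw [← wordPoly_maskWord, ← wordPoly_maskWord, armMean_word, armMean_word, armMean_word]
    refine (tendsto_meanOn_gluings hA hτ hτ' (i := i) (armGlue next C (maskWord Rᶜ w))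
      (armGlue id {⊤} (maskWord R w)) (armStart _ r₀) (armStart _ r₀)
      (fun π hπ => connected_armGlue hC hπ) (fun π hπ => connected_armGlue armConn_top hπ)
      ?_ ?_).congr fun N => ?_
    · rintro ⟨s, t⟩
      by_cases hs : s ∈ R
      · exact hcol s hs
      · have : (maskWord R w s).length = 0 := by simp [maskWord, hs]
        exact absurd t.2 (by omega)
    · rintro π hπ hs ⟨s, t⟩ ht hsi
      have hsR : s ∉ R := by
        intro hsR
        have : (maskWord Rᶜ w s).length = 0 := by simp [maskWord, hsR]
        exact absurd t.2 (by omega)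
      refine hfree _ (fun s => Quotient.mk _ (armStart (maskWord Rᶜ w) s)) hs ?_
        (fun s => isArm_armGlue hπ s) s hsR hsi _ hsi (memComp_compOf ht)
        (arm_memComp_start s t) (arm_memComp_next hπ s t)
      have : ker (fun s => Quotient.mk π (armStart (maskWord Rᶜ w) s)) =
          Setoid.comap (armStart (maskWord Rᶜ w)) π := by
        ext a b
        exact Quotient.eq
      exact this ▸ hπ.2
    · congr 1
      simp only [meanOn, traceOn_split hR]

end

open StarGraph

/-! ### Closed words of polynomials -/

theorem trace_prod_map {α : Type*} {N : ℕ} (f : α → Mat[N]) (a : α)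
    (l : List α) : ((a :: l).map f).prod.trace =
      ∑ x : Fin (l.length + 1) → Fin N, ∏ t, f (a :: l)[t] (x t) (x (t + 1)) := by
  rw [Matrix.trace]
  simp only [diag_apply, ← sum_path f (a :: l)]
  rw [sum_comm]
  have h1 : ∀ φ : Fin ((a :: l).length + 1) → Fin N,
      (∑ z, if φ 0 = z ∧ φ (Fin.last _) = z then
        ∏ t : Fin (a :: l).length, f (a :: l)[t] (φ t.castSucc) (φ t.succ) else 0) =
      if φ (Fin.last _) = φ 0 then
        ∏ t : Fin (a :: l).length, f (a :: l)[t] (φ t.castSucc) (φ t.succ) else 0 := by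
    intro φ
    rw [sum_eq_single (φ 0)]
    · simp only [true_and]
    · intro b _ hb
      rw [if_neg]
      exact fun h => hb h.1.symm
    · simp
  simp_rw [h1]
  refine (sum_equiv (Fin.snocEquiv (fun _ : Fin (l.length + 1 + 1) => Fin N)).symm _
      (fun q : Fin N × (Fin (l.length + 1) → Fin N) => if q.1 = q.2 0 then
        ∏ t, f (a :: l)[t] (q.2 t) (q.2 (t + 1)) else 0)
      fun φ => ?_).trans ?_
  · change _ = if φ (Fin.last _) = φ 0 then
      ∏ t : Fin (l.length + 1), f (a :: l)[t] (φ t.castSucc) (φ (t + 1).castSucc) else 0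
    refine if_ctx_congr Iff.rfl (fun h => ?_) fun _ => rfl
    · refine prod_congr rfl fun t _ => ?_
      congr 1
      refine Fin.lastCases (motive := fun t : Fin (l.length + 1) => φ t.succ = φ (t + 1).castSucc)
        ?_ (fun t => ?_) t
      · rw [Fin.last_add_one, Fin.succ_last]
        exact h
      · rw [Fin.coeSucc_eq_succ, Fin.succ_castSucc]
  · rw [sum_prod_type, sum_comm]
    refine sum_congr rfl fun x _ => ?_
    rw [sum_ite_eq' univ (x 0)]
    simp

section

variable {I : Type} [Fintype I] {N : ℕ} {next : I → I}

theorem armSum_top [Nonempty I] (M : I → Mat[N]) :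
    armSum next {⊤} M = ∑ i, ∏ s, M s i i := by
  have h : ∀ x : I → Fin N, (if ker x ∈ ({⊤} : Set (Setoid I)) then
      ∏ s, M s (x s) (x (next s)) else 0) = ∑ z, if ker x ∈ ({⊤} : Set (Setoid I)) then
        (∏ s, M s (x s) (x (next s))) * (if x (Classical.arbitrary I) = z then 1 else 0) else 0 := by
    intro x
    by_cases h : ker x ∈ ({⊤} : Set (Setoid I))
    · simp only [h, if_true]
      rw [← mul_sum, sum_ite_eq]
      simp
    · simp only [h, if_false, Finset.sum_const_zero]
  unfold armSum
  refine (sum_congr rfl fun x _ => Eq.trans (by congr) (h x)).trans ?_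
  rw [sum_comm]
  refine sum_congr rfl fun z _ => ?_
  exact Eq.trans (sum_congr rfl fun x _ => by congr) (sum_ker_top (Classical.arbitrary I) z
    fun x => ∏ s, M s (x s) (x (next s)))

theorem armSum_union {C D : Set (Setoid I)} (h : Disjoint C D) (M : I → Mat[N]) :
    armSum next (C ∪ D) M = armSum next C M + armSum next D M := by
  unfold armSum
  rw [← sum_add_distrib]
  refine sum_congr rfl fun x _ => ?_
  by_cases h1 : ker x ∈ C
  · have h2 : ker x ∉ D := disjoint_left.1 h h1
    simp [h1, h2]
  · by_cases h2 : ker x ∈ D <;> simp [h1, h2]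

theorem armSum_four (M : Fin 4 → Mat[N]) :
    armSum (· + 1) Set.univ M = (M 0 * (M 1 * (M 2 * M 3))).trace := by
  have h := trace_prod_map M 0 [1, 2, 3]
  simp only [List.map_cons, List.map_nil, List.prod_cons, List.prod_nil, mul_one] at h
  rw [h]
  simp only [armSum, Set.mem_univ, if_true]
  refine sum_congr (by congr!) fun x _ => ?_
  refine Eq.trans ?_ (Fin.prod_univ_four _).symm
  rw [Fin.prod_univ_four]
  rfl

end

section

variable {I : Type} [Fintype I] {col : I → ι}
variable {A : (Σ i, K i) → MatrixSeq Ω} [∀ N, IsProbabilityMeasure (P N)]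
  (hA : ∀ k, Moments P (A k)) {next : I → I} {C D : Set (Setoid I)}

omit [∀ N, IsProbabilityMeasure (P N)] in
theorem armMean_top [Nonempty I] (p : ∀ s, StarPoly (K (col s))) :
    armMean P A next {⊤} p = armMean P A id {⊤} p := by
  funext N
  simp only [armMean, armSum_top]

include hA in
theorem armMean_union (h : Disjoint C D) (p : ∀ s, StarPoly (K (col s))) (N : ℕ) :
    armMean P A next (C ∪ D) p N = armMean P A next C p N + armMean P A next D p N := by
  unfold armMean
  rw [← integral_add (integrable_armSum hA _ N) (integrable_armSum hA _ N)]
  congr 1; funext ω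
  rw [armSum_union h, add_div]

omit [∀ N, IsProbabilityMeasure (P N)] in
/-- A corner at which a single arm is kept. -/
theorem armMean_mask_single [Nonempty I] (p : ∀ s, StarPoly (K (col s))) (r : I) (N : ℕ) :
    armMean P A id {⊤} (mask {r} p) N =
      meanTrace (P N) fun ω => (p r).eval fun k => A ⟨col r, k⟩ N ω := by
  unfold armMean meanTrace
  congr 1; funext ω
  simp only [armSum_top, Matrix.trace, diag_apply]
  congr 1
  refine sum_congr rfl fun i _ => ?_
  rw [Finset.prod_eq_single r]
  · simp [mask]
  · intro s _ hs
    simp [mask, hs, StarPoly.eval]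
  · simp

omit [∀ N, IsProbabilityMeasure (P N)] in
/-- A corner at which two arms are kept. -/
theorem armMean_mask_pair [Nonempty I] (p : ∀ s, StarPoly (K (col s))) {r r' : I} (h : r ≠ r')
    (N : ℕ) :
    armMean P A id {⊤} (mask {r, r'} p) N = meanTrace (P N) fun ω =>
      ((p r).eval fun k => A ⟨col r, k⟩ N ω) ⊙ ((p r').eval fun k => A ⟨col r', k⟩ N ω) := by
  unfold armMean meanTrace
  congr 1; funext ω
  simp only [armSum_top, Matrix.trace, diag_apply, hadamard_apply]
  congr 1
  refine sum_congr rfl fun i _ => ?_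
  rw [← Finset.prod_subset (Finset.subset_univ {r, r'})]
  · rw [Finset.prod_pair h]
    simp [mask]
  · intro s _ hs
    simp only [Finset.mem_insert, mem_singleton, not_or] at hs
    simp [mask, hs, StarPoly.eval]

end

/-! ### Four alternating arms -/

theorem armConn_cycle {n : ℕ} [NeZero n] (C : Set (Setoid (Fin n))) : ArmConn (· + 1) C := by
  intro ρ _
  have key : ∀ a : Fin n, EqvGen (fun a b => b = a + 1 ∨ ρ a b) 0 a := by
    obtain ⟨m, rfl⟩ := Nat.exists_eq_succ_of_ne_zero (NeZero.ne n)
    intro a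
    induction a using Fin.induction with
    | zero => exact EqvGen.refl _
    | succ a ih => exact ih.trans _ _ _ (EqvGen.rel _ _ (Or.inl (Fin.coeSucc_eq_succ).symm))
  exact fun a b => (key a).symm.trans _ _ _ (key b)

theorem sep_four_of_ne {ι : Type*} {K : ι → Type*} {G : StarGraph (Σ i, K i)} (hG : G.Sep)
    {i j : ι} (hij : i ≠ j) {a b c d : G.V} (h₁ : G.IsArm i a b) (h₂ : G.IsArm j b c)
    (h₃ : G.IsArm i c d) (h₄ : G.IsArm j d a) (h : a ≠ b) : b = c ∧ d = a := by
  rcases h₁ with h₁ | ⟨e, he, ha, hb⟩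
  · exact absurd h₁ h
  have hj : (G.label e).1 ≠ j := he ▸ hij
  rcases h₃.linked_or (G.compOf e) with h₃ | ⟨hc, hd⟩
  · exact absurd (hG _ _ _ hb ha ((h₂.linked hj).trans (h₃.trans (h₄.linked hj)))).symm h
  · exact ⟨hG _ _ _ hb hc (h₂.linked hj), hG _ _ _ hd ha (h₄.linked hj)⟩

section

variable {A : (Σ i, K i) → MatrixSeq Ω} [∀ N, IsProbabilityMeasure (P N)]
  (hA : ∀ k, Moments P (A k)) {τ : StarGraph (Σ i, K i) → ℂ} (hτ : TrafficLimit P A τ)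
  (hτ' : FreeState τ)
  {I : Type} [Fintype I] {col : I → ι} {next : I → I} {C D : Set (Setoid I)}

include hA

theorem tendsto_armMean_inter_sdiff (X : Set (Setoid I)) {p : ∀ s, StarPoly (K (col s))}
    (h₁ : Tendsto (armMean P A next (C ∩ X) p) atTop (𝓝 0))
    (h₂ : Tendsto (armMean P A next (C \ X) p) atTop (𝓝 0)) :
    Tendsto (armMean P A next C p) atTop (𝓝 0) := by
  simpa [← armMean_union hA (Set.disjoint_sdiff_inter.symm) p, Set.inter_union_sdiff] using h₁.add h₂

theorem tendsto_armMean_sub_of_subset (h : D ⊆ C) {p : ∀ s, StarPoly (K (col s))} {f : ℕ → ℂ}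
    (h₁ : Tendsto (armMean P A next (C \ D) p) atTop (𝓝 0))
    (h₂ : Tendsto (fun N => armMean P A next D p N - f N) atTop (𝓝 0)) :
    Tendsto (fun N => armMean P A next C p N - f N) atTop (𝓝 0) := by
  simpa [← add_sub_assoc, ← armMean_union hA Set.disjoint_sdiff_left p, Set.sdiff_union_of_subset h]
    using h₁.add h₂

include hτ hτ'

theorem tendsto_armMean_split_single (hC : ArmConn next C) {r : I}
    (hr : ∀ ρ ∈ C, ρ r (next r))
    (hfree : ∀ (G : StarGraph (Σ i, K i)) (x : I → G.V), G.Sep → ker x ∈ C →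
      (∀ s, G.IsArm (col s) (x s) (x (next s))) → ∀ s, s ≠ r → col s = col r → ∀ e : G.E,
        (G.label e).1 = col r → G.MemComp (x r) (G.compOf e) → G.MemComp (x s) (G.compOf e) →
        G.MemComp (x (next s)) (G.compOf e) → False)
    (p : ∀ s, StarPoly (K (col s)))
    (hp : Tendsto (fun N => meanTrace (P N) fun ω => (p r).eval fun k => A ⟨col r, k⟩ N ω)
      atTop (𝓝 0)) :
    Tendsto (armMean P A next C p) atTop (𝓝 0) := by
  have : Nonempty I := ⟨r⟩
  have hs := tendsto_armMean_split hA hτ hτ' hC (R := {r}) (r₀ := r) (i := col r)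
    (fun ρ hρ s hs => by subst hs; exact ⟨hr ρ hρ, ρ.refl' _⟩) (by rintro _ rfl; rfl)
    (fun G x hG hx harm s hs => hfree G x hG hx harm s hs) p
  obtain ⟨l, hl⟩ := exists_tendsto_armMean hA hτ hC (mask {r}ᶜ p)
  have h2 := hl.mul hp
  simp only [armMean_mask_single] at hs
  simpa using hs.add h2

theorem tendsto_armMean_four {i j : ι} (hij : i ≠ j)
    (p : ∀ s : Fin 4, StarPoly (K (![i, j, i, j] s)))
    (h₀ : Tendsto (fun N => meanTrace (P N) fun ω => (p 0).eval fun k => A ⟨i, k⟩ N ω) atTop (𝓝 0))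
    (h₁ : Tendsto (fun N => meanTrace (P N) fun ω => (p 1).eval fun k => A ⟨j, k⟩ N ω)
      atTop (𝓝 0)) :
    Tendsto (fun N => armMean P A (· + 1) Set.univ p N -
      armMean P A id {⊤} (mask {1, 3} p) N * armMean P A id {⊤} (mask {0, 2} p) N)
      atTop (𝓝 0) := by
  have hc : ({0, 2} : Set (Fin 4))ᶜ = {1, 3} := by
    ext a
    fin_cases a <;> simp
  refine tendsto_armMean_sub_of_subset hA (Set.subset_univ {⊤})
    (tendsto_armMean_inter_sdiff hA {ρ | ρ 0 1 ∧ ρ 2 3} ?_ <|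
      tendsto_armMean_inter_sdiff hA {ρ | ρ 1 2 ∧ ρ 3 0} ?_ ?_) ?_
  · refine tendsto_armMean_split_single hA hτ hτ' (armConn_cycle _) (r := 0) (fun ρ hρ => hρ.2.1)
      (fun G x hG hx harm s hs hsi e he h1 h2 _ => ?_) p h₀
    obtain rfl : s = 2 := by fin_cases s <;> simp_all
    obtain ⟨h01, h23⟩ : x 0 = x 1 ∧ x 2 = x 3 := hx.2
    have h02 : x 0 = x 2 := hG _ _ _ h1 h2 (h01 ▸ (harm 1).linked (he.trans_ne hij))
    have h3 : ∀ a : Fin 4, x a = x 0 := by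
      intro a
      fin_cases a
      exacts [rfl, h01.symm, h02.symm, h23.symm.trans h02.symm]
    exact hx.1.2 (Setoid.ext fun a b => ⟨fun _ => trivial, fun _ => (h3 a).trans (h3 b).symm⟩)
  · refine tendsto_armMean_split_single hA hτ hτ' (armConn_cycle _) (r := 1) (fun ρ hρ => hρ.2.1)
      (fun G x hG hx harm s hs hsi e he h1 h2 _ => ?_) p h₁
    obtain rfl : s = 3 := by fin_cases s <;> simp_all
    obtain ⟨h12, h30⟩ : x 1 = x 2 ∧ x 3 = x 0 := hx.2
    have h13 : x 1 = x 3 :=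
      hG _ _ _ h1 h2 (h30 ▸ (harm 0).symm.linked (he.trans_ne hij.symm))
    exact hx.1.2 ⟨(h13.trans h30).symm, h12.symm.trans h13⟩
  · refine tendsto_armMean_zero hA hτ hτ' (armConn_cycle _) (fun G x hG hx harm => ?_) p
    have hx' : ¬ (x 0 = x 1 ∧ x 2 = x 3) := hx.1.2
    refine hx.2 ?_
    by_cases h : x 0 = x 1
    · exact (sep_four_of_ne hG hij (harm 2) (harm 3) (harm 0) (harm 1) fun h' => hx' ⟨h, h'⟩).symm
    · exact sep_four_of_ne hG hij (harm 0) (harm 1) (harm 2) (harm 3) h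
  · have hCt := tendsto_armMean_split hA hτ hτ' (armConn_cycle (n := 4) {⊤}) (R := {0, 2}) (r₀ := 0)
      (i := i) (fun ρ hρ r hr => by rw [hρ]; exact ⟨trivial, trivial⟩)
      (by rintro _ (rfl | rfl) <;> rfl)
      (fun G x hG hx harm s hs hsi e he h1 h2 _ => by fin_cases s <;> simp_all) p
    simpa only [hc, armMean_top (mask _ p)] using hCt

end

section Centered

variable {Ω : Type*} [MeasurableSpace Ω] {P : Measure Ω} [IsProbabilityMeasure P] {N : ℕ}

theorem meanTrace_sub_smul_one (hN : N ≠ 0) {M : Ω → Mat[N]}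
    (hM : HasAllMoments P M) (c : ℂ) :
    meanTrace P (fun ω => M ω - c • (1 : Mat[N])) = meanTrace P M - c := by
  unfold meanTrace
  simp only [trace_sub, trace_smul, Matrix.trace_one, card_fin, smul_eq_mul, sub_div]
  rw [integral_sub (hM.trace.div_const _).integrable (integrable_const _)]
  have hN' : (N : ℂ) ≠ 0 := Nat.cast_ne_zero.2 hN
  simp [hN']

theorem meanTrace_hadamard_centered (hN : N ≠ 0) {M L : Ω → Mat[N]}
    (hM : HasAllMoments P M) (hL : HasAllMoments P L) (c d : ℂ) :
    meanTrace P (fun ω => (M ω - c • (1 : Mat[N])) ⊙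
      (L ω - d • (1 : Mat[N]))) =
      kappaN P M L + (meanTrace P M - c) * (meanTrace P L - d) := by
  have hN' : (N : ℂ) ≠ 0 := Nat.cast_ne_zero.2 hN
  have h : ∀ ω, ((M ω - c • (1 : Mat[N])) ⊙
      (L ω - d • (1 : Mat[N]))).trace / (N : ℂ) =
      (M ω ⊙ L ω).trace / N - d * ((M ω).trace / N) - c * ((L ω).trace / N) + c * d := by
    intro ω
    field_simp
    simp only [Matrix.trace, diag_apply, hadamard_apply, Matrix.sub_apply,
      Matrix.smul_apply, one_apply_eq, smul_eq_mul, mul_one, sub_mul, mul_sub,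
      sum_sub_distrib, mul_sum, sum_const, card_univ, card_fin,
      nsmul_eq_mul]
    simp only [← mul_sum, ← sum_mul]
    ring
  have i1 := ((hM.hadamard hL).trace.div_const (N : ℂ)).integrable
  have i2 := (hM.trace.div_const (N : ℂ)).integrable
  have i3 := (hL.trace.div_const (N : ℂ)).integrable
  have : meanTrace P (fun ω => (M ω - c • (1 : Mat[N])) ⊙
      (L ω - d • (1 : Mat[N]))) = meanTrace P (fun ω => M ω ⊙ L ω) -
        d * meanTrace P M - c * meanTrace P L + c * d := by
    unfold meanTrace
    simp only [h]
    have e1 : Integrable (fun ω => (M ω ⊙ L ω).trace / (N : ℂ) - d * ((M ω).trace / (N : ℂ))) P :=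
      i1.sub (i2.const_mul d)
    have e2 : Integrable (fun ω => (M ω ⊙ L ω).trace / (N : ℂ) - d * ((M ω).trace / (N : ℂ)) -
      c * ((L ω).trace / (N : ℂ))) P := e1.sub (i3.const_mul c)
    rw [integral_add e2 (integrable_const _), integral_sub e1 (i3.const_mul c),
      integral_sub i1 (i2.const_mul d), integral_const_mul, integral_const_mul]
    simp
  rw [this, kappaN]
  ring

end Centered

theorem eval_sub_algebraMap {J : Type*} {N : ℕ} (p : StarPoly J) (c : ℂ)
    (A : J → Mat[N]) :
    (p - algebraMap ℂ (StarPoly J) c).eval A = p.eval A - c • (1 : Mat[N]) := by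
  simp only [StarPoly.eval, map_sub, AlgHom.commutes]
  rw [Algebra.algebraMap_eq_smul_one]

section

variable [∀ N, IsProbabilityMeasure (P N)]
  {A : ∀ i, K i → MatrixSeq Ω}

omit [∀ N, IsProbabilityMeasure (P N)] in
theorem AsympTrafficFree.exists_state (h : AsympTrafficFree P A) :
    ∃ τ : StarGraph (Σ i, K i) → ℂ, TrafficLimit P (fun x => A x.1 x.2) τ ∧ FreeState τ := h

theorem tendsto_meanTrace_centered {J : Type*} {A : J → MatrixSeq Ω}
    (hA : ∀ k, Moments P (A k)) (p : StarPoly J) {l : ℂ}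
    (hl : Tendsto (fun N => meanTrace (P N) fun ω => p.eval fun k => A k N ω) atTop (𝓝 l)) :
    Tendsto (fun N => meanTrace (P N) fun ω =>
      (p - algebraMap ℂ _ l).eval fun k => A k N ω) atTop (𝓝 0) := by
  have h := hl.sub_const l
  rw [sub_self] at h
  refine h.congr' ?_
  filter_upwards [eventually_ne_atTop 0] with N hN
  simp only [eval_sub_algebraMap]
  exact (meanTrace_sub_smul_one hN (HasAllMoments.polyEval (fun k => hA k N) p) l).symm

theorem tendsto_meanTrace_hadamard {J : Type*} {A : J → MatrixSeq Ω}
    (hA : ∀ k, Moments P (A k)) (p q : StarPoly J) {l m c : ℂ}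
    (hl : Tendsto (fun N => meanTrace (P N) fun ω => p.eval fun k => A k N ω) atTop (𝓝 l))
    (hm : Tendsto (fun N => meanTrace (P N) fun ω => q.eval fun k => A k N ω) atTop (𝓝 m))
    (hc : HasKappa P (fun N ω => p.eval fun k => A k N ω) (fun N ω => q.eval fun k => A k N ω) c) :
    Tendsto (fun N => meanTrace (P N) fun ω =>
      ((p - algebraMap ℂ _ l).eval fun k => A k N ω) ⊙
        ((q - algebraMap ℂ _ m).eval fun k => A k N ω)) atTop (𝓝 c) := by
  have h := Tendsto.add hc ((hl.sub_const l).mul (hm.sub_const m))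
  simp only [sub_self, mul_zero, add_zero] at h
  refine h.congr' ?_
  filter_upwards [eventually_ne_atTop 0] with N hN
  simp only [eval_sub_algebraMap]
  exact (meanTrace_hadamard_centered hN (HasAllMoments.polyEval (fun k => hA k N) p)
    (HasAllMoments.polyEval (fun k => hA k N) q) l m).symm

theorem exists_tendsto_meanTrace {A : (Σ i, K i) → MatrixSeq Ω}
    (hA : ∀ k, Moments P (A k)) {τ : StarGraph (Σ i, K i) → ℂ}
    (hτ : TrafficLimit P A τ) {i : ι} (p : StarPoly (K i)) :
    ∃ l, Tendsto (fun N => meanTrace (P N) fun ω => p.eval fun k => A ⟨i, k⟩ N ω) atTop (𝓝 l) := by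
  obtain ⟨l, hl⟩ := exists_tendsto_armMean (I := Unit) (col := fun _ => i) (next := id) (C := {⊤})
    hA hτ armConn_top (mask {()} fun _ => p)
  exact ⟨l, hl.congr fun N =>
    armMean_mask_single (P := P) (A := A) (I := Unit) (col := fun _ => i) (fun _ => p) () N⟩

/-- The expectation of an alternating word with four letters. -/
theorem tendsto_meanTrace_four {A : (Σ i, K i) → MatrixSeq Ω}
    (hA : ∀ k, Moments P (A k)) {τ : StarGraph (Σ i, K i) → ℂ}
    (hτ : TrafficLimit P A τ) (hτ' : FreeState τ) {i j : ι} (hij : i ≠ j)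
    (p₁ p₂ : StarPoly (K i)) (q₁ q₂ : StarPoly (K j))
    (hp : Tendsto (fun N => meanTrace (P N) fun ω => p₁.eval fun k => A ⟨i, k⟩ N ω) atTop (𝓝 0))
    (hq : Tendsto (fun N => meanTrace (P N) fun ω => q₁.eval fun k => A ⟨j, k⟩ N ω) atTop (𝓝 0)) :
    Tendsto (fun N => meanTrace (P N) (fun ω =>
        (p₁.eval fun k => A ⟨i, k⟩ N ω) * ((q₁.eval fun k => A ⟨j, k⟩ N ω) *
          ((p₂.eval fun k => A ⟨i, k⟩ N ω) * (q₂.eval fun k => A ⟨j, k⟩ N ω)))) -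
      meanTrace (P N) (fun ω => (q₁.eval fun k => A ⟨j, k⟩ N ω) ⊙ (q₂.eval fun k => A ⟨j, k⟩ N ω)) *
      meanTrace (P N) (fun ω => (p₁.eval fun k => A ⟨i, k⟩ N ω) ⊙ (p₂.eval fun k => A ⟨i, k⟩ N ω)))
      atTop (𝓝 0) := by
  let p : ∀ s : Fin 4, StarPoly (K (![i, j, i, j] s))
    | 0 => p₁
    | 1 => q₁
    | 2 => p₂
    | 3 => q₂
  have h2 := fun N => armMean_mask_pair (P := P) (A := A) p (r := 0) (r' := 2) (by decide) N
  have h3 := fun N => armMean_mask_pair (P := P) (A := A) p (r := 1) (r' := 3) (by decide) N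
  refine (tendsto_armMean_four hA hτ hτ' hij p hp hq).congr fun N => ?_
  rw [h2, h3]
  congr 1
  unfold armMean meanTrace
  congr 1; funext ω
  simp only [armSum_four]
  rfl

/-- Traffic-free families can be `*`-free only if one of them has vanishing `κ`. -/
theorem kappa_mul_kappa_eq_zero (hA : ∀ i k, Moments P (A i k))
    (htf : AsympTrafficFree P A) (hsf : AsympStarFree P A) {i j : ι} (hij : i ≠ j)
    (p₁ p₂ : StarPoly (K i)) (q₁ q₂ : StarPoly (K j)) {a b : ℂ}
    (ha : HasKappa P (fun N ω => p₁.eval fun k => A i k N ω)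
      (fun N ω => p₂.eval fun k => A i k N ω) a)
    (hb : HasKappa P (fun N ω => q₁.eval fun k => A j k N ω)
      (fun N ω => q₂.eval fun k => A j k N ω) b) : a * b = 0 := by
  obtain ⟨τ, hτ, hτ'⟩ := htf.exists_state
  have hA' : ∀ (x : Σ i, K i) N, HasAllMoments (P N) (A x.1 x.2 N) := fun x => hA x.1 x.2
  obtain ⟨l₁, hl₁⟩ := exists_tendsto_meanTrace hA' hτ p₁
  obtain ⟨l₂, hl₂⟩ := exists_tendsto_meanTrace hA' hτ p₂
  obtain ⟨m₁, hm₁⟩ := exists_tendsto_meanTrace hA' hτ q₁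
  obtain ⟨m₂, hm₂⟩ := exists_tendsto_meanTrace hA' hτ q₂
  have hp₁ := tendsto_meanTrace_centered (hA i) p₁ hl₁
  have hp₂ := tendsto_meanTrace_centered (hA i) p₂ hl₂
  have hq₁ := tendsto_meanTrace_centered (hA j) q₁ hm₁
  have hq₂ := tendsto_meanTrace_centered (hA j) q₂ hm₂
  have hfree := hsf.2 [⟨i, p₁ - algebraMap ℂ _ l₁⟩, ⟨j, q₁ - algebraMap ℂ _ m₁⟩,
    ⟨i, p₂ - algebraMap ℂ _ l₂⟩, ⟨j, q₂ - algebraMap ℂ _ m₂⟩] (by simp)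
    (by simp [hij, hij.symm])
    (by
      intro x hx
      simp only [List.mem_cons, List.not_mem_nil, or_false] at hx
      rcases hx with rfl | rfl | rfl | rfl
      · exact hp₁
      · exact hq₁
      · exact hp₂
      · exact hq₂)
  simp only [List.map_cons, List.map_nil, List.prod_cons, List.prod_nil, mul_one] at hfree
  have h1 := hfree.sub (tendsto_meanTrace_four hA' hτ hτ' hij _ (p₂ - algebraMap ℂ _ l₂) _
    (q₂ - algebraMap ℂ _ m₂) hp₁ hq₁)
  simp only [sub_sub_cancel, sub_zero] at h1
  have h5 := tendsto_nhds_unique h1 ((tendsto_meanTrace_hadamard (hA j) q₁ q₂ hm₁ hm₂ hb).mul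
    (tendsto_meanTrace_hadamard (hA i) p₁ p₂ hl₁ hl₂ ha))
  rw [mul_comm]
  exact h5.symm

end

open StarGraph

theorem eval_generator {J : Type*} {N : ℕ} (A : J → Mat[N]) (x : J × Bool) :
    StarPoly.eval (FreeAlgebra.ι ℂ x) A = starIf x.2 (A x.1) := by
  simp [StarPoly.eval]

/-! ### Diagonal matrices -/

theorem roots_charpoly_of_isDiag {N : ℕ} {D : Mat[N]} (hD : D.IsDiag) :
    D.charpoly.roots = univ.val.map fun i => D i i := by
  have h : D.charpoly = ((univ.val.map fun i => D i i).map fun a =>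
      Polynomial.X - Polynomial.C a).prod := by
    rw [Multiset.map_map]
    conv_lhs => rw [← (Matrix.isDiag_iff_diagonal_diag D).1 hD, Matrix.charpoly_diagonal]
    rfl
  rw [h, Polynomial.roots_multiset_prod_X_sub_C]

theorem eq_dirac_of_variance_eq_zero {μ : Measure ℂ} [IsProbabilityMeasure μ]
    (h1 : Integrable (fun z : ℂ => z) μ) (h2 : Integrable (fun z : ℂ => z * conj z) μ)
    (h : ∫ z, z * conj z ∂μ = (∫ z, z ∂μ) * ∫ z, conj z ∂μ) : ∃ m, μ = Measure.dirac m := by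
  set m := ∫ z, z ∂μ with hm
  have hc : ∫ z, conj z ∂μ = conj m := integral_conj
  have h3 : Integrable (fun z : ℂ => conj z) μ :=
    (LinearIsometryEquiv.integrable_comp_iff Complex.conjLIE).2 h1
  have e : ∀ z : ℂ, ((‖z - m‖ ^ 2 : ℝ) : ℂ) = z * conj z - conj m * z - m * conj z + m * conj m := by
    intro z
    rw [← normSq_eq_norm_sq, ← mul_conj, map_sub]
    ring
  have i1 : Integrable (fun z => z * conj z - conj m * z) μ := h2.sub (h1.const_mul _)
  have i2 : Integrable (fun z => z * conj z - conj m * z - m * conj z) μ := i1.sub (h3.const_mul _)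
  have i3 : Integrable (fun z => z * conj z - conj m * z - m * conj z + m * conj m) μ :=
    i2.add (integrable_const _)
  have e1 : ∫ z, ((‖z - m‖ ^ 2 : ℝ) : ℂ) ∂μ = 0 := by
    simp only [e]
    rw [integral_add i2 (integrable_const _), integral_sub i1 (h3.const_mul _),
      integral_sub h2 (h1.const_mul _), integral_const_mul, integral_const_mul, h, hc, ← hm]
    simp
    ring
  have e2 : ∫ z, ‖z - m‖ ^ 2 ∂μ = 0 := by
    have e0 : ((∫ z, ‖z - m‖ ^ 2 ∂μ : ℝ) : ℂ) = 0 := (integral_ofReal (𝕜 := ℂ)).symm.trans e1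
    exact_mod_cast e0
  have i4 : Integrable (fun z => ‖z - m‖ ^ 2) μ := by
    have := i3.re
    refine this.congr (ae_of_all _ fun z => ?_)
    simp only [← e]
    exact ofReal_re _
  rw [integral_eq_zero_iff_of_nonneg (fun z => by positivity) i4] at e2
  refine ⟨m, ?_⟩
  have e3 : id =ᵐ[μ] fun _ => m := by
    filter_upwards [e2] with z hz
    simpa [sub_eq_zero] using hz
  have e4 := Measure.map_congr (mβ := Complex.measurableSpace) e3
  rw [Measure.map_id, Measure.map_const] at e4
  simpa using e4

theorem HasLimitingEED.tendsto_diag {D : MatrixSeq Ω} {μ : Measure ℂ} (h : HasLimitingEED P D μ)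
    (hD : ∀ N, ∀ᵐ ω ∂(P N), (D N ω).IsDiag) (k l : ℕ) :
    Tendsto (fun N => ∫ ω, (∑ i, D N ω i i ^ k * conj (D N ω i i) ^ l) / (N : ℂ) ∂(P N)) atTop
      (𝓝 (∫ z, z ^ k * conj z ^ l ∂μ)) := by
  refine (h.2 k l).2.congr fun N => integral_congr_ae ?_
  filter_upwards [hD N] with ω hω
  rw [roots_charpoly_of_isDiag hω, Multiset.map_map]
  rfl

/-- The limit of `κ_N(D, D^*)` is the variance of the limiting distribution. -/
theorem HasLimitingEED.hasKappa {D : MatrixSeq Ω} {μ : Measure ℂ} (h : HasLimitingEED P D μ)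
    (hD : ∀ N, ∀ᵐ ω ∂(P N), (D N ω).IsDiag) (hμ : ∀ z, μ ≠ Measure.dirac z) :
    ∃ b, HasKappa P D (fun N ω => (D N ω)ᴴ) b ∧ b ≠ 0 := by
  have := h.1
  have h11 := h.tendsto_diag hD 1 1
  have h10 := h.tendsto_diag hD 1 0
  have h01 := h.tendsto_diag hD 0 1
  simp only [pow_one, pow_zero, mul_one, one_mul] at h11 h10 h01
  refine ⟨_, (h11.sub (h10.mul h01)).congr fun N => ?_, fun hb => ?_⟩
  · simp only [kappaN, meanTrace, Matrix.trace, diag_apply, hadamard_apply, conjTranspose_apply]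
    rfl
  · have i10 := (h.2 1 0).1
    have i11 := (h.2 1 1).1
    simp only [pow_one, pow_zero, mul_one] at i10 i11
    obtain ⟨m, hm⟩ := eq_dirac_of_variance_eq_zero i10 i11 (sub_eq_zero.1 hb)
    exact hμ m hm

theorem not_asympStarFree_of_pairs [∀ N, IsProbabilityMeasure (P N)] (A B : Fin 2 → MatrixSeq Ω)
    (hA : ∀ k, Moments P (A k)) (hB : ∀ k, Moments P (B k))
    (htf : AsympTrafficFree P (two A B)) (a b : ℂ) (ha : HasKappa P (A 0) (A 1) a)
    (hb : HasKappa P (B 0) (B 1) b) (ha0 : a ≠ 0) (hb0 : b ≠ 0) : ¬ AsympStarFree P (two A B) := by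
  intro hsf
  have h := kappa_mul_kappa_eq_zero (A := two A B) (i := false) (j := true)
    (by rintro (_ | _) k N; exacts [hA k N, hB k N]) htf hsf (by decide)
    (FreeAlgebra.ι ℂ ((0 : Fin 2), false)) (FreeAlgebra.ι ℂ ((1 : Fin 2), false))
    (FreeAlgebra.ι ℂ ((0 : Fin 2), false)) (FreeAlgebra.ι ℂ ((1 : Fin 2), false)) (a := a) (b := b)
    (by simp only [eval_generator]; exact ha) (by simp only [eval_generator]; exact hb)
  exact (mul_ne_zero ha0 hb0) h

theorem hasAllMoments_two_single {A B : MatrixSeq Ω} (hA : Moments P A)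
    (hB : Moments P B) (i : Bool) (k : Unit) (N : ℕ) :
    HasAllMoments (P N) (two (single A) (single B) i k N) := by
  cases i
  exacts [hA N, hB N]

theorem not_asympStarFree_of_diagonal [∀ N, IsProbabilityMeasure (P N)] (A D : MatrixSeq Ω) (hA : Moments P A)
    (hD : Moments P D) (hdiag : ∀ N, ∀ᵐ ω ∂(P N), (D N ω).IsDiag)
    (htf : AsympTrafficFree P (two (single A) (single D)))
    (hκ : ∃ (p q : StarPoly Unit) (a : ℂ), HasKappa P (polySeq p A) (polySeq q A) a ∧ a ≠ 0)
    (μ : Measure ℂ) (hμ : HasLimitingEED P D μ) (hμ' : ∀ z, μ ≠ Measure.dirac z) :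
    ¬ AsympStarFree P (two (single A) (single D)) := by
  intro hsf
  obtain ⟨p, q, a, ha, ha0⟩ := hκ
  obtain ⟨b, hb, hb0⟩ := hμ.hasKappa hdiag hμ'
  have h := kappa_mul_kappa_eq_zero (A := two (single A) (single D)) (i := false) (j := true)
    (hasAllMoments_two_single hA hD) htf hsf (by decide) p q
    (FreeAlgebra.ι ℂ ((), false)) (FreeAlgebra.ι ℂ ((), true)) (a := a) (b := b)
    ha (by simp only [eval_generator]; exact hb)
  exact (mul_ne_zero ha0 hb0) h

/-! ### Expectations of entries at random indices -/

section RandomIndex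

variable {Ω : Type*} [MeasurableSpace Ω] {P : Measure Ω} {α : Type*} [Fintype α]
  [MeasurableSpace α] [MeasurableSingletonClass α] {X : Ω → α}

omit [MeasurableSpace Ω] [MeasurableSpace α] [MeasurableSingletonClass α] in
theorem comp_eq_sum (g : α → Ω → ℝ) (X : Ω → α) (ω : Ω) :
    g (X ω) ω = ∑ t, (if X ω = t then 1 else 0) * g t ω := by
  simp

theorem memLp_randomIndex (hX : AEMeasurable X P) {p : ENNReal} {g : α → Ω → ℝ}
    (hg : ∀ t, MemLp (g t) p P) : MemLp (fun ω => g (X ω) ω) p P := by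
  simp only [comp_eq_sum g X]
  refine memLp_finsetSum _ fun t _ => (hg t).of_le ?_ (ae_of_all _ fun ω => ?_)
  · have h : Measurable fun a : α => if a = t then (1 : ℝ) else 0 := measurable_of_finite _
    exact (h.comp_aemeasurable hX).aestronglyMeasurable.mul (hg t).1
  · split_ifs <;> simp

theorem integral_randomIndex [IsFiniteMeasure P] {β : Type*} [MeasurableSpace β] {A : Ω → β}
    (hX : AEMeasurable X P) (hXA : IndepFun X A P) {G : α → β → ℝ} (hG : ∀ t, Measurable (G t))
    (hg : ∀ t, Integrable (fun ω => G t (A ω)) P) :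
    ∫ ω, G (X ω) (A ω) ∂P = ∑ t, P.real {ω | X ω = t} * ∫ ω, G t (A ω) ∂P := by
  simp only [comp_eq_sum (fun t ω => G t (A ω)) X]
  have hm : ∀ t : α, Measurable fun a : α => if a = t then (1 : ℝ) else 0 :=
    fun t => measurable_of_finite _
  rw [integral_finsetSum]
  · refine sum_congr rfl fun t _ => ?_
    have h := (hXA.comp (hm t) (hG t)).integral_mul_eq_mul_integral
      ((hm t).comp_aemeasurable hX).aestronglyMeasurable (hg t).1
    refine h.trans ?_
    congr 1
    have h1 : (fun a : α => if a = t then (1 : ℝ) else 0) = Set.indicator {t} 1 := by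
      funext a
      simp [Set.indicator_apply]
    have h2 : ∫ ω, ((fun a : α => if a = t then (1 : ℝ) else 0) ∘ X) ω ∂P =
        ∫ a, (if a = t then (1 : ℝ) else 0) ∂(P.map X) :=
      (integral_map hX (hm t).aestronglyMeasurable).symm
    rw [h2, h1, integral_indicator_one (measurableSet_singleton t), Measure.real,
      Measure.map_apply_of_aemeasurable hX (measurableSet_singleton t)]
    rfl
  · intro t _
    exact (hg t).mono (((hm t).comp_aemeasurable hX).aestronglyMeasurable.mul (hg t).1)
      (ae_of_all _ fun ω => by split_ifs <;> simp)

end RandomIndex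

theorem measurable_entry {m n : Type*} (i : m) (j : n) :
    Measurable fun M : Matrix m n ℂ => M i j :=
  (measurable_pi_apply j).comp (measurable_pi_apply (X := fun _ : m => n → ℂ) i)

section Triples

variable {N : ℕ}

/-- The triples of distinct indices. -/
def distinctTriples (N : ℕ) : Set (Fin N × Fin N × Fin N) :=
  {t | t.1 ≠ t.2.1 ∧ t.1 ≠ t.2.2 ∧ t.2.1 ≠ t.2.2}

theorem sum_third (i j : Fin N) (hN : 3 ≤ N) (c : ℝ) :
    (∑ k, if i ≠ j ∧ i ≠ k ∧ j ≠ k then c else 0) = if i ≠ j then ((N : ℝ) - 2) * c else 0 := by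
  by_cases h : i = j
  · simp [h]
  · simp only [ne_eq, h, not_false_eq_true, true_and, if_true]
    rw [← sum_filter, sum_const, nsmul_eq_mul]
    congr 1
    have : (univ.filter fun k => ¬ i = k ∧ ¬ j = k) = ({i, j} : Finset (Fin N))ᶜ := by
      ext k
      simp [eq_comm]
    rw [this, Finset.card_compl, Finset.card_pair h, card_fin, Nat.cast_sub (by omega)]
    norm_num

theorem sum_ne (N : ℕ) : (∑ i : Fin N, ∑ j : Fin N, if i ≠ j then (1 : ℝ) else 0) =
    (N : ℝ) * ((N : ℝ) - 1) := by
  have : ∀ i : Fin N, (∑ j : Fin N, if i ≠ j then (1 : ℝ) else 0) = (N : ℝ) - 1 := by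
    intro i
    have h : ∀ j, (if i ≠ j then (1 : ℝ) else 0) = 1 - if i = j then 1 else 0 := by
      intro j
      by_cases h : i = j <;> simp [h]
    simp only [h, sum_sub_distrib, sum_ite_eq]
    simp
  rw [sum_congr rfl fun i _ => this i]
  simp [mul_sub]

theorem uniformOn_real (hN : 3 ≤ N) (t : Fin N × Fin N × Fin N) :
    (uniformOn (distinctTriples N)).real {t} =
      if t ∈ distinctTriples N then ((N : ℝ) * (N - 1) * (N - 2))⁻¹ else 0 := by
  have hcard : ((distinctTriples N).toFinset.card : ℝ) = N * (N - 1) * (N - 2) := by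
    have h : (∑ i : Fin N, ∑ j : Fin N, ∑ k : Fin N, if i ≠ j ∧ i ≠ k ∧ j ≠ k then (1 : ℝ) else 0) =
        N * (N - 1) * (N - 2) := by
      simp only [sum_third _ _ hN, mul_one]
      have h2 : ∀ i j : Fin N, (if i ≠ j then ((N : ℝ) - 2) else 0) =
          (if i ≠ j then 1 else 0) * ((N : ℝ) - 2) := by
        intro i j
        split_ifs <;> simp
      simp only [h2, ← sum_mul, sum_ne]
    rw [← h, Finset.card_eq_sum_ones, Nat.cast_sum]
    have h3 : (distinctTriples N).toFinset = univ.filter fun t : Fin N × Fin N × Fin N =>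
        t.1 ≠ t.2.1 ∧ t.1 ≠ t.2.2 ∧ t.2.1 ≠ t.2.2 := by
      ext t
      rw [Set.mem_toFinset, mem_filter]
      simp only [mem_univ, true_and]
      rfl
    rw [h3, sum_filter, sum_prod_type]
    refine sum_congr rfl fun i _ => ?_
    rw [sum_prod_type]
    simp
  have h := uniformOn_apply_finset (s := (distinctTriples N).toFinset) (t := {t})
  rw [Set.coe_toFinset, Finset.coe_singleton] at h
  rw [Measure.real, h, ENNReal.toReal_div, ENNReal.toReal_natCast, ENNReal.toReal_natCast, hcard]
  split_ifs with ht
  · have : (distinctTriples N).toFinset ∩ {t} = {t} := by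
      rw [Finset.inter_singleton_of_mem (Set.mem_toFinset.2 ht)]
    rw [this]
    simp
  · have : (distinctTriples N).toFinset ∩ {t} = ∅ := by
      rw [Finset.inter_singleton_of_notMem fun h => ht (Set.mem_toFinset.1 h)]
    rw [this]
    simp

end Triples

section KappaFormula

variable {Ω : Type*} [MeasurableSpace Ω] {P : Measure Ω} [IsProbabilityMeasure P] {N : ℕ}
  {A : Ω → Mat[N]}

theorem integral_distinct (hN : 3 ≤ N) {i j k : Ω → Fin N}
    (hlaw : HasLaw (fun ω => (i ω, j ω, k ω)) (uniformOn (distinctTriples N)) P)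
    (hind : IndepFun (fun ω => (i ω, j ω, k ω)) A P)
    {G : Fin N × Fin N × Fin N → Mat[N] → ℝ} (hG : ∀ t, Measurable (G t))
    (hg : ∀ t, Integrable (fun ω => G t (A ω)) P) :
    ∫ ω, G (i ω, j ω, k ω) (A ω) ∂P = ((N : ℝ) * (N - 1) * (N - 2))⁻¹ *
      ∑ a, ∑ b, ∑ c, if a ≠ b ∧ a ≠ c ∧ b ≠ c then ∫ ω, G (a, b, c) (A ω) ∂P else 0 := by
  rw [integral_randomIndex (X := fun ω => (i ω, j ω, k ω)) hlaw.aemeasurable hind hG hg,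
    sum_prod_type, mul_sum]
  refine sum_congr rfl fun a _ => ?_
  rw [sum_prod_type, mul_sum]
  refine sum_congr rfl fun b _ => ?_
  rw [mul_sum]
  refine sum_congr rfl fun c _ => ?_
  have h : P.real {ω | (i ω, j ω, k ω) = (a, b, c)} =
      (uniformOn (distinctTriples N)).real {(a, b, c)} := by
    rw [Measure.real, Measure.real, ← hlaw.map_eq,
      Measure.map_apply_of_aemeasurable hlaw.aemeasurable (measurableSet_singleton _)]
    rfl
  rw [h, uniformOn_real hN]
  have h' : (a, b, c) ∈ distinctTriples N ↔ a ≠ b ∧ a ≠ c ∧ b ≠ c := Iff.rfl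
  simp only [h']
  by_cases hc : a ≠ b ∧ a ≠ c ∧ b ≠ c
  · rw [if_pos hc, if_pos hc]
  · rw [if_neg hc, if_neg hc, zero_mul, mul_zero]

omit [IsProbabilityMeasure P] in
theorem memLp_normSq (hA : HasAllMoments P A) (a b : Fin N) (p : ℕ) :
    MemLp (fun ω => ‖A ω a b‖ ^ 2) p P := by
  have h := (((hA.entry a b).mul (hA.entry a b).star) p).norm
  refine h.congr_norm ?_ (ae_of_all _ fun ω => ?_)
  · exact ((hA a b 0).1.norm.pow 2)
  · simp [sq]

/-- `κ_N(AA^*, AA^*)` in terms of the entries of a matrix with null diagonal. -/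
theorem kappaN_mul_conjTranspose (hN : 3 ≤ N) (hA : HasAllMoments P A)
    (hdiag : ∀ᵐ ω ∂P, ∀ i, A ω i i = 0) {i j k : Ω → Fin N}
    (hlaw : HasLaw (fun ω => (i ω, j ω, k ω)) (uniformOn (distinctTriples N)) P)
    (hind : IndepFun (fun ω => (i ω, j ω, k ω)) A P) :
    kappaN P (fun ω => A ω * (A ω)ᴴ) (fun ω => A ω * (A ω)ᴴ) =
      ((((N : ℝ) ^ 2 - 3 * (N : ℝ) + 2) *
          cov[fun ω => ‖A ω (i ω) (j ω)‖ ^ 2, fun ω => ‖A ω (i ω) (k ω)‖ ^ 2; P] +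
        ((N : ℝ) - 1) * Var[fun ω => ‖A ω (i ω) (j ω)‖ ^ 2; P] : ℝ) : ℂ) := by
  have hN3 : (3 : ℝ) ≤ N := by exact_mod_cast hN
  have hms : ∀ a b : Fin N, Measurable fun M : Mat[N] => ‖M a b‖ ^ 2 :=
    fun a b => (measurable_entry a b).norm.pow_const 2
  have hs1 : ∀ a b, Integrable (fun ω => ‖A ω a b‖ ^ 2) P := fun a b => by
    have := memLp_normSq hA a b 1
    rwa [Nat.cast_one, memLp_one_iff_integrable] at this
  have hs2 : ∀ a b, MemLp (fun ω => ‖A ω a b‖ ^ 2) 2 P := fun a b => memLp_normSq hA a b 2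
  have hs11 : ∀ a b c d, Integrable (fun ω => ‖A ω a b‖ ^ 2 * ‖A ω c d‖ ^ 2) P :=
    fun a b c d => (hs2 a b).integrable_mul (hs2 c d)
  have hX : ∀ a, ∫ ω, ‖A ω a a‖ ^ 2 ∂P = 0 := fun a =>
    integral_eq_zero_of_ae (hdiag.mono fun ω h => by simp [h])
  have hY : ∀ a b c, a = b ∨ a = c → ∫ ω, ‖A ω a b‖ ^ 2 * ‖A ω a c‖ ^ 2 ∂P = 0 := fun a b c e =>
    integral_eq_zero_of_ae (hdiag.mono fun ω h => by rcases e with rfl | rfl <;> simp [h])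
  have h3 : ∀ g : Fin N → Fin N → ℝ, (∀ a, g a a = 0) →
      (∑ a, ∑ b, ∑ c, if a ≠ b ∧ a ≠ c ∧ b ≠ c then g a b else 0) = (N - 2) * ∑ a, ∑ b, g a b := by
    intro g hg
    simp only [sum_third _ _ hN, mul_sum]
    refine sum_congr rfl fun a _ => sum_congr rfl fun b _ => ?_
    split_ifs with h
    · rfl
    · rw [not_not.1 h, hg, mul_zero]
  set α : ℝ := ∑ a, ∑ b, ∫ ω, ‖A ω a b‖ ^ 2 ∂P with hα
  set β : ℝ := ∑ a, ∑ b, ∫ ω, ‖A ω a b‖ ^ 2 * ‖A ω a b‖ ^ 2 ∂P with hβ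
  set γ : ℝ := ∑ a, ∑ b, ∑ c, ∫ ω, ‖A ω a b‖ ^ 2 * ‖A ω a c‖ ^ 2 ∂P with hγ
  set t : ℝ := (N : ℝ) * (N - 1) * (N - 2) with ht
  have e1 : ∫ ω, ‖A ω (i ω) (j ω)‖ ^ 2 ∂P = t⁻¹ * ((N - 2) * α) :=
    (integral_distinct hN hlaw hind (G := fun t M => ‖M t.1 t.2.1‖ ^ 2)
      (fun t => hms _ _) fun t => hs1 _ _).trans
      (congrArg _ (h3 (fun a b => ∫ ω, ‖A ω a b‖ ^ 2 ∂P) hX))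
  have e2 : ∫ ω, ‖A ω (i ω) (k ω)‖ ^ 2 ∂P = t⁻¹ * ((N - 2) * α) := by
    refine (integral_distinct hN hlaw hind (G := fun t M => ‖M t.1 t.2.2‖ ^ 2)
      (fun t => hms _ _) fun t => hs1 _ _).trans (congrArg _ (Eq.trans ?_
      (h3 (fun a b => ∫ ω, ‖A ω a b‖ ^ 2 ∂P) hX)))
    refine sum_congr rfl fun a _ => sum_comm.trans ?_
    refine sum_congr rfl fun c _ => sum_congr rfl fun b _ => if_congr ?_ rfl rfl
    tauto
  have e3 : ∫ ω, ‖A ω (i ω) (j ω)‖ ^ 2 * ‖A ω (i ω) (j ω)‖ ^ 2 ∂P = t⁻¹ * ((N - 2) * β) :=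
    (integral_distinct hN hlaw hind (G := fun t M => ‖M t.1 t.2.1‖ ^ 2 * ‖M t.1 t.2.1‖ ^ 2)
      (fun t => (hms _ _).mul (hms _ _)) fun t => hs11 _ _ _ _).trans
      (congrArg _ (h3 (fun a b => ∫ ω, ‖A ω a b‖ ^ 2 * ‖A ω a b‖ ^ 2 ∂P)
        fun a => hY a a a (Or.inl rfl)))
  have e4 : ∫ ω, ‖A ω (i ω) (j ω)‖ ^ 2 * ‖A ω (i ω) (k ω)‖ ^ 2 ∂P = t⁻¹ * (γ - β) := by
    refine (integral_distinct hN hlaw hind (G := fun t M => ‖M t.1 t.2.1‖ ^ 2 * ‖M t.1 t.2.2‖ ^ 2)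
      (fun t => (hms _ _).mul (hms _ _)) fun t => hs11 _ _ _ _).trans (congrArg _ ?_)
    simp only [hγ, hβ, ← sum_sub_distrib]
    refine sum_congr rfl fun a _ => sum_congr rfl fun b _ => ?_
    rw [eq_sub_iff_add_eq, ← Finset.sum_ite_eq_of_mem univ b (fun c =>
      ∫ ω, ‖A ω a b‖ ^ 2 * ‖A ω a c‖ ^ 2 ∂P) (mem_univ b), ← sum_add_distrib]
    refine sum_congr rfl fun c _ => ?_
    by_cases hbc : b = c
    · simp [hbc]
    · by_cases h : a = b ∨ a = c
      · rw [hY a b c h]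
        simp [hbc]
      · simp [hbc, not_or.1 h]
  have m1 : MemLp (fun ω => ‖A ω (i ω) (j ω)‖ ^ 2) 2 P :=
    memLp_randomIndex (X := fun ω => (i ω, j ω, k ω)) (g := fun t ω => ‖A ω t.1 t.2.1‖ ^ 2)
      hlaw.aemeasurable fun t => hs2 _ _
  have m2 : MemLp (fun ω => ‖A ω (i ω) (k ω)‖ ^ 2) 2 P :=
    memLp_randomIndex (X := fun ω => (i ω, j ω, k ω)) (g := fun t ω => ‖A ω t.1 t.2.2‖ ^ 2)
      hlaw.aemeasurable fun t => hs2 _ _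
  have hcov := covariance_eq_sub m1 m2
  have hvar := covariance_eq_sub m1 m1
  rw [covariance_self m1.aemeasurable] at hvar
  simp only [Pi.mul_apply] at hcov hvar
  rw [hcov, hvar, e1, e2, e3, e4]
  have hdg : ∀ ω a, (A ω * (A ω)ᴴ) a a = ((∑ b, ‖A ω a b‖ ^ 2 : ℝ) : ℂ) := by
    intro ω a
    simp only [mul_apply, conjTranspose_apply]
    rw [ofReal_sum]
    refine sum_congr rfl fun b _ => ?_
    rw [← normSq_eq_norm_sq, ← mul_conj]
    rfl
  have f1 : meanTrace P (fun ω => A ω * (A ω)ᴴ) = ((α / N : ℝ) : ℂ) := by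
    simp only [meanTrace, Matrix.trace, diag_apply, hdg, ← ofReal_sum, ← ofReal_natCast,
      ← ofReal_div]
    rw [integral_complex_ofReal, integral_div, integral_finsetSum _ fun a _ =>
      integrable_finsetSum _ fun b _ => hs1 a b]
    simp only [integral_finsetSum _ fun b _ => hs1 _ b, hα]
  have f2 : meanTrace P (fun ω => (A ω * (A ω)ᴴ) ⊙ (A ω * (A ω)ᴴ)) = ((γ / N : ℝ) : ℂ) := by
    simp only [meanTrace, Matrix.trace, diag_apply, hadamard_apply, hdg, ← ofReal_mul,
      ← ofReal_sum, ← ofReal_natCast, ← ofReal_div, sum_mul_sum]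
    rw [integral_complex_ofReal, integral_div, integral_finsetSum _ fun a _ =>
      integrable_finsetSum _ fun b _ => integrable_finsetSum _ fun c _ => hs11 a b a c]
    simp only [integral_finsetSum _ fun b _ => integrable_finsetSum _ fun c _ => hs11 _ b _ c,
      integral_finsetSum _ fun c _ => hs11 _ _ _ c, hγ]
  rw [kappaN, f1, f2]
  have hN0 : (N : ℝ) ≠ 0 := by positivity
  have hN1 : (N : ℝ) - 1 ≠ 0 := by linarith
  have hN2 : (N : ℝ) - 2 ≠ 0 := by linarith
  rw [← ofReal_mul, ← Complex.ofReal_sub]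
  congr 1
  rw [ht]
  field_simp
  ring

end KappaFormula

open StarGraph

/-! ### Matrices with uniformly bounded row sums -/

section RowBounded

/-- The absolute row sums are bounded, uniformly in `N` and in the randomness. -/
def RowBounded (P : ∀ N, Measure (Ω N)) (M : MatrixSeq Ω) : Prop :=
  ∃ C : ℝ, 0 ≤ C ∧ ∀ N, ∀ᵐ ω ∂(P N), ∀ i, ∑ j, ‖M N ω i j‖ ≤ C

variable {M L : MatrixSeq Ω}

theorem RowBounded.mul (hM : RowBounded P M) (hL : RowBounded P L) :
    RowBounded P (fun N ω => M N ω * L N ω) := by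
  obtain ⟨C, hC, hM⟩ := hM
  obtain ⟨D, hD, hL⟩ := hL
  refine ⟨C * D, mul_nonneg hC hD, fun N => ?_⟩
  filter_upwards [hM N, hL N] with ω h1 h2 i
  calc ∑ j, ‖(M N ω * L N ω) i j‖ ≤ ∑ j, ∑ k, ‖M N ω i k‖ * ‖L N ω k j‖ := by
        refine sum_le_sum fun j _ => ?_
        rw [mul_apply]
        exact (norm_sum_le _ _).trans (le_of_eq (by simp only [norm_mul]))
    _ = ∑ k, ‖M N ω i k‖ * ∑ j, ‖L N ω k j‖ := by
        rw [sum_comm]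
        simp only [mul_sum]
    _ ≤ ∑ k, ‖M N ω i k‖ * D :=
        sum_le_sum fun k _ => mul_le_mul_of_nonneg_left (h2 k) (norm_nonneg _)
    _ ≤ C * D := by
        rw [← sum_mul]
        exact mul_le_mul_of_nonneg_right (h1 i) hD

theorem RowBounded.add (hM : RowBounded P M) (hL : RowBounded P L) :
    RowBounded P (fun N ω => M N ω + L N ω) := by
  obtain ⟨C, hC, hM⟩ := hM
  obtain ⟨D, hD, hL⟩ := hL
  refine ⟨C + D, add_nonneg hC hD, fun N => ?_⟩
  filter_upwards [hM N, hL N] with ω h1 h2 i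
  refine le_trans (sum_le_sum fun j _ => norm_add_le _ _) ?_
  rw [sum_add_distrib]
  exact add_le_add (h1 i) (h2 i)

theorem rowBounded_smul_one (c : ℂ) :
    RowBounded P (fun N _ => c • (1 : Mat[N])) := by
  refine ⟨‖c‖, norm_nonneg _, fun N => ae_of_all _ fun ω i => ?_⟩
  rw [sum_eq_single i]
  · simp
  · intro j _ h
    simp [one_apply_ne h.symm]
  · simp

theorem RowBounded.polyEval {J : Type*} {A : J → MatrixSeq Ω}
    (hA : ∀ k s, RowBounded P fun N ω => starIf s (A k N ω)) (p : StarPoly J) :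
    RowBounded P (fun N ω => p.eval fun k => A k N ω) := by
  induction p using FreeAlgebra.induction with
  | grade0 c =>
    have h : ∀ N ω, (StarPoly.eval (algebraMap ℂ (FreeAlgebra ℂ (J × Bool)) c) fun k => A k N ω) =
        c • (1 : Mat[N]) := by
      intro N ω
      rw [StarPoly.eval, AlgHom.commutes, Algebra.algebraMap_eq_smul_one]
    simp only [h]
    exact rowBounded_smul_one c
  | grade1 x =>
    simp only [eval_generator]
    exact hA x.1 x.2
  | add a b ha hb =>
    simp only [StarPoly.eval, map_add] at ha hb ⊢
    exact ha.add hb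
  | mul a b ha hb =>
    simp only [StarPoly.eval, map_mul] at ha hb ⊢
    exact ha.mul hb

theorem sum_norm_eq_ncard {N : ℕ} {f : Fin N → ℂ} (h : ∀ j, f j = 0 ∨ f j = 1) :
    ∑ j, ‖f j‖ = ({j | f j = 1}.ncard : ℝ) := by
  have h1 : ∀ j, ‖f j‖ = if f j = 1 then 1 else 0 := by
    intro j
    rcases h j with h | h <;> simp [h]
  simp only [h1]
  rw [sum_boole, ncard_eq_toFinset_card']
  congr 2
  ext j
  simp

theorem IsBoundedZeroOne.rowBounded {A : MatrixSeq Ω} (hA : IsBoundedZeroOne P A) (s : Bool) :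
    RowBounded P fun N ω => starIf s (A N ω) := by
  obtain ⟨C, hC⟩ := hA
  refine ⟨C, Nat.cast_nonneg _, fun N => ?_⟩
  filter_upwards [hC N] with ω ⟨h01, hr, hc⟩ i
  cases s
  · change ∑ j, ‖A N ω i j‖ ≤ C
    rw [sum_norm_eq_ncard fun j => h01 i j]
    exact_mod_cast hr i
  · change ∑ j, ‖star (A N ω j i)‖ ≤ C
    simp only [norm_star]
    rw [sum_norm_eq_ncard fun j => h01 j i]
    exact_mod_cast hc i

/-- The matrix without its diagonal. -/
def offDiag {N : ℕ} (M : Mat[N]) : Mat[N] := Matrix.of fun i j => if i = j then 0 else M i j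

theorem RowBounded.offDiag (hM : RowBounded P M) :
    RowBounded P (fun N ω => Traffic.offDiag (M N ω)) := by
  obtain ⟨C, hC, hM⟩ := hM
  refine ⟨C, hC, fun N => ?_⟩
  filter_upwards [hM N] with ω h1 i
  refine le_trans (sum_le_sum fun j _ => ?_) (h1 i)
  simp only [Traffic.offDiag, Matrix.of_apply]
  split_ifs
  · simp
  · exact le_rfl

theorem _root_.Traffic.HasAllMoments.offDiag {Ω : Type*} [MeasurableSpace Ω] {P : Measure Ω}
    [IsFiniteMeasure P] {N : ℕ} {M : Ω → Mat[N]} (hM : HasAllMoments P M) :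
    HasAllMoments P (fun ω => Traffic.offDiag (M ω)) := by
  intro i j
  simp only [Traffic.offDiag, Matrix.of_apply]
  split_ifs
  · exact allMom_const 0
  · exact hM.entry i j

/-- The mean square of the diagonal entries. -/
def diagSq (P : ∀ N, Measure (Ω N)) (M : MatrixSeq Ω) (N : ℕ) : ℝ :=
  ∫ ω, (∑ i, ‖M N ω i i‖ ^ 2) / (N : ℝ) ∂(P N)

theorem integrable_diagSq (hM : Moments P M) (N : ℕ) :
    Integrable (fun ω => (∑ i, ‖M N ω i i‖ ^ 2) / (N : ℝ)) (P N) :=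
  (integrable_finsetSum _ fun i _ => (memLp_one_iff_integrable.1
    (by simpa using memLp_normSq (hM N) i i 1))).div_const _

variable [∀ N, IsProbabilityMeasure (P N)]

/-- A factor may be replaced by its off-diagonal part if its diagonal is negligible. -/
theorem tendsto_meanTrace_offDiag {L R : MatrixSeq Ω} (hL : RowBounded P L) (hR : RowBounded P R)
    (mL : Moments P L) (mR : Moments P R)
    (mM : Moments P M) (hM : Tendsto (diagSq P M) atTop (𝓝 0)) :
    Tendsto (fun N => meanTrace (P N) (fun ω => L N ω * (M N ω * R N ω)) -
      meanTrace (P N) (fun ω => L N ω * (offDiag (M N ω) * R N ω))) atTop (𝓝 0) := by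
  obtain ⟨C, hC, hRL⟩ := hR.mul hL
  have key : ∀ N ω, (L N ω * (M N ω * R N ω)).trace / (N : ℂ) -
      (L N ω * (offDiag (M N ω) * R N ω)).trace / (N : ℂ) =
      (∑ i, M N ω i i * (R N ω * L N ω) i i) / (N : ℂ) := by
    intro N ω
    rw [← sub_div, ← trace_sub, ← mul_sub, ← sub_mul, trace_mul_comm, mul_assoc]
    congr 1
    simp only [Matrix.trace, diag_apply]
    refine sum_congr rfl fun i _ => ?_
    rw [mul_apply, sum_eq_single i]
    · simp [offDiag]
    · intro j _ hj
      simp [offDiag, hj.symm]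
    · simp
  have hint : ∀ N, meanTrace (P N) (fun ω => L N ω * (M N ω * R N ω)) -
      meanTrace (P N) (fun ω => L N ω * (offDiag (M N ω) * R N ω)) =
      ∫ ω, (∑ i, M N ω i i * (R N ω * L N ω) i i) / (N : ℂ) ∂(P N) := by
    intro N
    unfold meanTrace
    rw [← integral_sub]
    · simp only [key]
    · exact (((mL N).mul ((mM N).mul (mR N))).trace.div_const _).integrable
    · exact (((mL N).mul ((mM N).offDiag.mul (mR N))).trace.div_const _).integrable
  simp only [hint]
  rw [Metric.tendsto_atTop]
  intro ε hε
  set δ := ε / (2 * (C + 1)) with hδ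
  have hδ0 : 0 < δ := by positivity
  obtain ⟨N₀, hN₀⟩ := (Metric.tendsto_atTop.1 hM) (δ ^ 2) (by positivity)
  refine ⟨N₀, fun N hN => ?_⟩
  have h1 := hN₀ N hN
  rw [Real.dist_0_eq_abs] at h1
  have h2 : diagSq P M N < δ ^ 2 := lt_of_abs_lt h1
  rw [dist_zero_right]
  have hb : ∀ᵐ ω ∂(P N), ‖(∑ i, M N ω i i * (R N ω * L N ω) i i) / (N : ℂ)‖ ≤
      C * δ + C / δ * ((∑ i, ‖M N ω i i‖ ^ 2) / (N : ℝ)) := by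
    filter_upwards [hRL N] with ω hω
    rcases Nat.eq_zero_or_pos N with rfl | hN0
    · simp
      positivity
    have hN' : (0 : ℝ) < N := by exact_mod_cast hN0
    have h3 : ‖∑ i, M N ω i i * (R N ω * L N ω) i i‖ ≤ ∑ i, (C * δ + C / δ * ‖M N ω i i‖ ^ 2) := by
      refine (norm_sum_le _ _).trans (sum_le_sum fun i _ => ?_)
      rw [norm_mul]
      have h4 : ‖(R N ω * L N ω) i i‖ ≤ C :=
        (single_le_sum (f := fun j => ‖(R N ω * L N ω) i j‖)
          (fun j _ => norm_nonneg _) (mem_univ i)).trans (hω i)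
      have h5 : ‖M N ω i i‖ ≤ δ + ‖M N ω i i‖ ^ 2 / δ := by
        rw [← sub_le_iff_le_add', le_div_iff₀ hδ0]
        nlinarith [norm_nonneg (M N ω i i), sq_nonneg (‖M N ω i i‖ - δ)]
      calc ‖M N ω i i‖ * ‖(R N ω * L N ω) i i‖ ≤ (δ + ‖M N ω i i‖ ^ 2 / δ) * C :=
            mul_le_mul h5 h4 (norm_nonneg _) (by positivity)
        _ = _ := by ring
    rw [norm_div, Complex.norm_natCast, div_le_iff₀ hN']
    refine h3.trans (le_of_eq ?_)
    rw [sum_add_distrib, ← mul_sum univ (fun x => ‖M N ω x x‖ ^ 2) (C / δ),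
      sum_const, card_univ,
      card_fin, nsmul_eq_mul, add_mul, mul_assoc (C / δ), div_mul_cancel₀ _ hN'.ne']
    ring
  have hi : Integrable (fun ω => C * δ + C / δ * ((∑ i, ‖M N ω i i‖ ^ 2) / (N : ℝ))) (P N) :=
    (integrable_const _).add ((integrable_diagSq mM N).const_mul _)
  refine lt_of_le_of_lt (norm_integral_le_of_norm_le hi hb) ?_
  rw [integral_add (integrable_const _) ((integrable_diagSq mM N).const_mul _),
    integral_const, integral_const_mul (C / δ)]
  simp only [probReal_univ, one_smul]
  change C * δ + C / δ * diagSq P M N < ε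
  have h6 : C / δ * diagSq P M N ≤ C / δ * δ ^ 2 := mul_le_mul_of_nonneg_left h2.le (by positivity)
  have h7 : C / δ * δ ^ 2 = C * δ := by field_simp
  have h8 : 2 * (C + 1) * δ = ε := by rw [hδ]; field_simp
  nlinarith

end RowBounded

open StarGraph

/-! ### Eight alternating arms -/

section Octagon

variable {G : StarGraph (Σ i, K i)} {i j : ι} {a : Fin 8 → G.V}

/-- The colors of eight alternating arms. -/
abbrev altCol (i j : ι) : Fin 8 → ι := ![i, j, i, j, i, j, i, j]

/-- A closed chain of eight arms of alternating colors, every second one being open. -/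
structure Octagon (G : StarGraph (Σ i, K i)) (i j : ι) (a : Fin 8 → G.V) : Prop where
  sep : G.Sep
  ne : i ≠ j
  arm : ∀ s, G.IsArm (altCol i j s) (a s) (a (s + 1))
  open₁ : a 1 ≠ a 2
  open₃ : a 3 ≠ a 4
  open₅ : a 5 ≠ a 6
  open₇ : a 7 ≠ a 0

namespace Octagon

theorem rotate (h : Octagon G i j a) : Octagon G i j fun s => a (s + 2) where
  sep := h.sep
  ne := h.ne
  arm s := by
    have h1 : altCol i j (s + 2) = altCol i j s := by fin_cases s <;> rfl
    have h2 := h.arm (s + 2)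
    rw [h1, add_right_comm] at h2
    exact h2
  open₁ := h.open₃
  open₃ := h.open₅
  open₅ := h.open₇
  open₇ := h.open₁

variable (h : Octagon G i j a) {e : G.E} (he : (G.label e).1 = i)
include h he

theorem linked₁ : G.Linked (fun f => G.compOf f ≠ G.compOf e) (a 1) (a 2) :=
  (h.arm 1).linked (he.trans_ne h.ne)

theorem linked₃ : G.Linked (fun f => G.compOf f ≠ G.compOf e) (a 3) (a 4) :=
  (h.arm 3).linked (he.trans_ne h.ne)

theorem linked₅ : G.Linked (fun f => G.compOf f ≠ G.compOf e) (a 5) (a 6) :=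
  (h.arm 5).linked (he.trans_ne h.ne)

theorem linked₇ : G.Linked (fun f => G.compOf f ≠ G.compOf e) (a 7) (a 0) :=
  (h.arm 7).linked (he.trans_ne h.ne)

omit he

theorem opposite (h01 : a 0 ≠ a 1) : a 1 = a 4 ∧ a 5 = a 0 := by
  obtain h0 | ⟨e, he, m0, m1⟩ := h.arm 0
  · exact absurd h0 h01
  have l14 : G.Linked (fun f => G.compOf f ≠ G.compOf e) (a 1) (a 4) := by
    rcases (h.arm 2).linked_or (G.compOf e) with l | ⟨m2, -⟩
    · exact ((h.linked₁ he).trans l).trans (h.linked₃ he)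
    · exact absurd (h.sep _ _ _ m1 m2 (h.linked₁ he)) h.open₁
  have l50 : G.Linked (fun f => G.compOf f ≠ G.compOf e) (a 5) (a 0) := by
    rcases (h.arm 6).linked_or (G.compOf e) with l | ⟨-, m7⟩
    · exact ((h.linked₅ he).trans l).trans (h.linked₇ he)
    · exact absurd (h.sep _ _ _ m7 m0 (h.linked₇ he)) h.open₇
  rcases (h.arm 4).linked_or (G.compOf e) with l | ⟨m4, m5⟩
  · exact absurd (h.sep _ _ _ m1 m0 ((l14.trans l).trans l50)).symm h01
  · exact ⟨h.sep _ _ _ m1 m4 l14, h.sep _ _ _ m5 m0 l50⟩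

theorem closed_of_open (h01 : a 0 ≠ a 1) : a 2 = a 3 ∧ a 6 = a 7 := by
  have key : a 7 = a 2 → False := by
    intro h72
    obtain h0 | ⟨e, he, m0, m1⟩ := h.arm 0
    · exact absurd h0 h01
    have l := (h.linked₁ he)
    rw [← h72] at l
    exact h01 (h.sep _ _ _ m1 m0 (l.trans (h.linked₇ he))).symm
  constructor
  · by_contra h23
    exact key (h.rotate.opposite h23).2
  · by_contra h67
    exact key (h.rotate.rotate.rotate.opposite h67).1

theorem notMem_of_open (h01 : a 0 ≠ a 1) (he : (G.label e).1 = i)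
    (m2 : G.MemComp (a 2) (G.compOf e)) {s : Fin 8} (hs : s = 0 ∨ s = 4 ∨ s = 6)
    (ms : G.MemComp (a s) (G.compOf e)) (ms' : G.MemComp (a (s + 1)) (G.compOf e)) : False := by
  obtain ⟨h14, h50⟩ := h.opposite h01
  obtain ⟨h23, h67⟩ := h.closed_of_open h01
  rcases hs with rfl | rfl | rfl
  · exact h.open₁ (h.sep _ _ _ ms' m2 (h.linked₁ he))
  · rw [h23] at m2
    exact h.open₃ (h.sep _ _ _ m2 ms (h.linked₃ he))
  · rcases (h.arm 0).linked_or (G.compOf e) with l | ⟨-, m1⟩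
    · have h26 : a 2 = a 6 := by
        refine h.sep _ _ _ m2 ms (((h.linked₁ he).symm.trans l.symm).trans ?_)
        rw [← h50]
        exact h.linked₅ he
      obtain h0 | ⟨f, hf, m0, m1⟩ := h.arm 0
      · exact h01 h0
      · refine h01 (h.sep _ _ _ m0 m1 ?_)
        have l5 := h.linked₅ hf
        rw [h50, ← h26] at l5
        exact l5.trans (h.linked₁ hf).symm
    · exact h.open₁ (h.sep _ _ _ m1 m2 (h.linked₁ he))

theorem linked_of_closed (h01 : a 0 = a 1) (h23 : a 2 = a 3) (h45 : a 4 = a 5) (h67 : a 6 = a 7)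
    (he : (G.label e).1 = i) (s : Fin 8) :
    G.Linked (fun f => G.compOf f ≠ G.compOf e) (a 0) (a s) := by
  have l2 := h.linked₁ he
  rw [← h01] at l2
  have l4 := h.linked₃ he
  rw [← h23] at l4
  have l6 := h.linked₅ he
  rw [← h45] at l6
  have l3 := l2
  rw [h23] at l3
  have l5 := l2.trans l4
  rw [h45] at l5
  have l7 := (l2.trans l4).trans l6
  rw [h67] at l7
  fin_cases s
  · exact Linked.refl _
  · exact h01 ▸ Linked.refl _
  · exact l2
  · exact l3
  · exact l2.trans l4
  · exact l5
  · exact (l2.trans l4).trans l6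
  · exact l7

theorem eq_of_closed (h01 : a 0 = a 1) (h23 : a 2 = a 3) (h45 : a 4 = a 5) (h67 : a 6 = a 7)
    (he : (G.label e).1 = i) {s t : Fin 8} (ms : G.MemComp (a s) (G.compOf e))
    (mt : G.MemComp (a t) (G.compOf e)) : a s = a t :=
  h.sep _ _ _ ms mt ((h.linked_of_closed h01 h23 h45 h67 he s).symm.trans
    (h.linked_of_closed h01 h23 h45 h67 he t))

end Octagon

end Octagon

section

variable {A : (Σ i, K i) → MatrixSeq Ω} [∀ N, IsProbabilityMeasure (P N)]
  (hA : ∀ k, Moments P (A k))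
  {τ : StarGraph (Σ i, K i) → ℂ} (hτ : TrafficLimit P A τ) (hτ' : FreeState τ)

/-- Every second arm is open. -/
def altOpen : Set (Setoid (Fin 8)) := {ρ | ¬ ρ 1 2 ∧ ¬ ρ 3 4 ∧ ¬ ρ 5 6 ∧ ¬ ρ 7 0}

/-- The arms go back and forth between two distinct points. -/
def altPair : Set (Setoid (Fin 8)) := altOpen ∩ {ρ | ρ 0 1 ∧ ρ 2 3 ∧ ρ 4 5 ∧ ρ 6 7 ∧ ρ 2 6 ∧ ρ 0 4}

theorem octagon_of_ker {G : StarGraph (Σ i, K i)} {i j : ι} (hij : i ≠ j) {x : Fin 8 → G.V}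
    (hG : G.Sep) (hx : ker x ∈ altOpen)
    (harm : ∀ s, G.IsArm (altCol i j s) (x s) (x (s + 1))) : Octagon G i j x :=
  ⟨hG, hij, harm, hx.1, hx.2.1, hx.2.2.1, hx.2.2.2⟩

include hA hτ hτ'

theorem tendsto_armMean_eight {i j : ι} (hij : i ≠ j)
    (p : ∀ s : Fin 8, StarPoly (K (altCol i j s)))
    (h₀ : Tendsto (fun N => meanTrace (P N) fun ω => (p 0).eval fun k => A ⟨i, k⟩ N ω) atTop (𝓝 0))
    (h₂ : Tendsto (fun N => meanTrace (P N) fun ω => (p 2).eval fun k => A ⟨i, k⟩ N ω)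
      atTop (𝓝 0)) :
    Tendsto (fun N => armMean P A (· + 1) altOpen p N -
      armMean P A (· + 1) altPair (mask {0, 4}ᶜ (mask {2, 6}ᶜ p)) N *
        armMean P A id {⊤} (mask {0, 4} (mask {2, 6}ᶜ p)) N *
        armMean P A id {⊤} (mask {2, 6} p) N) atTop (𝓝 0) := by
  have hev : ∀ s : Fin 8, altCol i j s = i → s = 0 ∨ s = 2 ∨ s = 4 ∨ s = 6 := by
    intro s hs
    fin_cases s <;> first | (exact absurd hs hij.symm) | decide
  have hpair : ∀ (G : StarGraph (Σ i, K i)) (x : Fin 8 → G.V), G.Sep → ker x ∈ altPair →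
      (∀ s, G.IsArm (altCol i j s) (x s) (x (s + 1))) → ∀ e : G.E, (G.label e).1 = i →
      G.MemComp (x 0) (G.compOf e) → G.MemComp (x 2) (G.compOf e) → False := by
    intro G x hG hx harm e he m0 m2
    have o := octagon_of_ker hij hG hx.1 harm
    obtain ⟨h01, h23, h45, h67, -⟩ : x 0 = x 1 ∧ x 2 = x 3 ∧ x 4 = x 5 ∧ x 6 = x 7 ∧ x 2 = x 6 ∧
      x 0 = x 4 := hx.2
    exact o.open₁ (h01.symm.trans (o.eq_of_closed h01 h23 h45 h67 he m0 m2))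
  have s₁ := tendsto_armMean_split hA hτ hτ' (armConn_cycle altPair) (R := {2, 6}) (r₀ := 2) (i := i)
    (fun ρ hρ r hr => by
      rcases hr with rfl | rfl
      · exact ⟨hρ.2.2.1, ρ.refl' _⟩
      · exact ⟨hρ.2.2.2.2.1, ρ.symm' hρ.2.2.2.2.2.1⟩)
    (by rintro _ (rfl | rfl) <;> rfl)
    (fun G x hG hx harm s hs hsi e he m2 ms _ => by
      have h04 : x 0 = x 4 := hx.2.2.2.2.2.2
      rcases hev s hsi with rfl | rfl | rfl | rfl
      · exact hpair G x hG hx harm e he ms m2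
      · exact hs (by simp)
      · exact hpair G x hG hx harm e he (h04 ▸ ms) m2
      · exact hs (by simp)) p
  have s₂ := tendsto_armMean_split hA hτ hτ' (armConn_cycle altPair) (R := {0, 4}) (r₀ := 0) (i := i)
    (fun ρ hρ r hr => by
      rcases hr with rfl | rfl
      · exact ⟨hρ.2.1, ρ.refl' _⟩
      · exact ⟨hρ.2.2.2.1, ρ.symm' hρ.2.2.2.2.2.2⟩)
    (by rintro _ (rfl | rfl) <;> rfl)
    (fun G x hG hx harm s hs hsi e he m0 ms _ => by
      have h26 : x 2 = x 6 := hx.2.2.2.2.2.1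
      rcases hev s hsi with rfl | rfl | rfl | rfl
      · exact hs (by simp)
      · exact hpair G x hG hx harm e he m0 ms
      · exact hs (by simp)
      · exact hpair G x hG hx harm e he m0 (h26 ▸ ms)) (mask {2, 6}ᶜ p)
  obtain ⟨l, hl⟩ := exists_tendsto_armMean hA hτ armConn_top (mask {2, 6} p)
  have t := s₁.add (s₂.mul hl)
  rw [zero_mul, add_zero] at t
  refine tendsto_armMean_sub_of_subset (D := altPair) hA Set.inter_subset_left
    (tendsto_armMean_inter_sdiff hA {ρ | ¬ ρ 0 1 ∧ ρ 2 3} ?_ <|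
      tendsto_armMean_inter_sdiff hA {ρ | ρ 0 1 ∧ ¬ ρ 2 3} ?_ <|
      tendsto_armMean_inter_sdiff hA {ρ | ρ 0 1 ∧ ρ 2 3 ∧ ρ 4 5 ∧ ρ 6 7}
        (tendsto_armMean_inter_sdiff hA {ρ | ρ 2 6} ?_ ?_) ?_)
    (t.congr fun N => by ring)
  · refine tendsto_armMean_split_single hA hτ hτ' (armConn_cycle _) (r := 2)
      (fun ρ hρ => hρ.2.2) (fun G x hG hx harm s hs hsi e he m2 ms ms' => ?_) p h₂
    have o := octagon_of_ker hij hG hx.1.1 harm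
    refine o.notMem_of_open hx.2.1 he m2 ?_ ms ms'
    rcases hev s hsi with h | h | h | h
    exacts [Or.inl h, absurd h hs, Or.inr (Or.inl h), Or.inr (Or.inr h)]
  · refine tendsto_armMean_split_single hA hτ hτ' (armConn_cycle _) (r := 0)
      (fun ρ hρ => hρ.2.1) (fun G x hG hx harm s hs hsi e he m0 ms ms' => ?_) p h₀
    have o := octagon_of_ker hij hG hx.1.1.1 harm
    have h23 : x 2 ≠ x 3 := hx.2.2
    obtain ⟨h36, h72⟩ := o.rotate.opposite h23
    have h67 : x 6 ≠ x 7 := fun h => h23 (h72.symm.trans (h.symm.trans h36.symm))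
    have o' := o.rotate.rotate.rotate
    rcases hev s hsi with rfl | rfl | rfl | rfl
    · exact absurd rfl hs
    · exact o'.notMem_of_open h67 he m0 (s := 4) (by decide) ms ms'
    · exact o'.notMem_of_open h67 he m0 (s := 6) (by decide) ms ms'
    · exact o'.notMem_of_open h67 he m0 (s := 0) (by decide) ms ms'
  · refine tendsto_armMean_split_single hA hτ hτ' (armConn_cycle _) (r := 0)
      (fun ρ hρ => hρ.1.2.1) (fun G x hG hx harm s hs hsi e he m2 ms _ => ?_) p h₀
    have o := octagon_of_ker hij hG hx.1.1.1.1.1 harm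
    obtain ⟨h01, h23, h45, h67⟩ : x 0 = x 1 ∧ x 2 = x 3 ∧ x 4 = x 5 ∧ x 6 = x 7 := hx.1.2
    have h := o.eq_of_closed h01 h23 h45 h67 he m2 ms
    rcases hev s hsi with rfl | rfl | rfl | rfl
    · exact hs rfl
    · exact o.open₁ (h01.symm.trans h)
    · exact hx.1.1.1.1.2 ⟨hx.1.1.1.1.1, h01, h23, h45, h67, hx.2, h⟩
    · exact o.open₇ (h67.symm.trans h.symm)
  · refine tendsto_armMean_split_single hA hτ hτ' (armConn_cycle _) (r := 2)
      (fun ρ hρ => hρ.1.2.2.1) (fun G x hG hx harm s hs hsi e he m2 ms _ => ?_) p h₂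
    have o := octagon_of_ker hij hG hx.1.1.1.1.1 harm
    obtain ⟨h01, h23, h45, h67⟩ : x 0 = x 1 ∧ x 2 = x 3 ∧ x 4 = x 5 ∧ x 6 = x 7 := hx.1.2
    have h := o.eq_of_closed h01 h23 h45 h67 he m2 ms
    rcases hev s hsi with rfl | rfl | rfl | rfl
    · exact o.open₁ (h01.symm.trans h.symm)
    · exact hs rfl
    · exact o.open₃ (h23.symm.trans h)
    · exact hx.2 h
  · refine tendsto_armMean_zero hA hτ hτ' (armConn_cycle _) (fun G x hG hx harm => ?_) p
    have o := octagon_of_ker hij hG hx.1.1.1.1 harm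
    obtain ⟨⟨⟨-, g1⟩, g2⟩, g3⟩ : ((_ ∧ ¬ (¬ x 0 = x 1 ∧ x 2 = x 3)) ∧ ¬ (x 0 = x 1 ∧ ¬ x 2 = x 3)) ∧
      ¬ (x 0 = x 1 ∧ x 2 = x 3 ∧ x 4 = x 5 ∧ x 6 = x 7) := hx
    by_cases h01 : x 0 = x 1
    · by_cases h23 : x 2 = x 3
      · refine g3 ⟨h01, h23, ?_, ?_⟩
        · by_contra h45
          have h := o.rotate.rotate.opposite h45
          exact h45 (h.2.symm.trans (h01.symm.trans h.1.symm))
        · by_contra h67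
          have h := o.rotate.rotate.rotate.opposite h67
          exact h67 (h.2.symm.trans (h23.symm.trans h.1.symm))
      · exact g2 ⟨h01, h23⟩
    · exact g1 ⟨h01, (o.closed_of_open h01).1⟩

end

open StarGraph

/-! ### Words with eight letters -/

theorem eval_mask_of_notMem {ι : Type*} {K : ι → Type*} {I : Type} {col : I → ι} {R : Set I}
    (p : ∀ s, StarPoly (K (col s))) {s : I} (hs : s ∉ R) {N : ℕ}
    (F : K (col s) → Mat[N]) : (mask R p s).eval F = 1 := by
  simp [mask, hs, StarPoly.eval]

theorem eval_mask_eq_one {ι : Type*} {K : ι → Type*} {I : Type} {col : I → ι} (R : Set I)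
    (p : ∀ s, StarPoly (K (col s))) {s : I} {N : ℕ} (F : K (col s) → Mat[N])
    (h : (p s).eval F = 1) : (mask R p s).eval F = 1 := by
  by_cases hs : s ∈ R
  · simpa [mask, hs] using h
  · exact eval_mask_of_notMem p hs F

section

variable {N : ℕ}

theorem armSum_altOpen (M : Fin 8 → Mat[N]) :
    armSum (· + 1) altOpen M = (M 0 * (offDiag (M 1) * (M 2 * (offDiag (M 3) *
      (M 4 * (offDiag (M 5) * (M 6 * offDiag (M 7)))))))).trace := by
  have h := trace_prod_map id (M 0) [offDiag (M 1), M 2, offDiag (M 3), M 4, offDiag (M 5), M 6,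
    offDiag (M 7)]
  simp only [List.map_cons, List.map_nil, List.prod_cons, List.prod_nil, mul_one, id] at h
  rw [h]
  unfold armSum
  refine sum_congr (by congr!) fun x _ => ?_
  change Fin 8 → Fin N at x
  have hx : ker x ∈ altOpen ↔ x 1 ≠ x 2 ∧ x 3 ≠ x 4 ∧ x 5 ≠ x 6 ∧ x 7 ≠ x 0 := Iff.rfl
  have hp : (∏ t : Fin 8, [M 0, offDiag (M 1), M 2, offDiag (M 3), M 4, offDiag (M 5), M 6,
      offDiag (M 7)][t] (x t) (x (t + 1))) = M 0 (x 0) (x 1) * offDiag (M 1) (x 1) (x 2) *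
      M 2 (x 2) (x 3) * offDiag (M 3) (x 3) (x 4) * M 4 (x 4) (x 5) * offDiag (M 5) (x 5) (x 6) *
      M 6 (x 6) (x 7) * offDiag (M 7) (x 7) (x 0) := Fin.prod_univ_eight _
  refine Eq.trans ?_ hp.symm
  rw [Fin.prod_univ_eight]
  simp only [offDiag, Matrix.of_apply, hx]
  by_cases h1 : x 1 = x 2
  · simp [h1]
  by_cases h2 : x 3 = x 4
  · simp [h2]
  by_cases h3 : x 5 = x 6
  · simp [h3]
  by_cases h4 : x 7 = x 0
  · simp [h4]
  simp only [h1, h2, h3, h4, ne_eq, not_false_eq_true, and_self, if_true, if_false]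
  rfl

theorem armSum_altPair (M : Fin 8 → Mat[N]) (h0 : M 0 = 1) (h2 : M 2 = 1)
    (h4 : M 4 = 1) (h6 : M 6 = 1) :
    armSum (· + 1) altPair M = ∑ u, ∑ v, if u ≠ v then
      M 1 u v * M 3 v u * (M 5 u v * M 7 v u) else 0 := by
  have hx : ∀ x : Fin 8 → Fin N, ker x ∈ altPair ↔
      (x 1 ≠ x 2 ∧ x 3 ≠ x 4 ∧ x 5 ≠ x 6 ∧ x 7 ≠ x 0) ∧
        (x 0 = x 1 ∧ x 2 = x 3 ∧ x 4 = x 5 ∧ x 6 = x 7 ∧ x 2 = x 6 ∧ x 0 = x 4) :=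
    fun x => Iff.rfl
  have h1 : ∀ x : Fin 8 → Fin N, (if ker x ∈ altPair then ∏ s, M s (x s) (x (s + 1)) else 0)
      = ∑ u, ∑ v, if x = ![u, u, v, v, u, u, v, v] then (if u ≠ v then
      M 1 u v * M 3 v u * (M 5 u v * M 7 v u) else 0) else 0 := by
    intro x
    have h3 : ∀ u v, x = ![u, u, v, v, u, u, v, v] → u = x 0 ∧ v = x 2 := by
      rintro u v rfl
      exact ⟨rfl, rfl⟩
    rw [sum_eq_single (x 0), sum_eq_single (x 2)]
    · by_cases h : ker x ∈ altPair
      · obtain ⟨⟨g1, g2, g3, g4⟩, f1, f2, f3, f4, f5, f6⟩ := (hx x).1 h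
        have hxe : x = ![x 0, x 0, x 2, x 2, x 0, x 0, x 2, x 2] := by
          funext s
          fin_cases s
          · rfl
          · exact f1.symm
          · rfl
          · exact f2.symm
          · exact f6.symm
          · exact f3.symm.trans f6.symm
          · exact f5.symm
          · exact f4.symm.trans f5.symm
        have hne : x 0 ≠ x 2 := fun h => g1 (f1.symm.trans h)
        rw [if_pos h, if_pos hxe, if_pos hne, Fin.prod_univ_eight]
        have e3 : x 3 = x 2 := f2.symm
        have e1 : x 1 = x 0 := f1.symm
        have e4 : x 4 = x 0 := f6.symm
        have e5 : x 5 = x 0 := f3.symm.trans f6.symm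
        have e6 : x 6 = x 2 := f5.symm
        have e7 : x 7 = x 2 := f4.symm.trans f5.symm
        change M 0 (x 0) (x 1) * M 1 (x 1) (x 2) * M 2 (x 2) (x 3) * M 3 (x 3) (x 4) *
          M 4 (x 4) (x 5) * M 5 (x 5) (x 6) * M 6 (x 6) (x 7) * M 7 (x 7) (x 0) = _
        rw [h0, h2, h4, h6, e1, e3, e4, e5, e6, e7]
        simp only [one_apply_eq]
        ring
      · rw [if_neg h]
        split_ifs with hxe hne
        · refine absurd ((hx x).2 ?_) h
          rw [hxe]
          exact ⟨⟨hne, hne.symm, hne, hne.symm⟩, rfl, rfl, rfl, rfl, rfl, rfl⟩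
        · rfl
        · rfl
    · intro v _ hv
      rw [if_neg fun h => hv (h3 _ _ h).2]
    · simp
    · intro u _ hu
      refine sum_eq_zero fun v _ => ?_
      rw [if_neg fun h => hu (h3 _ _ h).1]
    · simp
  unfold armSum
  refine (sum_congr (by congr!) fun x _ => Eq.trans (by congr) (h1 x)).trans ?_
  rw [sum_comm]
  refine sum_congr rfl fun u _ => ?_
  rw [sum_comm]
  refine sum_congr rfl fun v _ => ?_
  rw [sum_ite_eq']
  simp

end

section

variable {A : (Σ i, K i) → MatrixSeq Ω} [∀ N, IsProbabilityMeasure (P N)]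
  (hA : ∀ k, Moments P (A k))
  {τ : StarGraph (Σ i, K i) → ℂ} (hτ : TrafficLimit P A τ) (hτ' : FreeState τ)
include hA hτ

theorem exists_tendsto_hadamard {i : ι} (p q : StarPoly (K i)) : ∃ l, Tendsto (fun N =>
    meanTrace (P N) fun ω => (p.eval fun k => A ⟨i, k⟩ N ω) ⊙ (q.eval fun k => A ⟨i, k⟩ N ω))
    atTop (𝓝 l) := by
  obtain ⟨l, hl⟩ := exists_tendsto_armMean (I := Bool) (col := fun _ => i) (next := id) (C := {⊤})
    hA hτ armConn_top (mask {false, true} fun s => if s then q else p)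
  refine ⟨l, hl.congr fun N => ?_⟩
  have h := armMean_mask_pair (P := P) (A := A) (I := Bool) (col := fun _ => i)
    (fun s => if s then q else p) (r := false) (r' := true) (by decide) N
  simpa using h

include hτ'

/-- The expectation of an alternating word with eight letters, in which the second family enters
through the off-diagonal parts of two polynomials only. -/
theorem tendsto_meanTrace_eight {i j : ι} (hij : i ≠ j) (p : StarPoly (K i))
    (q₁ q₂ : StarPoly (K j))
    (hp : Tendsto (fun N => meanTrace (P N) fun ω => p.eval fun k => A ⟨i, k⟩ N ω) atTop (𝓝 0)) :
    Tendsto (fun N => meanTrace (P N) (fun ω =>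
        (p.eval fun k => A ⟨i, k⟩ N ω) * (offDiag (q₁.eval fun k => A ⟨j, k⟩ N ω) *
        ((p.eval fun k => A ⟨i, k⟩ N ω) * (offDiag (q₂.eval fun k => A ⟨j, k⟩ N ω) *
        ((p.eval fun k => A ⟨i, k⟩ N ω) * (offDiag (q₁.eval fun k => A ⟨j, k⟩ N ω) *
        ((p.eval fun k => A ⟨i, k⟩ N ω) * offDiag (q₂.eval fun k => A ⟨j, k⟩ N ω)))))))) -
      (∫ ω, (∑ u, ∑ v, if u ≠ v then
        ((q₁.eval fun k => A ⟨j, k⟩ N ω) u v * (q₂.eval fun k => A ⟨j, k⟩ N ω) v u) ^ 2 else 0) /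
          (N : ℂ) ∂(P N)) *
      meanTrace (P N) (fun ω => (p.eval fun k => A ⟨i, k⟩ N ω) ⊙ (p.eval fun k => A ⟨i, k⟩ N ω)) *
      meanTrace (P N) (fun ω => (p.eval fun k => A ⟨i, k⟩ N ω) ⊙ (p.eval fun k => A ⟨i, k⟩ N ω)))
      atTop (𝓝 0) ∧ ∃ l, Tendsto (fun N => ∫ ω, (∑ u, ∑ v, if u ≠ v then
        ((q₁.eval fun k => A ⟨j, k⟩ N ω) u v * (q₂.eval fun k => A ⟨j, k⟩ N ω) v u) ^ 2 else 0) /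
          (N : ℂ) ∂(P N)) atTop (𝓝 l) := by
  let f : ∀ s : Fin 8, StarPoly (K (altCol i j s))
    | 0 => p
    | 1 => q₁
    | 2 => p
    | 3 => q₂
    | 4 => p
    | 5 => q₁
    | 6 => p
    | 7 => q₂
  have h2 := fun N => armMean_mask_pair (P := P) (A := A) f (r := 2) (r' := 6) (by decide) N
  have h0 := fun N => armMean_mask_pair (P := P) (A := A) (mask {2, 6}ᶜ f) (r := 0) (r' := 4)
    (by decide) N
  have m0 : mask {2, 6}ᶜ f 0 = p := by simp [mask, f]
  have m4 : mask {2, 6}ᶜ f 4 = p := by simp [mask, f]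
  have h3 : ∀ N, armMean P A (· + 1) altPair (mask {0, 4}ᶜ (mask {2, 6}ᶜ f)) N =
      ∫ ω, (∑ u, ∑ v, if u ≠ v then
        ((q₁.eval fun k => A ⟨j, k⟩ N ω) u v * (q₂.eval fun k => A ⟨j, k⟩ N ω) v u) ^ 2 else 0) /
          (N : ℂ) ∂(P N) := by
    intro N
    unfold armMean
    congr 1; funext ω
    have n1 : mask {0, 4}ᶜ (mask {2, 6}ᶜ f) 1 = q₁ := by simp [mask, f]
    have n3 : mask {0, 4}ᶜ (mask {2, 6}ᶜ f) 3 = q₂ := by simp [mask, f]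
    have n5 : mask {0, 4}ᶜ (mask {2, 6}ᶜ f) 5 = q₁ := by simp [mask, f]
    have n7 : mask {0, 4}ᶜ (mask {2, 6}ᶜ f) 7 = q₂ := by simp [mask, f]
    rw [armSum_altPair]
    · congr 1
      refine sum_congr rfl fun u _ => sum_congr rfl fun v _ => ?_
      refine if_congr Iff.rfl ?_ rfl
      rw [n1, n3, n5, n7, sq]
      rfl
    · exact eval_mask_of_notMem (col := altCol i j) _ (by simp) _
    · exact eval_mask_eq_one (col := altCol i j) _ _ _
        (eval_mask_of_notMem (col := altCol i j) _ (by simp) _)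
    · exact eval_mask_of_notMem (col := altCol i j) _ (by simp) _
    · exact eval_mask_eq_one (col := altCol i j) _ _ _
        (eval_mask_of_notMem (col := altCol i j) _ (by simp) _)
  constructor
  · refine (tendsto_armMean_eight hA hτ hτ' hij f hp hp).congr fun N => ?_
    rw [h2, h0, m0, m4, h3]
    congr 1
    unfold armMean meanTrace
    congr 1; funext ω
    simp only [armSum_altOpen]
    rfl
  · obtain ⟨l, hl⟩ := exists_tendsto_armMean hA hτ (armConn_cycle altPair)
      (mask {0, 4}ᶜ (mask {2, 6}ᶜ f))
    exact ⟨l, hl.congr h3⟩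

end

open StarGraph

/-! ### Bounded zero-one matrices: the diagonal of a polynomial is asymptotically constant -/

section

theorem meanTrace_conjTranspose {Ω : Type*} [MeasurableSpace Ω] {P : Measure Ω} {N : ℕ}
    (M : Ω → Mat[N]) :
    meanTrace P (fun ω => (M ω)ᴴ) = conj (meanTrace P M) := by
  unfold meanTrace
  rw [← integral_conj]
  simp [Matrix.trace_conjTranspose]

theorem diagSq_conjTranspose (M : MatrixSeq Ω) : diagSq P (fun N ω => (M N ω)ᴴ) = diagSq P M := by
  funext N
  simp [diagSq]

theorem ofReal_diagSq (M : MatrixSeq Ω) (N : ℕ) :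
    ((diagSq P M N : ℝ) : ℂ) = meanTrace (P N) fun ω => M N ω ⊙ (M N ω)ᴴ := by
  rw [diagSq, ← integral_complex_ofReal, meanTrace]
  congr 1; funext ω
  simp only [ofReal_div, ofReal_sum, ofReal_natCast, Matrix.trace,
    diag_apply, hadamard_apply, conjTranspose_apply]
  congr 1
  refine sum_congr rfl fun i _ => ?_
  rw [← normSq_eq_norm_sq, ← mul_conj]
  rfl

theorem meanTrace_mul_conjTranspose_self [∀ N, IsProbabilityMeasure (P N)] {M : MatrixSeq Ω}
    (hM : Moments P M) (N : ℕ) :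
    meanTrace (P N) (fun ω => M N ω * (M N ω)ᴴ) =
      ∫ ω, (∑ u, ∑ v, if u ≠ v then ((‖M N ω u v‖ ^ 2 : ℝ) : ℂ) else 0) / (N : ℂ) ∂(P N) +
      (diagSq P M N : ℝ) := by
  have hm : ∀ u v, AllMom (P N) fun ω => ((‖M N ω u v‖ ^ 2 : ℝ) : ℂ) := by
    intro u v
    refine (((hM N).entry u v).mul ((hM N).entry u v).star).congr (ae_of_all _ fun ω => ?_)
    simp only
    rw [← normSq_eq_norm_sq, ← mul_conj]
    rfl
  have hd : ((diagSq P M N : ℝ) : ℂ) =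
      ∫ ω, (∑ i, ((‖M N ω i i‖ ^ 2 : ℝ) : ℂ)) / (N : ℂ) ∂(P N) := by
    rw [diagSq, ← integral_complex_ofReal]
    simp
  rw [hd, ← integral_add]
  · unfold meanTrace
    congr 1; funext ω
    rw [← add_div]
    congr 1
    simp only [Matrix.trace, diag_apply, mul_apply, conjTranspose_apply]
    rw [← sum_add_distrib]
    refine sum_congr rfl fun u _ => ?_
    rw [← Finset.add_sum_erase _ _ (mem_univ u), add_comm,
      ← Finset.add_sum_erase (f := fun v => if u ≠ v then ((‖M N ω u v‖ ^ 2 : ℝ) : ℂ) else 0) _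
      (mem_univ u), if_neg (by simp), zero_add]
    have e : ∀ v, M N ω u v * star (M N ω u v) = ((‖M N ω u v‖ ^ 2 : ℝ) : ℂ) := by
      intro v
      rw [← normSq_eq_norm_sq, ← mul_conj]
      rfl
    rw [e]
    congr 1
    refine sum_congr rfl fun v hv => ?_
    rw [if_pos (ne_of_mem_erase hv).symm, e]
  · refine (AllMom.div_const (AllMom.sum _ fun u _ => AllMom.sum _ fun v _ => ?_) _).integrable
    split_ifs
    · exact hm u v
    · exact allMom_const 0
  · exact (AllMom.div_const (AllMom.sum _ fun u _ => hm u u) _).integrable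

variable [∀ N, IsProbabilityMeasure (P N)]

open FreeAlgebra in
/-- If a bounded zero-one matrix that is not asymptotically scalar is both traffic-free and
`*`-free from another bounded zero-one matrix, then the diagonal of any `*`-polynomial in the
latter is asymptotically constant. -/
theorem tendsto_hadamard_centered_zero {A : ι → Unit → MatrixSeq Ω}
    (hA : ∀ i k, Moments P (A i k)) (h01 : ∀ i, IsBoundedZeroOne P (A i ()))
    (htf : AsympTrafficFree P A) (hsf : AsympStarFree P A) {i j : ι} (hij : i ≠ j)
    (hns : ¬ AsympScalar P (A j ())) (p : StarPoly Unit) {m : ℂ}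
    (hm : Tendsto (fun N => meanTrace (P N) fun ω => p.eval fun k => A i k N ω) atTop (𝓝 m)) :
    Tendsto (fun N => meanTrace (P N) fun ω => ((p - algebraMap ℂ _ m).eval fun k => A i k N ω) ⊙
      ((p - algebraMap ℂ _ m).eval fun k => A i k N ω)) atTop (𝓝 0) := by
  obtain ⟨τ, hτ, hτ'⟩ := htf.exists_state
  have hA' : ∀ (x : Σ _ : ι, Unit) N, HasAllMoments (P N) (A x.1 x.2 N) := fun x => hA x.1 x.2
  set y : StarPoly Unit := FreeAlgebra.ι ℂ ((), false) with hy
  set z : StarPoly Unit := FreeAlgebra.ι ℂ ((), true) with hz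
  have ey : ∀ N ω, (y.eval fun k => A j k N ω) = A j () N ω := fun N ω => eval_generator _ _
  have ez : ∀ N ω, (z.eval fun k => A j k N ω) = (A j () N ω)ᴴ := fun N ω => eval_generator _ _
  obtain ⟨l, hl⟩ := exists_tendsto_meanTrace hA' hτ (i := j) y
  have hl' : Tendsto (fun N => meanTrace (P N) fun ω => z.eval fun k => A j k N ω) atTop
      (𝓝 (conj l)) := by
    simp only [ez, meanTrace_conjTranspose]
    simp only [ey] at hl
    exact (Complex.continuous_conj.tendsto _).comp hl
  obtain ⟨c₁, hc₁⟩ := exists_tendsto_hadamard hA' hτ (i := i) p p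
  obtain ⟨b₁, hb₁⟩ := exists_tendsto_hadamard hA' hτ (i := j) y z
  have hc : HasKappa P (fun N ω => p.eval fun k => A i k N ω) (fun N ω => p.eval fun k => A i k N ω)
      (c₁ - m * m) := hc₁.sub (hm.mul hm)
  have hb : HasKappa P (fun N ω => y.eval fun k => A j k N ω) (fun N ω => z.eval fun k => A j k N ω)
      (b₁ - l * conj l) := hb₁.sub (hl.mul hl')
  have hpp := tendsto_meanTrace_hadamard (hA i) p p hm hm hc
  have hyz := tendsto_meanTrace_hadamard (hA j) y z hl hl' hb
  rcases mul_eq_zero.1 (kappa_mul_kappa_eq_zero hA htf hsf hij p p y z hc hb) with h0 | h0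
  · rwa [h0] at hpp
  rw [h0] at hyz
  set pc := p - algebraMap ℂ (StarPoly Unit) m with hpc
  set yc := y - algebraMap ℂ (StarPoly Unit) l with hyc
  set zc := z - algebraMap ℂ (StarPoly Unit) (conj l) with hzc
  have eyc : ∀ N ω, (yc.eval fun k => A j k N ω) = A j () N ω - l • 1 := by
    intro N ω
    rw [hyc, eval_sub_algebraMap, ey]
  have ezc : ∀ N ω, (zc.eval fun k => A j k N ω) = (yc.eval fun k => A j k N ω)ᴴ := by
    intro N ω
    rw [hzc, eval_sub_algebraMap, ez, eyc]
    simp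
  have mom : ∀ (i : ι) (q : StarPoly Unit) N,
      HasAllMoments (P N) (fun ω => q.eval fun k => A i k N ω) :=
    fun i q N => HasAllMoments.polyEval (fun k => hA i k N) q
  have row : ∀ (i : ι) (q : StarPoly Unit), RowBounded P (fun N ω => q.eval fun k => A i k N ω) :=
    fun i q => RowBounded.polyEval (fun k s => (h01 i).rowBounded s) q
  have dy : Tendsto (diagSq P fun N ω => yc.eval fun k => A j k N ω) atTop (𝓝 0) := by
    have h1 : Tendsto (fun N => ((diagSq P (fun N ω => yc.eval fun k => A j k N ω) N : ℝ) : ℂ))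
        atTop (𝓝 ((0 : ℝ) : ℂ)) := by
      simp only [ofReal_diagSq, ← ezc]
      simpa using hyz
    exact (Complex.continuous_re.tendsto _).comp h1
  have dz : Tendsto (diagSq P fun N ω => zc.eval fun k => A j k N ω) atTop (𝓝 0) := by
    simp only [ezc, diagSq_conjTranspose]
    exact dy
  have ty := tendsto_meanTrace_centered (hA j) y hl
  have tz := tendsto_meanTrace_centered (hA j) z hl'
  have tp := tendsto_meanTrace_centered (hA i) p hm
  have hfree := hsf.2 [⟨i, pc⟩, ⟨j, yc⟩, ⟨i, pc⟩, ⟨j, zc⟩, ⟨i, pc⟩, ⟨j, yc⟩, ⟨i, pc⟩, ⟨j, zc⟩]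
    (by simp) (by simp [hij, hij.symm])
    (by
      intro x hx
      simp only [List.mem_cons, List.not_mem_nil, or_false] at hx
      rcases hx with rfl | rfl | rfl | rfl | rfl | rfl | rfl | rfl
      exacts [tp, ty, tp, tz, tp, ty, tp, tz])
  simp only [List.map_cons, List.map_nil, List.prod_cons, List.prod_nil, mul_one] at hfree
  set X : MatrixSeq Ω := fun N ω => pc.eval fun k => A i k N ω with hX
  set Y : MatrixSeq Ω := fun N ω => yc.eval fun k => A j k N ω with hY
  set Z : MatrixSeq Ω := fun N ω => zc.eval fun k => A j k N ω with hZ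
  have mX : Moments P X := mom i pc
  have mY : Moments P Y := mom j yc
  have mZ : Moments P Z := mom j zc
  have rX : RowBounded P X := row i pc
  have rY : RowBounded P Y := row j yc
  have rZ : RowBounded P Z := row j zc
  have s1 := tendsto_meanTrace_offDiag (L := X) (M := Y)
    (R := fun N ω => X N ω * (Z N ω * (X N ω * (Y N ω * (X N ω * Z N ω))))) rX
    (rX.mul (rZ.mul (rX.mul (rY.mul (rX.mul rZ))))) mX
    (fun N => (mX N).mul ((mZ N).mul ((mX N).mul ((mY N).mul ((mX N).mul (mZ N)))))) mY dy
  have s2 := tendsto_meanTrace_offDiag (L := fun N ω => X N ω * (offDiag (Y N ω) * X N ω)) (M := Z)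
    (R := fun N ω => X N ω * (Y N ω * (X N ω * Z N ω))) (rX.mul (rY.offDiag.mul rX))
    (rX.mul (rY.mul (rX.mul rZ))) (fun N => (mX N).mul ((mY N).offDiag.mul (mX N)))
    (fun N => (mX N).mul ((mY N).mul ((mX N).mul (mZ N)))) mZ dz
  have s3 := tendsto_meanTrace_offDiag
    (L := fun N ω => X N ω * (offDiag (Y N ω) * (X N ω * (offDiag (Z N ω) * X N ω)))) (M := Y)
    (R := fun N ω => X N ω * Z N ω) (rX.mul (rY.offDiag.mul (rX.mul (rZ.offDiag.mul rX))))
    (rX.mul rZ)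
    (fun N => (mX N).mul ((mY N).offDiag.mul ((mX N).mul ((mZ N).offDiag.mul (mX N)))))
    (fun N => (mX N).mul (mZ N)) mY dy
  have s4 := tendsto_meanTrace_offDiag
    (L := fun N ω => X N ω * (offDiag (Y N ω) * (X N ω * (offDiag (Z N ω) * (X N ω *
      (offDiag (Y N ω) * X N ω)))))) (M := Z) (R := fun N _ => (1 : ℂ) • 1)
    (rX.mul (rY.offDiag.mul (rX.mul (rZ.offDiag.mul (rX.mul (rY.offDiag.mul rX))))))
    (rowBounded_smul_one 1)
    (fun N => (mX N).mul ((mY N).offDiag.mul ((mX N).mul ((mZ N).offDiag.mul ((mX N).mul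
      ((mY N).offDiag.mul (mX N)))))))
    (fun N => hasAllMoments_const _) mZ dz
  simp only [one_smul, mul_one, mul_assoc] at s1 s2 s3 s4
  have h8 := tendsto_meanTrace_eight hA' hτ hτ' hij pc yc zc tp
  obtain ⟨h8, β, hβ⟩ := h8
  have h9 := ((((hfree.sub s1).sub s2).sub s3).sub s4).sub h8
  have h10 : Tendsto (fun N => (∫ ω, (∑ u, ∑ v, if u ≠ v then
      (Y N ω u v * Z N ω v u) ^ 2 else 0) / (N : ℂ) ∂(P N)) *
      meanTrace (P N) (fun ω => X N ω ⊙ X N ω) * meanTrace (P N) (fun ω => X N ω ⊙ X N ω)) atTop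
      (𝓝 0) := by
    simp only [sub_zero] at h9
    refine h9.congr fun N => ?_
    ring
  have h11 := tendsto_nhds_unique h10 ((hβ.mul hpp).mul hpp)
  have hc0 : c₁ - m * m = 0 := by
    by_contra hne
    have hβ0 : β = 0 := by
      rcases mul_eq_zero.1 h11.symm with h | h
      · exact (mul_eq_zero.1 h).resolve_right hne
      · exact absurd h hne
    refine hns ⟨l, ?_⟩
    have hsum : ∀ N, meanTrace (P N) (fun ω => (A j () N ω - l • 1) * (A j () N ω - l • 1)ᴴ) =
        ∫ ω, (∑ u, ∑ v, if u ≠ v then (Y N ω u v * Z N ω v u) ^ 2 else 0) / (N : ℂ) ∂(P N) +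
        (diagSq P Y N : ℝ) := by
      intro N
      have h1 := meanTrace_mul_conjTranspose_self mY N
      simp only [hY, eyc] at h1 ⊢
      rw [h1]
      congr 1
      obtain ⟨C, hC⟩ := h01 j
      refine integral_congr_ae ?_
      filter_upwards [hC N] with ω hω
      congr 1
      refine sum_congr rfl fun u _ => sum_congr rfl fun v _ => ?_
      split_ifs with huv
      · rcases hω.1 u v with h | h <;>
          simp [hZ, ezc, eyc, one_apply_ne huv, one_apply_ne huv.symm, h]
      · rfl
    simp only [hsum]
    have h12 : Tendsto (fun N => ((diagSq P Y N : ℝ) : ℂ)) atTop (𝓝 ((0 : ℝ) : ℂ)) :=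
      (Complex.continuous_ofReal.tendsto _).comp dy
    have h13 := hβ.add h12
    rw [hβ0] at h13
    simpa using h13
  rwa [hc0] at hpp

end

/-! ### Bounded zero-one matrices: almost all degrees are equal -/

theorem one_le_four_mul_sq_sub {r : ℝ} {k : ℕ} (h : k ≠ (round r).toNat) :
    1 ≤ 4 * ((k : ℝ) - r) ^ 2 := by
  have h1 : (k : ℤ) ≠ round r := fun h' => h (by rw [← h']; simp)
  have h2 := abs_sub_round r
  have h3 : (1 : ℝ) ≤ |(k : ℝ) - round r| := by
    have h4 : 1 ≤ |(k : ℤ) - round r| := Int.one_le_abs (sub_ne_zero.2 h1)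
    exact_mod_cast h4
  have h5 : |(k : ℝ) - round r| ≤ |(k : ℝ) - r| + |r - round r| := by
    have : (k : ℝ) - round r = ((k : ℝ) - r) + (r - round r) := by ring
    rw [this]
    exact abs_add_le _ _
  have h6 : 1 / 2 ≤ |(k : ℝ) - r| := by linarith
  rw [← sq_abs]
  nlinarith

section

theorem meanTrace_hadamard_sub_eq {M : MatrixSeq Ω} {f : ∀ N, Ω N → Fin N → ℕ} (r : ℝ) (N : ℕ)
    (hf : ∀ᵐ ω ∂(P N), ∀ u, M N ω u u = f N ω u) :
    meanTrace (P N) (fun ω => (M N ω - (r : ℂ) • 1) ⊙ (M N ω - (r : ℂ) • 1)) =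
      ((∫ ω, (∑ u, ((f N ω u : ℝ) - r) ^ 2) / (N : ℝ) ∂(P N) : ℝ) : ℂ) := by
  rw [← integral_complex_ofReal, meanTrace]
  refine integral_congr_ae ?_
  filter_upwards [hf] with ω hω
  simp only [Matrix.trace, diag_apply, hadamard_apply, Matrix.sub_apply, hω,
    Matrix.smul_apply, one_apply_eq]
  push_cast
  simp [sq]

variable [∀ N, IsProbabilityMeasure (P N)]

theorem tendsto_integral_ncard_ne {M : MatrixSeq Ω} {f : ∀ N, Ω N → Fin N → ℕ}
    (hM : Moments P M) (hf : ∀ N, ∀ᵐ ω ∂(P N), ∀ u, M N ω u u = f N ω u) {r : ℝ}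
    (h : Tendsto (fun N => meanTrace (P N) fun ω =>
      (M N ω - (r : ℂ) • 1) ⊙ (M N ω - (r : ℂ) • 1)) atTop (𝓝 0)) :
    Tendsto (fun N => ∫ ω, ({u | f N ω u ≠ (round r).toNat}.ncard : ℝ) / (N : ℝ) ∂(P N)) atTop
      (𝓝 0) := by
  simp only [fun N => meanTrace_hadamard_sub_eq r N (hf N)] at h
  have h1 : Tendsto (fun N => ∫ ω, (∑ u, ((f N ω u : ℝ) - r) ^ 2) / (N : ℝ) ∂(P N)) atTop (𝓝 0) :=
    (Complex.continuous_re.tendsto _).comp h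
  have h2 := h1.const_mul 4
  rw [mul_zero] at h2
  refine squeeze_zero (fun N => integral_nonneg fun ω => by positivity) (fun N => ?_) h2
  rw [← integral_const_mul]
  refine integral_mono_of_nonneg (ae_of_all _ fun ω => by positivity) ?_ (ae_of_all _ fun ω => ?_)
  · have h3 : AllMom (P N) fun ω => (∑ u, (M N ω u u - r) * (M N ω u u - r)) / (N : ℂ) :=
      (AllMom.sum _ fun u _ => (((hM N).entry u u).sub (allMom_const _)).mul
        (((hM N).entry u u).sub (allMom_const _))).div_const _
    refine (h3.integrable.re.congr ?_).const_mul 4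
    filter_upwards [hf N] with ω hω
    simp only [hω, ← ofReal_natCast, ← Complex.ofReal_sub, ← ofReal_mul, ← ofReal_sum, ← ofReal_div]
    rw [RCLike.re_eq_complex_re, ofReal_re]
    simp [sq]
  · simp only
    rw [← mul_div_assoc]
    gcongr
    rw [ncard_eq_toFinset_card', mul_sum, Finset.card_eq_sum_ones, Nat.cast_sum]
    refine (sum_le_sum (g := fun u => 4 * ((f N ω u : ℝ) - r) ^ 2) fun u hu => ?_).trans
      (Finset.sum_le_univ_sum_of_nonneg fun u => by positivity)
    simp only [Set.mem_toFinset, Set.mem_ofPred_eq] at hu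
    simpa using one_le_four_mul_sq_sub hu

end

/-! ### Adjacency patterns -/

/-- The adjacency relation of the graph of a zero-one matrix. -/
def pattern {N : ℕ} (M : Mat[N]) (u v : Fin N) : Prop := M u v = 1

section

variable {Ω : Type*} [MeasurableSpace Ω] {P : Measure Ω} {N : ℕ}
  {M : Ω → Mat[N]} (hM : HasAllMoments P M)
include hM

theorem HasAllMoments.aemeasurable_pattern : AEMeasurable (fun ω => pattern (M ω)) P := by
  refine aemeasurable_pi_iff.2 fun u => aemeasurable_pi_iff.2 fun v => ?_
  have h : AEMeasurable (fun ω => M ω u v) P := (hM u v 0).aestronglyMeasurable.aemeasurable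
  have h2 : Measurable fun z : ℂ => z = 1 := measurableSet_setOfPred.1 (measurableSet_singleton 1)
  exact h2.comp_aemeasurable h

theorem HasAllMoments.integrable_pattern [IsFiniteMeasure P] {E : Type*} [NormedAddCommGroup E]
    (F : (Fin N → Fin N → Prop) → E) : Integrable (fun ω => F (pattern (M ω))) P := by
  have h : Integrable F (P.map fun ω => pattern (M ω)) := Integrable.of_finite
  exact h.comp_aemeasurable hM.aemeasurable_pattern

end

/-- The vertices whose in-degree or out-degree is not `d`. -/
def badVertices {N : ℕ} (g : Fin N → Fin N → Prop) (d : ℕ) : Set (Fin N) :=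
  {u | {v | g u v}.ncard ≠ d ∨ {v | g v u}.ncard ≠ d}

section

variable [∀ N, IsProbabilityMeasure (P N)]

theorem mul_conjTranspose_self_apply_of_zeroOne {N : ℕ} {M : Mat[N]}
    (h : ∀ u v, M u v = 0 ∨ M u v = 1) (u : Fin N) :
    (M * Mᴴ) u u = ({v | M u v = 1}.ncard : ℕ) := by
  rw [mul_apply, ncard_eq_toFinset_card', Finset.card_eq_sum_ones, Nat.cast_sum]
  rw [show {v | M u v = 1}.toFinset = univ.filter fun v => M u v = 1 by ext; simp, sum_filter]
  refine sum_congr rfl fun v _ => ?_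
  rcases h u v with h | h <;> simp [h]

theorem exists_tendsto_badVertices {A : ι → Unit → MatrixSeq Ω}
    (hA : ∀ i k, Moments P (A i k)) (h01 : ∀ i, IsBoundedZeroOne P (A i ()))
    (htf : AsympTrafficFree P A) (hsf : AsympStarFree P A) {i j : ι} (hij : i ≠ j)
    (hns : ¬ AsympScalar P (A j ())) : ∃ d : ℕ, Tendsto (fun N =>
      ∫ ω, ((badVertices (pattern (A i () N ω)) d).ncard : ℝ) / (N : ℝ) ∂(P N)) atTop (𝓝 0) := by
  obtain ⟨τ, hτ, hτ'⟩ := htf.exists_state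
  have hA' : ∀ (x : Σ _ : ι, Unit) N, HasAllMoments (P N) (A x.1 x.2 N) := fun x => hA x.1 x.2
  obtain ⟨C, hC⟩ := h01 i
  set x : StarPoly Unit := FreeAlgebra.ι ℂ ((), false) with hx
  set y : StarPoly Unit := FreeAlgebra.ι ℂ ((), true) with hy
  have exy : ∀ N ω, ((x * y).eval fun k => A i k N ω) = A i () N ω * (A i () N ω)ᴴ := by
    intro N ω
    rw [StarPoly.eval, map_mul]
    simp [hx, hy, starIf]
  have eyx : ∀ N ω, ((y * x).eval fun k => A i k N ω) = (A i () N ω)ᴴ * A i () N ω := by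
    intro N ω
    rw [StarPoly.eval, map_mul]
    simp [hx, hy, starIf]
  obtain ⟨m, hm⟩ := exists_tendsto_meanTrace hA' hτ (i := i) (x * y)
  have hm' : Tendsto (fun N => meanTrace (P N) fun ω => (y * x).eval fun k => A i k N ω) atTop
      (𝓝 m) := by
    refine hm.congr fun N => ?_
    simp only [exy, eyx, meanTrace, fun ω => trace_mul_comm (A i () N ω) (A i () N ω)ᴴ]
  have hreal : conj m = m := by
    refine tendsto_nhds_unique ((Complex.continuous_conj.tendsto _).comp hm) (hm.congr fun N => ?_)
    simp only [Function.comp, ← meanTrace_conjTranspose, exy, conjTranspose_mul,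
      conjTranspose_conjTranspose]
  obtain ⟨r, rfl⟩ := Complex.conj_eq_iff_real.1 hreal
  have h1 := tendsto_hadamard_centered_zero hA h01 htf hsf hij hns (x * y) hm
  have h2 := tendsto_hadamard_centered_zero hA h01 htf hsf hij hns (y * x) hm'
  simp only [eval_sub_algebraMap, exy, eyx] at h1 h2
  have t1 := tendsto_integral_ncard_ne (M := fun N ω => A i () N ω * (A i () N ω)ᴴ)
    (f := fun N ω u => {v | A i () N ω u v = 1}.ncard)
    (fun N => (hA i () N).mul (hA i () N).conjTranspose)
    (fun N => (hC N).mono fun ω hω u => mul_conjTranspose_self_apply_of_zeroOne hω.1 u) h1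
  have t2 := tendsto_integral_ncard_ne (M := fun N ω => (A i () N ω)ᴴ * A i () N ω)
    (f := fun N ω u => {v | A i () N ω v u = 1}.ncard)
    (fun N => (hA i () N).conjTranspose.mul (hA i () N))
    (fun N => (hC N).mono fun ω hω u => by
      have h := mul_conjTranspose_self_apply_of_zeroOne (M := (A i () N ω)ᴴ) (fun u v => by
        rcases hω.1 v u with h | h <;> simp [h]) u
      rw [conjTranspose_conjTranspose] at h
      rw [h]
      congr 3
      ext v
      rcases hω.1 v u with h | h <;> simp [h]) h2
  refine ⟨(round r).toNat, squeeze_zero (fun N => integral_nonneg fun ω => by positivity)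
    (fun N => ?_) (by simpa using t1.add t2)⟩
  rw [← integral_add]
  · refine integral_mono ((hA i () N).integrable_pattern fun g => ((badVertices g _).ncard : ℝ) / N)
      (Integrable.add ?_ ?_) fun ω => ?_
    · exact (hA i () N).integrable_pattern
        fun g => ({u | {v | g u v}.ncard ≠ (round r).toNat}.ncard : ℝ) / N
    · exact (hA i () N).integrable_pattern
        fun g => ({u | {v | g v u}.ncard ≠ (round r).toNat}.ncard : ℝ) / N
    · rw [← add_div]
      gcongr
      rw [← Nat.cast_add]
      exact Nat.cast_le.2 <| Set.ncard_union_le {u | {v | A i () N ω u v = 1}.ncard ≠ (round r).toNat}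
        {u | {v | A i () N ω v u = 1}.ncard ≠ (round r).toNat}
  · exact (hA i () N).integrable_pattern
      fun g => ({u | {v | g u v}.ncard ≠ (round r).toNat}.ncard : ℝ) / N
  · exact (hA i () N).integrable_pattern
      fun g => ({u | {v | g v u}.ncard ≠ (round r).toNat}.ncard : ℝ) / N

end

/-! ### Rooted digraphs -/

namespace RootedDigraph

variable {G G' G'' H : RootedDigraph} {p q : ℕ}

theorem Isomorphic.symm (h : G.Isomorphic G') : G'.Isomorphic G := by
  obtain ⟨e, h1, h2⟩ := h
  exact ⟨e.symm, by rw [← h1, Equiv.symm_apply_apply], fun v w => by rw [h2]; simp⟩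

theorem Isomorphic.trans (h : G.Isomorphic G') (h' : G'.Isomorphic G'') : G.Isomorphic G'' := by
  obtain ⟨e, h1, h2⟩ := h
  obtain ⟨f, h3, h4⟩ := h'
  exact ⟨e.trans f, by simp [h1, h3], fun v w => by rw [h2, h4]; simp⟩

theorem Within.mono (h : p ≤ q) {v : G.V} (hv : G.Within p v) : G.Within q v := by
  induction h with
  | refl => exact hv
  | step _ ih => exact Or.inl ih

/-- `G` with another root. -/
abbrev reroot (G : RootedDigraph) (v : G.V) : RootedDigraph := ⟨G.V, G.adj, v⟩

theorem within_reroot_of_adj {u v w : G.V} (h : G.adj u v ∨ G.adj v u)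
    (hw : (G.reroot v).Within p w) : (G.reroot u).Within (p + 1) w := by
  induction p generalizing w with
  | zero =>
    obtain rfl : w = v := hw
    exact Or.inr ⟨u, rfl, h⟩
  | succ p ih =>
    rcases hw with hw | ⟨x, hx, hxw⟩
    · exact Or.inl (ih hw)
    · exact Or.inr ⟨x, ih hx, hxw⟩

theorem within_reroot_symm {u v : G.V} (h : (G.reroot u).Within p v) :
    (G.reroot v).Within p u := by
  induction p generalizing v with
  | zero =>
    obtain rfl : v = u := h
    exact rfl
  | succ p ih =>
    rcases h with h | ⟨w, hw, hwv⟩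
    · exact Or.inl (ih h)
    · exact within_reroot_of_adj (G := G) (u := v) (v := w) hwv.symm (ih hw)

/-- An isomorphism onto a union of connected components that contains the root. -/
structure IsFullEmbedding (f : G.V → G'.V) : Prop where
  injective : Injective f
  root : f G.root = G'.root
  adj_iff : ∀ v w, G.adj v w ↔ G'.adj (f v) (f w)
  closed : ∀ v b, G'.adj (f v) b ∨ G'.adj b (f v) → b ∈ Set.range f

theorem IsFullEmbedding.within_iff {f : G.V → G'.V} (hf : IsFullEmbedding f) {b : G'.V} :
    G'.Within p b ↔ ∃ v, f v = b ∧ G.Within p v := by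
  induction p generalizing b with
  | zero =>
    constructor
    · intro h
      exact ⟨G.root, hf.root.trans (Eq.symm h), rfl⟩
    · rintro ⟨v, rfl, h⟩
      obtain rfl : v = G.root := h
      exact hf.root
  | succ p ih =>
    constructor
    · rintro (h | ⟨c, hc, h⟩)
      · obtain ⟨v, rfl, hv⟩ := ih.1 h
        exact ⟨v, rfl, Or.inl hv⟩
      · obtain ⟨v, rfl, hv⟩ := ih.1 hc
        obtain ⟨w, rfl⟩ := hf.closed v b h
        rw [← hf.adj_iff, ← hf.adj_iff] at h
        exact ⟨w, rfl, Or.inr ⟨v, hv, h⟩⟩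
    · rintro ⟨v, rfl, h | ⟨w, hw, h⟩⟩
      · exact Or.inl (ih.2 ⟨v, rfl, h⟩)
      · rw [hf.adj_iff, hf.adj_iff v w] at h
        exact Or.inr ⟨f w, ih.2 ⟨w, rfl, hw⟩, h⟩

theorem IsFullEmbedding.ball {f : G.V → G'.V} (hf : IsFullEmbedding f) (p : ℕ) :
    (G.ball p).Isomorphic (G'.ball p) := by
  let g : (G.ball p).V → (G'.ball p).V := fun v => ⟨f v.1, hf.within_iff.2 ⟨v.1, rfl, v.2⟩⟩
  have hg : Bijective g := by
    constructor
    · intro v w h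
      exact Subtype.ext (hf.injective (congrArg Subtype.val h))
    · rintro ⟨b, hb⟩
      obtain ⟨v, rfl, hv⟩ := hf.within_iff.1 hb
      exact ⟨⟨v, hv⟩, rfl⟩
  exact ⟨Equiv.ofBijective g hg, Subtype.ext hf.root, fun v w => hf.adj_iff v.1 w.1⟩

theorem isFullEmbedding_equiv {e : G.V ≃ H.V} (h1 : e G.root = H.root)
    (h2 : ∀ v w, G.adj v w ↔ H.adj (e v) (e w)) : IsFullEmbedding e :=
  ⟨e.injective, h1, h2, fun _ b _ => e.surjective b⟩

/-- The vertices that are linked to the root. -/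
def core (G : RootedDigraph) : RootedDigraph where
  V := {v : G.V // ∃ p, G.Within p v}
  adj v w := G.adj v.1 w.1
  root := ⟨G.root, 0, rfl⟩

theorem isFullEmbedding_core (G : RootedDigraph) :
    IsFullEmbedding (G := G.core) (G' := G) Subtype.val where
  injective := Subtype.val_injective
  root := rfl
  adj_iff _ _ := Iff.rfl
  closed := by
    rintro ⟨v, p, hv⟩ b h
    exact ⟨⟨b, p + 1, Or.inr ⟨v, hv, h⟩⟩, rfl⟩

theorem within_ball (hq : q ≤ p) {v : (G.ball p).V} : (G.ball p).Within q v ↔ G.Within q v.1 := by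
  induction q generalizing v with
  | zero => exact Subtype.ext_iff
  | succ q ih =>
    constructor
    · rintro (h | ⟨w, hw, h⟩)
      · exact Or.inl ((ih (by omega)).1 h)
      · exact Or.inr ⟨w.1, (ih (by omega)).1 hw, h⟩
    · rintro (h | ⟨w, hw, h⟩)
      · exact Or.inl ((ih (by omega)).2 h)
      · exact Or.inr ⟨⟨w, hw.mono (by omega)⟩, (ih (by omega)).2 hw, h⟩

/-- The number of outgoing edges and the number of incoming edges are equal to `d`. -/
def RegularAt (G : RootedDigraph) (d : ℕ) (v : G.V) : Prop :=
  {w | G.adj v w}.encard = d ∧ {w | G.adj w v}.encard = d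

theorem IsFullEmbedding.regularAt_iff {f : G.V → G'.V} (hf : IsFullEmbedding f) {d : ℕ} {v : G.V} :
    G.RegularAt d v ↔ G'.RegularAt d (f v) := by
  have h1 : {b | G'.adj (f v) b} = f '' {w | G.adj v w} := by
    ext b
    constructor
    · intro hb
      obtain ⟨w, rfl⟩ := hf.closed v b (Or.inl hb)
      exact ⟨w, (hf.adj_iff _ _).2 hb, rfl⟩
    · rintro ⟨w, hw, rfl⟩
      exact (hf.adj_iff _ _).1 hw
  have h2 : {b | G'.adj b (f v)} = f '' {w | G.adj w v} := by
    ext b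
    constructor
    · intro hb
      obtain ⟨w, rfl⟩ := hf.closed v b (Or.inr hb)
      exact ⟨w, (hf.adj_iff _ _).2 hb, rfl⟩
    · rintro ⟨w, hw, rfl⟩
      exact (hf.adj_iff _ _).1 hw
  rw [RegularAt, RegularAt, h1, h2, hf.injective.encard_image, hf.injective.encard_image]

theorem regularAt_ball {d : ℕ} {v : (G.ball p).V} (hv : G.Within q v.1) (hq : q < p) :
    (G.ball p).RegularAt d v ↔ G.RegularAt d v.1 := by
  have h1 : {b | G.adj v.1 b} = Subtype.val '' {w : (G.ball p).V | (G.ball p).adj v w} := by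
    ext b
    constructor
    · intro hb
      have hb' : G.Within (q + 1) b := Or.inr ⟨v.1, hv, Or.inl hb⟩
      exact ⟨⟨b, hb'.mono hq⟩, hb, rfl⟩
    · rintro ⟨w, hw, rfl⟩
      exact hw
  have h2 : {b | G.adj b v.1} = Subtype.val '' {w : (G.ball p).V | (G.ball p).adj w v} := by
    ext b
    constructor
    · intro hb
      have hb' : G.Within (q + 1) b := Or.inr ⟨v.1, hv, Or.inr hb⟩
      exact ⟨⟨b, hb'.mono hq⟩, hb, rfl⟩
    · rintro ⟨w, hw, rfl⟩
      exact hw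
  rw [RegularAt, RegularAt, h1, h2, Subtype.val_injective.encard_image,
    Subtype.val_injective.encard_image]
  exact Iff.rfl

/-- Some vertex at distance less than `p` from the root violates `d`-regularity. -/
def NearBad (G : RootedDigraph) (d p : ℕ) : Prop := ∃ q < p, ∃ v, G.Within q v ∧ ¬ G.RegularAt d v

theorem nearBad_ball {d : ℕ} : (G.ball p).NearBad d p ↔ G.NearBad d p := by
  constructor
  · rintro ⟨q, hq, v, hv, h⟩
    have hv' := (within_ball hq.le).1 hv
    exact ⟨q, hq, v.1, hv', fun h' => h ((regularAt_ball hv' hq).2 h')⟩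
  · rintro ⟨q, hq, v, hv, h⟩
    exact ⟨q, hq, ⟨v, hv.mono hq.le⟩, (within_ball hq.le).2 hv,
      fun h' => h ((regularAt_ball hv hq).1 h')⟩

theorem Isomorphic.nearBad {d : ℕ} (h : G.Isomorphic H) (hG : G.NearBad d p) : H.NearBad d p := by
  obtain ⟨e, h1, h2⟩ := h
  have he := isFullEmbedding_equiv h1 h2
  obtain ⟨q, hq, v, hv, hb⟩ := hG
  exact ⟨q, hq, e v, he.within_iff.2 ⟨v, rfl, hv⟩, fun h => hb (he.regularAt_iff.2 h)⟩

/-! ### Induced copies of a finite graph -/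

/-- The induced copies of `H` in `G` at the root. -/
def copies (H G : RootedDigraph) : Set (H.V → G.V) :=
  {φ | Injective φ ∧ φ H.root = G.root ∧ ∀ v w, H.adj v w ↔ G.adj (φ v) (φ w)}

theorem within_of_mem_copies {φ : H.V → G.V} (hφ : φ ∈ copies H G) {v : H.V} (hv : H.Within q v) :
    G.Within q (φ v) := by
  induction q generalizing v with
  | zero =>
    obtain rfl : v = H.root := hv
    exact hφ.2.1
  | succ q ih =>
    rcases hv with h | ⟨w, hw, h⟩
    · exact Or.inl (ih h)
    · rw [hφ.2.2, hφ.2.2 v w] at h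
      exact Or.inr ⟨φ w, ih hw, h⟩

theorem ncard_copies (hH : ∀ v, H.Within p v) (h : (G.ball p).Isomorphic H) :
    (copies H G).ncard = (copies H H).ncard := by
  obtain ⟨e, h1, h2⟩ := h
  have h1' : e.symm H.root = (G.ball p).root := by rw [← h1, Equiv.symm_apply_apply]
  symm
  refine Set.ncard_congr (fun ψ _ => fun v => (e.symm (ψ v)).1) ?_ ?_ ?_
  · rintro ψ ⟨i1, i2, i3⟩
    refine ⟨fun v w hvw => i1 (e.symm.injective (Subtype.ext hvw)), ?_, fun v w => ?_⟩
    · simp only [i2, h1']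
      rfl
    · rw [i3]
      have := h2 (e.symm (ψ v)) (e.symm (ψ w))
      rw [Equiv.apply_symm_apply, Equiv.apply_symm_apply] at this
      exact this.symm
  · intro ψ ψ' _ _ h
    funext v
    exact e.symm.injective (Subtype.ext (congrFun h v))
  · intro φ hφ
    let φ' : H.V → (G.ball p).V := fun v => ⟨φ v, within_of_mem_copies hφ (hH v)⟩
    refine ⟨fun v => e (φ' v), ⟨fun v w hvw => ?_, ?_, fun v w => ?_⟩, ?_⟩
    · exact hφ.1 (congrArg Subtype.val (e.injective hvw))
    · refine Eq.trans (congrArg e ?_) h1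
      exact Subtype.ext hφ.2.1
    · rw [← h2]
      exact hφ.2.2 v w
    · funext v
      exact congrArg Subtype.val (e.symm_apply_apply (φ' v))

theorem isomorphic_of_mem_copies [Finite G.V] {d : ℕ} (hH : ∀ v, H.Within p v)
    (hH' : ¬ H.NearBad d p) (hG : ¬ G.NearBad d p) {φ : H.V → G.V} (hφ : φ ∈ copies H G) :
    (G.ball p).Isomorphic H := by
  have key : ∀ q ≤ p, ∀ b, G.Within q b → ∃ v, H.Within q v ∧ φ v = b := by
    intro q
    induction q with
    | zero =>
      intro _ b hb
      exact ⟨H.root, rfl, hφ.2.1.trans (Eq.symm hb)⟩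
    | succ q ih =>
      rintro hq b (hb | ⟨c, hc, hb⟩)
      · obtain ⟨v, hv, rfl⟩ := ih (by omega) b hb
        exact ⟨v, Or.inl hv, rfl⟩
      · obtain ⟨v, hv, rfl⟩ := ih (by omega) c hc
        have r1 : H.RegularAt d v := by
          by_contra h
          exact hH' ⟨q, hq, v, hv, h⟩
        have r2 : G.RegularAt d (φ v) := by
          by_contra h
          exact hG ⟨q, hq, φ v, hc, h⟩
        have e1 : φ '' {w | H.adj v w} = {b | G.adj (φ v) b} := by
          refine Set.Finite.eq_of_subset_of_encard_le (toFinite _) ?_ ?_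
          · rintro _ ⟨w, hw, rfl⟩
            exact (hφ.2.2 _ _).1 hw
          · rw [hφ.1.encard_image, r1.1, r2.1]
        have e2 : φ '' {w | H.adj w v} = {b | G.adj b (φ v)} := by
          refine Set.Finite.eq_of_subset_of_encard_le (toFinite _) ?_ ?_
          · rintro _ ⟨w, hw, rfl⟩
            exact (hφ.2.2 _ _).1 hw
          · rw [hφ.1.encard_image, r1.2, r2.2]
        rcases hb with hb | hb
        · have hb' : b ∈ {b | G.adj (φ v) b} := hb
          rw [← e1] at hb'
          obtain ⟨w, hw, rfl⟩ := hb'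
          exact ⟨w, Or.inr ⟨v, hv, Or.inl hw⟩, rfl⟩
        · have hb' : b ∈ {b | G.adj b (φ v)} := hb
          rw [← e2] at hb'
          obtain ⟨w, hw, rfl⟩ := hb'
          exact ⟨w, Or.inr ⟨v, hv, Or.inr hw⟩, rfl⟩
  let φ' : H.V → (G.ball p).V := fun v => ⟨φ v, within_of_mem_copies hφ (hH v)⟩
  have hb : Bijective φ' := by
    constructor
    · intro v w h
      exact hφ.1 (congrArg Subtype.val h)
    · rintro ⟨b, hb⟩
      obtain ⟨v, -, rfl⟩ := key p le_rfl b hb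
      exact ⟨v, rfl⟩
  have h : H.Isomorphic (G.ball p) :=
    ⟨Equiv.ofBijective φ' hb, Subtype.ext hφ.2.1, fun v w => hφ.2.2 v w⟩
  exact h.symm

/-! ### Bounded degrees -/

/-- At most `C` outgoing and at most `C` incoming edges at each vertex. -/
def DegreeLE (G : RootedDigraph) (C : ℕ) : Prop :=
  ∀ v, {w | G.adj v w}.ncard ≤ C ∧ {w | G.adj w v}.ncard ≤ C

theorem DegreeLE.ncard_within [Finite G.V] {C : ℕ} (hG : G.DegreeLE C) (p : ℕ) :
    {v | G.Within p v}.ncard ≤ (2 * C + 1) ^ p := by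
  induction p with
  | zero =>
    have : {v | G.Within 0 v} = {G.root} := rfl
    simp [this]
  | succ p ih =>
    have : Fintype G.V := ofFinite _
    have h1 : {v | G.Within (p + 1) v} ⊆ ⋃ w ∈ {v | G.Within p v}.toFinset,
        ({w} ∪ ({v | G.adj w v} ∪ {v | G.adj v w})) := by
      rintro v (h | ⟨w, hw, h | h⟩)
      · exact Set.mem_biUnion (by simpa using h) (Or.inl rfl)
      · exact Set.mem_biUnion (by simpa using hw) (Or.inr (Or.inl h))
      · exact Set.mem_biUnion (by simpa using hw) (Or.inr (Or.inr h))
    refine (Set.ncard_le_ncard h1).trans ((Finset.set_ncard_biUnion_le _ _).trans ?_)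
    refine (Finset.sum_le_card_nsmul _ _ (2 * C + 1) fun w _ => ?_).trans ?_
    · refine (Set.ncard_union_le _ _).trans ?_
      have h2 := Set.ncard_union_le {v | G.adj w v} {v | G.adj v w}
      have h3 := hG w
      rw [Set.ncard_singleton]
      omega
    · rw [smul_eq_mul, pow_succ, ← ncard_eq_toFinset_card']
      exact Nat.mul_le_mul_right _ ih

theorem DegreeLE.ncard_copies_le [Finite G.V] [Finite H.V] {C : ℕ} (hG : G.DegreeLE C)
    (hH : ∀ v, H.Within p v) :
    (copies H G).ncard ≤ ((2 * C + 1) ^ p) ^ Nat.card H.V := by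
  have h1 : Nat.card (H.V → {v // G.Within p v}) ≤ ((2 * C + 1) ^ p) ^ Nat.card H.V := by
    rw [Nat.card_fun]
    exact Nat.pow_le_pow_left (hG.ncard_within p) _
  refine le_trans ?_ h1
  rw [← Nat.card_coe_set_eq]
  refine Nat.card_le_card_of_injective
    (fun φ : copies H G => fun v => (⟨φ.1 v, within_of_mem_copies φ.2 (hH v)⟩ :
      {v // G.Within p v})) fun φ ψ h => Subtype.ext (funext fun v => ?_)
  exact congrArg Subtype.val (congrFun h v)

theorem ncard_nearBad_le [Finite G.V] {C d : ℕ} (hG : G.DegreeLE C) (p : ℕ) :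
    {i | (G.reroot i).NearBad d p}.ncard ≤ {v | ¬ G.RegularAt d v}.ncard * (2 * C + 1) ^ p := by
  have : Fintype G.V := ofFinite _
  have h1 : {i | (G.reroot i).NearBad d p} ⊆ ⋃ v ∈ {v | ¬ G.RegularAt d v}.toFinset,
      {i | (G.reroot v).Within p i} := by
    rintro i ⟨q, hq, v, hv, h⟩
    exact Set.mem_biUnion (x := v) (Finset.mem_coe.2 (Set.mem_toFinset.2 h))
      (within_reroot_symm (hv.mono hq.le))
  refine (Set.ncard_le_ncard h1).trans ((Finset.set_ncard_biUnion_le _ _).trans ?_)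
  refine (Finset.sum_le_card_nsmul _ _ ((2 * C + 1) ^ p) fun w _ => ?_).trans ?_
  · exact DegreeLE.ncard_within (G := G.reroot w) hG p
  · rw [smul_eq_mul, ← ncard_eq_toFinset_card']

end RootedDigraph

open RootedDigraph

/-! ### Frequencies of neighbourhoods -/

section

variable (P) (A : MatrixSeq Ω)

/-- The probability that the graph of `A_N`, rooted at a uniform vertex, satisfies `F`. -/
def freq (F : RootedDigraph → Prop) (N : ℕ) : ℝ :=
  (∑ i : Fin N, (P N).real {ω | F (ofMatrix (A N ω) i)}) / (N : ℝ)

variable {P A} [∀ N, IsProbabilityMeasure (P N)] (hA : Moments P A)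

theorem HasAllMoments.real_pattern {Ω : Type*} [MeasurableSpace Ω] {P : Measure Ω} {N : ℕ}
    {M : Ω → Mat[N]} (hM : HasAllMoments P M) [IsFiniteMeasure P]
    (F : (Fin N → Fin N → Prop) → Prop) [DecidablePred F] :
    P.real {ω | F (pattern (M ω))} = ∫ ω, (if F (pattern (M ω)) then 1 else 0 : ℝ) ∂P := by
  have hg := hM.aemeasurable_pattern
  have h1 : (P.map fun ω => pattern (M ω)).real {g | F g} = P.real {ω | F (pattern (M ω))} := by
    rw [Measure.real, Measure.map_apply_of_aemeasurable hg (toFinite _).measurableSet]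
    rfl
  have h2 := integral_map hg (f := fun g => (if F g then 1 else 0 : ℝ))
    (Integrable.of_finite.aestronglyMeasurable)
  rw [← h2, ← h1, ← integral_indicator_one (toFinite {g | F g}).measurableSet]
  congr 1; funext g
  simp [Set.indicator_apply]

include hA

theorem freq_eq_integral (F : RootedDigraph → Prop) (N : ℕ) :
    freq P A F N = ∫ ω, ({i | F (ofMatrix (A N ω) i)}.ncard : ℝ) / (N : ℝ) ∂(P N) := by
  have h1 : ∀ i : Fin N, (P N).real {ω | F (ofMatrix (A N ω) i)} =
      ∫ ω, (if F (ofMatrix (A N ω) i) then 1 else 0 : ℝ) ∂(P N) :=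
    fun i => (hA N).real_pattern fun g => F ⟨Fin N, g, i⟩
  rw [freq, integral_div]
  congr 1
  simp only [h1]
  rw [← integral_finsetSum]
  · congr 1; funext ω
    simp only [sum_boole]
    rw [ncard_eq_toFinset_card']
    congr 2
    ext
    simp
  · intro i _
    exact (hA N).integrable_pattern fun g => (if F ⟨Fin N, g, i⟩ then 1 else 0 : ℝ)

theorem tendsto_freq_nearBad (h01 : IsBoundedZeroOne P A) {d : ℕ} (hd : Tendsto (fun N =>
      ∫ ω, ((badVertices (pattern (A N ω)) d).ncard : ℝ) / (N : ℝ) ∂(P N)) atTop (𝓝 0)) (p : ℕ) :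
    Tendsto (freq P A fun G => G.NearBad d p) atTop (𝓝 0) := by
  obtain ⟨C, hC⟩ := h01
  have h2 := hd.mul_const (((2 * C + 1) ^ p : ℕ) : ℝ)
  rw [zero_mul] at h2
  refine squeeze_zero (fun N => ?_) (fun N => ?_) h2
  · unfold freq
    positivity
  rw [freq_eq_integral hA, ← integral_mul_const]
  refine integral_mono_ae ((hA N).integrable_pattern fun g =>
      ({i | NearBad ⟨Fin N, g, i⟩ d p}.ncard : ℝ) / (N : ℝ))
    (((hA N).integrable_pattern fun g => ((badVertices g d).ncard : ℝ) / (N : ℝ)).mul_const _) ?_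
  filter_upwards [hC N] with ω hω
  rw [div_mul_eq_mul_div]
  gcongr
  rw [← Nat.cast_mul, Nat.cast_le]
  rcases isEmpty_or_nonempty (Fin N) with hN | ⟨⟨i₀⟩⟩
  · rw [Set.eq_empty_of_isEmpty {i | (ofMatrix (A N ω) i).NearBad d p}]
    simp
  have hf : Finite (ofMatrix (A N ω) i₀).V := inferInstanceAs (Finite (Fin N))
  have h3 : (ofMatrix (A N ω) i₀).DegreeLE C := fun v => ⟨hω.2.1 v, hω.2.2 v⟩
  refine (ncard_nearBad_le (d := d) h3 p).trans (Nat.mul_le_mul_right _ ?_)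
  refine Set.ncard_le_ncard (fun v hv => ?_) (toFinite (badVertices (pattern (A N ω)) d))
  by_contra hv'
  obtain ⟨h4, h5⟩ := not_or.1 hv'
  refine hv ⟨?_, ?_⟩
  · rw [← not_not.1 h4]
    exact (toFinite {w : Fin N | pattern (A N ω) v w}).cast_ncard_eq.symm
  · rw [← not_not.1 h5]
    exact (toFinite {w : Fin N | pattern (A N ω) w v}).cast_ncard_eq.symm

end

/-! ### Injective sums over copies -/

section

variable {H : RootedDigraph} [Fintype H.V]

/-- The `*`-graph with the edges of `H` and the further edges `S`. -/
def copyGraph (H : RootedDigraph) [Fintype H.V] (S : Finset (H.V × H.V)) : StarGraph Unit where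
  V := H.V
  E := {q : H.V × H.V // q ∈ (univ.filter fun q : H.V × H.V => H.adj q.1 q.2) ∪ S}
  fintypeE := Finset.fintypeCoeSort _
  src q := q.1.1
  tgt q := q.1.2
  label _ := ()
  star _ := false

theorem copyGraph_connected {p : ℕ} (hH : ∀ v, H.Within p v) (S : Finset (H.V × H.V)) :
    (copyGraph H S).Connected := by
  refine ⟨⟨H.root⟩, ?_⟩
  set R := EqvGen (fun a b => ∃ e, (copyGraph H S).src e = a ∧ (copyGraph H S).tgt e = b)
  have key : ∀ q v, H.Within q v → R H.root v := by
    intro q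
    induction q with
    | zero =>
      intro v hv
      obtain rfl : v = H.root := hv
      exact EqvGen.refl _
    | succ q ih =>
      rintro v (h | ⟨w, hw, h | h⟩)
      · exact ih v h
      · exact (ih w hw).trans _ _ _ (EqvGen.rel _ _ ⟨⟨(w, v), by simp [h]⟩, rfl, rfl⟩)
      · exact (ih w hw).trans _ _ _ (EqvGen.symm _ _
          (EqvGen.rel _ _ ⟨⟨(v, w), by simp [h]⟩, rfl, rfl⟩))
  exact fun v w => ((key p v (hH v)).symm _ _).trans _ _ _ (key p w (hH w))

theorem sum_ncard_copies {N : ℕ} {M : Mat[N]}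
    (hM : ∀ u v, M u v = 0 ∨ M u v = 1) :
    ∑ i, ((copies H (ofMatrix M i)).ncard : ℂ) =
      ∑ S ∈ (univ.filter fun q : H.V × H.V => ¬ H.adj q.1 q.2).powerset,
        (-1) ^ S.card * (copyGraph H S).traceOn {⊥} fun _ => M := by
  have h1 : ∀ i, ((copies H (ofMatrix M i)).ncard : ℂ) =
      ∑ φ : H.V → Fin N, if φ H.root = i then
        (if Injective φ ∧ ∀ v w, H.adj v w ↔ M (φ v) (φ w) = 1 then (1 : ℂ) else 0)
        else 0 := by
    intro i
    have hs : (copies H (ofMatrix M i)).ncard = Set.ncard (α := H.V → Fin N)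
        {φ | φ H.root = i ∧ Injective φ ∧ ∀ v w, H.adj v w ↔ M (φ v) (φ w) = 1} :=
      congrArg Set.ncard (Set.ext fun φ =>
        ⟨fun h => ⟨h.2.1, h.1, h.2.2⟩, fun h => ⟨h.2.1, h.1, h.2.2⟩⟩)
    rw [hs, ncard_eq_toFinset_card', ← Set.filter_mem_univ_eq_toFinset, ← sum_boole]
    refine sum_congr rfl fun φ _ => ?_
    by_cases h : φ H.root = i <;> simp [h]
  simp only [h1]
  rw [sum_comm]
  simp only [sum_ite_eq, mem_univ, if_true]
  have h2 : ∀ S : Finset (H.V × H.V), (copyGraph H S).traceOn {⊥} (fun _ => M) =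
      ∑ φ : H.V → Fin N, if Injective φ then ∏ q ∈ (univ.filter
        fun q : H.V × H.V => H.adj q.1 q.2) ∪ S, M (φ q.1) (φ q.2) else 0 := by
    intro S
    unfold StarGraph.traceOn
    refine sum_congr (by congr!) fun φ _ => ?_
    change H.V → Fin N at φ
    have hk : ker φ ∈ ({⊥} : Set (Setoid H.V)) ↔ Injective φ := by
      rw [Set.mem_singleton_iff, Setoid.injective_iff_ker_bot]
    by_cases h : Injective φ
    · refine (if_pos (hk.2 h)).trans (Eq.trans ?_ (if_pos h).symm)
      exact Finset.prod_coe_sort ((univ.filter fun q : H.V × H.V => H.adj q.1 q.2) ∪ S)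
        fun q => M (φ q.1) (φ q.2)
    · exact (if_neg fun h' => h (hk.1 h')).trans (if_neg h).symm
  simp only [h2, mul_sum]
  rw [sum_comm]
  refine sum_congr rfl fun φ _ => ?_
  by_cases hφ : Injective φ
  swap
  · simp [hφ]
  simp only [hφ, true_and, if_true]
  have h3 : ∀ S ∈ (univ.filter fun q : H.V × H.V => ¬ H.adj q.1 q.2).powerset,
      (-1) ^ S.card * ∏ q ∈ (univ.filter fun q : H.V × H.V => H.adj q.1 q.2) ∪ S,
        M (φ q.1) (φ q.2) =
      (∏ q ∈ univ.filter fun q : H.V × H.V => H.adj q.1 q.2, M (φ q.1) (φ q.2)) *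
        ∏ q ∈ S, - M (φ q.1) (φ q.2) := by
    intro S hS
    rw [Finset.prod_union, Finset.prod_neg]
    · ring
    · rw [Finset.disjoint_left]
      intro q hq hq'
      exact (mem_filter.1 (Finset.mem_powerset.1 hS hq')).2 (mem_filter.1 hq).2
  rw [sum_congr rfl h3, ← mul_sum, ← Finset.prod_one_add]
  split_ifs with h
  · rw [Finset.prod_eq_one, Finset.prod_eq_one, mul_one]
    · intro q hq
      have h4 := (mem_filter.1 hq).2
      rw [h] at h4
      rw [(hM _ _).resolve_right h4]
      simp
    · intro q hq
      exact (h _ _).1 (mem_filter.1 hq).2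
  · push Not at h
    obtain ⟨v, w, h | h⟩ := h
    · symm
      refine mul_eq_zero_of_left (Finset.prod_eq_zero (i := (v, w)) (by simp [h.1]) ?_) _
      exact (hM _ _).resolve_right h.2
    · symm
      refine mul_eq_zero_of_right _ (Finset.prod_eq_zero (i := (v, w)) (by simp [h.1]) ?_)
      simp [h.2]

end

section

variable {A : MatrixSeq Ω}
  [∀ N, IsProbabilityMeasure (P N)] (hA : Moments P A)
  (h01 : IsBoundedZeroOne P A) {τ : StarGraph Unit → ℂ} (hτ : TrafficLimit P (fun _ => A) τ)
include hA h01 hτ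

theorem exists_tendsto_copies {H : RootedDigraph} [Fintype H.V] {p : ℕ}
    (hH : ∀ v, H.Within p v) : ∃ l : ℝ, Tendsto (fun N => ∫ ω,
      (∑ i, ((copies H (ofMatrix (A N ω) i)).ncard : ℝ)) / (N : ℝ) ∂(P N)) atTop (𝓝 l) := by
  have h1 : ∀ N, ((∫ ω, (∑ i, ((copies H (ofMatrix (A N ω) i)).ncard : ℝ)) / (N : ℝ) ∂(P N) : ℝ) : ℂ)
      = ∑ S ∈ (univ.filter fun q : H.V × H.V => ¬ H.adj q.1 q.2).powerset,
        (-1) ^ S.card * meanOn P (fun _ => A) (copyGraph H S) {⊥} N := by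
    intro N
    obtain ⟨C, hC⟩ := h01
    unfold meanOn
    simp only [← integral_const_mul]
    rw [← integral_finsetSum, ← integral_complex_ofReal]
    · refine integral_congr_ae ?_
      filter_upwards [hC N] with ω hω
      push_cast
      rw [sum_ncard_copies hω.1, sum_div]
      exact sum_congr (by congr!) fun S _ => mul_div_assoc _ _ _
    · intro S _
      exact (integrable_traceOn (A := fun _ : Unit => A) (fun _ => hA) _ _ N).const_mul _
  have h2 : ∀ S, ∃ l, Tendsto (meanOn P (fun _ => A) (copyGraph H S) {⊥}) atTop (𝓝 l) :=
    fun S => ⟨_, tendsto_meanOn_bot (fun _ => hA) hτ _ _ rfl (copyGraph_connected hH S)⟩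
  choose l hl using h2
  have h3 := tendsto_finsetSum (univ.filter fun q : H.V × H.V => ¬ H.adj q.1 q.2).powerset
    fun S _ => (hl S).const_mul ((-1) ^ S.card)
  simp only [← h1] at h3
  exact ⟨_, (Complex.continuous_re.tendsto _).comp h3⟩

/-- The frequencies of the neighbourhoods converge. -/
theorem exists_tendsto_freq_ball {d : ℕ} (hd : Tendsto (fun N =>
      ∫ ω, ((badVertices (pattern (A N ω)) d).ncard : ℝ) / (N : ℝ) ∂(P N)) atTop (𝓝 0)) (p : ℕ)
    (H : RootedDigraph) [Finite H.V] :
    ∃ l, Tendsto (freq P A fun G => (G.ball p).Isomorphic H) atTop (𝓝 l) := by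
  have : Fintype H.V := ofFinite _
  have hbad := tendsto_freq_nearBad hA h01 hd p
  by_cases hH : ∀ v, H.Within p v
  swap
  · refine ⟨0, tendsto_const_nhds.congr fun N => ?_⟩
    have h1 : ∀ G : RootedDigraph, ¬ (G.ball p).Isomorphic H := by
      rintro G ⟨e, h1, h2⟩
      refine hH fun v => ?_
      exact (isFullEmbedding_equiv h1 h2).within_iff.2
        ⟨e.symm v, e.apply_symm_apply v, (within_ball le_rfl).2 (e.symm v).2⟩
    simp [freq, h1]
  by_cases hH' : H.NearBad d p
  · refine ⟨0, squeeze_zero (fun N => ?_) (fun N => ?_) hbad⟩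
    · unfold freq
      positivity
    · unfold freq
      gcongr
      · exact measure_ne_top _ _
      · rename_i i _ ω
        exact fun h => nearBad_ball.1 (h.symm.nearBad hH')
  obtain ⟨l, hl⟩ := exists_tendsto_copies hA h01 hτ hH
  set a : ℝ := ((copies H H).ncard : ℝ) with ha
  have ha0 : 0 < a := by
    have h1 : id ∈ copies H H := ⟨Function.injective_id, rfl, fun _ _ => Iff.rfl⟩
    rw [ha, Nat.cast_pos, Set.ncard_pos]
    exact ⟨_, h1⟩
  refine ⟨l / a, ?_⟩
  obtain ⟨C, hC⟩ := h01
  set K : ℕ := ((2 * C + 1) ^ p) ^ Nat.card H.V with hK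
  have key : ∀ N, |∫ ω, (∑ i, ((copies H (ofMatrix (A N ω) i)).ncard : ℝ)) / (N : ℝ) ∂(P N) -
      a * freq P A (fun G => (G.ball p).Isomorphic H) N| ≤
      K * freq P A (fun G => G.NearBad d p) N := by
    intro N
    have i1 : Integrable (fun ω => (∑ i, ((copies H (ofMatrix (A N ω) i)).ncard : ℝ)) / (N : ℝ))
      (P N) := (hA N).integrable_pattern fun g =>
        (∑ i, ((copies H ⟨Fin N, g, i⟩).ncard : ℝ)) / (N : ℝ)
    have i2 : Integrable (fun ω =>
      a * (({i | ((ofMatrix (A N ω) i).ball p).Isomorphic H}.ncard : ℝ) / (N : ℝ))) (P N) :=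
      (hA N).integrable_pattern fun g =>
        a * (({i | (RootedDigraph.ball ⟨Fin N, g, i⟩ p).Isomorphic H}.ncard : ℝ) / (N : ℝ))
    have i3 : Integrable (fun ω =>
      K * (({i | (ofMatrix (A N ω) i).NearBad d p}.ncard : ℝ) / (N : ℝ))) (P N) :=
      (hA N).integrable_pattern fun g => K * (({i | NearBad ⟨Fin N, g, i⟩ d p}.ncard : ℝ) / (N : ℝ))
    rw [freq_eq_integral hA, freq_eq_integral hA, ← integral_const_mul, ← integral_const_mul,
      ← integral_sub i1 i2, ← Real.norm_eq_abs]
    refine norm_integral_le_of_norm_le i3 ?_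
    filter_upwards [hC N] with ω hω
    have hN : (0 : ℝ) ≤ N := Nat.cast_nonneg N
    rw [← mul_div_assoc, ← sub_div, ← mul_div_assoc, Real.norm_eq_abs, abs_div, abs_of_nonneg hN]
    gcongr
    rw [ncard_eq_toFinset_card', ncard_eq_toFinset_card', ← Set.filter_mem_univ_eq_toFinset,
      ← Set.filter_mem_univ_eq_toFinset, ← sum_boole, ← sum_boole, mul_sum,
      mul_sum, ← sum_sub_distrib]
    refine (Finset.abs_sum_le_sum_abs _ _).trans (sum_le_sum fun i _ => ?_)
    have hf : Finite (ofMatrix (A N ω) i).V := inferInstanceAs (Finite (Fin N))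
    have hG : (ofMatrix (A N ω) i).DegreeLE C := fun v => ⟨hω.2.1 v, hω.2.2 v⟩
    simp only [Set.mem_ofPred_eq]
    by_cases h1 : ((ofMatrix (A N ω) i).ball p).Isomorphic H
    · rw [if_pos h1, ncard_copies hH h1, mul_one, ← ha, sub_self, abs_zero]
      positivity
    · rw [if_neg h1, mul_zero, sub_zero, Nat.abs_cast]
      by_cases h2 : (ofMatrix (A N ω) i).NearBad d p
      · rw [if_pos h2, mul_one]
        exact_mod_cast hG.ncard_copies_le hH
      · rw [if_neg h2, mul_zero]
        have h3 : copies H (ofMatrix (A N ω) i) = ∅ := by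
          refine Set.eq_empty_of_forall_notMem fun φ hφ => h1 ?_
          exact isomorphic_of_mem_copies hH hH' h2 hφ
        simp [h3]
  have h4 : Tendsto (fun N => a * freq P A (fun G => (G.ball p).Isomorphic H) N) atTop (𝓝 l) := by
    have h5 := squeeze_zero (fun N => abs_nonneg _) key (by simpa using hbad.const_mul (K : ℝ))
    have h6 := hl.sub ((tendsto_zero_iff_abs_tendsto_zero _).2 h5)
    simpa using h6
  refine (h4.div_const a).congr fun N => ?_
  field_simp

end

open RootedDigraph

/-! ### A compact space of rooted graphs -/

/-- Adjacency tables for vertices labelled by their distance to the root and by an index. -/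
abbrev Conf := (ℕ × ℕ) × (ℕ × ℕ) → Bool

/-- The rooted graph of an adjacency table. At most `(2 * C + 1) ^ q` labels are used at
distance `q`. -/
def confGraph (C : ℕ) (x : Conf) : RootedDigraph where
  V := ℕ × ℕ
  adj a b := x (a, b) = true ∧ (a.2 < (2 * C + 1) ^ a.1 ∧ b.2 < (2 * C + 1) ^ b.1) ∧
    a.1 ≤ b.1 + 1 ∧ b.1 ≤ a.1 + 1
  root := (0, 0)

/-- The labels that may occur at distance at most `p`. -/
def labels (C p : ℕ) : Finset (ℕ × ℕ) := Finset.range (p + 1) ×ˢ Finset.range ((2 * C + 1) ^ p)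

variable {C : ℕ} {x y : Conf}

theorem mem_labels {p : ℕ} {a : ℕ × ℕ} (h1 : a.1 ≤ p) (h2 : a.2 < (2 * C + 1) ^ a.1) :
    a ∈ labels C p := by
  simp only [labels, mem_product, Finset.mem_range]
  exact ⟨by omega, h2.trans_le (Nat.pow_le_pow_right (by omega) h1)⟩

theorem within_confGraph {q : ℕ} {a : ℕ × ℕ} (h : (confGraph C x).Within q a) :
    a.1 ≤ q ∧ a.2 < (2 * C + 1) ^ a.1 := by
  induction q generalizing a with
  | zero =>
    obtain rfl : a = (0, 0) := h
    simp
  | succ q ih =>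
    rcases h with h | ⟨b, hb, h | h⟩
    · exact ⟨(ih h).1.trans (Nat.le_succ q), (ih h).2⟩
    · exact ⟨h.2.2.2.trans (Nat.succ_le_succ (ih hb).1), h.2.1.2⟩
    · exact ⟨h.2.2.1.trans (Nat.succ_le_succ (ih hb).1), h.2.1.1⟩

theorem within_congr {p q : ℕ} (hq : q ≤ p) (hxy : ∀ i ∈ labels C p ×ˢ labels C p, x i = y i)
    {a : ℕ × ℕ} (h : (confGraph C x).Within q a) : (confGraph C y).Within q a := by
  induction q generalizing a with
  | zero => exact h
  | succ q ih =>
    rcases h with h | ⟨b, hb, h⟩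
    · exact Or.inl (ih (by omega) h)
    · have hb' := within_confGraph hb
      have ha' := within_confGraph (q := q + 1) (Or.inr ⟨b, hb, h⟩ : (confGraph C x).Within (q + 1) a)
      have lb := mem_labels (C := C) (hb'.1.trans (by omega : q ≤ p)) hb'.2
      have la := mem_labels (C := C) (ha'.1.trans hq) ha'.2
      refine Or.inr ⟨b, ih (by omega) hb, ?_⟩
      rcases h with h | h
      · exact Or.inl ⟨(hxy _ (mem_product.2 ⟨lb, la⟩)).symm.trans h.1, h.2⟩
      · exact Or.inr ⟨(hxy _ (mem_product.2 ⟨la, lb⟩)).symm.trans h.1, h.2⟩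

theorem ball_congr {p : ℕ} (hxy : ∀ i ∈ labels C p ×ˢ labels C p, x i = y i) :
    ((confGraph C x).ball p).Isomorphic ((confGraph C y).ball p) := by
  refine ⟨Equiv.subtypeEquivRight fun a => ⟨within_congr le_rfl hxy,
    within_congr le_rfl fun i hi => (hxy i hi).symm⟩, rfl, fun v w => ?_⟩
  have hv := within_confGraph v.2
  have hw := within_confGraph w.2
  have h := hxy (v.1, w.1) (mem_product.2 ⟨mem_labels hv.1 hv.2, mem_labels hw.1 hw.2⟩)
  change (x (v.1, w.1) = true ∧ _) ↔ (y (v.1, w.1) = true ∧ _)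
  rw [h]
  rfl

theorem isClopen_of_finset {ι : Type*} {S : Set (ι → Bool)} (I : Finset ι)
    (h : ∀ x y : ι → Bool, (∀ i ∈ I, x i = y i) → x ∈ S → y ∈ S) : IsClopen S := by
  have hS : S = I.restrict ⁻¹' (I.restrict '' S) := by
    refine (Set.subset_preimage_image _ _).antisymm ?_
    rintro y ⟨x, hx, hxy⟩
    exact h x y (fun i hi => congrFun hxy ⟨i, hi⟩) hx
  rw [hS]
  exact (isClopen_discrete _).preimage (by fun_prop)

/-- A property of rooted digraphs that is invariant under isomorphisms. -/
def IsoInvariant (F : RootedDigraph → Prop) : Prop :=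
  ∀ ⦃G G' : RootedDigraph⦄, G.Isomorphic G' → F G → F G'

theorem isClopen_confGraph {F : RootedDigraph → Prop} (hF : IsoInvariant F) (C p : ℕ) :
    IsClopen {x | F ((confGraph C x).ball p)} :=
  isClopen_of_finset (labels C p ×ˢ labels C p) fun _ _ h hx => hF (ball_congr h) hx

/-- A graph with bounded degrees has an adjacency table. -/
theorem exists_conf {G : RootedDigraph} [Finite G.V] (hG : G.DegreeLE C) :
    ∃ x : Conf, ∀ p, ((confGraph C x).ball p).Isomorphic (G.ball p) := by
  have h1 : ∀ q, ∃ f : G.V → ℕ, (∀ v, G.Within q v → f v < (2 * C + 1) ^ q) ∧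
      ∀ v w, G.Within q v → G.Within q w → f v = f w → v = w := by
    intro q
    have : Fintype {v // G.Within q v} := ofFinite _
    obtain ⟨e⟩ := Function.Embedding.nonempty_of_card_le (α := {v // G.Within q v})
      (β := Fin ((2 * C + 1) ^ q)) (by
        rw [card_fin, ← Nat.card_eq_fintype_card]
        exact hG.ncard_within q)
    refine ⟨fun v => if h : G.Within q v then e ⟨v, h⟩ else 0, fun v hv => ?_, fun v w hv hw h => ?_⟩
    · simp only [dif_pos hv]
      exact (e ⟨v, hv⟩).2
    · simp only [dif_pos hv, dif_pos hw] at h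
      exact congrArg Subtype.val (e.injective (Fin.ext h))
  choose f hf1 hf2 using h1
  let lev : G.core.V → ℕ := fun v => Nat.find v.2
  have hlev : ∀ v, G.Within (lev v) v.1 := fun v => Nat.find_spec v.2
  have hlev' : ∀ v q, G.Within q v.1 → lev v ≤ q := fun v q h => Nat.find_min' v.2 h
  let e : G.core.V → ℕ × ℕ := fun v => (lev v, f (lev v) v.1)
  have he : Injective e := by
    intro v w h
    obtain ⟨h2, h3⟩ := Prod.ext_iff.1 h
    change lev v = lev w at h2
    change f (lev v) v.1 = f (lev w) w.1 at h3
    have h4 := hlev w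
    rw [← h2] at h3 h4
    exact Subtype.ext (hf2 _ _ _ (hlev v) h4 h3)
  have hidx : ∀ v, (e v).2 < (2 * C + 1) ^ (e v).1 := fun v => hf1 _ _ (hlev v)
  have hnear : ∀ v w : G.core.V, G.adj v.1 w.1 ∨ G.adj w.1 v.1 → lev w ≤ lev v + 1 :=
    fun v w h => hlev' w _ (Or.inr ⟨v.1, hlev v, h⟩)
  let x : Conf := fun q => decide (∃ v w : G.core.V, e v = q.1 ∧ e w = q.2 ∧ G.core.adj v w)
  have hx : ∀ a b, x (a, b) = true ↔ ∃ v w : G.core.V, e v = a ∧ e w = b ∧ G.core.adj v w :=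
    fun a b => decide_eq_true_iff
  have hfull : IsFullEmbedding (G := G.core) (G' := confGraph C x) e := by
    refine ⟨he, ?_, fun v w => ⟨fun h => ?_, fun h => ?_⟩, fun v b h => ?_⟩
    · have h0 : lev G.core.root = 0 := Nat.le_zero.1 (hlev' _ 0 rfl)
      have h2 := hidx G.core.root
      refine Prod.ext h0 ?_
      change f (lev G.core.root) G.core.root.1 = 0
      change f (lev G.core.root) G.core.root.1 < (2 * C + 1) ^ lev G.core.root at h2
      rw [h0, pow_zero] at h2
      rw [h0]
      omega
    · exact ⟨(hx _ _).2 ⟨v, w, rfl, rfl, h⟩, ⟨hidx v, hidx w⟩, hnear w v (Or.inr h),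
        hnear v w (Or.inl h)⟩
    · obtain ⟨v', w', hv, hw, h'⟩ := (hx _ _).1 h.1
      rwa [he hv, he hw] at h'
    · rcases h with h | h
      · obtain ⟨_, w, -, hw, -⟩ := (hx _ _).1 h.1
        exact ⟨w, hw⟩
      · obtain ⟨w, _, hw, -, -⟩ := (hx _ _).1 h.1
        exact ⟨w, hw⟩
  exact ⟨x, fun p => (hfull.ball p).symm.trans ((isFullEmbedding_core G).ball p)⟩

section

variable {A : MatrixSeq Ω}
  [∀ N, IsProbabilityMeasure (P N)] (hA : Moments P A)
include hA

theorem exists_probabilityMeasure_conf (hC : ∀ N, ∀ᵐ ω ∂(P N),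
      (∀ i, {j | A N ω i j = 1}.ncard ≤ C) ∧ ∀ j, {i | A N ω i j = 1}.ncard ≤ C) (N : ℕ) :
    ∃ μ : ProbabilityMeasure Conf, N ≠ 0 → ∀ (F : RootedDigraph → Prop), IsoInvariant F → ∀ p,
      (μ : Measure Conf).real {x | F ((confGraph C x).ball p)} =
        freq P A (fun G => F (G.ball p)) N := by
  rcases eq_or_ne N 0 with hN | hN
  · exact ⟨⟨Measure.dirac fun _ => false, inferInstance⟩, fun h => absurd hN h⟩
  have h1 : ∀ (g : Fin N → Fin N → Prop) (i : Fin N), ∃ x : Conf,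
      DegreeLE ⟨Fin N, g, i⟩ C → ∀ p, ((confGraph C x).ball p).Isomorphic
        (RootedDigraph.ball ⟨Fin N, g, i⟩ p) := by
    intro g i
    by_cases h : DegreeLE ⟨Fin N, g, i⟩ C
    · have : Finite (RootedDigraph.mk (Fin N) g i).V := inferInstanceAs (Finite (Fin N))
      obtain ⟨x, hx⟩ := exists_conf h
      exact ⟨x, fun _ => hx⟩
    · exact ⟨fun _ => false, fun h' => absurd h' h⟩
  choose enc henc using h1
  have hmeas : ∀ i, AEMeasurable (fun ω => enc (pattern (A N ω)) i) (P N) := fun i =>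
    (Measurable.of_discrete (f := fun g => enc g i)).comp_aemeasurable (hA N).aemeasurable_pattern
  let μ : Measure Conf := ∑ i : Fin N, (N : ENNReal)⁻¹ • (P N).map fun ω => enc (pattern (A N ω)) i
  have hN' : (N : ENNReal) ≠ 0 := by exact_mod_cast hN
  have hμ : IsProbabilityMeasure μ := by
    constructor
    simp only [μ, Measure.coe_finsetSum, Finset.sum_apply, Measure.smul_apply, smul_eq_mul]
    have : ∀ i, ((P N).map fun ω => enc (pattern (A N ω)) i) Set.univ = 1 := fun i => by
      rw [Measure.map_apply_of_aemeasurable (hmeas i) MeasurableSet.univ]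
      simp
    simp only [this, sum_const, card_univ, card_fin, mul_one, nsmul_eq_mul]
    exact ENNReal.mul_inv_cancel hN' (ENNReal.natCast_ne_top N)
  refine ⟨⟨μ, hμ⟩, fun _ F hF p => ?_⟩
  have hS := (isClopen_confGraph hF C p).isOpen.measurableSet
  have h2 : ∀ i, ((P N).map fun ω => enc (pattern (A N ω)) i) {x | F ((confGraph C x).ball p)} =
      P N {ω | F ((ofMatrix (A N ω) i).ball p)} := by
    intro i
    rw [Measure.map_apply_of_aemeasurable (hmeas i) hS]
    refine measure_congr ?_
    filter_upwards [hC N] with ω hω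
    have h3 := henc (pattern (A N ω)) i (fun v => ⟨hω.1 v, hω.2 v⟩) p
    exact propext ⟨fun h => hF h3 h, fun h => hF h3.symm h⟩
  change μ.real _ = _
  simp only [μ, Measure.real, Measure.coe_finsetSum, Finset.sum_apply, Measure.smul_apply,
    smul_eq_mul, h2, freq]
  rw [ENNReal.toReal_sum fun i _ => ENNReal.mul_ne_top (ENNReal.inv_ne_top.2 hN') (measure_ne_top _ _),
    sum_div]
  refine sum_congr rfl fun i _ => ?_
  rw [ENNReal.toReal_mul, ENNReal.toReal_inv, ENNReal.toReal_natCast, div_eq_inv_mul]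

theorem convergesLocallyToRegular_of_tendsto (h01 : IsBoundedZeroOne P A)
    {τ : StarGraph Unit → ℂ} (hτ : TrafficLimit P (fun _ => A) τ) {d : ℕ}
    (hd : Tendsto (fun N => ∫ ω, ((badVertices (pattern (A N ω)) d).ncard : ℝ) / (N : ℝ) ∂(P N))
      atTop (𝓝 0)) : ConvergesLocallyToRegular P A := by
  obtain ⟨C, hC⟩ := id h01
  choose μ hμ using exists_probabilityMeasure_conf (C := C) hA fun N => (hC N).mono fun ω h => h.2
  let U : Ultrafilter (ProbabilityMeasure Conf) := (Filter.hyperfilter ℕ).map μ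
  set Q := U.lim
  have hQ : Tendsto μ (Filter.hyperfilter ℕ : Filter ℕ) (𝓝 Q) := U.le_nhds_lim
  have hle : (Filter.hyperfilter ℕ : Filter ℕ) ≤ atTop := Nat.hyperfilter_le_atTop
  have key : ∀ (F : RootedDigraph → Prop) (p : ℕ) (l : ℝ), IsoInvariant F →
      Tendsto (freq P A fun G => F (G.ball p)) atTop (𝓝 l) →
      (Q : Measure Conf).real {x | F ((confGraph C x).ball p)} = l := by
    intro F p l hF hl
    have h1 := ProbabilityMeasure.tendsto_measure_of_null_frontier_of_tendsto' hQ
      (E := {x | F ((confGraph C x).ball p)}) (by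
        rw [(isClopen_confGraph hF C p).frontier_eq, measure_empty])
    have h2 := (ENNReal.tendsto_toReal (measure_ne_top _ _)).comp h1
    refine tendsto_nhds_unique h2 ((hl.mono_left hle).congr' ?_)
    filter_upwards [hle (eventually_ne_atTop 0)] with N hN
    exact (hμ N hN F hF p).symm
  have hcore : ∀ x p, ((confGraph C x).core.ball p).Isomorphic ((confGraph C x).ball p) :=
    fun x p => (isFullEmbedding_core _).ball p
  have hiso : ∀ H, IsoInvariant fun G => G.Isomorphic H := fun H G G' h h' => h.symm.trans h'
  have hset : ∀ p H, {x | ((confGraph C x).core.ball p).Isomorphic H} =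
      {x | ((confGraph C x).ball p).Isomorphic H} := fun p H =>
    Set.ext fun x => ⟨fun h => (hcore x p).symm.trans h, fun h => (hcore x p).trans h⟩
  refine ⟨d, Conf, inferInstance, Q, fun x => (confGraph C x).core, inferInstance, ?_, ?_, ?_⟩
  · intro p H _
    rw [hset]
    exact (isClopen_confGraph (hiso H) C p).isOpen.measurableSet
  · have h1 : ∀ p, ∀ᵐ x ∂(Q : Measure Conf), ¬ ((confGraph C x).ball p).NearBad d p := by
      intro p
      have h2 := key (fun G => G.NearBad d p) p 0 (fun G G' h h' => h.nearBad h') (by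
        simp only [nearBad_ball]
        exact tendsto_freq_nearBad hA h01 hd p)
      rw [Measure.real, ENNReal.toReal_eq_zero_iff] at h2
      have h3 := h2.resolve_right (measure_ne_top _ _)
      rw [ae_iff]
      simpa using h3
    filter_upwards [ae_all_iff.2 h1] with x hx
    rintro ⟨v, q, hv⟩
    by_contra hb
    refine hx (q + 1) (nearBad_ball.2 ⟨q, Nat.lt_succ_self q, v, hv, fun h => hb ?_⟩)
    exact (isFullEmbedding_core _).regularAt_iff.2 h
  · intro p H _
    obtain ⟨l, hl⟩ := exists_tendsto_freq_ball hA h01 hτ hd p H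
    rw [hset, key _ p l (hiso H) hl]
    exact hl

end

section

theorem TrafficLimit.restrict {J : Type*} {A : J → MatrixSeq Ω} {τ : StarGraph J → ℂ}
    (hτ : TrafficLimit P A τ) (k : J) : TrafficLimit P (fun _ : Unit => A k)
      fun T => τ ⟨T.V, T.E, T.src, T.tgt, fun _ => k, T.star⟩ := by
  intro T hT
  exact (hτ ⟨T.V, T.E, T.src, T.tgt, fun _ => k, T.star⟩ hT).congr fun N => rfl

variable [∀ N, IsProbabilityMeasure (P N)]

theorem convergesLocallyToRegular_of_not_asympScalar {A : ι → Unit → MatrixSeq Ω}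
    (hA : ∀ i k, Moments P (A i k)) (h01 : ∀ i, IsBoundedZeroOne P (A i ()))
    (htf : AsympTrafficFree P A) (hsf : AsympStarFree P A) {i j : ι} (hij : i ≠ j)
    (hns : ¬ AsympScalar P (A j ())) : ConvergesLocallyToRegular P (A i ()) := by
  obtain ⟨τ, hτ, -⟩ := htf.exists_state
  obtain ⟨d, hd⟩ := exists_tendsto_badVertices hA h01 htf hsf hij hns
  exact convergesLocallyToRegular_of_tendsto (hA i ()) (h01 i) (hτ.restrict ⟨i, ()⟩) hd

end

/-! ### Matchings of four edges -/

section Matching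

variable {α : Type*}

/-- The unordered pairs are equal. -/
def SamePair (u v u' v' : α) : Prop := (u = u' ∧ v = v') ∨ (u = v' ∧ v = u')

/-- The pair `(u, v)` is a loop or equal to another pair. -/
def Matched (u v a b c d e f : α) : Prop :=
  u = v ∨ SamePair u v a b ∨ SamePair u v c d ∨ SamePair u v e f

/-- Every pair is a loop or equal to another one. -/
def AllMatched (u v a b c d e f : α) : Prop :=
  Matched u v a b c d e f ∧ Matched a b u v c d e f ∧ Matched c d u v a b e f ∧
    Matched e f u v a b c d

theorem AllMatched.eq_or_eq {i a k b l : α} (H : AllMatched i a a i k b b l) (h : k ≠ l) :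
    i = k ∨ i = l := by
  simp only [AllMatched, Matched, SamePair] at H
  grind

theorem AllMatched.of_loop {i a b l : α} (H : AllMatched i a a i i b b l) (h : i ≠ l) :
    a = l ∧ (b = i ∨ b = l) := by
  simp only [AllMatched, Matched, SamePair] at H
  grind

theorem AllMatched.of_cycle {i a b j : α} (H : AllMatched i a a j j b b i) (h : i ≠ j) :
    a = b ∨ (a = i ∧ b = j) ∨ (a = j ∧ b = i) := by
  simp only [AllMatched, Matched, SamePair] at H
  grind

theorem AllMatched.samePair {i a b j k l : α} (H : AllMatched i a a j k b b l) (h : i ≠ j)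
    (h' : k ≠ l) : SamePair k l i j := by
  simp only [AllMatched, Matched, SamePair] at H ⊢
  grind

end Matching

/-! ### Entries of Wigner matrices -/

section Wigner

/-- The positions on or below the diagonal. -/
abbrev LowerPair (N : ℕ) := {q : Fin N × Fin N // q.2 ≤ q.1}

/-- The position on or below the diagonal that corresponds to `(u, v)`. -/
def lowerPair {N : ℕ} (u v : Fin N) : LowerPair N :=
  if h : v ≤ u then ⟨(u, v), h⟩ else ⟨(v, u), (not_le.1 h).le⟩

theorem samePair_of_lowerPair_eq {N : ℕ} {u v u' v' : Fin N}
    (h : lowerPair u v = lowerPair u' v') : SamePair u v u' v' := by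
  unfold lowerPair at h
  unfold SamePair
  split_ifs at h <;> simp only [Subtype.mk.injEq, Prod.mk.injEq] at h <;> tauto

variable {Ω : Type*} [MeasurableSpace Ω] {P : Measure Ω} {N : ℕ}
  {A : Ω → Mat[N]}

/-- `f` is a function of the entries of `A` at the positions in `S`. -/
def DependsOnEntries {β : Type*} [MeasurableSpace β] (P : Measure Ω)
    (A : Ω → Mat[N]) (S : Finset (LowerPair N)) (f : Ω → β) : Prop :=
  ∃ F : (S → ℂ) → β, Measurable F ∧ f =ᵐ[P] fun ω => F fun q => A ω q.1.1.1 q.1.1.2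

/-- The properties of Wigner matrices that are used: `t` and `v` are the first two moments of the
diagonal entries, and `w` is the fourth moment of the other ones. -/
structure WignerMoments (P : Measure Ω) (A : Ω → Mat[N]) (t v w : ℝ) :
    Prop where
  herm : ∀ᵐ ω ∂P, (A ω).IsHermitian
  mom : HasAllMoments P A
  indep : iIndepFun (fun (q : LowerPair N) (ω : Ω) => A ω q.1.1 q.1.2) P
  mean : ∀ i j, i ≠ j → ∫ ω, A ω i j ∂P = 0
  sq : ∀ i j, i ≠ j → ∫ ω, ‖A ω i j‖ ^ 2 ∂P = 1 / N
  fourth : ∀ i j, i ≠ j → ∫ ω, ‖A ω i j‖ ^ 4 ∂P = w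
  diag : ∀ i, ∫ ω, A ω i i ∂P = t
  diagSq : ∀ i, ∫ ω, ‖A ω i i‖ ^ 2 ∂P = v

section

variable {β γ : Type*} [MeasurableSpace β] [MeasurableSpace γ] {S T : Finset (LowerPair N)}

theorem DependsOnEntries.comp {f : Ω → β} (hf : DependsOnEntries P A S f) {φ : β → γ}
    (hφ : Measurable φ) : DependsOnEntries P A S fun ω => φ (f ω) := by
  obtain ⟨F, hF, h⟩ := hf
  exact ⟨φ ∘ F, hφ.comp hF, h.mono fun ω hω => congrArg φ hω⟩

theorem DependsOnEntries.mul {f g : Ω → ℂ} (hf : DependsOnEntries P A S f)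
    (hg : DependsOnEntries P A T g) : DependsOnEntries P A (S ∪ T) fun ω => f ω * g ω := by
  obtain ⟨F, hF, h⟩ := hf
  obtain ⟨G, hG, h'⟩ := hg
  refine ⟨fun x => F (fun q => x ⟨q.1, Finset.mem_union_left _ q.2⟩) *
    G (fun q => x ⟨q.1, Finset.mem_union_right _ q.2⟩), ?_, ?_⟩
  · exact (hF.comp (measurable_pi_lambda _ fun q => measurable_pi_apply _)).mul
      (hG.comp (measurable_pi_lambda _ fun q => measurable_pi_apply _))
  · filter_upwards [h, h'] with ω h1 h2
    rw [h1, h2]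

end

namespace WignerMoments

variable {t s w : ℝ} (h : WignerMoments P A t s w)
include h

theorem conj_apply : ∀ᵐ ω ∂P, ∀ i j, conj (A ω i j) = A ω j i := by
  filter_upwards [h.herm] with ω hω i j
  exact hω.apply j i

theorem dependsOn (u v : Fin N) : DependsOnEntries P A {lowerPair u v} fun ω => A ω u v := by
  by_cases huv : v ≤ u
  · have h1 : lowerPair u v = ⟨(u, v), huv⟩ := dif_pos huv
    rw [h1]
    exact ⟨fun x => x ⟨_, Finset.mem_singleton_self _⟩, measurable_pi_apply _, ae_of_all _ fun ω => rfl⟩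
  · have h1 : lowerPair u v = ⟨(v, u), (not_le.1 huv).le⟩ := dif_neg huv
    rw [h1]
    refine ⟨fun x => conj (x ⟨_, Finset.mem_singleton_self _⟩),
      Complex.continuous_conj.measurable.comp (measurable_pi_apply _), ?_⟩
    filter_upwards [h.conj_apply] with ω hω
    exact (hω v u).symm

theorem indepFun {β γ : Type*} [MeasurableSpace β] [MeasurableSpace γ] {S T : Finset (LowerPair N)}
    {f : Ω → β} {g : Ω → γ} (hf : DependsOnEntries P A S f) (hg : DependsOnEntries P A T g)
    (hST : Disjoint S T) : IndepFun f g P := by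
  obtain ⟨F, hF, e⟩ := hf
  obtain ⟨G, hG, e'⟩ := hg
  have h1 := h.indep.indepFun_finset₀ S T hST
    fun q => (h.mom q.1.1 q.1.2 0).aestronglyMeasurable.aemeasurable
  exact (h1.comp hF hG).congr e.symm e'.symm

theorem allMom_four (u v a b c d e f : Fin N) :
    AllMom P fun ω => A ω u v * A ω a b * (A ω c d * A ω e f) :=
  ((h.mom.entry u v).mul (h.mom.entry a b)).mul ((h.mom.entry c d).mul (h.mom.entry e f))

theorem integral_two_eq_zero {u v a b : Fin N} (huv : u ≠ v) (hn : ¬ SamePair u v a b) :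
    ∫ ω, A ω u v * A ω a b ∂P = 0 := by
  have h1 := h.indepFun (h.dependsOn u v) (h.dependsOn a b)
    (disjoint_singleton.2 fun e => hn (samePair_of_lowerPair_eq e))
  rw [h1.integral_fun_mul_eq_mul_integral (h.mom u v 0).1 (h.mom a b 0).1, h.mean u v huv, zero_mul]

theorem matched_of_integral_ne_zero {u v a b c d e f : Fin N}
    (hI : ∫ ω, A ω u v * A ω a b * (A ω c d * A ω e f) ∂P ≠ 0) : Matched u v a b c d e f := by
  by_contra hm
  simp only [Matched, not_or] at hm
  obtain ⟨huv, h1, h2, h3⟩ := hm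
  refine hI ?_
  have hd := h.indepFun (h.dependsOn u v)
    (((h.dependsOn a b).mul (h.dependsOn c d)).mul (h.dependsOn e f)) (by
      rw [Finset.disjoint_singleton_left]
      simp only [Finset.mem_union, mem_singleton, not_or]
      exact ⟨⟨fun e => h1 (samePair_of_lowerPair_eq e), fun e => h2 (samePair_of_lowerPair_eq e)⟩,
        fun e => h3 (samePair_of_lowerPair_eq e)⟩)
  have hi := hd.integral_fun_mul_eq_mul_integral (h.mom u v 0).1
    ((((h.mom.entry a b).mul (h.mom.entry c d)).mul (h.mom.entry e f)) 0).1
  rw [h.mean u v huv, zero_mul] at hi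
  rw [← hi]
  congr 1; funext ω
  ring

theorem allMatched_of_integral_ne_zero {u v a b c d e f : Fin N}
    (hI : ∫ ω, A ω u v * A ω a b * (A ω c d * A ω e f) ∂P ≠ 0) : AllMatched u v a b c d e f := by
  refine ⟨h.matched_of_integral_ne_zero hI,
    h.matched_of_integral_ne_zero (u := a) (v := b) (a := u) (b := v) (c := c) (d := d) (e := e)
      (f := f) ?_, h.matched_of_integral_ne_zero (u := c) (v := d) (a := u) (b := v) (c := a)
      (d := b) (e := e) (f := f) ?_, h.matched_of_integral_ne_zero (u := e) (v := f) (a := u)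
      (b := v) (c := a) (d := b) (e := c) (f := d) ?_⟩ <;>
  · refine fun h0 => hI (Eq.trans (integral_congr_ae (ae_of_all _ fun ω => ?_)) h0)
    simp only
    ring

theorem integral_eq_zero {u v a b c d e f : Fin N} (hn : ¬ AllMatched u v a b c d e f) :
    ∫ ω, A ω u v * A ω a b * (A ω c d * A ω e f) ∂P = 0 := by
  by_contra h0
  exact hn (h.allMatched_of_integral_ne_zero h0)

theorem integral_normSq (i a : Fin N) :
    ∫ ω, ‖A ω i a‖ ^ 2 ∂P = 1 / N + if a = i then s - 1 / N else 0 := by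
  by_cases hia : a = i
  · subst hia
    rw [h.diagSq, if_pos rfl]
    ring
  · rw [h.sq i a (Ne.symm hia), if_neg hia, add_zero]

theorem mul_apply_swap : ∀ᵐ ω ∂P, ∀ i a, A ω i a * A ω a i = ((‖A ω i a‖ ^ 2 : ℝ) : ℂ) := by
  filter_upwards [h.conj_apply] with ω hω i a
  rw [← hω i a, mul_conj, normSq_eq_norm_sq]

theorem integral_mul_self_apply (i j : Fin N) :
    ∫ ω, (A ω * A ω) i j ∂P = if i = j then ((s + (N - 1) / N : ℝ) : ℂ) else 0 := by
  have hint : ∀ a, Integrable (fun ω => A ω i a * A ω a j) P :=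
    fun a => ((h.mom.entry i a).mul (h.mom.entry a j)).integrable
  simp only [mul_apply]
  rw [integral_finsetSum _ fun a _ => hint a]
  split_ifs with hij
  · subst hij
    have h1 : ∀ a, ∫ ω, A ω i a * A ω a i ∂P = ((1 / N + if a = i then s - 1 / N else 0 : ℝ) : ℂ) := by
      intro a
      rw [← h.integral_normSq, ← integral_complex_ofReal]
      exact integral_congr_ae (h.mul_apply_swap.mono fun ω hω => hω i a)
    rw [sum_congr rfl fun a _ => h1 a, ← ofReal_sum, sum_add_distrib]
    have hN : (N : ℝ) ≠ 0 := by
      have := i.pos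
      positivity
    congr 1
    simp only [sum_const, card_univ, card_fin, nsmul_eq_mul, sum_ite_eq', mem_univ, if_true]
    field_simp
    ring
  · refine sum_eq_zero fun a _ => ?_
    by_cases hia : i = a
    · subst hia
      refine Eq.trans (integral_congr_ae (ae_of_all _ fun ω => mul_comm _ _))
        (h.integral_two_eq_zero hij ?_)
      simp only [SamePair]
      grind
    · refine h.integral_two_eq_zero hia ?_
      simp only [SamePair]
      grind

end WignerMoments

end Wigner

/-! ### The covariances of the square of a Wigner matrix -/

/-- The square, centered at its mean `s + (N - 1) / N`. -/
def centeredSq {N : ℕ} (s : ℝ) (M : Mat[N]) : Mat[N] := M * M - ((s + (N - 1) / N : ℝ) : ℂ) • 1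

section

variable {Ω : Type*} [MeasurableSpace Ω] {P : Measure Ω} {N : ℕ}
  {A : Ω → Mat[N]}

/-- The covariance of two entries of the square. -/
def sqCov (P : Measure Ω) (A : Ω → Mat[N]) (s : ℝ) (a b c d : Fin N) : ℂ :=
  ∫ ω, centeredSq s (A ω) a b * centeredSq s (A ω) c d ∂P

theorem sqCov_comm (s : ℝ) (a b c d : Fin N) : sqCov P A s a b c d = sqCov P A s c d a b := by
  simp only [sqCov, mul_comm]

/-- The common value of the variances of the off-diagonal entries of the square. -/
def offVar (N : ℕ) (t s : ℝ) : ℝ := 1 / N + 2 * (s - 1 / N) / N + 2 * t ^ 2 / N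

namespace WignerMoments

variable {t s w : ℝ} (h : WignerMoments P A t s w)
include h

theorem conj_centeredSq : ∀ᵐ ω ∂P, ∀ i j,
    conj (centeredSq s (A ω) i j) = centeredSq s (A ω) j i := by
  filter_upwards [h.herm] with ω hω i j
  have h1 : (centeredSq s (A ω)).IsHermitian := by
    unfold centeredSq
    refine Matrix.IsHermitian.sub ?_ ?_
    · have h2 := hω.eq
      rw [Matrix.IsHermitian, conjTranspose_mul, h2]
    · simp [Matrix.IsHermitian, Complex.conj_ofReal]
  exact h1.apply j i

theorem sqCov_conj (a b c d : Fin N) : sqCov P A s b a d c = conj (sqCov P A s a b c d) := by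
  unfold sqCov
  rw [← integral_conj]
  refine integral_congr_ae ?_
  filter_upwards [h.conj_centeredSq] with ω hω
  rw [map_mul, hω, hω]

variable [IsProbabilityMeasure P]

theorem hasAllMoments_centeredSq : HasAllMoments P fun ω => centeredSq s (A ω) := by
  intro i j
  exact ((h.mom.mul h.mom).entry i j).sub (allMom_const _)

theorem integral_centeredSq (i j : Fin N) : ∫ ω, centeredSq s (A ω) i j ∂P = 0 := by
  simp only [centeredSq, Matrix.sub_apply]
  rw [integral_sub ((h.mom.mul h.mom).entry i j).integrable (integrable_const _),
    h.integral_mul_self_apply, integral_const]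
  by_cases hij : i = j <;> simp [hij]

omit [IsProbabilityMeasure P] in
theorem integrable_normSq (i a : Fin N) : Integrable (fun ω => ‖A ω i a‖ ^ 2) P := by
  have := memLp_normSq h.mom i a 1
  rwa [Nat.cast_one, memLp_one_iff_integrable] at this

omit [IsProbabilityMeasure P] in
theorem sqCov_eq_sum {a b c d : Fin N} (hcd : c ≠ d) : sqCov P A s a b c d =
    ∑ x, ∑ y, ∫ ω, A ω a x * A ω x b * (A ω c y * A ω y d) ∂P := by
  have h1 : ∀ ω, centeredSq s (A ω) a b * centeredSq s (A ω) c d =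
      (A ω * A ω) a b * (A ω * A ω) c d -
        (((s + (N - 1) / N : ℝ) : ℂ) • (1 : Mat[N])) a b * (A ω * A ω) c d := by
    intro ω
    simp only [centeredSq, Matrix.sub_apply, Matrix.smul_apply, one_apply_ne hcd]
    simp
    ring
  have m2 := h.mom.mul h.mom
  simp only [sqCov, h1]
  rw [integral_sub ((m2.entry a b).mul (m2.entry c d)).integrable
    ((m2.entry c d).const_mul _).integrable, integral_const_mul, h.integral_mul_self_apply,
    if_neg hcd, mul_zero, sub_zero]
  simp only [mul_apply, sum_mul_sum]
  rw [integral_finsetSum _ fun x _ => integrable_finsetSum _ fun y _ =>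
    AllMom.integrable (h.allMom_four a x x b c y y d)]
  exact sum_congr rfl fun x _ =>
    integral_finsetSum _ fun y _ => AllMom.integrable (h.allMom_four a x x b c y y d)

theorem sqCov_loop_eq_zero {i k l : Fin N} (hkl : k ≠ l) (hk : i ≠ k) (hl : i ≠ l) :
    sqCov P A s i i k l = 0 := by
  rw [h.sqCov_eq_sum hkl]
  refine sum_eq_zero fun x _ => sum_eq_zero fun y _ => h.integral_eq_zero fun H => ?_
  exact (H.eq_or_eq hkl).elim hk hl

theorem sqCov_eq_zero {i j k l : Fin N} (hij : i ≠ j) (hkl : k ≠ l) (hn : ¬ SamePair k l i j) :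
    sqCov P A s i j k l = 0 := by
  rw [h.sqCov_eq_sum hkl]
  refine sum_eq_zero fun x _ => sum_eq_zero fun y _ => h.integral_eq_zero fun H => ?_
  exact hn (H.samePair hij hkl)

omit [IsProbabilityMeasure P] in
theorem integrable_normSq_mul (a b c d : Fin N) :
    Integrable (fun ω => ‖A ω a b‖ ^ 2 * ‖A ω c d‖ ^ 2) P := by
  have h1 := ((h.allMom_four a b a b c d c d).integrable).norm
  refine h1.congr (ae_of_all _ fun ω => ?_)
  simp only [norm_mul]
  ring

omit [IsProbabilityMeasure P] in
theorem integral_normSq_mul {a b c d : Fin N} (hn : ¬ SamePair a b c d) :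
    ∫ ω, ‖A ω a b‖ ^ 2 * ‖A ω c d‖ ^ 2 ∂P = (∫ ω, ‖A ω a b‖ ^ 2 ∂P) * ∫ ω, ‖A ω c d‖ ^ 2 ∂P := by
  have hm : Measurable fun z : ℂ => ‖z‖ ^ 2 := by fun_prop
  have h1 := h.indepFun ((h.dependsOn a b).comp hm) ((h.dependsOn c d).comp hm)
    (disjoint_singleton.2 fun e => hn (samePair_of_lowerPair_eq e))
  exact h1.integral_fun_mul_eq_mul_integral ((h.mom a b 0).1.norm.pow 2) ((h.mom c d 0).1.norm.pow 2)

omit [IsProbabilityMeasure P] in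
theorem norm_swap : ∀ᵐ ω ∂P, ∀ i j, ‖A ω i j‖ = ‖A ω j i‖ := by
  filter_upwards [h.conj_apply] with ω hω i j
  rw [← hω i j, RCLike.norm_conj]

omit [IsProbabilityMeasure P] in
/-- The bound for the two terms that contribute to the covariance of a diagonal entry and of
another one. -/
theorem norm_integral_le {i l k : Fin N} (hil : i ≠ l) {F : Ω → ℂ}
    (hF : ∀ᵐ ω ∂P, ‖F ω‖ = ‖A ω i l‖ ^ 3 * ‖A ω k k‖) :
    ‖∫ ω, F ω ∂P‖ ≤ (w + s / N) / 2 := by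
  have i1 : Integrable (fun ω => ‖A ω i l‖ ^ 4) P :=
    (h.integrable_normSq_mul i l i l).congr (ae_of_all _ fun ω => by simp only; ring)
  have i2 := h.integrable_normSq_mul i l k k
  have hn : ¬ SamePair i l k k := by
    unfold SamePair
    grind
  have h2 : ∫ ω, (‖A ω i l‖ ^ 4 + ‖A ω i l‖ ^ 2 * ‖A ω k k‖ ^ 2) / 2 ∂P = (w + s / N) / 2 := by
    rw [integral_div, integral_add i1 i2, h.fourth i l hil, h.integral_normSq_mul hn, h.sq i l hil,
      h.diagSq]
    ring
  rw [← h2]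
  refine norm_integral_le_of_norm_le ((i1.add i2).div_const 2) (hF.mono fun ω hω => ?_)
  rw [hω]
  have h3 := norm_nonneg (A ω i l)
  nlinarith [sq_nonneg (‖A ω i l‖ * (‖A ω i l‖ - ‖A ω k k‖))]

theorem norm_sqCov_loop_le {i l : Fin N} (hil : i ≠ l) : ‖sqCov P A s i i i l‖ ≤ w + s / N := by
  rw [h.sqCov_eq_sum hil, sum_eq_single l]
  · rw [Finset.sum_eq_add i l hil]
    · refine (norm_add_le _ _).trans ((add_le_add (h.norm_integral_le (k := i) hil ?_)
        (h.norm_integral_le (k := l) hil ?_)).trans (le_of_eq (by ring)))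
      all_goals
        filter_upwards [h.norm_swap] with ω hω
        simp only [norm_mul]
        rw [hω l i]
        ring
    · intro y _ hy
      refine h.integral_eq_zero fun H => ?_
      exact (H.of_loop hil).2.elim hy.1 hy.2
    · simp
    · simp
  · intro x _ hx
    refine sum_eq_zero fun y _ => h.integral_eq_zero fun H => hx (H.of_loop hil).1
  · simp

omit [IsProbabilityMeasure P] in
theorem integral_cycle_diag {i j : Fin N} (hij : i ≠ j) (a : Fin N) :
    ∫ ω, A ω i a * A ω a j * (A ω j a * A ω a i) ∂P =
      (((1 / N + if a = i then s - 1 / N else 0) * (1 / N + if a = j then s - 1 / N else 0) : ℝ) :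
        ℂ) := by
  have hn : ¬ SamePair i a j a := by
    unfold SamePair
    grind
  rw [← h.integral_normSq, ← h.integral_normSq, ← h.integral_normSq_mul hn,
    ← integral_complex_ofReal]
  refine integral_congr_ae ?_
  filter_upwards [h.mul_apply_swap] with ω hω
  rw [ofReal_mul, ← hω i a, ← hω j a]
  ring

omit [IsProbabilityMeasure P] in
theorem integral_cycle_loops {i j : Fin N} (hij : i ≠ j) :
    ∫ ω, A ω i i * A ω i j * (A ω j j * A ω j i) ∂P = ((t ^ 2 / N : ℝ) : ℂ) := by
  have h1 := h.indepFun (h.dependsOn i i) (h.dependsOn j j)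
    (disjoint_singleton.2 fun e => by
      have := samePair_of_lowerPair_eq e
      unfold SamePair at this
      grind)
  have hm : Measurable fun z : ℂ => ((‖z‖ ^ 2 : ℝ) : ℂ) := by fun_prop
  have h2 := h.indepFun ((h.dependsOn i i).mul (h.dependsOn j j)) ((h.dependsOn i j).comp hm) (by
    rw [Finset.disjoint_singleton_right]
    simp only [Finset.mem_union, mem_singleton, not_or]
    constructor <;> intro e <;>
    · have := samePair_of_lowerPair_eq e
      unfold SamePair at this
      grind)
  have e1 := h2.integral_fun_mul_eq_mul_integral ((h.mom.entry i i).mul (h.mom.entry j j) 0).1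
    (hm.comp_aemeasurable (h.mom i j 0).1.aemeasurable).aestronglyMeasurable
  rw [h1.integral_fun_mul_eq_mul_integral (h.mom i i 0).1 (h.mom j j 0).1, h.diag, h.diag] at e1
  have e2 : ∫ ω, ((‖A ω i j‖ ^ 2 : ℝ) : ℂ) ∂P = ((1 / N : ℝ) : ℂ) := by
    rw [← h.sq i j hij, ← integral_complex_ofReal]
  rw [e2] at e1
  refine Eq.trans (integral_congr_ae ?_) (e1.trans ?_)
  · filter_upwards [h.mul_apply_swap] with ω hω
    rw [← hω i j]
    ring
  · push_cast
    ring

theorem sqCov_swap {i j : Fin N} (hij : i ≠ j) : sqCov P A s i j j i = (offVar N t s : ℂ) := by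
  have hN : (N : ℂ) ≠ 0 := by
    have := i.pos
    exact_mod_cast this.ne'
  have h1 : ∀ x, ∑ y, ∫ ω, A ω i x * A ω x j * (A ω j y * A ω y i) ∂P =
      (((1 / N + if x = i then s - 1 / N else 0) * (1 / N + if x = j then s - 1 / N else 0) : ℝ) :
        ℂ) + ((if x = i then (t ^ 2 / N : ℝ) else 0) + if x = j then (t ^ 2 / N : ℝ) else 0 : ℝ) := by
    intro x
    rw [← Finset.add_sum_erase _ _ (mem_univ x), h.integral_cycle_diag hij]
    congr 1
    by_cases hxi : x = i
    · subst hxi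
      rw [Finset.sum_eq_single_of_mem j (by simp [hij.symm]), h.integral_cycle_loops hij]
      · simp [hij]
      · intro y hy hyj
        refine h.integral_eq_zero fun H => ?_
        rcases H.of_cycle hij with e | ⟨-, e⟩ | ⟨e, -⟩
        · exact (ne_of_mem_erase hy) e.symm
        · exact hyj e
        · exact hij e
    · by_cases hxj : x = j
      · subst hxj
        rw [Finset.sum_eq_single_of_mem i (by simp [hij])]
        · have := h.integral_cycle_loops hij
          simp only [hxi, if_false, if_true, zero_add]
          rw [← this]
          congr 1; funext ω
          ring
        · intro y hy hyi
          refine h.integral_eq_zero fun H => ?_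
          rcases H.of_cycle hij with e | ⟨e, -⟩ | ⟨-, e⟩
          · exact (ne_of_mem_erase hy) e.symm
          · exact hxi e
          · exact hyi e
      · rw [sum_eq_zero]
        · simp [hxi, hxj]
        · intro y hy
          refine h.integral_eq_zero fun H => ?_
          rcases H.of_cycle hij with e | ⟨e, -⟩ | ⟨e, -⟩
          · exact (ne_of_mem_erase hy) e.symm
          · exact hxi e
          · exact hxj e
  have h2 : ∀ x, (1 / N + if x = i then s - 1 / N else 0) * (1 / N + if x = j then s - 1 / N else 0) +
      ((if x = i then (t ^ 2 / N : ℝ) else 0) + if x = j then (t ^ 2 / N : ℝ) else 0) =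
      1 / N * (1 / N) + (if x = i then (s - 1 / N) / N + t ^ 2 / N else 0) +
      if x = j then (s - 1 / N) / N + t ^ 2 / N else 0 := by
    intro x
    by_cases hxi : x = i
    · subst hxi
      simp only [hij, if_true, if_false]
      ring
    · by_cases hxj : x = j
      · subst hxj
        simp only [hxi, if_true, if_false]
        ring
      · simp only [hxi, hxj, if_false]
        ring
  rw [h.sqCov_eq_sum hij.symm, sum_congr rfl fun x _ => h1 x]
  simp only [← Complex.ofReal_add, h2]
  rw [← ofReal_sum]
  congr 1
  have hN' : (N : ℝ) ≠ 0 := by exact_mod_cast hN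
  simp only [sum_add_distrib, sum_const, card_univ, card_fin,
    nsmul_eq_mul, sum_ite_eq', mem_univ, if_true, offVar]
  field_simp
  ring

theorem integral_normSq_centeredSq {i j : Fin N} (hij : i ≠ j) :
    ∫ ω, ‖centeredSq s (A ω) i j‖ ^ 2 ∂P = offVar N t s := by
  have h1 := h.sqCov_swap hij
  have h2 : sqCov P A s i j j i = ((∫ ω, ‖centeredSq s (A ω) i j‖ ^ 2 ∂P : ℝ) : ℂ) := by
    rw [← integral_complex_ofReal]
    refine integral_congr_ae ?_
    filter_upwards [h.conj_centeredSq] with ω hω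
    rw [← hω i j, mul_conj, normSq_eq_norm_sq]
  rw [h2] at h1
  exact_mod_cast h1

theorem offVar_nonneg {i j : Fin N} (hij : i ≠ j) : 0 ≤ offVar N t s := by
  rw [← h.integral_normSq_centeredSq hij]
  exact integral_nonneg fun ω => by positivity

theorem norm_sqCov_pair_le {i j : Fin N} (hij : i ≠ j) : ‖sqCov P A s i j i j‖ ≤ offVar N t s := by
  rw [← h.integral_normSq_centeredSq hij]
  refine (norm_integral_le_integral_norm _).trans (le_of_eq ?_)
  simp only [norm_mul, pow_two]

/-- The covariance of two squared moduli of entries. -/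
theorem integral_normSq_sub_mul (i a j b : Fin N) :
    (SamePair i a j b → ∫ ω, (‖A ω i a‖ ^ 2 - ∫ ω, ‖A ω i a‖ ^ 2 ∂P) *
        (‖A ω j b‖ ^ 2 - ∫ ω, ‖A ω j b‖ ^ 2 ∂P) ∂P =
      ∫ ω, (‖A ω i a‖ ^ 2 - ∫ ω, ‖A ω i a‖ ^ 2 ∂P) ^ 2 ∂P) ∧
    (¬ SamePair i a j b → ∫ ω, (‖A ω i a‖ ^ 2 - ∫ ω, ‖A ω i a‖ ^ 2 ∂P) *
        (‖A ω j b‖ ^ 2 - ∫ ω, ‖A ω j b‖ ^ 2 ∂P) ∂P = 0) := by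
  constructor
  · intro hs
    have h1 : (fun ω => ‖A ω j b‖ ^ 2) =ᵐ[P] fun ω => ‖A ω i a‖ ^ 2 := by
      filter_upwards [h.norm_swap] with ω hω
      rcases hs with ⟨rfl, rfl⟩ | ⟨rfl, rfl⟩
      · rfl
      · rw [hω]
    rw [integral_congr_ae h1]
    refine integral_congr_ae (h1.mono fun ω hω => ?_)
    simp only at hω ⊢
    rw [hω, pow_two (‖A ω i a‖ ^ 2 - _)]
  · intro hs
    have hm : ∀ c : ℝ, Measurable fun z : ℂ => ‖z‖ ^ 2 - c := fun c => by fun_prop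
    have h1 := h.indepFun ((h.dependsOn i a).comp (hm (∫ ω, ‖A ω i a‖ ^ 2 ∂P)))
      ((h.dependsOn j b).comp (hm (∫ ω, ‖A ω j b‖ ^ 2 ∂P)))
      (disjoint_singleton.2 fun e => hs (samePair_of_lowerPair_eq e))
    rw [h1.integral_fun_mul_eq_mul_integral
      (((h.mom i a 0).1.norm.pow 2).sub aestronglyMeasurable_const)
      (((h.mom j b 0).1.norm.pow 2).sub aestronglyMeasurable_const),
      integral_sub (h.integrable_normSq i a) (integrable_const _)]
    simp

end WignerMoments

end

section

variable {Ω : Type*} [MeasurableSpace Ω] {P : Measure Ω} {N : ℕ}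
  {A : Ω → Mat[N]}

namespace WignerMoments

variable {t s w : ℝ} (h : WignerMoments P A t s w)
include h

theorem centeredSq_diag : ∀ᵐ ω ∂P, ∀ i, centeredSq s (A ω) i i =
    ((∑ a, (‖A ω i a‖ ^ 2 - ∫ ω, ‖A ω i a‖ ^ 2 ∂P) : ℝ) : ℂ) := by
  filter_upwards [h.mul_apply_swap] with ω hω i
  have hN : (N : ℝ) ≠ 0 := by
    have := i.pos
    positivity
  have h1 : ∑ a, ∫ ω, ‖A ω i a‖ ^ 2 ∂P = s + (N - 1) / N := by
    simp only [h.integral_normSq, sum_add_distrib, sum_const, card_univ,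
      card_fin, nsmul_eq_mul, sum_ite_eq', mem_univ, if_true]
    field_simp
    ring
  rw [sum_sub_distrib, h1]
  simp [centeredSq, mul_apply, hω]

variable [IsProbabilityMeasure P]

theorem sqCov_diag_eq (i j : Fin N) : sqCov P A s i i j j =
    ((∑ a, ∑ b, ∫ ω, (‖A ω i a‖ ^ 2 - ∫ ω, ‖A ω i a‖ ^ 2 ∂P) *
        (‖A ω j b‖ ^ 2 - ∫ ω, ‖A ω j b‖ ^ 2 ∂P) ∂P : ℝ) : ℂ) := by
  have h2 : ∀ i a, MemLp (fun ω => ‖A ω i a‖ ^ 2 - ∫ ω, ‖A ω i a‖ ^ 2 ∂P) 2 P :=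
    fun i a => (memLp_normSq h.mom i a 2).sub (memLp_const _)
  have h3 : ∀ a b, Integrable (fun ω => (‖A ω i a‖ ^ 2 - ∫ ω, ‖A ω i a‖ ^ 2 ∂P) *
        (‖A ω j b‖ ^ 2 - ∫ ω, ‖A ω j b‖ ^ 2 ∂P)) P := fun a b => (h2 i a).integrable_mul (h2 j b)
  have h1 : sqCov P A s i i j j = ((∫ ω, (∑ a, (‖A ω i a‖ ^ 2 - ∫ ω, ‖A ω i a‖ ^ 2 ∂P)) *
      ∑ b, (‖A ω j b‖ ^ 2 - ∫ ω, ‖A ω j b‖ ^ 2 ∂P) ∂P : ℝ) : ℂ) := by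
    rw [← integral_complex_ofReal]
    refine integral_congr_ae ?_
    filter_upwards [h.centeredSq_diag] with ω hω
    rw [hω, hω, ofReal_mul]
  rw [h1]
  congr 1
  simp only [sum_mul_sum]
  rw [integral_finsetSum _ fun a _ => integrable_finsetSum _ fun b _ => h3 a b]
  exact sum_congr rfl fun a _ => integral_finsetSum _ fun b _ => h3 a b

theorem integral_normSq_sub_mul_nonneg (i a j b : Fin N) :
    0 ≤ ∫ ω, (‖A ω i a‖ ^ 2 - ∫ ω, ‖A ω i a‖ ^ 2 ∂P) *
        (‖A ω j b‖ ^ 2 - ∫ ω, ‖A ω j b‖ ^ 2 ∂P) ∂P := by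
  by_cases hs : SamePair i a j b
  · rw [(h.integral_normSq_sub_mul i a j b).1 hs]
    exact integral_nonneg fun ω => by positivity
  · exact ((h.integral_normSq_sub_mul i a j b).2 hs).ge

theorem sqCov_diag_nonneg (i j : Fin N) :
    ∃ r : ℝ, 0 ≤ r ∧ sqCov P A s i i j j = r :=
  ⟨_, sum_nonneg fun a _ => sum_nonneg fun b _ =>
    h.integral_normSq_sub_mul_nonneg i a j b, h.sqCov_diag_eq i j⟩

theorem le_sqCov_diag (i : Fin N) :
    ((N : ℝ) - 1) * (w - 1 / (N : ℝ) ^ 2) ≤ (sqCov P A s i i i i).re := by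
  rw [h.sqCov_diag_eq, ofReal_re]
  have h1 : ∀ a, a ≠ i → ∫ ω, (‖A ω i a‖ ^ 2 - ∫ ω, ‖A ω i a‖ ^ 2 ∂P) *
        (‖A ω i a‖ ^ 2 - ∫ ω, ‖A ω i a‖ ^ 2 ∂P) ∂P = w - 1 / (N : ℝ) ^ 2 := by
    intro a ha
    rw [h.sq i a ha.symm]
    have h2 : ∀ ω, (‖A ω i a‖ ^ 2 - 1 / (N : ℝ)) * (‖A ω i a‖ ^ 2 - 1 / (N : ℝ)) =
        ‖A ω i a‖ ^ 4 - 2 / N * ‖A ω i a‖ ^ 2 + 1 / (N : ℝ) ^ 2 := fun ω => by ring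
    have i1 : Integrable (fun ω => ‖A ω i a‖ ^ 4) P :=
      (h.integrable_normSq_mul i a i a).congr (ae_of_all _ fun ω => by simp only; ring)
    have i2 : Integrable (fun ω => 2 / N * ‖A ω i a‖ ^ 2) P := (h.integrable_normSq i a).const_mul _
    have i3 : Integrable (fun ω => ‖A ω i a‖ ^ 4 - 2 / N * ‖A ω i a‖ ^ 2) P := i1.sub i2
    simp only [h2]
    rw [integral_add i3 (integrable_const _), integral_sub i1 i2, integral_const_mul,
      h.sq i a ha.symm, h.fourth i a ha.symm]
    simp
    ring
  calc ((N : ℝ) - 1) * (w - 1 / (N : ℝ) ^ 2)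
      = ∑ a ∈ univ.erase i, ∫ ω, (‖A ω i a‖ ^ 2 - ∫ ω, ‖A ω i a‖ ^ 2 ∂P) *
        (‖A ω i a‖ ^ 2 - ∫ ω, ‖A ω i a‖ ^ 2 ∂P) ∂P := by
        rw [sum_congr rfl fun a ha => h1 a (ne_of_mem_erase ha), sum_const,
          Finset.card_erase_of_mem (mem_univ _), card_univ, card_fin,
          nsmul_eq_mul, Nat.cast_sub i.pos, Nat.cast_one]
    _ ≤ ∑ a, ∫ ω, (‖A ω i a‖ ^ 2 - ∫ ω, ‖A ω i a‖ ^ 2 ∂P) *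
        (‖A ω i a‖ ^ 2 - ∫ ω, ‖A ω i a‖ ^ 2 ∂P) ∂P :=
        Finset.sum_le_sum_of_subset_of_nonneg (Finset.erase_subset _ _)
          fun a _ _ => h.integral_normSq_sub_mul_nonneg i a i a
    _ ≤ _ := sum_le_sum fun a _ => single_le_sum
        (f := fun b => ∫ ω, (‖A ω i a‖ ^ 2 - ∫ ω, ‖A ω i a‖ ^ 2 ∂P) *
        (‖A ω i b‖ ^ 2 - ∫ ω, ‖A ω i b‖ ^ 2 ∂P) ∂P)
        (fun b _ => h.integral_normSq_sub_mul_nonneg i a i b) (mem_univ a)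

end WignerMoments

end

/-! ### A lower bound for a quadratic form -/

section Form

variable {N : ℕ} {q : Fin N → Fin N → ℂ}

theorem sum_diag_le (q : Fin N → Fin N → ℂ) : ∑ a, ‖q a a‖ ^ 2 ≤ ∑ a, ∑ d, ‖q a d‖ ^ 2 :=
  sum_le_sum fun a _ => single_le_sum (f := fun d => ‖q a d‖ ^ 2)
    (fun d _ => by positivity) (mem_univ a)

theorem norm_sum_diag_mul_le {δ : ℝ} (hδ : 0 ≤ δ) {x g : Fin N → Fin N → ℂ}
    (hx : ∑ a, ∑ d, ‖x a d‖ ^ 2 = ∑ a, ∑ d, ‖q a d‖ ^ 2)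
    (hg : ∀ a d, ‖g a d‖ ≤ δ * (‖q a a‖ * ‖x a d‖)) :
    ‖∑ a, ∑ d, g a d‖ ≤ δ * √N * ∑ a, ∑ d, ‖q a d‖ ^ 2 := by
  rcases Nat.eq_zero_or_pos N with rfl | hN
  · simp
  have hN' : (0 : ℝ) < √N := Real.sqrt_pos.2 (by exact_mod_cast hN)
  have h1 : ∀ a d, ‖g a d‖ ≤ δ * (√N / 2 * ‖x a d‖ ^ 2 + (√N)⁻¹ / 2 * ‖q a a‖ ^ 2) := by
    intro a d
    refine (hg a d).trans (mul_le_mul_of_nonneg_left ?_ hδ)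
    have h2 : √N / 2 * ‖x a d‖ ^ 2 + (√N)⁻¹ / 2 * ‖q a a‖ ^ 2 - ‖q a a‖ * ‖x a d‖ =
        (√N)⁻¹ / 2 * (√N * ‖x a d‖ - ‖q a a‖) ^ 2 := by
      field_simp
      ring
    have h3 : 0 ≤ (√N)⁻¹ / 2 * (√N * ‖x a d‖ - ‖q a a‖) ^ 2 := by positivity
    linarith
  have h2 : √(N : ℝ) * √N = N := Real.mul_self_sqrt (by positivity)
  calc ‖∑ a, ∑ d, g a d‖ ≤ ∑ a, ∑ d, ‖g a d‖ :=
        (norm_sum_le _ _).trans (sum_le_sum fun a _ => norm_sum_le _ _)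
    _ ≤ ∑ a, ∑ d, δ * (√N / 2 * ‖x a d‖ ^ 2 + (√N)⁻¹ / 2 * ‖q a a‖ ^ 2) :=
        sum_le_sum fun a _ => sum_le_sum fun d _ => h1 a d
    _ = δ * (√N / 2 * ∑ a, ∑ d, ‖x a d‖ ^ 2 + √N / 2 * ∑ a, ‖q a a‖ ^ 2) := by
        simp only [← mul_sum, sum_add_distrib, sum_const, card_univ, card_fin, nsmul_eq_mul]
        have h4 : ∀ y : ℝ, (√N)⁻¹ / 2 * (N * y) = √N / 2 * y := fun y => by
          rw [← h2, Real.sqrt_mul_self hN'.le]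
          field_simp
        rw [h4]
    _ ≤ _ := by
        have := sum_diag_le q
        have h3 : 0 ≤ δ * √N := by positivity
        rw [hx]
        nlinarith [mul_le_mul_of_nonneg_left this h3]

theorem form_eq {T : Fin N → Fin N → Fin N → Fin N → ℂ}
    (h1 : ∀ i k l, k ≠ l → i ≠ k → i ≠ l → T i i k l = 0 ∧ T k l i i = 0)
    (h2 : ∀ i j k l, i ≠ j → k ≠ l → ¬ SamePair k l i j → T i j k l = 0) :
    ∑ a, ∑ b, ∑ c, ∑ d, T a b c d = ∑ a, ∑ c, T a a c c + ∑ a, ∑ d, (if a = d then 0 else T a a a d)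
      + ∑ a, ∑ d, (if a = d then 0 else T a a d a) + ∑ a, ∑ d, (if a = d then 0 else T a d a a)
      + ∑ a, ∑ d, (if a = d then 0 else T d a a a) + ∑ a, ∑ d, (if a = d then 0 else T a d a d)
      + ∑ a, ∑ d, (if a = d then 0 else T a d d a) := by
  have h3 : ∀ a b c d, T a b c d = (if a = b then if c = d then T a a c c else 0 else 0)
      + (if a = b then if a = c then if a = d then 0 else T a a a d else 0 else 0)
      + (if a = b then if a = d then if a = c then 0 else T a a c a else 0 else 0)
      + (if a = c then if a = d then if a = b then 0 else T a b a a else 0 else 0)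
      + (if b = c then if b = d then if b = a then 0 else T a b b b else 0 else 0)
      + (if a = c then if b = d then if a = b then 0 else T a b a b else 0 else 0)
      + (if b = c then if a = d then if a = b then 0 else T a b b a else 0 else 0) := by
    intro a b c d
    have h1' := h1
    have e1 := h1 a c d
    have e2 := h1 c a b
    have e3 := h2 a b c d
    unfold SamePair at e3
    clear h1 h2 h1'
    grind
  rw [sum_congr rfl fun a _ => sum_congr rfl fun b _ => sum_congr rfl
    fun c _ => sum_congr rfl fun d _ => h3 a b c d]
  simp only [sum_add_distrib, Finset.sum_ite_irrel, Finset.sum_const_zero,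
    sum_ite_eq, mem_univ, if_true]
  congr 3
  rw [sum_comm]

theorem re_form_ge {f : Fin N → Fin N → Fin N → Fin N → ℂ} {κ δ γ : ℝ} (hδ : 0 ≤ δ) (hγ : 0 ≤ γ)
    (hcomm : ∀ a b c d, f a b c d = f c d a b)
    (hconj : ∀ a b c d, f b a d c = conj (f a b c d))
    (h1 : ∀ i k l, k ≠ l → i ≠ k → i ≠ l → f i i k l = 0)
    (h2 : ∀ i j k l, i ≠ j → k ≠ l → ¬ SamePair k l i j → f i j k l = 0)
    (h3 : ∀ i l, i ≠ l → ‖f i i i l‖ ≤ δ) (h4 : ∀ i j, i ≠ j → f i j j i = γ)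
    (h5 : ∀ i j, i ≠ j → ‖f i j i j‖ ≤ γ) (h6 : ∀ i j, ∃ r : ℝ, 0 ≤ r ∧ f i i j j = r)
    (h7 : ∀ i, κ ≤ (f i i i i).re) (q : Fin N → Fin N → ℂ) :
    κ * ∑ a, ‖q a a‖ ^ 2 - (4 * δ * √N + 2 * γ) * ∑ a, ∑ d, ‖q a d‖ ^ 2 ≤
      (∑ a, ∑ b, ∑ c, ∑ d, f a b c d * (q b c * conj (q a d))).re := by
  set S := ∑ a, ∑ d, ‖q a d‖ ^ 2 with hS
  have hS' : ∑ a, ∑ d, ‖q d a‖ ^ 2 = S := sum_comm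
  have h3' : ∀ i l, i ≠ l → ‖f i i l i‖ ≤ δ := fun i l hil => by
    rw [hconj i i i l, RCLike.norm_conj]
    exact h3 i l hil
  rw [form_eq (T := fun a b c d => f a b c d * (q b c * conj (q a d)))]
  · simp only [add_re]
    have hb : ∀ {z : ℂ} {c : ℝ}, ‖z‖ ≤ c → -c ≤ z.re := fun hz =>
      (neg_le_neg hz).trans (neg_le_of_abs_le (Complex.abs_re_le_norm _))
    have e1 : κ * ∑ a, ‖q a a‖ ^ 2 ≤ (∑ a, ∑ c, f a a c c * (q a c * conj (q a c))).re := by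
      have h8 : ∀ a c, (f a a c c * (q a c * conj (q a c))).re = (f a a c c).re * ‖q a c‖ ^ 2 := by
        intro a c
        rw [mul_conj, Complex.re_mul_ofReal, normSq_eq_norm_sq]
      rw [Complex.re_sum, mul_sum]
      refine sum_le_sum fun a _ => ?_
      rw [Complex.re_sum]
      refine le_trans (b := (f a a a a).re * ‖q a a‖ ^ 2)
        (mul_le_mul_of_nonneg_right (h7 a) (by positivity)) ?_
      rw [← h8]
      refine single_le_sum (f := fun c => (f a a c c * (q a c * conj (q a c))).re)
        (fun c _ => ?_) (mem_univ a)
      obtain ⟨r, hr, e⟩ := h6 a c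
      simp only [h8]
      rw [e, ofReal_re]
      positivity
    have hd : ∀ {w z z' : ℂ} {a d : Fin N}, (a ≠ d → ‖w‖ ≤ δ) →
        ‖if a = d then 0 else w * (z * conj z')‖ ≤ δ * (‖z‖ * ‖z'‖) := by
      intro w z z' a d hw
      split_ifs with had
      · rw [norm_zero]; positivity
      · rw [norm_mul, norm_mul, RCLike.norm_conj]
        exact mul_le_mul_of_nonneg_right (hw had) (by positivity)
    have e2 := hb (norm_sum_diag_mul_le hδ (q := q) (x := q)
      (g := fun a d => if a = d then 0 else f a a a d * (q a a * conj (q a d))) rfl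
      fun a d => hd (h3 a d))
    have e3 := hb (norm_sum_diag_mul_le hδ (q := q) (x := q)
      (g := fun a d => if a = d then 0 else f a a d a * (q a d * conj (q a a))) rfl
      fun a d => (hd (h3' a d)).trans_eq (by rw [mul_comm ‖q a d‖]))
    have e4 := hb (norm_sum_diag_mul_le hδ (q := q) (x := fun a d => q d a)
      (g := fun a d => if a = d then 0 else f a d a a * (q d a * conj (q a a))) hS'
      fun a d => (hd (hcomm a a a d ▸ h3 a d)).trans_eq (by rw [mul_comm ‖q d a‖]))
    have e5 := hb (norm_sum_diag_mul_le hδ (q := q) (x := fun a d => q d a)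
      (g := fun a d => if a = d then 0 else f d a a a * (q a a * conj (q d a))) hS'
      fun a d => hd (hcomm a a d a ▸ h3' a d))
    have e6 : -(γ * S) ≤
        (∑ a, ∑ d, if a = d then 0 else f a d a d * (q d a * conj (q a d))).re := by
      refine hb ?_
      have h9 : ∀ a d, ‖if a = d then 0 else f a d a d * (q d a * conj (q a d))‖ ≤
          γ * (‖q d a‖ ^ 2 / 2 + ‖q a d‖ ^ 2 / 2) := by
        intro a d
        split_ifs with had
        · simp only [norm_zero]; positivity
        · rw [norm_mul, norm_mul, RCLike.norm_conj]
          refine mul_le_mul (h5 a d had) ?_ (by positivity) hγ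
          nlinarith [sq_nonneg (‖q d a‖ - ‖q a d‖)]
      refine (norm_sum_le _ _).trans ((sum_le_sum fun a _ => (norm_sum_le _ _).trans
        (sum_le_sum fun d _ => h9 a d)).trans (le_of_eq ?_))
      simp only [← mul_sum, sum_add_distrib, ← sum_div]
      rw [hS', ← hS]
      ring
    have e7 : -(γ * S) ≤
        (∑ a, ∑ d, if a = d then 0 else f a d d a * (q d d * conj (q a a))).re := by
      have h9 : ∀ a d, (if a = d then 0 else f a d d a * (q d d * conj (q a a))) =
          γ * (q d d * conj (q a a) - if a = d then (‖q a a‖ ^ 2 : ℝ) else 0) := by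
        intro a d
        split_ifs with had
        · subst had
          rw [mul_conj, normSq_eq_norm_sq, sub_self, mul_zero]
        · rw [h4 a d had, Complex.ofReal_zero, sub_zero]
      have h10 : ∑ a, ∑ d, (γ : ℂ) * (q d d * conj (q a a) - (if a = d then (‖q a a‖ ^ 2 : ℝ) else 0 : ℝ)) =
          ((γ * (‖∑ a, q a a‖ ^ 2 - ∑ a, ‖q a a‖ ^ 2) : ℝ) : ℂ) := by
        simp only [← mul_sum, sum_sub_distrib, ← ofReal_sum, sum_ite_eq, mem_univ, if_true]
        rw [ofReal_mul, Complex.ofReal_sub]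
        congr 2
        rw [← normSq_eq_norm_sq, ← mul_conj, map_sum, sum_mul_sum, sum_comm]
      simp only [h9]
      rw [h10, ofReal_re]
      have := sum_diag_le q
      nlinarith [mul_le_mul_of_nonneg_left this hγ, mul_nonneg hγ (sq_nonneg ‖∑ a, q a a‖)]
    rw [← hS] at e2 e3 e4 e5
    linarith
  · intro i k l hkl hik hil
    rw [hcomm k l i i, h1 i k l hkl hik hil]
    simp
  · intro i j k l hij hkl hn
    rw [h2 i j k l hij hkl hn, zero_mul]

end Form

section

variable {Ω : Type*} [MeasurableSpace Ω] {P : Measure Ω} {N : ℕ}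
  {A Q : Ω → Mat[N]}

theorem measurable_centeredSq_apply (s : ℝ) (a b : Fin N) :
    Measurable fun M : Mat[N] => centeredSq s M a b := by
  simp only [centeredSq, Matrix.sub_apply, mul_apply]
  exact (measurable_sum _ fun c _ => (measurable_entry a c).mul (measurable_entry c b)).sub_const _

theorem measurable_conj_entry (a b : Fin N) :
    Measurable fun M : Mat[N] => conj (M a b) :=
  Complex.continuous_conj.measurable.comp (measurable_entry a b)

theorem trace_mul_four (C Q : Mat[N]) : (C * (Q * (C * Qᴴ))).trace =
    ∑ a, ∑ b, ∑ c, ∑ d, C a b * C c d * (Q b c * conj (Q a d)) := by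
  simp only [Matrix.trace, diag_apply, mul_apply, conjTranspose_apply, mul_sum]
  refine sum_congr rfl fun a _ => sum_congr rfl fun b _ => sum_congr rfl
    fun c _ => sum_congr rfl fun d _ => ?_
  rw [starRingEnd_apply]
  ring

theorem trace_mul_conjTranspose_self (Q : Mat[N]) :
    (Q * Qᴴ).trace = ((∑ a, ∑ d, ‖Q a d‖ ^ 2 : ℝ) : ℂ) := by
  simp only [Matrix.trace, diag_apply, mul_apply, conjTranspose_apply]
  push_cast
  refine sum_congr rfl fun a _ => sum_congr rfl fun d _ => ?_
  rw [← starRingEnd_apply, mul_conj, normSq_eq_norm_sq]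
  push_cast
  rfl

theorem re_integral {f : Ω → ℂ} (hf : Integrable f P) : (∫ ω, f ω ∂P).re = ∫ ω, (f ω).re ∂P :=
  (Complex.reCLM.integral_comp_comm hf).symm

namespace WignerMoments

variable {t s w : ℝ} (h : WignerMoments P A t s w) [IsProbabilityMeasure P]
include h

theorem re_form_sqCov_ge (hN : 2 ≤ N) (q : Fin N → Fin N → ℂ) :
    ((N : ℝ) - 1) * (w - 1 / (N : ℝ) ^ 2) * ∑ a, ‖q a a‖ ^ 2 -
        (4 * (w + s / N) * √N + 2 * offVar N t s) * ∑ a, ∑ d, ‖q a d‖ ^ 2 ≤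
      (∑ a, ∑ b, ∑ c, ∑ d, sqCov P A s a b c d * (q b c * conj (q a d))).re := by
  have h01 : (⟨0, by omega⟩ : Fin N) ≠ ⟨1, by omega⟩ := by simp
  exact re_form_ge ((norm_nonneg _).trans (h.norm_sqCov_loop_le h01)) (h.offVar_nonneg h01)
    (sqCov_comm s) h.sqCov_conj (fun i k l => h.sqCov_loop_eq_zero)
    (fun i j k l => h.sqCov_eq_zero) (fun i l => h.norm_sqCov_loop_le) (fun i j => h.sqCov_swap)
    (fun i j => h.norm_sqCov_pair_le) h.sqCov_diag_nonneg h.le_sqCov_diag q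

variable (hQ : HasAllMoments P Q) (hind : IndepFun A Q P)
include hQ hind

theorem meanTrace_mul_four :
    meanTrace P (fun ω => centeredSq s (A ω) * (Q ω * (centeredSq s (A ω) * (Q ω)ᴴ))) =
      ∫ ω, (∑ a, ∑ b, ∑ c, ∑ d, sqCov P A s a b c d * (Q ω b c * conj (Q ω a d))) / (N : ℂ) ∂P := by
  have hC := h.hasAllMoments_centeredSq
  have m1 : ∀ a b c d, AllMom P fun ω => centeredSq s (A ω) a b * centeredSq s (A ω) c d *
      (Q ω b c * conj (Q ω a d)) := fun a b c d =>
    ((hC.entry a b).mul (hC.entry c d)).mul ((hQ.entry b c).mul (hQ.entry a d).star)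
  have m2 : ∀ a b c d, AllMom P fun ω => sqCov P A s a b c d * (Q ω b c * conj (Q ω a d)) :=
    fun a b c d => ((hQ.entry b c).mul (hQ.entry a d).star).const_mul _
  simp only [meanTrace, trace_mul_four]
  rw [integral_div, integral_div]
  congr 1
  rw [integral_finsetSum _ fun a _ => AllMom.integrable <| AllMom.sum _ fun b _ => AllMom.sum _
      fun c _ => AllMom.sum _ fun d _ => m1 a b c d,
    integral_finsetSum _ fun a _ => AllMom.integrable <| AllMom.sum _ fun b _ => AllMom.sum _
      fun c _ => AllMom.sum _ fun d _ => m2 a b c d]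
  refine sum_congr rfl fun a _ => ?_
  rw [integral_finsetSum _ fun b _ => AllMom.integrable <| AllMom.sum _
      fun c _ => AllMom.sum _ fun d _ => m1 a b c d,
    integral_finsetSum _ fun b _ => AllMom.integrable <| AllMom.sum _
      fun c _ => AllMom.sum _ fun d _ => m2 a b c d]
  refine sum_congr rfl fun b _ => ?_
  rw [integral_finsetSum _ fun c _ => AllMom.integrable <| AllMom.sum _ fun d _ => m1 a b c d,
    integral_finsetSum _ fun c _ => AllMom.integrable <| AllMom.sum _ fun d _ => m2 a b c d]
  refine sum_congr rfl fun c _ => ?_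
  rw [integral_finsetSum _ fun d _ => AllMom.integrable <| m1 a b c d,
    integral_finsetSum _ fun d _ => AllMom.integrable <| m2 a b c d]
  refine sum_congr rfl fun d _ => ?_
  have h1 := hind.comp ((measurable_centeredSq_apply s a b).mul (measurable_centeredSq_apply s c d))
    ((measurable_entry b c).mul (measurable_conj_entry a d))
  exact (h1.integral_fun_mul_eq_mul_integral
    (((hC.entry a b).mul (hC.entry c d)) 0).1 (((hQ.entry b c).mul (hQ.entry a d).star) 0).1).trans
    (integral_const_mul _ _).symm

theorem le_re_meanTrace (hN : 2 ≤ N) :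
    ((N : ℝ) - 1) * (w - 1 / (N : ℝ) ^ 2) * ∫ ω, (∑ a, ‖Q ω a a‖ ^ 2) / (N : ℝ) ∂P -
        (4 * (w + s / N) * √N + 2 * offVar N t s) * (meanTrace P fun ω => Q ω * (Q ω)ᴴ).re ≤
      (meanTrace P fun ω => centeredSq s (A ω) * (Q ω * (centeredSq s (A ω) * (Q ω)ᴴ))).re := by
  have m2 : AllMom P fun ω => (∑ a, ∑ b, ∑ c, ∑ d,
      sqCov P A s a b c d * (Q ω b c * conj (Q ω a d))) / (N : ℂ) :=
    (AllMom.sum _ fun a _ => AllMom.sum _ fun b _ => AllMom.sum _ fun c _ => AllMom.sum _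
      fun d _ => ((hQ.entry b c).mul (hQ.entry a d).star).const_mul _).div_const _
  have i0 : ∀ a d, Integrable (fun ω => ‖Q ω a d‖ ^ 2) P := fun a d => by
    have := memLp_normSq hQ a d 1
    rwa [Nat.cast_one, memLp_one_iff_integrable] at this
  have i1 : Integrable (fun ω => (∑ a, ‖Q ω a a‖ ^ 2) / (N : ℝ)) P :=
    (integrable_finsetSum _ fun a _ => i0 a a).div_const _
  have i2 : Integrable (fun ω => (∑ a, ∑ d, ‖Q ω a d‖ ^ 2) / (N : ℝ)) P :=
    (integrable_finsetSum _ fun a _ => integrable_finsetSum _ fun d _ => i0 a d).div_const _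
  have e1 : (meanTrace P fun ω => Q ω * (Q ω)ᴴ).re = ∫ ω, (∑ a, ∑ d, ‖Q ω a d‖ ^ 2) / (N : ℝ) ∂P := by
    rw [meanTrace, re_integral ((hQ.mul hQ.conjTranspose).trace.div_const _).integrable]
    congr 1; funext ω
    simp only [trace_mul_conjTranspose_self]
    rw [← ofReal_natCast, ← ofReal_div, ofReal_re]
  rw [h.meanTrace_mul_four hQ hind, re_integral m2.integrable, e1, ← integral_const_mul,
    ← integral_const_mul, ← integral_sub (i1.const_mul _) (i2.const_mul _)]
  refine integral_mono ((i1.const_mul _).sub (i2.const_mul _)) m2.integrable.re fun ω => ?_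
  have h2 := h.re_form_sqCov_ge hN (Q ω)
  have hN' : (0 : ℝ) < N := by positivity
  simp only
  rw [← ofReal_natCast, Complex.div_ofReal_re, ← mul_div_assoc, ← mul_div_assoc, ← sub_div]
  exact div_le_div_of_nonneg_right h2 hN'.le

omit hQ hind in
theorem meanTrace_centeredSq_mul {L : Ω → Mat[N]} (hL : HasAllMoments P L)
    (hAL : IndepFun A L P) : meanTrace P (fun ω => centeredSq s (A ω) * L ω) = 0 := by
  have hC := h.hasAllMoments_centeredSq
  have m1 : ∀ a b, AllMom P fun ω => centeredSq s (A ω) a b * L ω b a :=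
    fun a b => (hC.entry a b).mul (hL.entry b a)
  simp only [meanTrace, Matrix.trace, diag_apply, mul_apply]
  rw [integral_div, integral_finsetSum _ fun a _ => AllMom.integrable <| AllMom.sum _ fun b _ => m1 a b,
    sum_eq_zero, zero_div]
  intro a _
  rw [integral_finsetSum _ fun b _ => AllMom.integrable <| m1 a b]
  refine sum_eq_zero fun b _ => ?_
  have h1 := hAL.comp (measurable_centeredSq_apply s a b) (measurable_entry b a)
  refine (h1.integral_fun_mul_eq_mul_integral ((hC.entry a b) 0).1 ((hL.entry b a) 0).1).trans ?_
  exact (congrArg (· * _) (h.integral_centeredSq a b)).trans (zero_mul _)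

theorem meanTrace_sub_smul_mul_four (σ : ℂ) :
    meanTrace P (fun ω => (A ω * A ω - σ • 1) * (Q ω * ((A ω * A ω - σ • 1) * (Q ω)ᴴ))) =
      meanTrace P (fun ω => centeredSq s (A ω) * (Q ω * (centeredSq s (A ω) * (Q ω)ᴴ))) +
        (((s + (N - 1) / N : ℝ) : ℂ) - σ) ^ 2 * meanTrace P (fun ω => Q ω * (Q ω)ᴴ) := by
  set e : ℂ := ((s + (N - 1) / N : ℝ) : ℂ) - σ with he
  have hC := h.hasAllMoments_centeredSq
  have h1 : ∀ M : Mat[N], M * M - σ • 1 = centeredSq s M + e • 1 := by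
    intro M
    rw [centeredSq, he, sub_smul]
    abel
  have h2 : ∀ ω, ((A ω * A ω - σ • 1) * (Q ω * ((A ω * A ω - σ • 1) * (Q ω)ᴴ))).trace / (N : ℂ) =
      (centeredSq s (A ω) * (Q ω * (centeredSq s (A ω) * (Q ω)ᴴ))).trace / (N : ℂ) +
      e * ((centeredSq s (A ω) * (Q ω * (Q ω)ᴴ)).trace / (N : ℂ)) +
      e * ((centeredSq s (A ω) * ((Q ω)ᴴ * Q ω)).trace / (N : ℂ)) +
      e ^ 2 * ((Q ω * (Q ω)ᴴ).trace / (N : ℂ)) := by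
    intro ω
    have h3 : (Q ω * (centeredSq s (A ω) * (Q ω)ᴴ)).trace =
        (centeredSq s (A ω) * ((Q ω)ᴴ * Q ω)).trace := by
      rw [trace_mul_comm, Matrix.mul_assoc]
    rw [← h3, h1]
    simp only [Matrix.add_mul, Matrix.mul_add, Matrix.smul_mul, Matrix.mul_smul, Matrix.one_mul,
      trace_add, trace_smul, smul_eq_mul]
    ring
  have hQQ := hQ.mul hQ.conjTranspose
  have hQQ' := hQ.conjTranspose.mul hQ
  have m1 : AllMom P fun ω => (centeredSq s (A ω) * (Q ω * (centeredSq s (A ω) * (Q ω)ᴴ))).trace / (N : ℂ) :=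
    (hC.mul (hQ.mul (hC.mul hQ.conjTranspose))).trace.div_const _
  have m2 : AllMom P fun ω => e * ((centeredSq s (A ω) * (Q ω * (Q ω)ᴴ)).trace / (N : ℂ)) :=
    ((hC.mul hQQ).trace.div_const _).const_mul _
  have m3 : AllMom P fun ω => e * ((centeredSq s (A ω) * ((Q ω)ᴴ * Q ω)).trace / (N : ℂ)) :=
    ((hC.mul hQQ').trace.div_const _).const_mul _
  have m4 : AllMom P fun ω => e ^ 2 * ((Q ω * (Q ω)ᴴ).trace / (N : ℂ)) :=
    (hQQ.trace.div_const _).const_mul _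
  have z1 := h.meanTrace_centeredSq_mul hQQ (hind.comp measurable_id
    (ψ := fun M : Mat[N] => M * Mᴴ) (by
      refine measurable_pi_iff.2 fun a => measurable_pi_iff.2 fun b => ?_
      simp only [mul_apply, conjTranspose_apply]
      exact measurable_sum _ fun c _ => (measurable_entry a c).mul (measurable_conj_entry b c)))
  have z2 := h.meanTrace_centeredSq_mul hQQ' (hind.comp measurable_id
    (ψ := fun M : Mat[N] => Mᴴ * M) (by
      refine measurable_pi_iff.2 fun a => measurable_pi_iff.2 fun b => ?_
      simp only [mul_apply, conjTranspose_apply]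
      exact measurable_sum _ fun c _ => (measurable_conj_entry c a).mul (measurable_entry c b)))
  unfold meanTrace at z1 z2 ⊢
  simp only [h2]
  rw [integral_add ((m1.add m2).add m3).integrable m4.integrable,
    integral_add (m1.add m2).integrable m3.integrable, integral_add m1.integrable m2.integrable,
    integral_const_mul, integral_const_mul, integral_const_mul, z1, z2]
  ring

end WignerMoments

end

/-! ### Moments of Wigner matrices -/

section

variable {Ω : Type*} [MeasurableSpace Ω] {P : Measure Ω} {N : ℕ}
  {A : Ω → Mat[N]}

/-- The real and the complex entry laws are centered, with variance one and all moments. -/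
theorem IsWigner.exists_law (hA : IsWigner P A) : ∃ L : Measure ℂ,
    (∀ p : ℕ, MemLp (fun z : ℂ => z) p L) ∧ ∫ z, z ∂L = 0 ∧ ∫ z, ‖z‖ ^ 2 ∂L = 1 ∧
      ∀ i j, j < i → HasLaw (fun ω => (√(N : ℝ) : ℂ) * A ω i j) L P := by
  obtain ⟨μ, ν, hμ, -, mμ, -, hm, hv, -, -, -, hr | hc⟩ := hA
  · have hf : Measurable fun t : ℝ => (t : ℂ) := Complex.measurable_ofReal
    refine ⟨_, fun p => ?_, ?_, ?_, hr⟩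
    · rw [memLp_map_measure_iff (by fun_prop) hf.aemeasurable]
      exact (mμ p).ofReal
    · rw [integral_map hf.aemeasurable (by fun_prop), integral_complex_ofReal,
        hm, Complex.ofReal_zero]
    · rw [integral_map hf.aemeasurable (by fun_prop)]
      simp only [norm_real, Real.norm_eq_abs, sq_abs]
      exact hv
  · have hf : Measurable fun t : ℝ × ℝ => ((t.1 : ℂ) + Complex.I * (t.2 : ℂ)) / (√(2 : ℝ) : ℂ) := by
      fun_prop
    have m1 : ∀ p : ℕ, MemLp (fun t : ℝ × ℝ => (t.1 : ℂ)) p (μ.prod μ) := fun p =>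
      ((mμ p).comp_fst μ).ofReal
    have m2 : ∀ p : ℕ, MemLp (fun t : ℝ × ℝ => (t.2 : ℂ)) p (μ.prod μ) := fun p =>
      ((mμ p).comp_snd μ).ofReal
    have i1 : Integrable (fun t : ℝ × ℝ => (t.1 : ℂ)) (μ.prod μ) := AllMom.integrable m1
    have i2 : Integrable (fun t : ℝ × ℝ => (t.2 : ℂ)) (μ.prod μ) := AllMom.integrable m2
    have s1 : Integrable (fun t : ℝ => t ^ 2) μ := (mμ 2).integrable_sq
    refine ⟨_, fun p => ?_, ?_, ?_, hc⟩
    · rw [memLp_map_measure_iff (by fun_prop) hf.aemeasurable]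
      exact (AllMom.add m1 (AllMom.const_mul m2 Complex.I)).div_const _ p
    · rw [integral_map hf.aemeasurable (by fun_prop), integral_div,
        integral_add i1 (i2.const_mul _), integral_const_mul, integral_complex_ofReal,
        integral_complex_ofReal, integral_fun_fst (f := fun t : ℝ => t),
        integral_fun_snd (f := fun t : ℝ => t), hm]
      simp
    · rw [integral_map hf.aemeasurable (by fun_prop)]
      have e : ∀ t : ℝ × ℝ, ‖((t.1 : ℂ) + Complex.I * (t.2 : ℂ)) / (√(2 : ℝ) : ℂ)‖ ^ 2 =
          (t.1 ^ 2 + t.2 ^ 2) / 2 := by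
        intro t
        rw [norm_div, div_pow, norm_real, Real.norm_eq_abs, sq_abs,
          Real.sq_sqrt (by norm_num), ← normSq_eq_norm_sq, mul_comm Complex.I,
          Complex.normSq_add_mul_I]
      simp only [e]
      rw [integral_div, integral_add (s1.comp_fst μ) (s1.comp_snd μ),
        integral_fun_fst (f := fun t : ℝ => t ^ 2), integral_fun_snd (f := fun t : ℝ => t ^ 2), hv]
      simp

theorem HasLaw.allMom {Z : Ω → ℂ} {L : Measure ℂ} (h : HasLaw Z L P)
    (hL : ∀ p : ℕ, MemLp (fun z : ℂ => z) p L) : AllMom P Z := by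
  intro p
  have h1 := hL p
  rw [← h.map_eq, memLp_map_measure_iff (by fun_prop) h.aemeasurable] at h1
  exact h1

theorem IsWigner.exists_wignerMoments (hA : IsWigner P A) {m : ℝ}
    (hm : ∀ i j : Fin N, i ≠ j → (N : ℝ) * ∫ ω, ‖A ω i j‖ ^ 4 ∂P = m) :
    ∃ t s, WignerMoments P A t s (m / N) := by
  obtain ⟨L, mL, hL1, hL2, hL⟩ := hA.exists_law
  obtain ⟨μ, ν, -, -, -, mν, -, -, herm, hind, hd, -⟩ := hA
  have hf : Measurable fun t : ℝ => (t : ℂ) := Complex.measurable_ofReal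
  have hN : ∀ _ : Fin N, (0 : ℝ) < √N := fun i => Real.sqrt_pos.2 (by exact_mod_cast i.pos)
  have hNc : ∀ _ : Fin N, (√(N : ℝ) : ℂ) ≠ 0 := fun i => by exact_mod_cast (hN i).ne'
  have hconj : ∀ᵐ ω ∂P, ∀ i j, conj (A ω i j) = A ω j i := by
    filter_upwards [herm] with ω hω i j
    exact hω.apply j i
  have hdiv : ∀ i j, (fun ω => A ω i j) = fun ω => (√(N : ℝ) : ℂ) * A ω i j / (√(N : ℝ) : ℂ) :=
      fun i j => funext fun ω => by
    rw [mul_div_cancel_left₀ _ (hNc i)]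
  have hnd : ∀ i j, (fun ω => ‖A ω i j‖ ^ 2) = fun ω => ‖(√(N : ℝ) : ℂ) * A ω i j‖ ^ 2 / N :=
      fun i j => funext fun ω => by
    have h0 : (N : ℝ) ≠ 0 := by
      have := i.pos
      positivity
    rw [norm_mul, mul_pow, norm_real, Real.norm_eq_abs, sq_abs, Real.sq_sqrt (by positivity),
      mul_div_cancel_left₀ _ h0]
  have mdiag : ∀ i, AllMom P fun ω => A ω i i := fun i => by
    rw [hdiv i i]
    refine (HasLaw.allMom (hd i) fun p => ?_).div_const _
    rw [memLp_map_measure_iff (by fun_prop) hf.aemeasurable]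
    exact (mν p).ofReal
  have mlow : ∀ i j, j < i → AllMom P fun ω => A ω i j := fun i j hij => by
    rw [hdiv i j]
    exact (HasLaw.allMom (hL i j hij) mL).div_const _
  have mean_low : ∀ i j, j < i → ∫ ω, A ω i j ∂P = 0 := fun i j hij => by
    rw [hdiv i j]
    rw [integral_div]
    have := (hL i j hij).integral_comp (f := fun z : ℂ => z) (by fun_prop)
    simp only [Function.comp_def] at this
    rw [this, hL1, zero_div]
  have sq_low : ∀ i j, j < i → ∫ ω, ‖A ω i j‖ ^ 2 ∂P = 1 / N := fun i j hij => by
    rw [hnd i j]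
    rw [integral_div]
    have := (hL i j hij).integral_comp (f := fun z : ℂ => ‖z‖ ^ 2) (by fun_prop)
    simp only [Function.comp_def] at this
    rw [this, hL2]
  refine ⟨(∫ t, t ∂ν) / √N, (∫ t, t ^ 2 ∂ν) / N, herm, fun i j => ?_, hind, fun i j hij => ?_,
    fun i j hij => ?_, fun i j hij => ?_, fun i => ?_, fun i => ?_⟩
  · change AllMom P fun ω => A ω i j
    rcases lt_trichotomy j i with hij | rfl | hij
    · exact mlow i j hij
    · exact mdiag j
    · exact (mlow j i hij).star.congr (hconj.mono fun ω hω => hω j i)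
  · rcases lt_or_gt_of_ne hij with hij | hij
    · rw [← integral_congr_ae (hconj.mono fun ω hω => hω j i), integral_conj, mean_low j i hij,
        map_zero]
    · exact mean_low i j hij
  · rcases lt_or_gt_of_ne hij with hij | hij
    · rw [← sq_low j i hij]
      refine integral_congr_ae (hconj.mono fun ω hω => ?_)
      simp only
      rw [← hω j i, RCLike.norm_conj]
    · exact sq_low i j hij
  · have h0 : (N : ℝ) ≠ 0 := by
      have := i.pos
      positivity
    rw [← hm i j hij, mul_div_cancel_left₀ _ h0]
  · rw [hdiv i i]
    rw [integral_div]
    have := (hd i).integral_comp (f := fun z : ℂ => z) (by fun_prop)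
    simp only [Function.comp_def] at this
    rw [this, integral_map hf.aemeasurable (by fun_prop), integral_complex_ofReal, ofReal_div]
  · rw [hnd i i]
    rw [integral_div]
    have := (hd i).integral_comp (f := fun z : ℂ => ‖z‖ ^ 2) (by fun_prop)
    simp only [Function.comp_def] at this
    rw [this, integral_map hf.aemeasurable (by fun_prop)]
    simp only [norm_real, Real.norm_eq_abs, sq_abs]

end

theorem measurable_eval {N : ℕ} (p : StarPoly Unit) :
    Measurable fun M : Mat[N] => p.eval fun _ => M := by
  have hm : ∀ f : Mat[N] → Mat[N],
      (∀ i j, Measurable fun M => f M i j) → Measurable f := fun f hf =>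
    measurable_pi_iff.2 fun i => measurable_pi_iff.2 fun j => hf i j
  have hm' : ∀ f : Mat[N] → Mat[N], Measurable f →
      ∀ i j, Measurable fun M => f M i j := fun f hf i j => (measurable_entry i j).comp hf
  induction p using FreeAlgebra.induction with
  | grade0 r =>
    simp only [StarPoly.eval, AlgHom.commutes]
    exact measurable_const
  | grade1 x =>
    simp only [eval_generator]
    refine hm _ fun i j => ?_
    unfold starIf
    split_ifs
    · exact measurable_conj_entry j i
    · exact measurable_entry i j
  | mul p q hp hq =>
    simp only [StarPoly.eval, map_mul] at hp hq ⊢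
    refine hm _ fun i j => ?_
    simp only [mul_apply]
    exact measurable_sum _ fun k _ => (hm' _ hp i k).mul (hm' _ hq k j)
  | add p q hp hq =>
    simp only [StarPoly.eval, map_add] at hp hq ⊢
    exact hm _ fun i j => (hm' _ hp i j).add (hm' _ hq i j)

section

theorem AsympStarFree.exists_tendsto {ι : Type*} {K : ι → Type*} {A : ∀ i, K i → MatrixSeq Ω}
    (h : AsympStarFree P A) (i : ι) (p : StarPoly (K i)) : ∃ l, Tendsto
      (fun N => meanTrace (P N) fun ω => p.eval fun k => A i k N ω) atTop (𝓝 l) := by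
  have h1 : ∀ {N : ℕ} (M : (Σ i, K i) → Mat[N]),
      StarPoly.eval (FreeAlgebra.lift ℂ (fun x : K i × Bool =>
        (FreeAlgebra.ι ℂ ((⟨i, x.1⟩, x.2) : (Σ i, K i) × Bool) : StarPoly (Σ i, K i))) p) M =
        p.eval fun k => M ⟨i, k⟩ := by
    intro N M
    unfold StarPoly.eval
    rw [← AlgHom.comp_apply]
    congr 1
    ext x
    simp
  obtain ⟨l, hl⟩ := h.1 (FreeAlgebra.lift ℂ (fun x : K i × Bool =>
    (FreeAlgebra.ι ℂ ((⟨i, x.1⟩, x.2) : (Σ i, K i) × Bool) : StarPoly (Σ i, K i))) p)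
  simp only [h1] at hl
  exact ⟨l, hl⟩

/-- The square of the indeterminate. -/
def sqPoly (b : Bool) : StarPoly Unit := FreeAlgebra.ι ℂ ((), b) * FreeAlgebra.ι ℂ ((), b)

theorem eval_sqPoly {N : ℕ} (b : Bool) (M : Mat[N]) :
    (sqPoly b).eval (fun _ => M) = starIf b M * starIf b M := by
  simp [sqPoly, StarPoly.eval]

variable [∀ N, IsProbabilityMeasure (P N)] {A B : MatrixSeq Ω} {m : ℕ → ℝ} {a : ℝ}

theorem norm_diag_le {t s w : ℝ} {N : ℕ} (h : WignerMoments (P N) (A N) t s w) (hN : 0 < N) :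
    |t| ≤ (1 + s) / 2 := by
  have i1 := (h.mom.entry ⟨0, hN⟩ ⟨0, hN⟩).integrable
  have h1 := norm_integral_le_integral_norm (μ := P N) (fun ω => A N ω ⟨0, hN⟩ ⟨0, hN⟩)
  rw [h.diag, norm_real, Real.norm_eq_abs] at h1
  refine h1.trans ?_
  have i2 := h.integrable_normSq ⟨0, hN⟩ ⟨0, hN⟩
  have h2 : ∫ ω, (1 + ‖A N ω ⟨0, hN⟩ ⟨0, hN⟩‖ ^ 2) / 2 ∂(P N) = (1 + s) / 2 := by
    rw [integral_div, integral_add (integrable_const _) i2, h.diagSq]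
    simp
  rw [← h2]
  refine integral_mono i1.norm (((integrable_const _).add i2).div_const 2) fun ω => ?_
  simp only
  nlinarith [sq_nonneg (‖A N ω ⟨0, hN⟩ ⟨0, hN⟩‖ - 1)]

theorem tendsto_mul_sub (hm : Tendsto m atTop (𝓝 a)) :
    Tendsto (fun N : ℕ => ((N : ℝ) - 1) * (m N / N - 1 / (N : ℝ) ^ 2)) atTop (𝓝 a) := by
  have h1 : Tendsto (fun N : ℕ => (1 : ℝ) / N) atTop (𝓝 0) := tendsto_one_div_atTop_nhds_zero_nat
  have h2 : Tendsto (fun N : ℕ => (1 - 1 / (N : ℝ)) * (m N - 1 / (N : ℝ))) atTop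
      (𝓝 ((1 - 0) * (a - 0))) := (h1.const_sub 1).mul (hm.sub h1)
  rw [sub_zero, sub_zero, one_mul] at h2
  refine h2.congr' ?_
  filter_upwards [eventually_gt_atTop 0] with N hN
  have : (N : ℝ) ≠ 0 := by positivity
  field_simp

theorem tendsto_error {s t : ℕ → ℝ} (hm : Tendsto m atTop (𝓝 a)) {s' : ℝ}
    (hs : Tendsto s atTop (𝓝 s')) (ht : ∀ᶠ N in atTop, |t N| ≤ (1 + s N) / 2) :
    Tendsto (fun N : ℕ => 4 * (m N / N + s N / N) * √N + 2 * offVar N (t N) (s N)) atTop (𝓝 0) := by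
  have h1 : Tendsto (fun N : ℕ => (1 : ℝ) / N) atTop (𝓝 0) := tendsto_one_div_atTop_nhds_zero_nat
  have h2 : Tendsto (fun N : ℕ => (√(N : ℝ))⁻¹) atTop (𝓝 0) :=
    tendsto_inv_atTop_zero.comp (Real.tendsto_sqrt_atTop.comp tendsto_natCast_atTop_atTop)
  have h3 : Tendsto (fun N : ℕ => t N ^ 2 * (1 / (N : ℝ))) atTop (𝓝 0) := by
    have h4 : Tendsto (fun N : ℕ => ((1 + s N) / 2) ^ 2 * (1 / (N : ℝ))) atTop
        (𝓝 (((1 + s') / 2) ^ 2 * 0)) := (((hs.const_add 1).div_const 2).pow 2).mul h1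
    rw [mul_zero] at h4
    refine squeeze_zero' (Eventually.of_forall fun N => by positivity) ?_ h4
    filter_upwards [ht] with N hN
    refine mul_le_mul_of_nonneg_right ?_ (by positivity)
    rw [← sq_abs]
    exact pow_le_pow_left₀ (abs_nonneg _) hN 2
  have h5 : Tendsto (fun N : ℕ => 4 * (m N + s N) * (√(N : ℝ))⁻¹ +
      2 * (1 / (N : ℝ) + 2 * (s N - 1 / N) * (1 / N) + 2 * (t N ^ 2 * (1 / (N : ℝ))))) atTop
      (𝓝 (4 * (a + s') * 0 + 2 * (0 + 2 * (s' - 0) * 0 + 2 * 0))) :=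
    (((hm.add hs).const_mul 4).mul h2).add
      (((h1.add (((hs.sub h1).const_mul 2).mul h1)).add (h3.const_mul 2)).const_mul 2)
  simp only [mul_zero, add_zero] at h5
  refine h5.congr' ?_
  filter_upwards [eventually_gt_atTop 0] with N hN
  have hN' : (0 : ℝ) < √N := Real.sqrt_pos.2 (by exact_mod_cast hN)
  have hN2 : √(N : ℝ) * √N = N := Real.mul_self_sqrt (by positivity)
  have h6 : √(N : ℝ) / N = (√(N : ℝ))⁻¹ := by
    nth_rw 2 [← hN2]
    field_simp
  rw [offVar, ← h6]
  ring

/-- If a Wigner matrix with heavy tails is asymptotically free from an independent matrix, then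
the centered polynomials of the latter have small diagonals. -/
theorem tendsto_diagSq_of_asympStarFree (hW : ∀ N, IsWigner (P N) (A N))
    (hm : ∀ (N : ℕ) (i j : Fin N), i ≠ j → (N : ℝ) * ∫ ω, ‖A N ω i j‖ ^ 4 ∂(P N) = m N)
    (hma : Tendsto m atTop (𝓝 a)) (ha : 0 < a) (hB : Moments P B)
    (hind : ∀ N, IndepFun (A N) (B N) (P N)) (hsf : AsympStarFree P (two (single A) (single B)))
    (q q' : StarPoly Unit) (hq' : ∀ (N : ℕ) (M : Mat[N]),
      q'.eval (fun _ => M) = (q.eval fun _ => M)ᴴ)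
    (hq : Tendsto (fun N => meanTrace (P N) (polySeq q B N)) atTop (𝓝 0)) :
    Tendsto (diagSq P (polySeq q B)) atTop (𝓝 0) := by
  choose t s hWM using fun N => (hW N).exists_wignerMoments (hm N)
  have hA : Moments P A := fun N => (hWM N).mom
  obtain ⟨σ, hσ⟩ := hsf.exists_tendsto false (sqPoly false)
  obtain ⟨l, hl⟩ := hsf.exists_tendsto true (q * q')
  have hQ : ∀ N, HasAllMoments (P N) (polySeq q B N) := fun N =>
    (hB N).eval q
  have hiQ : ∀ N, IndepFun (A N) (polySeq q B N) (P N) := fun N =>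
    (hind N).comp measurable_id (measurable_eval q)
  let L : ℕ → ℂ := fun N => meanTrace (P N) fun ω => polySeq q B N ω * (polySeq q B N ω)ᴴ
  let F : ℕ → ℂ := fun N => meanTrace (P N) fun ω => (A N ω * A N ω - σ • 1) *
      (polySeq q B N ω * ((A N ω * A N ω - σ • 1) * (polySeq q B N ω)ᴴ))
  let c : ℕ → ℂ := fun N => ((s N + (N - 1) / N : ℝ) : ℂ)
  have hl' : Tendsto L atTop (𝓝 l) := by
    refine hl.congr fun N => ?_
    congr 1
    funext ω
    rw [polySeq, ← hq', StarPoly.eval, map_mul]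
    rfl
  have hc : ∀ N, 0 < N → meanTrace (P N) (fun ω => (sqPoly false).eval fun _ => A N ω) =
      c N := by
    intro N hN
    have hN' : (N : ℂ) ≠ 0 := by exact_mod_cast hN.ne'
    simp only [meanTrace, eval_sqPoly, starIf, Matrix.trace, diag_apply,
      Bool.false_eq_true, if_false]
    rw [integral_div, integral_finsetSum _ fun i _ => (((hA N).mul (hA N)).entry i i).integrable]
    rw [sum_congr rfl fun i _ => (hWM N).integral_mul_self_apply i i]
    simp only [if_true, sum_const, card_univ, card_fin, nsmul_eq_mul]
    rw [mul_div_cancel_left₀ _ hN']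
  have hσ' : Tendsto c atTop (𝓝 σ) := by
    refine hσ.congr' ?_
    filter_upwards [eventually_gt_atTop 0] with N hN
    exact hc N hN
  have hs : Tendsto s atTop (𝓝 (σ.re - 1)) := by
    have h1 : Tendsto (fun N : ℕ => s N + ((N : ℝ) - 1) / N) atTop (𝓝 σ.re) :=
      (Complex.continuous_re.tendsto σ).comp hσ'
    have h2 : Tendsto (fun N : ℕ => 1 - (1 : ℝ) / N) atTop (𝓝 (1 - 0)) :=
      tendsto_one_div_atTop_nhds_zero_nat.const_sub 1
    rw [sub_zero] at h2
    refine (h1.sub h2).congr' ?_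
    filter_upwards [eventually_gt_atTop 0] with N hN
    have : (N : ℝ) ≠ 0 := by positivity
    field_simp
    ring
  have herr := tendsto_error (t := t) hma hs
    ((eventually_gt_atTop 0).mono fun N hN => norm_diag_le (hWM N) hN)
  have hp0 : ∀ (N : ℕ) (M : Mat[N]),
      (sqPoly false - algebraMap ℂ (StarPoly Unit) σ).eval (fun _ => M) = M * M - σ • 1 := by
    intro N M
    rw [eval_sub_algebraMap, eval_sqPoly]
    rfl
  have hfour : Tendsto F atTop (𝓝 0) := by
    have h1 := hsf.2 [⟨false, sqPoly false - algebraMap ℂ (StarPoly Unit) σ⟩, ⟨true, q⟩,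
      ⟨false, sqPoly false - algebraMap ℂ (StarPoly Unit) σ⟩, ⟨true, q'⟩] (by simp) (by simp) (by
        have h2 := tendsto_meanTrace_centered (A := single A) (fun _ N => hA N) (sqPoly false) hσ
        have h3 : Tendsto (fun N => meanTrace (P N) (polySeq q' B N)) atTop (𝓝 0) := by
          have h4 := (Complex.continuous_conj.tendsto _).comp hq
          rw [map_zero] at h4
          refine h4.congr fun N => ?_
          rw [Function.comp_apply, ← meanTrace_conjTranspose]
          congr 1
          funext ω
          exact (hq' N _).symm
        intro b hb
        simp only [List.mem_cons, List.not_mem_nil, or_false] at hb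
        rcases hb with rfl | rfl | rfl | rfl
        exacts [h2, hq, h2, h3])
    refine h1.congr fun N => ?_
    congr 1
    funext ω
    simp only [List.map_cons, List.map_nil, List.prod_cons, List.prod_nil, mul_one]
    change (sqPoly false - algebraMap ℂ (StarPoly Unit) σ).eval (fun _ => A N ω) *
      (q.eval (fun _ => B N ω) * ((sqPoly false - algebraMap ℂ (StarPoly Unit) σ).eval
        (fun _ => A N ω) * q'.eval fun _ => B N ω)) = _
    rw [hp0, hq']
    rfl
  have hub : Tendsto (fun N : ℕ => (F N).re + ‖(c N - σ) ^ 2 * L N‖ +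
      (4 * (m N / N + s N / N) * √N + 2 * offVar N (t N) (s N)) * (L N).re) atTop (𝓝 0) := by
    have h1 := ((Complex.continuous_re.tendsto _).comp hfour).add
      ((((hσ'.sub_const σ).pow 2).mul hl').norm)
    have h2 := h1.add (herr.mul ((Complex.continuous_re.tendsto _).comp hl'))
    simpa using h2
  have hub2 := hub.const_mul (2 / a)
  rw [mul_zero] at hub2
  refine squeeze_zero' (Eventually.of_forall fun N => integral_nonneg fun ω => by positivity) ?_ hub2
  filter_upwards [eventually_ge_atTop 2, (tendsto_mul_sub hma).eventually_const_lt (half_lt_self ha)] with N hN hκN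
  have h1 := (hWM N).le_re_meanTrace (hQ N) (hiQ N) hN
  have h2 : (F N).re = _ :=
    congrArg Complex.re ((hWM N).meanTrace_sub_smul_mul_four (hQ N) (hiQ N) σ)
  have h3 : -‖(c N - σ) ^ 2 * L N‖ ≤ _ := neg_le_of_abs_le (Complex.abs_re_le_norm _)
  rw [add_re] at h2
  have h4 : 0 ≤ diagSq P (polySeq q B) N := integral_nonneg fun ω => by positivity
  have h5 : a / 2 * diagSq P (polySeq q B) N ≤
      ((N : ℝ) - 1) * (m N / N - 1 / (N : ℝ) ^ 2) * diagSq P (polySeq q B) N :=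
    mul_le_mul_of_nonneg_right hκN.le h4
  rw [← diagSq] at h1
  rw [div_mul_eq_mul_div, le_div_iff₀ ha]
  linarith

end

/-! ### Conjugation by permutation matrices -/

theorem permMatrix_mul_mul_conjTranspose {N : ℕ} (s : Perm (Fin N))
    (M : Mat[N]) :
    s.permMatrix ℂ * M * (s.permMatrix ℂ)ᴴ = M.submatrix s s := by
  rw [Matrix.conjTranspose_permMatrix]
  simp only [Equiv.Perm.permMatrix]
  rw [PEquiv.toMatrix_toPEquiv_mul, PEquiv.mul_toMatrix_toPEquiv]
  rfl

theorem eval_submatrix {N : ℕ} (s : Perm (Fin N)) (p : StarPoly Unit)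
    (M : Mat[N]) :
    p.eval (fun _ => M.submatrix s s) = (p.eval fun _ => M).submatrix s s := by
  have h : FreeAlgebra.lift ℂ (fun x : Unit × Bool => starIf x.2 (M.submatrix s s)) =
      (Matrix.reindexAlgEquiv ℂ ℂ s.symm).toAlgHom.comp
        (FreeAlgebra.lift ℂ (fun x : Unit × Bool => starIf x.2 M)) := by
    ext x i j
    simp only [Function.comp_apply, FreeAlgebra.lift_ι_apply, AlgHom.coe_comp]
    unfold starIf
    split_ifs <;> simp
  have h2 := DFunLike.congr_fun h p
  exact h2

theorem trace_submatrix_perm {N : ℕ} (s : Perm (Fin N)) (M : Mat[N]) :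
    (M.submatrix s s).trace = M.trace := by
  simp only [Matrix.trace, diag_apply, submatrix_apply]
  exact Equiv.sum_comp s fun i => M i i

section

variable {Ω : Type*} [MeasurableSpace Ω] {P : Measure Ω} {N : ℕ}
  {A A' U : Ω → Mat[N]}

theorem IsRandomPermMatrix.hasAllMoments [IsFiniteMeasure P] (hU : IsRandomPermMatrix P U) :
    HasAllMoments P U := by
  intro i j p
  refine MemLp.of_bound ((measurable_entry i j).comp_aemeasurable hU.1).aestronglyMeasurable 1 ?_
  filter_upwards [hU.2] with ω hω
  obtain ⟨s, hs⟩ := hω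
  rw [hs, Equiv.Perm.permMatrix, PEquiv.toMatrix_apply]
  split_ifs <;> simp

theorem HasAllMoments.aemeasurable (hA : HasAllMoments P A) : AEMeasurable A P :=
  aemeasurable_pi_lambda _ fun i => aemeasurable_pi_lambda _ fun j =>
    (hA i j 0).aestronglyMeasurable.aemeasurable

theorem HasAllMoments.of_identDistrib (hA : HasAllMoments P A) (h : IdentDistrib A' A P P) :
    HasAllMoments P A' := fun i j p =>
  ((h.comp (measurable_entry i j)).memLp_iff).2 (hA i j p)

theorem indepFun_conj_of_iIndepFun (hA : AEMeasurable A P) (hA' : AEMeasurable A' P)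
    (hU : AEMeasurable U P) (h : iIndepFun ![A, A', U] P) :
    IndepFun A (fun ω => U ω * A' ω * (U ω)ᴴ) P := by
  have h1 : IndepFun (fun ω => (A' ω, U ω)) A P :=
    h.indepFun_prodMk₀ (by intro i; fin_cases i <;> assumption) 1 2 0 (by decide) (by decide)
  refine (h1.comp (φ := fun x : Mat[N] × Mat[N] => x.2 * x.1 * x.2ᴴ) ?_ measurable_id).symm
  refine measurable_pi_iff.2 fun i => measurable_pi_iff.2 fun j => ?_
  simp only [mul_apply, conjTranspose_apply]
  refine measurable_sum _ fun k _ => Measurable.mul (measurable_sum _ fun l _ => ?_) ?_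
  · exact ((measurable_entry i l).comp measurable_snd).mul ((measurable_entry l k).comp measurable_fst)
  · exact (measurable_conj_entry j k).comp measurable_snd

theorem meanTrace_eval_conj (hU : IsRandomPermMatrix P U) (hid : IdentDistrib A' A P P)
    (p : StarPoly Unit) :
    meanTrace P (fun ω => p.eval fun _ => U ω * A' ω * (U ω)ᴴ) =
      meanTrace P fun ω => p.eval fun _ => A ω := by
  have h1 : meanTrace P (fun ω => p.eval fun _ => U ω * A' ω * (U ω)ᴴ) =
      meanTrace P fun ω => p.eval fun _ => A' ω := by
    refine integral_congr_ae ?_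
    filter_upwards [hU.2] with ω hω
    obtain ⟨s, hs⟩ := hω
    rw [hs, permMatrix_mul_mul_conjTranspose, eval_submatrix, trace_submatrix_perm]
  rw [h1]
  have hm : Measurable fun M : Mat[N] => (p.eval fun _ => M).trace / (N : ℂ) := by
    simp only [Matrix.trace, diag_apply]
    exact (measurable_sum _ fun i _ => (measurable_entry i i).comp (measurable_eval p)).div_const _
  exact (hid.comp hm).integral_eq

theorem integral_normSq_eval_conj (hU : IsRandomPermMatrix P U) (hid : IdentDistrib A' A P P)
    (p : StarPoly Unit) :
    ∫ ω, (∑ i, ‖p.eval (fun _ => U ω * A' ω * (U ω)ᴴ) i i‖ ^ 2) / (N : ℝ) ∂P =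
      ∫ ω, (∑ i, ‖p.eval (fun _ => A ω) i i‖ ^ 2) / (N : ℝ) ∂P := by
  have h1 : ∫ ω, (∑ i, ‖p.eval (fun _ => U ω * A' ω * (U ω)ᴴ) i i‖ ^ 2) / (N : ℝ) ∂P =
      ∫ ω, (∑ i, ‖p.eval (fun _ => A' ω) i i‖ ^ 2) / (N : ℝ) ∂P := by
    refine integral_congr_ae ?_
    filter_upwards [hU.2] with ω hω
    obtain ⟨s, hs⟩ := hω
    simp only [hs, permMatrix_mul_mul_conjTranspose, eval_submatrix, submatrix_apply]
    congr 1
    exact Equiv.sum_comp s fun i => ‖p.eval (fun _ => A' ω) i i‖ ^ 2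
  rw [h1]
  have hm : Measurable fun M : Mat[N] =>
      (∑ i, ‖p.eval (fun _ => M) i i‖ ^ 2) / (N : ℝ) :=
    (measurable_sum _ fun i _ =>
      ((measurable_entry i i).comp (measurable_eval p)).norm.pow_const 2).div_const _
  exact (hid.comp hm).integral_eq

theorem WignerMoments.le_integral_normSq [IsProbabilityMeasure P] {t s w : ℝ}
    (h : WignerMoments P A t s w) (hN : 0 < N) (σ : ℂ) :
    ((N : ℝ) - 1) * (w - 1 / (N : ℝ) ^ 2) ≤
      ∫ ω, (∑ i, ‖(A ω * A ω - σ • 1) i i‖ ^ 2) / (N : ℝ) ∂P := by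
  set e : ℂ := ((s + (N - 1) / N : ℝ) : ℂ) - σ with he
  have hC := h.hasAllMoments_centeredSq
  have i1 : ∀ i, Integrable (fun ω => centeredSq s (A ω) i i * centeredSq s (A ω) i i) P :=
    fun i => ((hC.entry i i).mul (hC.entry i i)).integrable
  have i2 : ∀ i, Integrable (fun ω => 2 * conj e * centeredSq s (A ω) i i) P :=
    fun i => ((hC.entry i i).const_mul _).integrable
  have i3 : ∀ i, Integrable (fun ω => centeredSq s (A ω) i i * centeredSq s (A ω) i i +
      2 * conj e * centeredSq s (A ω) i i) P := fun i => (i1 i).add (i2 i)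
  have i4 : ∀ i, Integrable (fun ω => centeredSq s (A ω) i i * centeredSq s (A ω) i i +
      2 * conj e * centeredSq s (A ω) i i + ((‖e‖ ^ 2 : ℝ) : ℂ)) P :=
    fun i => (i3 i).add (integrable_const _)
  have h1 : ∀ᵐ ω ∂P, ∀ i, ‖(A ω * A ω - σ • 1) i i‖ ^ 2 =
      (centeredSq s (A ω) i i * centeredSq s (A ω) i i +
        2 * conj e * centeredSq s (A ω) i i + ((‖e‖ ^ 2 : ℝ) : ℂ)).re := by
    filter_upwards [h.conj_centeredSq] with ω hω i
    have h2 : (A ω * A ω - σ • 1) i i = centeredSq s (A ω) i i + e := by simp [centeredSq, he]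
    have h3 := Complex.conj_eq_iff_im.1 (hω i i)
    rw [h2, ← normSq_eq_norm_sq, ← normSq_eq_norm_sq, Complex.normSq_apply]
    simp only [add_re, Complex.add_im, Complex.mul_re, Complex.mul_im, h3, Complex.conj_re,
      Complex.conj_im, ofReal_re, Complex.normSq_apply]
    simp
    ring
  have h4 : ∀ i, ((N : ℝ) - 1) * (w - 1 / (N : ℝ) ^ 2) ≤ ∫ ω, ‖(A ω * A ω - σ • 1) i i‖ ^ 2 ∂P := by
    intro i
    rw [integral_congr_ae (h1.mono fun ω hω => hω i), ← re_integral (i4 i),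
      integral_add (i3 i) (integrable_const _), integral_add (i1 i) (i2 i), integral_const_mul,
      h.integral_centeredSq, mul_zero, add_zero, add_re]
    refine (h.le_sqCov_diag i).trans ?_
    rw [sqCov]
    simp only [integral_const, probReal_univ, one_smul, ofReal_re]
    linarith [sq_nonneg ‖e‖]
  have i5 : ∀ i, Integrable (fun ω => ‖(A ω * A ω - σ • 1) i i‖ ^ 2) P := fun i =>
    (i4 i).re.congr (h1.mono fun ω hω => (hω i).symm)
  have hN' : (0 : ℝ) < N := by exact_mod_cast hN
  rw [integral_div, integral_finsetSum _ fun i _ => i5 i, le_div_iff₀ hN']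
  refine le_trans (le_of_eq ?_) (sum_le_sum fun i _ => h4 i)
  rw [sum_const, card_univ, card_fin, nsmul_eq_mul, mul_comm]

end

/-! ### Heavy Wigner matrices -/

section

variable
  [∀ N, IsProbabilityMeasure (P N)] {A : MatrixSeq Ω} {m : ℕ → ℝ} {a : ℝ}

theorem conj_eval_sub {N : ℕ} (p p' : StarPoly Unit) (c : ℂ) (M : Mat[N])
    (h : p'.eval (fun _ => M) = (p.eval fun _ => M)ᴴ) :
    (p' - algebraMap ℂ _ (conj c)).eval (fun _ => M) = ((p - algebraMap ℂ _ c).eval fun _ => M)ᴴ := by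
  rw [eval_sub_algebraMap, eval_sub_algebraMap, h, Matrix.conjTranspose_sub,
    Matrix.conjTranspose_smul, Matrix.conjTranspose_one]
  rfl

theorem not_asympStarFree_wigner_conj (hW : ∀ N, IsWigner (P N) (A N))
    (hm : ∀ (N : ℕ) (i j : Fin N), i ≠ j → (N : ℝ) * ∫ ω, ‖A N ω i j‖ ^ 4 ∂(P N) = m N)
    (hma : Tendsto m atTop (𝓝 a)) (ha : 0 < a) (A' U : MatrixSeq Ω)
    (hid : ∀ N, IdentDistrib (A' N) (A N) (P N) (P N)) (hU : ∀ N, IsRandomPermMatrix (P N) (U N))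
    (hind : ∀ N, iIndepFun ![A N, A' N, U N] (P N)) :
    ¬ AsympStarFree P (two (single A) (single fun N ω => U N ω * A' N ω * (U N ω)ᴴ)) := by
  intro hsf
  choose t s hWM using fun N => (hW N).exists_wignerMoments (hm N)
  have hA : Moments P A := fun N => (hWM N).mom
  have hA' : Moments P A' := fun N => (hA N).of_identDistrib (hid N)
  have hU' : Moments P U := fun N => (hU N).hasAllMoments
  obtain ⟨σ, hσ⟩ := hsf.exists_tendsto true (sqPoly false)
  have hB : ∀ N, HasAllMoments (P N) (fun ω => U N ω * A' N ω * (U N ω)ᴴ) := fun N =>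
    ((hU' N).mul (hA' N)).mul (hU' N).conjTranspose
  have h1 := tendsto_diagSq_of_asympStarFree hW hm hma ha hB
    (fun N => indepFun_conj_of_iIndepFun (hA N).aemeasurable (hA' N).aemeasurable
      (hU' N).aemeasurable (hind N)) hsf (sqPoly false - algebraMap ℂ _ σ)
    (sqPoly true - algebraMap ℂ _ (conj σ)) (fun N M => conj_eval_sub _ _ _ _ (by
      rw [eval_sqPoly, eval_sqPoly, conjTranspose_mul]
      rfl))
    (tendsto_meanTrace_centered (A := single fun N ω => U N ω * A' N ω * (U N ω)ᴴ)
      (fun _ N => hB N) (sqPoly false) hσ)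
  have h2 := le_of_tendsto_of_tendsto (tendsto_mul_sub hma) h1 (by
    filter_upwards [eventually_gt_atTop 0] with N hN
    refine ((hWM N).le_integral_normSq hN σ).trans (le_of_eq ?_)
    have h3 := integral_normSq_eval_conj (hU N) (hid N) (sqPoly false - algebraMap ℂ _ σ)
    rw [diagSq]
    refine Eq.trans ?_ h3.symm
    simp only [eval_sub_algebraMap, eval_sqPoly]
    rfl)
  exact absurd h2 (not_le.2 ha)

theorem not_asympStarFree_wigner_diagonal (hW : ∀ N, IsWigner (P N) (A N))
    (hm : ∀ (N : ℕ) (i j : Fin N), i ≠ j → (N : ℝ) * ∫ ω, ‖A N ω i j‖ ^ 4 ∂(P N) = m N)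
    (hma : Tendsto m atTop (𝓝 a)) (ha : 0 < a) (D : MatrixSeq Ω)
    (hD : Moments P D) (hdiag : ∀ N, ∀ᵐ ω ∂(P N), (D N ω).IsDiag)
    (hind : ∀ N, IndepFun (A N) (D N) (P N)) (μ : Measure ℂ) (hμ : HasLimitingEED P D μ)
    (hμ' : ∀ z, μ ≠ Measure.dirac z) : ¬ AsympStarFree P (two (single A) (single D)) := by
  intro hsf
  obtain ⟨b, hb, hb0⟩ := hμ.hasKappa hdiag hμ'
  obtain ⟨c, hc⟩ := hsf.exists_tendsto true (FreeAlgebra.ι ℂ ((), false))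
  obtain ⟨c', hc'⟩ := hsf.exists_tendsto true (FreeAlgebra.ι ℂ ((), true))
  have hcc : c' = conj c := by
    refine tendsto_nhds_unique hc' (((Complex.continuous_conj.tendsto c).comp hc).congr fun N => ?_)
    rw [Function.comp_apply, ← meanTrace_conjTranspose]
    simp only [eval_generator]
    rfl
  subst hcc
  have hstar : ∀ (N : ℕ) (M : Mat[N]),
      StarPoly.eval (FreeAlgebra.ι ℂ ((), true) - algebraMap ℂ _ (conj c)) (fun _ => M) =
        (StarPoly.eval (FreeAlgebra.ι ℂ ((), false) - algebraMap ℂ _ c) fun _ => M)ᴴ := fun N M =>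
    conj_eval_sub _ _ _ _ (by
      rw [eval_generator, eval_generator]
      rfl)
  have h1 := tendsto_diagSq_of_asympStarFree hW hm hma ha hD hind hsf _ _ hstar
    (tendsto_meanTrace_centered (A := single D) (fun _ N => hD N) _ hc)
  have h2 := tendsto_meanTrace_hadamard (A := single D) (fun _ N => hD N) _ _ hc hc' (c := b)
    (by simp only [eval_generator]; exact hb)
  have h3 := ((Complex.continuous_ofReal.tendsto 0).comp h1).congr fun N =>
    (ofReal_diagSq (P := P) _ N)
  refine hb0 (tendsto_nhds_unique h2 (h3.congr fun N => ?_))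
  congr 1
  funext ω
  rw [polySeq, ← hstar]
  rfl

end

/-! ### Averages over permutations -/

section Perm

variable {I : Type*} [Fintype I] {N : ℕ}

/-- The sum over the maps with kernel `ρ`. -/
def kerSum (f : (I → Fin N) → ℂ) (ρ : Setoid I) : ℂ := ∑ c, if ker c = ρ then f c else 0

/-- The sum over the maps that are constant on the blocks of `ρ`. -/
def leSum (f : (I → Fin N) → ℂ) (ρ : Setoid I) : ℂ := ∑ c, if ρ ≤ ker c then f c else 0

theorem leSum_eq (f : (I → Fin N) → ℂ) (ρ : Setoid I) :
    leSum f ρ = kerSum f ρ + ∑ π ∈ univ.filter (ρ < ·), kerSum f π := by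
  have h : leSum f ρ = ∑ π ∈ univ.filter (ρ ≤ ·), kerSum f π := by
    unfold leSum kerSum
    rw [sum_comm]
    refine sum_congr rfl fun c _ => ?_
    simp
  have h2 : univ.filter (ρ ≤ ·) = insert ρ (univ.filter (ρ < ·)) := by
    ext π
    simp [le_iff_eq_or_lt, eq_comm]
  rw [h, h2, Finset.sum_insert (by simp)]

omit [Fintype I] in
theorem ker_comp_equiv {J : Type*} (e : J ≃ I) (c : I → Fin N) :
    ker (c ∘ e) = (ker c).comap e := rfl

theorem kerSum_comp_equiv (f : (I → Fin N) → ℂ) (e : Perm I) (ρ : Setoid I) :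
    kerSum (fun c => f (c ∘ e)) ρ = kerSum f (ρ.comap e) := by
  unfold kerSum
  rw [← Equiv.sum_comp (Equiv.arrowCongr e (Equiv.refl (Fin N)))]
  refine sum_congr rfl fun c _ => ?_
  have h1 : (Equiv.arrowCongr e (Equiv.refl (Fin N))) c ∘ e = c := by
    ext x
    simp
  have h2 : ker ((Equiv.arrowCongr e (Equiv.refl (Fin N))) c) = ρ ↔
      ker c = ρ.comap e := by
    nth_rw 2 [← h1]
    rw [ker_comp_equiv]
    refine ⟨fun h => by rw [h], fun h => ?_⟩
    ext a b
    have := Setoid.ext_iff.1 h (e.symm a) (e.symm b)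
    simpa [Setoid.comap_rel] using this
  simp only [h1, h2]

theorem exists_perm_comp {c c' : I → Fin N} (h : ker c = ker c') :
    ∃ s : Perm (Fin N), s ∘ c = c' := by
  let e : Set.range c ≃ Set.range c' := (Setoid.quotientKerEquivRange c).symm.trans
    ((Quotient.congrRight fun a b => by rw [h]).trans (Setoid.quotientKerEquivRange c'))
  have he : ∀ x, (e ⟨c x, x, rfl⟩ : Fin N) = c' x := by
    intro x
    have h1 : (Setoid.quotientKerEquivRange c).symm ⟨c x, x, rfl⟩ = Quotient.mk _ x :=
      (Equiv.symm_apply_eq _).2 rfl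
    simp only [e, Equiv.trans_apply, h1]
    rfl
  refine ⟨Equiv.extendSubtype e, funext fun x => ?_⟩
  rw [Function.comp_apply, Equiv.extendSubtype_apply_of_mem e _ ⟨x, rfl⟩]
  exact he x

theorem sum_perm_eq (f g : (I → Fin N) → ℂ) :
    ∑ s : Perm (Fin N), ∑ c, f c * g (s ∘ c) =
      N.factorial * ∑ ρ : Setoid I, kerSum f ρ * kerSum g ρ / kerSum (fun _ : I → Fin N => 1) ρ := by
  have h1 : ∀ (s : Perm (Fin N)) (ρ : Setoid I),
      ∑ c, (if ker c = ρ then g (s ∘ c) else 0) = kerSum g ρ := by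
    intro s ρ
    symm
    rw [kerSum, ← Equiv.sum_comp (Equiv.arrowCongr (Equiv.refl I) s)]
    refine sum_congr rfl fun c _ => ?_
    have h2 : ker ((Equiv.arrowCongr (Equiv.refl I) s) c) = ker c := by
      ext a b
      simp [Setoid.ker_def]
    rw [h2]
    rfl
  have h2 : ∀ c, (∑ s : Perm (Fin N), g (s ∘ c)) * kerSum (fun _ : I → Fin N => 1) (ker c) =
      N.factorial * kerSum g (ker c) := by
    intro c
    have h3 : ∀ c', ker c' = ker c →
        ∑ s : Perm (Fin N), g (s ∘ c) = ∑ s : Perm (Fin N), g (s ∘ c') := by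
      intro c' hc
      obtain ⟨t, rfl⟩ := exists_perm_comp hc
      exact Equiv.sum_comp (Equiv.mulRight t) fun s : Perm (Fin N) => g (s ∘ c')
    rw [kerSum, mul_sum]
    have h4 : ∀ c', (∑ s : Perm (Fin N), g (s ∘ c)) *
        (if ker c' = ker c then (1 : ℂ) else 0) =
        ∑ s : Perm (Fin N), if ker c' = ker c then g (s ∘ c') else 0 := by
      intro c'
      split_ifs with hc
      · rw [mul_one, h3 c' hc]
      · simp
    rw [sum_congr rfl fun c' _ => h4 c', sum_comm, sum_congr rfl fun s _ => h1 s _]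
    simp [Fintype.card_perm]
  have h5 : ∀ c : I → Fin N, kerSum (fun _ : I → Fin N => (1 : ℂ)) (ker c) ≠ 0 := by
    intro c
    rw [kerSum, sum_boole, Nat.cast_ne_zero]
    exact Finset.card_ne_zero_of_mem (a := c) (by simp)
  rw [sum_comm, mul_sum]
  have h6 : ∀ c, ∑ s : Perm (Fin N), f c * g (s ∘ c) = ∑ ρ : Setoid I,
      (if ker c = ρ then f c else 0) *
        (N.factorial * kerSum g ρ / kerSum (fun _ : I → Fin N => 1) ρ) := by
    intro c
    rw [← mul_sum, sum_eq_single (ker c) (by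
      intro ρ _ hρ
      rw [if_neg hρ.symm, zero_mul]) (by simp), if_pos rfl, ← h2, mul_div_cancel_right₀ _ (h5 c)]
  rw [sum_congr rfl fun c _ => h6 c, sum_comm]
  refine sum_congr rfl fun ρ _ => ?_
  rw [← sum_mul, ← kerSum]
  ring

theorem pow_le_kerSum_one (ρ : Setoid I) [Fintype (Quotient ρ)]
    (hN : 2 * Fintype.card (Quotient ρ) ≤ N) : (N : ℝ) ^ Fintype.card (Quotient ρ) ≤
      2 ^ Fintype.card (Quotient ρ) * ‖kerSum (fun _ : I → Fin N => 1) ρ‖ := by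
  set k := Fintype.card (Quotient ρ)
  have h1 : N.descFactorial k ≤ (univ.filter fun c : I → Fin N => ker c = ρ).card := by
    rw [← card_fin N, ← Fintype.card_embedding_eq, ← card_univ, card_fin]
    refine Finset.card_le_card_of_injOn (fun e => e ∘ Quotient.mk ρ) (fun e _ => ?_) ?_
    · simp only [Finset.coe_filter, mem_univ, true_and, Set.mem_ofPred_eq]
      ext a b
      rw [Setoid.ker_def, Function.comp_apply, Function.comp_apply, e.injective.eq_iff]
      exact Quotient.eq
    · intro e _ e' _ h
      ext q
      induction q using inductionOn with
      | h a => exact congrArg Fin.val (congrFun h a)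
  have h2 : (N + 1 - k) ^ k ≤ N.descFactorial k := Nat.pow_sub_le_descFactorial N k
  have h3 : N ^ k ≤ 2 ^ k * (N + 1 - k) ^ k := by
    rw [← mul_pow]
    exact Nat.pow_le_pow_left (by omega) k
  rw [kerSum, sum_boole, Complex.norm_natCast]
  exact_mod_cast h3.trans (Nat.mul_le_mul_left _ (h2.trans h1))

end Perm

open Asymptotics

theorem card_quotient_lt {I : Type*} [Finite I] {ρ π : Setoid I} (h : ρ < π) :
    Nat.card (Quotient π) < Nat.card (Quotient ρ) := by
  have := ofFinite (Quotient ρ)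
  have := ofFinite (Quotient π)
  rw [Nat.card_eq_fintype_card, Nat.card_eq_fintype_card]
  refine Fintype.card_lt_of_surjective_not_injective
    (Quotient.map' id fun a b hab => h.le hab : Quotient ρ → Quotient π) ?_ fun hi => ?_
  · intro q
    induction q using inductionOn with
    | h a => exact ⟨Quotient.mk ρ a, rfl⟩
  · refine h.not_ge fun a b hab => ?_
    have h1 : (Quotient.mk ρ a) = Quotient.mk ρ b := hi (sound (s := π) hab)
    exact Quotient.exact h1

theorem eq_top_of_ker_lt {I : Type*} {p : I → Fin 2} {π : Setoid I} (h : ker p < π) :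
    π = ⊤ := by
  have h1 : ∃ a b, π a b ∧ p a ≠ p b := by
    by_contra! h1
    exact h.not_ge fun a b hab => h1 a b hab
  obtain ⟨a, b, hab, hp⟩ := h1
  have key : ∀ x, π x a := by
    intro x
    have h2 : p x = p a ∨ p x = p b := by omega
    rcases h2 with h2 | h2
    · exact h.le h2
    · exact π.trans' (h.le h2) (π.symm' hab)
  exact top_le_iff.1 fun x y _ => π.trans' (key x) (π.symm' (key y))

/-- The indices `0`, `1` and the indices `2`, `3` are identified. -/
def pairing : Fin 4 → Fin 2 := ![0, 0, 1, 1]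

/-- The cyclic shift. -/
def shift : Perm (Fin 4) := Equiv.addRight 1

/-- The number of free indices in a sum over two edges. -/
def edgeComps (ρ : Setoid (Fin 4)) : ℕ := if ρ ≤ ker pairing then 2 else 1

theorem two_le_card {ρ : Setoid (Fin 4)} (h : ρ ≠ ⊤) : 2 ≤ Nat.card (Quotient ρ) :=
  lt_of_le_of_lt Nat.card_pos (card_quotient_lt (lt_top_iff_ne_top.2 h))

theorem three_le_card {ρ : Setoid (Fin 4)} (h : ρ < ker pairing) :
    3 ≤ Nat.card (Quotient ρ) := by
  refine lt_of_le_of_lt (two_le_card fun h1 => ?_) (card_quotient_lt h)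
  have h2 : (0 : Fin 2) = 1 := Setoid.eq_top_iff.1 h1 (0 : Fin 4) 2
  exact absurd h2 (by decide)

theorem card_quotient_comap {I : Type*} (e : Perm I) (ρ : Setoid I) :
    Nat.card (Quotient (ρ.comap e)) = Nat.card (Quotient ρ) :=
  Nat.card_congr (Quotient.congr e fun _ _ => Iff.rfl)

theorem comap_shift_pairing :
    (Setoid.comap shift (Setoid.comap shift (ker pairing))) = ker pairing := by
  ext a b
  revert a b
  simp only [Setoid.comap_rel, Setoid.ker_def]
  decide

theorem edgeComps_add_le {ρ : Setoid (Fin 4)} (h1 : ρ ≠ ⊤) (h2 : ρ ≠ ker pairing)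
    (h3 : ρ.comap shift ≠ ker pairing) :
    edgeComps ρ + edgeComps (ρ.comap shift) ≤ Nat.card (Quotient ρ) := by
  unfold edgeComps
  split_ifs with h4 h5 h5
  · have h6 : Injective (Quotient.mk ρ) := by
      intro a b hab
      have hab' : ρ a b := Quotient.exact hab
      have e1 : pairing a = pairing b := h4 hab'
      have e2 : pairing (shift.symm a) = pairing (shift.symm b) :=
        h5 (x := shift.symm a) (y := shift.symm b) (by simpa [Setoid.comap_rel] using hab')
      clear hab hab'
      revert a b
      decide
    simpa using Nat.card_le_card_of_injective _ h6
  · exact three_le_card (lt_of_le_of_ne h4 h2)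
  · rw [← card_quotient_comap shift]
    exact three_le_card (lt_of_le_of_ne h5 h3)
  · exact two_le_card h1

section Asymptotics

variable {f : ∀ N : ℕ, (Fin 4 → Fin N) → ℂ} {v : ℕ → ℝ}

theorem isBigO_kerSum
    (h : ∀ ρ, (fun N => leSum (f N) ρ) =O[atTop] fun N => v N * (N : ℝ) ^ edgeComps ρ)
    (ρ : Setoid (Fin 4)) :
    (fun N => kerSum (f N) ρ) =O[atTop] fun N => v N * (N : ℝ) ^ edgeComps ρ := by
  induction ρ using WellFoundedGT.induction with
  | ind ρ ih =>
    have h1 : (fun N => kerSum (f N) ρ) = fun N => leSum (f N) ρ -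
        ∑ π ∈ univ.filter (ρ < ·), kerSum (f N) π := by
      funext N
      rw [leSum_eq, add_sub_cancel_right]
    rw [h1]
    refine (h ρ).sub (IsBigO.fun_sum fun π hπ => ?_)
    have hπ' : ρ < π := (mem_filter.1 hπ).2
    refine (ih π hπ').trans ((isBigO_refl v atTop).mul (IsBigO.of_bound 1 ?_))
    filter_upwards [eventually_ge_atTop 1] with N hN
    rw [norm_pow, norm_pow, one_mul]
    refine pow_le_pow_right₀ (by simpa using hN) ?_
    unfold edgeComps
    split_ifs with h2 h3
    · rfl
    · exact absurd (hπ'.le.trans h2) h3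
    · norm_num
    · rfl

theorem isBigO_inv_kerSum_one (ρ : Setoid (Fin 4)) {k : ℕ} (hk : k ≤ Nat.card (Quotient ρ)) :
    (fun N : ℕ => (kerSum (fun _ : Fin 4 → Fin N => 1) ρ)⁻¹) =O[atTop] fun N : ℕ => ((N : ℝ) ^ k)⁻¹ := by
  have := ofFinite (Quotient ρ)
  rw [Nat.card_eq_fintype_card] at hk
  refine IsBigO.inv_rev (IsBigO.of_bound (2 ^ Fintype.card (Quotient ρ)) ?_) ?_
  · filter_upwards [eventually_ge_atTop (2 * Fintype.card (Quotient ρ)), eventually_ge_atTop 1] with N hN hN1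
    refine le_trans ?_ (pow_le_kerSum_one ρ hN)
    rw [norm_pow, RCLike.norm_natCast]
    exact pow_le_pow_right₀ (by exact_mod_cast hN1) hk
  · filter_upwards [eventually_ge_atTop 1] with N hN h
    exact absurd h (by positivity)

variable {a : ℂ} (hv : Tendsto (fun N => v N ^ 2 / N) atTop (𝓝 0))
  (h : ∀ ρ, (fun N => leSum (f N) ρ) =O[atTop] fun N => v N * (N : ℝ) ^ edgeComps ρ)
  (h0 : Tendsto (fun N => kerSum (f N) ⊤ / (N : ℂ)) atTop (𝓝 a))
  (h1 : Tendsto (fun N => leSum (f N) (ker pairing) / (N : ℂ) ^ 2) atTop (𝓝 0))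
  (h2 : (fun N => leSum (f N) (Setoid.comap shift (ker pairing)) / (N : ℂ)) =O[atTop]
    fun _ => (1 : ℝ))
include h0 h1 h2

theorem tendsto_kerSum_pairing {ρ : Setoid (Fin 4)} (hρ : ρ ≠ ⊤) :
    Tendsto (fun N => kerSum (f N) (ker pairing) *
      kerSum (f N) (Setoid.comap shift (ker pairing)) /
        kerSum (fun _ : Fin 4 → Fin N => 1) ρ / (N : ℂ)) atTop (𝓝 0) := by
  have key : ∀ p : Fin 4 → Fin 2, p 0 ≠ p 2 ∨ p 1 ≠ p 3 → ∀ N,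
      kerSum (f N) (ker p) = leSum (f N) (ker p) - kerSum (f N) ⊤ := by
    intro p hp N
    have h3 : univ.filter (ker p < ·) = {⊤} := by
      ext π
      simp only [mem_filter, mem_univ, true_and, mem_singleton]
      refine ⟨eq_top_of_ker_lt, ?_⟩
      rintro rfl
      refine lt_top_iff_ne_top.2 fun h4 => ?_
      have h5 := Setoid.eq_top_iff.1 h4
      exact hp.elim (fun h => h (h5 _ _)) fun h => h (h5 _ _)
    rw [leSum_eq, h3, Finset.sum_singleton, add_sub_cancel_right]
  have h3 : (fun N => kerSum (f N) (Setoid.comap shift (ker pairing)) / (N : ℂ)) =O[atTop]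
      fun _ => (1 : ℝ) := by
    refine (h2.sub (h0.isBigO_one ℝ)).congr_left fun N => ?_
    have h4 := key (pairing ∘ shift) (Or.inl (by decide)) N
    rw [← sub_div]
    exact congrArg (· / (N : ℂ)) h4.symm
  have h4 : Tendsto (fun N : ℕ => kerSum (f N) (ker pairing) / (N : ℂ) ^ 2) atTop (𝓝 0) := by
    have h5 := h1.sub (h0.mul (tendsto_inv_atTop_nhds_zero_nat (𝕜 := ℂ)))
    rw [mul_zero, sub_zero] at h5
    refine h5.congr fun N => ?_
    rw [key pairing (Or.inl (by decide))]
    ring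
  have h5 := (isBigO_inv_kerSum_one ρ (two_le_card hρ))
  have h6 : (fun N : ℕ => (N : ℂ) ^ 2 * (kerSum (fun _ : Fin 4 → Fin N => 1) ρ)⁻¹) =O[atTop]
      fun _ => (1 : ℝ) := by
    have h7 : (fun N : ℕ => (N : ℂ) ^ 2) =O[atTop] fun N : ℕ => (N : ℝ) ^ 2 :=
      IsBigO.of_bound 1 (Eventually.of_forall fun N => by simp)
    refine (h7.mul h5).trans (IsBigO.of_bound 1 ?_)
    filter_upwards [eventually_ge_atTop 1] with N hN
    rw [mul_inv_cancel₀ (by positivity)]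
    simp
  have h7 := (((isLittleO_one_iff ℝ).2 h4).mul_isBigO h3).mul_isBigO h6
  simp only [mul_one] at h7
  refine ((isLittleO_one_iff ℝ).1 h7).congr' ?_
  filter_upwards [eventually_ge_atTop 1] with N hN
  have : (N : ℂ) ≠ 0 := by exact_mod_cast (by omega : N ≠ 0)
  field_simp

include h hv in
theorem tendsto_sum_kerSum :
    Tendsto (fun N => (∑ ρ, kerSum (f N) ρ * kerSum (fun c => f N (c ∘ shift)) ρ /
      kerSum (fun _ : Fin 4 → Fin N => 1) ρ) / (N : ℂ)) atTop (𝓝 (a ^ 2)) := by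
  have key : ∀ ρ : Setoid (Fin 4), Tendsto (fun N => kerSum (f N) ρ * kerSum (f N) (ρ.comap shift) /
      kerSum (fun _ : Fin 4 → Fin N => 1) ρ / (N : ℂ)) atTop (𝓝 (if ρ = ⊤ then a ^ 2 else 0)) := by
    intro ρ
    by_cases hρ : ρ = ⊤
    · subst hρ
      rw [if_pos rfl, sq]
      refine (h0.mul h0).congr fun N => ?_
      have e1 : Setoid.comap shift (⊤ : Setoid (Fin 4)) = ⊤ := rfl
      have e2 : kerSum (fun _ : Fin 4 → Fin N => 1) ⊤ = N := by
        rw [kerSum, sum_boole]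
        congr 1
        refine (Finset.card_bij (s := univ) (fun i _ => fun _ => i) (fun i _ => ?_)
          (fun i _ j _ hij => congrFun hij 0) fun c hc => ?_).symm.trans (Finset.card_fin N)
        · simp [Setoid.eq_top_iff, Setoid.ker_def]
        · exact ⟨c 0, mem_univ _, funext fun x =>
            Setoid.eq_top_iff.1 (mem_filter.1 hc).2 0 x⟩
      rw [e1, e2]
      ring
    rw [if_neg hρ]
    by_cases h3 : ρ = ker pairing
    · rw [h3] at hρ ⊢
      exact tendsto_kerSum_pairing h0 h1 h2 hρ
    by_cases h4 : ρ.comap shift = ker pairing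
    · have h5 : ρ = Setoid.comap shift (ker pairing) := by
        rw [← h4]
        ext x y
        have e : ∀ z : Fin 4, shift (shift (shift (shift z))) = z := by decide
        have h6 := Setoid.ext_iff.1 h4
        have h7 := Setoid.ext_iff.1 comap_shift_pairing
        simp only [Setoid.comap_rel] at h6 h7 ⊢
        rw [h6, ← h7, ← h6, e, e]
      refine (tendsto_kerSum_pairing h0 h1 h2 hρ).congr fun N => ?_
      rw [h4, ← h5, mul_comm (kerSum (f N) ρ)]
    · have h5 := ((isBigO_kerSum h ρ).mul (isBigO_kerSum h (ρ.comap shift))).mul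
        (isBigO_inv_kerSum_one ρ (edgeComps_add_le hρ h3 h4))
      have h6 : (fun N : ℕ => (N : ℂ)⁻¹) =O[atTop] fun N : ℕ => (N : ℝ)⁻¹ :=
        IsBigO.of_bound 1 (Eventually.of_forall fun N => by simp)
      refine ((h5.mul h6).trans_tendsto (hv.congr' ?_)).congr fun N => by simp only [div_eq_mul_inv]
      filter_upwards [eventually_ge_atTop 1] with N hN
      have : (N : ℝ) ≠ 0 := by positivity
      rw [pow_add]
      field_simp
  have h3 := tendsto_finsetSum univ fun ρ _ => key ρ
  simp only [sum_ite_eq', mem_univ, if_true] at h3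
  refine h3.congr fun N => ?_
  simp only [kerSum_comp_equiv, sum_div]

end Asymptotics

/-! ### Sums over two edges -/

section Edges

variable {N : ℕ}

theorem leSum_def {I : Type*} [Fintype I] [DecidableEq I] (f : (I → Fin N) → ℂ) (ρ : Setoid I) :
    leSum f ρ = ∑ c, if ρ ≤ ker c then f c else 0 := by
  unfold leSum
  congr!

/-- The squared norms of the row sums, of the column sums and of the entries. -/
def edgeNorm (X : Mat[N]) : ℝ :=
  ∑ i, ‖∑ j, X i j‖ ^ 2 + ∑ j, ‖∑ i, X i j‖ ^ 2 + ∑ i, ∑ j, ‖X i j‖ ^ 2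

theorem edgeNorm_transpose (X : Mat[N]) : edgeNorm Xᵀ = edgeNorm X := by
  simp only [edgeNorm, Matrix.transpose_apply]
  rw [sum_comm (f := fun i j => ‖X j i‖ ^ 2)]
  ring

theorem sum_normSq_le_edgeNorm (p : Prop) (X : Mat[N]) :
    ∑ i, ‖∑ j, if p → i = j then X i j else 0‖ ^ 2 ≤ edgeNorm X := by
  have h0 : ∀ f : Fin N → ℂ, 0 ≤ ∑ i, ‖f i‖ ^ 2 := fun f => by positivity
  have h1 := h0 fun i => ∑ j, X i j
  have h2 := h0 fun j => ∑ i, X i j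
  have h3 := sum_nonneg fun i (_ : i ∈ univ) => h0 (X i)
  have h4 := sum_diag_le (fun i j => X i j)
  unfold edgeNorm
  by_cases hp : p
  · simp only [hp, true_imp_iff, sum_ite_eq, mem_univ, if_true]
    linarith
  · simp only [hp, false_imp_iff, if_true]
    linarith

theorem norm_sum_mul_le {ι : Type*} (s : Finset ι) (α β : ι → ℂ) :
    ‖∑ i ∈ s, α i * β i‖ ≤ (∑ i ∈ s, ‖α i‖ ^ 2 + ∑ i ∈ s, ‖β i‖ ^ 2) / 2 := by
  rw [← sum_add_distrib, sum_div]
  refine norm_sum_le_of_le s fun i _ => ?_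
  rw [norm_mul]
  nlinarith [sq_nonneg (‖α i‖ - ‖β i‖)]

theorem normSq_sum_le (α : Fin N → ℂ) : ‖∑ i, α i‖ ^ 2 ≤ N * ∑ i, ‖α i‖ ^ 2 := by
  refine (pow_le_pow_left₀ (norm_nonneg _) (norm_sum_le _ _) 2).trans ?_
  simpa using sq_sum_le_card_mul_sum_sq (s := univ) (f := fun i => ‖α i‖)

theorem norm_shared_le {ρ : Setoid (Fin 4)} (x x' y y' : Fin 4)
    (hx : ∀ z, z = x ∨ z = x' ∨ z = y ∨ z = y') (hn : [x, x', y, y'].Nodup) (hρ : ρ x y)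
    (X Z : Mat[N]) :
    ‖leSum (fun c : Fin 4 → Fin N => X (c x) (c x') * Z (c y) (c y')) ρ‖ ≤ edgeNorm X + edgeNorm Z := by
  have h1 : leSum (fun c : Fin 4 → Fin N => X (c x) (c x') * Z (c y) (c y')) ρ =
      ∑ t : Fin N × Fin N × Fin N, if (ρ x x' → t.1 = t.2.1) ∧ (ρ y y' → t.1 = t.2.2) ∧
        (ρ x' y' → t.2.1 = t.2.2) then X t.1 t.2.1 * Z t.1 t.2.2 else 0 := by
    rw [leSum_def, ← sum_filter, ← sum_filter]
    simp only [List.nodup_cons, List.mem_cons, List.not_mem_nil, not_or, or_false] at hn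
    refine Finset.sum_nbij' (fun c => (c x, c x', c y'))
      (fun t z => if z = x ∨ z = y then t.1 else if z = x' then t.2.1 else t.2.2) ?_ ?_ ?_ ?_ ?_
    · intro c hc
      have hc := (mem_filter.1 hc).2
      have e : c x = c y := hc hρ
      simp only [mem_filter, mem_univ, true_and]
      exact ⟨fun h => hc h, fun h => e.trans (hc h), fun h => hc h⟩
    · intro t ht
      have ht := (mem_filter.1 ht).2
      refine mem_filter.2 ⟨mem_univ _, fun a b hab => ?_⟩
      rw [Setoid.ker_def]
      have s1 := fun {u v} => @Setoid.symm' _ ρ u v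
      have s2 := fun {u v w} => @Setoid.trans' _ ρ u v w
      rcases hx a with rfl | rfl | rfl | rfl <;> rcases hx b with rfl | rfl | rfl | rfl <;> grind
    · intro c hc
      have hc := (mem_filter.1 hc).2
      have e : c x = c y := hc hρ
      funext z
      rcases hx z with rfl | rfl | rfl | rfl <;> grind
    · rintro ⟨i, j, k⟩ _
      simp only [Prod.mk.injEq]
      grind
    · intro c hc
      have hc := (mem_filter.1 hc).2
      have e : c x = c y := hc hρ
      simp only [e]
  rw [h1]
  simp only [sum_prod_type]
  have hX : 0 ≤ edgeNorm X := by unfold edgeNorm; positivity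
  have hZ : 0 ≤ edgeNorm Z := by unfold edgeNorm; positivity
  by_cases hr : ρ x' y' ∧ ¬ ρ x x'
  · have hy : ¬ ρ y y' := fun h => hr.2 (ρ.trans' hρ (ρ.trans' h (ρ.symm' hr.1)))
    simp only [hr, hy, true_imp_iff, false_imp_iff, true_and, sum_ite_eq,
      mem_univ, if_true, ← sum_prod_type']
    refine (norm_sum_mul_le _ _ _).trans ?_
    rw [sum_prod_type, sum_prod_type]
    have h3 : ∀ Y : Mat[N], ∑ i, ∑ j, ‖Y i j‖ ^ 2 ≤ edgeNorm Y := fun Y => by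
      unfold edgeNorm
      have : 0 ≤ ∑ i, ‖∑ j, Y i j‖ ^ 2 + ∑ j, ‖∑ i, Y i j‖ ^ 2 := by positivity
      linarith
    linarith [h3 X, h3 Z]
  · have h2 : ∀ i j k, (if (ρ x x' → i = j) ∧ (ρ y y' → i = k) ∧ (ρ x' y' → j = k) then
        X i j * Z i k else 0) = (if ρ x x' → i = j then X i j else 0) *
          (if ρ y y' → i = k then Z i k else 0) := by
      intro i j k
      have s2 : ρ x' y' → ρ x x' → ρ y y' := fun h h' => ρ.trans' (ρ.symm' hρ) (ρ.trans' h' h)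
      rw [ite_zero_mul_ite_zero]
      congr 1
      grind
    simp only [h2, ← sum_mul_sum]
    refine (norm_sum_mul_le _ _ _).trans ?_
    linarith [sum_normSq_le_edgeNorm (ρ x x') X, sum_normSq_le_edgeNorm (ρ y y') Z]

theorem norm_leSum_le (ρ : Setoid (Fin 4)) (X Z : Mat[N]) :
    N * ‖leSum (fun c : Fin 4 → Fin N => X (c 0) (c 1) * Z (c 2) (c 3)) ρ‖ ≤
      (edgeNorm X + edgeNorm Z) * (N : ℝ) ^ edgeComps ρ := by
  unfold edgeComps
  split_ifs with hρ
  · have h1 : leSum (fun c : Fin 4 → Fin N => X (c 0) (c 1) * Z (c 2) (c 3)) ρ =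
        (∑ i, ∑ j, if ρ 0 1 → i = j then X i j else 0) *
          ∑ k, ∑ l, if ρ 2 3 → k = l then Z k l else 0 := by
      have h2 : ∀ a b, ρ a b → a = b ∨ (a = 0 ∧ b = 1) ∨ (a = 1 ∧ b = 0) ∨ (a = 2 ∧ b = 3) ∨
          (a = 3 ∧ b = 2) := by
        intro a b hab
        have h3 : pairing a = pairing b := hρ hab
        clear hab
        revert a b
        decide
      simp only [← sum_prod_type', Fintype.sum_mul_sum]
      rw [leSum_def]
      refine sum_equiv ⟨fun c => ((c 0, c 1), (c 2, c 3)),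
        fun t => ![t.1.1, t.1.2, t.2.1, t.2.2], fun c => ?_, fun t => rfl⟩ _ _ fun c => ?_
      · funext z
        fin_cases z <;> rfl
      · rw [ite_zero_mul_ite_zero]
        congr 1
        refine propext ⟨fun h => ⟨fun h' => h h', fun h' => h h'⟩, fun h a b hab => ?_⟩
        have s1 := fun {u v} => @Setoid.symm' _ ρ u v
        rw [Setoid.ker_def]
        rcases h2 a b hab with rfl | ⟨rfl, rfl⟩ | ⟨rfl, rfl⟩ | ⟨rfl, rfl⟩ | ⟨rfl, rfl⟩
        exacts [rfl, h.1 hab, (h.1 (s1 hab)).symm, h.2 hab, (h.2 (s1 hab)).symm]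
    have h2 := normSq_sum_le fun i => ∑ j, if ρ 0 1 → i = j then X i j else 0
    have h3 := normSq_sum_le fun i => ∑ j, if ρ 2 3 → i = j then Z i j else 0
    have h4 := mul_le_mul_of_nonneg_left (sum_normSq_le_edgeNorm (ρ 0 1) X) (Nat.cast_nonneg (α := ℝ) N)
    have h5 := mul_le_mul_of_nonneg_left (sum_normSq_le_edgeNorm (ρ 2 3) Z) (Nat.cast_nonneg (α := ℝ) N)
    have h6 : ‖leSum (fun c : Fin 4 → Fin N => X (c 0) (c 1) * Z (c 2) (c 3)) ρ‖ ≤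
        N * (edgeNorm X + edgeNorm Z) := by
      rw [h1, norm_mul]
      nlinarith [two_mul_le_add_sq ‖∑ i, ∑ j, if ρ 0 1 → i = j then X i j else 0‖
        ‖∑ k, ∑ l, if ρ 2 3 → k = l then Z k l else 0‖]
    nlinarith [mul_le_mul_of_nonneg_left h6 (Nat.cast_nonneg (α := ℝ) N)]
  · rw [pow_one, mul_comm]
    refine mul_le_mul_of_nonneg_right ?_ (Nat.cast_nonneg N)
    have h1 : ρ 0 2 ∨ ρ 0 3 ∨ ρ 1 2 ∨ ρ 1 3 := by
      by_contra! h1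
      refine hρ fun a b hab => ?_
      have s1 := fun {u v} => @Setoid.symm' _ ρ u v
      fin_cases a <;> fin_cases b <;> first | rfl | exact absurd hab (by grind)
    rcases h1 with h1 | h1 | h1 | h1
    · exact norm_shared_le 0 1 2 3 (by decide) (by decide) h1 X Z
    · rw [← edgeNorm_transpose Z]
      exact norm_shared_le 0 1 3 2 (by decide) (by decide) h1 X Zᵀ
    · rw [← edgeNorm_transpose X]
      exact norm_shared_le 1 0 2 3 (by decide) (by decide) h1 Xᵀ Z
    · rw [← edgeNorm_transpose X, ← edgeNorm_transpose Z]
      exact norm_shared_le 1 0 3 2 (by decide) (by decide) h1 Xᵀ Zᵀ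

end Edges

/-! ### Uniform permutation matrices -/

section

variable {Ω : Type*} [MeasurableSpace Ω] {P : Measure Ω} [IsProbabilityMeasure P] {N : ℕ}
  {A A' U : Ω → Mat[N]}

instance {m n : Type*} [Countable m] [Countable n] : MeasurableSingletonClass (Matrix m n ℂ) :=
  inferInstanceAs (MeasurableSingletonClass (m → n → ℂ))

theorem permMatrix_injective : Injective fun s : Perm (Fin N) => s.permMatrix ℂ := by
  intro s t h
  refine Equiv.ext fun i => ?_
  have h1 := DFunLike.congr_fun (PEquiv.toMatrix_injective h) i
  exact Option.some.inj h1

omit [IsProbabilityMeasure P] in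
theorem IsUniformPermMatrix.nullMeasurableSet (hU : IsUniformPermMatrix P U)
    (s : Perm (Fin N)) : NullMeasurableSet {ω | U ω = s.permMatrix ℂ} P :=
  hU.1.nullMeasurableSet_preimage (measurableSet_singleton (s.permMatrix ℂ))

theorem IsUniformPermMatrix.isRandomPermMatrix (hU : IsUniformPermMatrix P U) :
    IsRandomPermMatrix P U := by
  refine ⟨hU.1, ?_⟩
  have h1 : P (⋃ s : Perm (Fin N), {ω | U ω = s.permMatrix ℂ}) = 1 := by
    rw [measure_iUnion₀ (fun s t hst => (disjoint_left.2 fun ω h1 h2 =>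
      hst (permMatrix_injective (h1.symm.trans h2))).aedisjoint) hU.nullMeasurableSet]
    simp only [hU.2, tsum_fintype, sum_const, card_univ, Fintype.card_perm, card_fin, nsmul_eq_mul]
    exact ENNReal.mul_div_cancel (by exact_mod_cast N.factorial_ne_zero) (ENNReal.natCast_ne_top _)
  have h2 := (prob_compl_eq_zero_iff₀ (NullMeasurableSet.iUnion hU.nullMeasurableSet)).2 h1
  filter_upwards [compl_mem_ae_iff.2 h2] with ω hω
  simpa using hω

theorem integral_conj_uniform (hU : IsUniformPermMatrix P U) (hind : IndepFun U A' P)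
    {Ψ : Mat[N] → ℂ} (hΨ : Measurable Ψ) (hid : IdentDistrib A' A P P)
    (hi : ∀ s : Perm (Fin N), Integrable (fun ω => Ψ ((A ω).submatrix s s)) P) :
    ∫ ω, Ψ (U ω * A' ω * (U ω)ᴴ) ∂P =
      (∑ s : Perm (Fin N), ∫ ω, Ψ ((A ω).submatrix s s) ∂P) / (N.factorial : ℂ) := by
  have hΨs : ∀ s : Perm (Fin N), Measurable fun M : Mat[N] =>
      Ψ (M.submatrix s s) := fun s => hΨ.comp (measurable_pi_iff.2 fun i =>
    measurable_pi_iff.2 fun j => measurable_entry (s i) (s j))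
  let δ : Perm (Fin N) → Mat[N] → ℂ := fun s M => if M = s.permMatrix ℂ then 1 else 0
  have hδ : ∀ s, Measurable (δ s) := fun s =>
    Measurable.ite (measurableSet_singleton _) measurable_const measurable_const
  have hi' : ∀ s : Perm (Fin N), Integrable (fun ω => Ψ ((A' ω).submatrix s s)) P := fun s =>
    ((hid.comp (hΨs s)).integrable_iff).2 (hi s)
  have h1 : (fun ω => Ψ (U ω * A' ω * (U ω)ᴴ)) =ᵐ[P] fun ω =>
      ∑ s, δ s (U ω) * Ψ ((A' ω).submatrix s s) := by
    filter_upwards [hU.isRandomPermMatrix.2] with ω hω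
    obtain ⟨s, hs⟩ := hω
    rw [sum_eq_single s (fun t _ hts => ?_) (by simp)]
    · simp only [δ, hs, if_true, one_mul, permMatrix_mul_mul_conjTranspose]
    · simp only [δ, hs]
      rw [if_neg fun h => hts (permMatrix_injective h).symm, zero_mul]
  have h2 : ∀ s, ∫ ω, δ s (U ω) ∂P = 1 / (N.factorial : ℂ) := by
    intro s
    have h3 : (fun ω => δ s (U ω)) = {ω | U ω = s.permMatrix ℂ}.indicator fun _ => 1 := by
      funext ω
      simp [δ, Set.indicator_apply]
    rw [h3, integral_indicator₀ (hU.nullMeasurableSet s), setIntegral_const, Measure.real, hU.2]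
    simp
  rw [integral_congr_ae h1, integral_finsetSum, sum_div]
  · refine sum_congr rfl fun (s : Perm (Fin N)) _ => ?_
    have h3 := (hind.comp (hδ s) (hΨs s)).integral_fun_mul_eq_mul_integral
      ((hδ s).comp_aemeasurable hU.1).aestronglyMeasurable (hi' s).1
    refine h3.trans ?_
    rw [(hid.comp (hΨs s)).integral_eq]
    refine (congrArg (· * _) (h2 s)).trans ?_
    rw [one_div_mul_eq_div]
    rfl
  · intro s _
    refine (hi' s).bdd_mul (c := 1) ((hδ s).comp_aemeasurable hU.1).aestronglyMeasurable
      (ae_of_all _ fun ω => ?_)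
    simp only [δ]
    split_ifs <;> simp

/-- The mean of the products of two entries. -/
def entryMean (P : Measure Ω) (X Z : Ω → Mat[N]) (c : Fin 4 → Fin N) : ℂ :=
  ∫ ω, X ω (c 0) (c 1) * Z ω (c 2) (c 3) ∂P

theorem meanTrace_conj_uniform (hA : HasAllMoments P A) (hid : IdentDistrib A' A P P)
    (hU : IsUniformPermMatrix P U) (hind : iIndepFun ![A, A', U] P) (p q : StarPoly Unit) :
    meanTrace P (fun ω => (p.eval fun _ => A ω) *
      ((p.eval fun _ => U ω * A' ω * (U ω)ᴴ) * ((q.eval fun _ => A ω) *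
        q.eval fun _ => U ω * A' ω * (U ω)ᴴ))) =
      (∑ ρ, kerSum (entryMean P (fun ω => p.eval fun _ => A ω) fun ω => q.eval fun _ => A ω) ρ *
        kerSum (fun c => entryMean P (fun ω => p.eval fun _ => A ω) (fun ω => q.eval fun _ => A ω)
          (c ∘ shift)) ρ / kerSum (fun _ : Fin 4 → Fin N => 1) ρ) / (N : ℂ) := by
  set f := entryMean P (fun ω => p.eval fun _ => A ω) fun ω => q.eval fun _ => A ω with hf
  have hp := hA.eval p
  have hq := hA.eval q
  have hA' := hA.of_identDistrib hid
  have hU' := hU.isRandomPermMatrix.hasAllMoments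
  have hB : HasAllMoments P fun ω => U ω * A' ω * (U ω)ᴴ := (hU'.mul hA').mul hU'.conjTranspose
  have hpB := hB.eval p
  have hqB := hB.eval q
  have hAB := indepFun_conj_of_iIndepFun hA.aemeasurable hA'.aemeasurable hU.1 hind
  have hm : ∀ (i j k l : Fin N), Measurable fun M : Mat[N] =>
      p.eval (fun _ => M) i j * q.eval (fun _ => M) k l := fun i j k l =>
    ((measurable_entry i j).comp (measurable_eval p)).mul
      ((measurable_entry k l).comp (measurable_eval q))
  have h1 : ∀ c : Fin 4 → Fin N, ∫ ω, p.eval (fun _ => U ω * A' ω * (U ω)ᴴ) (c 1) (c 2) *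
      q.eval (fun _ => U ω * A' ω * (U ω)ᴴ) (c 3) (c 0) ∂P =
      (∑ s : Perm (Fin N), f ((s ∘ c) ∘ shift)) / (N.factorial : ℂ) := by
    intro c
    refine (integral_conj_uniform hU (hind.indepFun (i := 2) (j := 1) (by decide)) (hm _ _ _ _) hid
      fun s => ?_).trans ?_
    · simp only [eval_submatrix, submatrix_apply]
      exact ((hp.entry _ _).mul (hq.entry _ _)).integrable
    · simp only [eval_submatrix, submatrix_apply]
      rfl
  have h2 : ∀ c : Fin 4 → Fin N, ∫ ω, (p.eval (fun _ => A ω) (c 0) (c 1) *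
      q.eval (fun _ => A ω) (c 2) (c 3)) * (p.eval (fun _ => U ω * A' ω * (U ω)ᴴ) (c 1) (c 2) *
      q.eval (fun _ => U ω * A' ω * (U ω)ᴴ) (c 3) (c 0)) ∂P =
      (∑ s : Perm (Fin N), f c * f ((s ∘ c) ∘ shift)) / (N.factorial : ℂ) := by
    intro c
    rw [← mul_sum, mul_div_assoc, ← h1]
    exact (hAB.comp (hm (c 0) (c 1) (c 2) (c 3)) (hm (c 1) (c 2) (c 3) (c 0))).integral_fun_mul_eq_mul_integral
      ((hp.entry _ _).mul (hq.entry _ _)).integrable.1 ((hpB.entry _ _).mul (hqB.entry _ _)).integrable.1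
  have h3 : ∀ X Y Z W : Mat[N], (X * (Y * (Z * W))).trace =
      ∑ c : Fin 4 → Fin N, (X (c 0) (c 1) * Z (c 2) (c 3)) * (Y (c 1) (c 2) * W (c 3) (c 0)) := by
    intro X Y Z W
    have h4 := trace_prod_map (fun i : Fin 4 => ![X, Y, Z, W] i) 0 [1, 2, 3]
    simp only [List.map_cons, List.map_nil, List.prod_cons, List.prod_nil, mul_one] at h4
    refine h4.trans (sum_congr rfl fun c _ => ?_)
    refine (Fin.prod_univ_four _).trans ?_
    change X (c 0) (c 1) * Y (c 1) (c 2) * Z (c 2) (c 3) * W (c 3) (c 0) = _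
    ring
  simp only [meanTrace, h3]
  rw [integral_div, integral_finsetSum]
  · simp only [h2]
    have h4 : ∑ s : Perm (Fin N), ∑ c, f c * f ((s ∘ c) ∘ shift) = _ :=
      Eq.trans (by congr!) (sum_perm_eq f fun c => f (c ∘ shift))
    rw [← sum_div, sum_comm, h4, mul_div_cancel_left₀ _ (Nat.cast_ne_zero.2 N.factorial_ne_zero)]
  · exact fun c _ => (((hp.entry _ _).mul (hq.entry _ _)).mul
      ((hpB.entry _ _).mul (hqB.entry _ _))).integrable

end

/-! ### Bounds for polynomials -/

theorem exists_eval_eq_conjTranspose (p : StarPoly Unit) : ∃ p' : StarPoly Unit,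
    ∀ (N : ℕ) (M : Mat[N]), p'.eval (fun _ => M) = (p.eval fun _ => M)ᴴ := by
  induction p using FreeAlgebra.induction with
  | grade0 c =>
    refine ⟨algebraMap ℂ _ (conj c), fun N M => ?_⟩
    simp only [StarPoly.eval, AlgHom.commutes]
    rw [Algebra.algebraMap_eq_smul_one, Algebra.algebraMap_eq_smul_one, Matrix.conjTranspose_smul,
      Matrix.conjTranspose_one]
    rfl
  | grade1 x =>
    refine ⟨FreeAlgebra.ι ℂ (x.1, !x.2), fun N M => ?_⟩
    rw [eval_generator, eval_generator]
    obtain ⟨u, b⟩ := x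
    cases b <;> simp [starIf]
  | mul a b ha hb =>
    obtain ⟨a', ha⟩ := ha
    obtain ⟨b', hb⟩ := hb
    refine ⟨b' * a', fun N M => ?_⟩
    have h1 := ha N M
    have h2 := hb N M
    simp only [StarPoly.eval, map_mul, conjTranspose_mul] at h1 h2 ⊢
    rw [h1, h2]
  | add a b ha hb =>
    obtain ⟨a', ha⟩ := ha
    obtain ⟨b', hb⟩ := hb
    refine ⟨a' + b', fun N M => ?_⟩
    have h1 := ha N M
    have h2 := hb N M
    simp only [StarPoly.eval, map_add, Matrix.conjTranspose_add] at h1 h2 ⊢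
    rw [h1, h2]

section

variable {N : ℕ}

theorem sum_rowSum_sq_le (X : Mat[N]) :
    (∑ i, ‖∑ j, X i j‖ ^ 2) ^ 2 ≤ N * ∑ i, ‖∑ j, (Xᴴ * X) i j‖ ^ 2 := by
  have h1 : ((∑ i, ‖∑ j, X i j‖ ^ 2 : ℝ) : ℂ) = ∑ i, ∑ j, (Xᴴ * X) i j := by
    push_cast
    simp only [mul_apply, conjTranspose_apply, ← Complex.conj_mul', map_sum, sum_mul_sum]
    rw [sum_comm]
    refine sum_congr rfl fun a _ => ?_
    rw [sum_comm]
    rfl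
  refine le_trans (le_of_eq ?_) (normSq_sum_le fun i => ∑ j, (Xᴴ * X) i j)
  rw [← h1, norm_real, Real.norm_eq_abs, sq_abs]

theorem sum_rowSum_le (X : Mat[N]) :
    ∑ i, ‖∑ j, X i j‖ ^ 2 ≤ N * (X * Xᴴ).trace.re := by
  rw [trace_mul_conjTranspose_self, ofReal_re, mul_sum]
  exact sum_le_sum fun i _ => normSq_sum_le _

theorem sum_rowSum_le_sqrt (hN : 0 < N) (X : Mat[N]) :
    ∑ i, ‖∑ j, X i j‖ ^ 2 ≤ N * √√N * (1 + ((Xᴴ * X) ^ 4).trace.re / N) := by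
  have hN' : (0 : ℝ) < N := by exact_mod_cast hN
  have hr0 : 0 ≤ ∑ i, ‖∑ j, X i j‖ ^ 2 := by positivity
  have h1 := sum_rowSum_sq_le X
  obtain ⟨H, hH⟩ : ∃ H, H = Xᴴ * X := ⟨_, rfl⟩
  rw [← hH] at h1 ⊢
  have hH' : Hᴴ = H := by rw [hH, conjTranspose_mul, conjTranspose_conjTranspose]
  have h2 := sum_rowSum_sq_le H
  have h3 := sum_rowSum_le (H * H)
  have e : H * H * (H * H)ᴴ = H ^ 4 := by
    rw [conjTranspose_mul, hH', pow_succ, pow_three, mul_assoc, mul_assoc, mul_assoc]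
  rw [e] at h3
  rw [hH'] at h2
  have hr0' : 0 ≤ ∑ i, ‖∑ j, H i j‖ ^ 2 := by positivity
  have h0 : 0 ≤ (H ^ 4).trace.re := by
    rw [← e, trace_mul_conjTranspose_self, ofReal_re]
    exact sum_nonneg fun _ _ => sum_nonneg fun _ _ => sq_nonneg _
  generalize (H ^ 4).trace.re = T at h0 h3 ⊢
  generalize ∑ i, ‖∑ j, H i j‖ ^ 2 = r' at h1 h2 hr0'
  generalize ∑ i, ‖∑ j, (H * H) i j‖ ^ 2 = r'' at h2 h3
  generalize ∑ i, ‖∑ j, X i j‖ ^ 2 = r at h1 hr0 ⊢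
  have h4 : r ^ 4 ≤ N ^ 4 * T := by
    calc r ^ 4 = (r ^ 2) ^ 2 := by ring
      _ ≤ (N * r') ^ 2 := pow_le_pow_left₀ (sq_nonneg r) h1 2
      _ = N ^ 2 * r' ^ 2 := by ring
      _ ≤ N ^ 2 * (N * (N * T)) := by gcongr; exact h2.trans (by gcongr)
      _ = N ^ 4 * T := by ring
  have hv : √√(N : ℝ) ^ 4 = N := by
    rw [show 4 = 2 * 2 from rfl, pow_mul, Real.sq_sqrt (Real.sqrt_nonneg _), Real.sq_sqrt hN'.le]
  have hτ0 : 0 ≤ T / N := by positivity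
  refine le_of_pow_le_pow_left₀ (n := 4) (by norm_num) (by positivity) (h4.trans ?_)
  rw [mul_pow, mul_pow, hv, mul_assoc]
  refine mul_le_mul_of_nonneg_left ?_ (by positivity)
  have h5 : T = N * (T / N) := by field_simp
  nth_rewrite 1 [h5]
  refine mul_le_mul_of_nonneg_left ?_ hN'.le
  have h6 := one_add_mul_le_pow (by linarith : -2 ≤ T / N) 4
  push_cast at h6
  linarith

theorem edgeNorm_le (hN : 0 < N) (X : Mat[N]) :
    edgeNorm X ≤ N * √√N * (2 + (((Xᴴ * X) ^ 4 + (X * Xᴴ) ^ 4 + X * Xᴴ).trace / N).re) := by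
  have hN' : (0 : ℝ) < N := by exact_mod_cast hN
  have h1 := sum_rowSum_le_sqrt hN X
  have h2 := sum_rowSum_le_sqrt hN Xᴴ
  have h3 := congrArg Complex.re (trace_mul_conjTranspose_self X)
  rw [ofReal_re] at h3
  have h4 : ∀ j, ‖∑ i, Xᴴ j i‖ = ‖∑ i, X i j‖ := by
    intro j
    rw [← norm_star (∑ i, X i j), star_sum]
    rfl
  simp only [h4, conjTranspose_conjTranspose] at h2
  have hv : 1 ≤ √√(N : ℝ) := by
    rw [Real.one_le_sqrt, Real.one_le_sqrt]
    exact_mod_cast hN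
  have h5 : 0 ≤ (X * Xᴴ).trace.re := by
    rw [h3]
    exact sum_nonneg fun _ _ => sum_nonneg fun _ _ => sq_nonneg _
  have h6 : (X * Xᴴ).trace.re ≤ N * √√N * ((X * Xᴴ).trace.re / N) := by
    have : (N : ℝ) * √√N * ((X * Xᴴ).trace.re / N) = √√N * (X * Xᴴ).trace.re := by field_simp
    rw [this]
    exact le_mul_of_one_le_left h5 hv
  rw [trace_add, trace_add, ← ofReal_natCast, Complex.div_ofReal_re,
    add_re, add_re, add_div, add_div]
  unfold edgeNorm
  rw [← h3]
  linarith

end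

/-- The norm of a polynomial in a matrix is controlled by the trace of another polynomial. -/
theorem exists_edgeNorm_eval_le (p : StarPoly Unit) : ∃ s : StarPoly Unit,
    ∀ (N : ℕ), 0 < N → ∀ (M : Mat[N]), edgeNorm (p.eval fun _ => M) ≤
      N * √√N * (2 + ((s.eval fun _ => M).trace / N).re) := by
  obtain ⟨p', hp'⟩ := exists_eval_eq_conjTranspose p
  refine ⟨(p' * p) ^ 4 + (p * p') ^ 4 + p * p', fun N hN M => (edgeNorm_le hN _).trans (le_of_eq ?_)⟩
  rw [← hp']
  simp only [StarPoly.eval, map_add, map_pow, map_mul]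

/-! ### Decorrelation of traces of polynomials -/

theorem exists_trace_eq_wordPoly (w : List (Unit × Bool)) : ∃ T : StarGraph Unit, T.Connected ∧
    ∀ (N : ℕ) (M : Mat[N]), T.trace (fun _ => M) = ((wordPoly w).eval fun _ => M).trace := by
  cases w with
  | nil =>
    refine ⟨⟨Unit, Empty, Empty.elim, Empty.elim, Empty.elim, Empty.elim⟩,
      ⟨⟨()⟩, fun _ _ => EqvGen.refl _⟩, fun N M => ?_⟩
    simp [StarGraph.trace, wordPoly, StarPoly.eval]
  | cons a l =>
    refine ⟨⟨Fin (l.length + 1), Fin (l.length + 1), id, (· + 1), fun _ => (),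
      fun t => ((a :: l)[t]).2⟩, ⟨⟨0⟩, fun v w => ?_⟩, fun N M => ?_⟩
    · have key : ∀ a : Fin (l.length + 1), EqvGen
          (fun a b => ∃ e : Fin (l.length + 1), e = a ∧ e + 1 = b) 0 a := by
        intro a
        induction a using Fin.induction with
        | zero => exact EqvGen.refl _
        | succ a ih => exact ih.trans _ _ _ (EqvGen.rel _ _ ⟨_, rfl, Fin.coeSucc_eq_succ⟩)
      exact (key v).symm.trans _ _ _ (key w)
    · rw [wordPoly_eval, wordMat]
      refine Eq.trans ?_ (trace_prod_map _ a l).symm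
      unfold StarGraph.trace
      congr!

section

variable
  [∀ N, IsProbabilityMeasure (P N)] {A : MatrixSeq Ω}

/-- The covariance of the normalized traces of two polynomials. -/
def traceCov (P : ∀ N, Measure (Ω N)) (A : MatrixSeq Ω) (p q : StarPoly Unit) (N : ℕ) : ℂ :=
  ∫ ω, ((p.eval fun _ => A N ω).trace / N) * ((q.eval fun _ => A N ω).trace / N) ∂P N -
    meanTrace (P N) (fun ω => p.eval fun _ => A N ω) * meanTrace (P N) fun ω => q.eval fun _ => A N ω

omit [∀ N, IsProbabilityMeasure (P N)] in
theorem traceCov_comm (p q : StarPoly Unit) (N : ℕ) : traceCov P A p q N = traceCov P A q p N := by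
  simp only [traceCov, mul_comm]

theorem tendsto_traceCov_of_words (hA : Moments P A) (q : StarPoly Unit)
    (h : ∀ w, Tendsto (traceCov P A (wordPoly w) q) atTop (𝓝 0)) (p : StarPoly Unit) :
    Tendsto (traceCov P A p q) atTop (𝓝 0) := by
  have i1 : ∀ (p : StarPoly Unit) N, AllMom (P N) fun ω => (p.eval fun _ => A N ω).trace / N :=
    fun p N => ((hA N).eval p).trace.div_const _
  have hp : p ∈ Submodule.span ℂ (Set.range (wordPoly (J := Unit))) := by
    rw [span_wordPoly]
    trivial
  induction hp using Submodule.span_induction with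
  | mem x hx =>
    obtain ⟨w, rfl⟩ := hx
    exact h w
  | zero => exact tendsto_const_nhds.congr fun N => by simp [traceCov, meanTrace, StarPoly.eval]
  | add x y _ _ hx hy =>
    refine (by simpa using hx.add hy :
      Tendsto (fun N => traceCov P A x q N + traceCov P A y q N) atTop (𝓝 0)).congr fun N => ?_
    have h1 := integral_add ((i1 x N).mul (i1 q N)).integrable ((i1 y N).mul (i1 q N)).integrable
    have h2 := meanTrace_add ((hA N).eval x)
      ((hA N).eval y)
    have h3 : ∀ M : Mat[N], StarPoly.eval (x + y) (fun _ => M) =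
      x.eval (fun _ => M) + y.eval fun _ => M := fun M => map_add _ _ _
    simp only [traceCov, h3, trace_add, add_div, add_mul] at h1 h2 ⊢
    rw [h1, h2]
    ring
  | smul c x _ hx =>
    refine (by simpa using hx.const_mul c :
      Tendsto (fun N => c * traceCov P A x q N) atTop (𝓝 0)).congr fun N => ?_
    have h3 : ∀ M : Mat[N], StarPoly.eval (c • x) (fun _ => M) =
      c • x.eval (fun _ => M) := fun M => map_smul _ _ _
    simp only [traceCov, h3, meanTrace_smul, trace_smul, smul_eq_mul, mul_div_assoc, mul_assoc,
      integral_const_mul]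
    ring

theorem Decorrelation.tendsto_traceCov (hA : Moments P A)
    (h : Decorrelation P A) (p q : StarPoly Unit) : Tendsto (traceCov P A p q) atTop (𝓝 0) := by
  refine tendsto_traceCov_of_words hA q (fun w => ?_) p
  simp only [funext (traceCov_comm (P := P) (A := A) (wordPoly w) q)]
  refine tendsto_traceCov_of_words hA _ (fun w' => ?_) q
  obtain ⟨T, hT, hT'⟩ := exists_trace_eq_wordPoly w
  obtain ⟨S, hS, hS'⟩ := exists_trace_eq_wordPoly w'
  refine (h [S, T] (by simp [hT, hS])).congr fun N => ?_
  simp only [List.map_cons, List.map_nil, List.prod_cons, List.prod_nil, mul_one, hT', hS']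
  rfl

end

/-! ### Independent copies conjugated by uniform permutation matrices -/

theorem leSum_ker {I J : Type*} [Fintype I] [Fintype J] [DecidableEq J] {N : ℕ} {π : I → J}
    (hπ : π.Surjective) (f : (I → Fin N) → ℂ) :
    leSum f (ker π) = ∑ d : J → Fin N, f (d ∘ π) := by
  rw [leSum_def, ← sum_filter]
  refine Finset.sum_bij' (fun c _ => c ∘ Function.surjInv hπ) (fun d _ => d ∘ π)
    (fun _ _ => mem_univ _) (fun d _ => ?_) (fun c hc => ?_) (fun d _ => ?_) fun c hc => ?_
  · exact mem_filter.2 ⟨mem_univ _, fun a b h => congrArg d h⟩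
  · funext x
    exact (mem_filter.1 hc).2 (Function.surjInv_eq hπ _)
  · funext x
    exact congrArg d (Function.surjInv_eq hπ x)
  · congr 1
    funext x
    exact ((mem_filter.1 hc).2 (Function.surjInv_eq hπ _)).symm

section

variable {N : ℕ} (X Z : Mat[N])

theorem leSum_top_mul :
    leSum (fun c : Fin 4 → Fin N => X (c 0) (c 1) * Z (c 2) (c 3)) ⊤ = (X ⊙ Z).trace := by
  have h : (⊤ : Setoid (Fin 4)) = ker fun _ => () := by
    ext
    simp [Setoid.ker_def]
  rw [h, leSum_ker (fun _ => ⟨0, rfl⟩)]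
  exact sum_equiv (Equiv.funUnique Unit (Fin N)) _ _ fun d => rfl

theorem leSum_pairing :
    leSum (fun c : Fin 4 → Fin N => X (c 0) (c 1) * Z (c 2) (c 3)) (ker pairing) =
      X.trace * Z.trace := by
  rw [leSum_ker (by decide), Matrix.trace, Matrix.trace, sum_mul_sum, ← sum_prod_type']
  exact sum_equiv (finTwoArrowEquiv (Fin N)) _ _ fun d => rfl

theorem leSum_shift_pairing :
    leSum (fun c : Fin 4 → Fin N => X (c 0) (c 1) * Z (c 2) (c 3))
      (Setoid.comap shift (ker pairing)) = (X * Z).trace := by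
  change leSum _ (ker (pairing ∘ shift)) = _
  rw [leSum_ker (by decide), Matrix.trace]
  simp only [diag_apply, mul_apply]
  rw [← sum_prod_type']
  exact sum_equiv (finTwoArrowEquiv (Fin N)) _ _ fun d => rfl

end

section

variable {Ω : Type*} [MeasurableSpace Ω] {P : Measure Ω} {N : ℕ}
  {X Z : Ω → Mat[N]}

theorem leSum_entryMean (hX : HasAllMoments P X) (hZ : HasAllMoments P Z) (ρ : Setoid (Fin 4)) :
    leSum (entryMean P X Z) ρ = ∫ ω, leSum (fun c => X ω (c 0) (c 1) * Z ω (c 2) (c 3)) ρ ∂P := by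
  unfold leSum
  rw [integral_finsetSum]
  · refine sum_congr rfl fun c _ => ?_
    split_ifs
    · rfl
    · simp
  · intro c _
    split_ifs
    · exact ((hX.entry _ _).mul (hZ.entry _ _)).integrable
    · exact integrable_zero _ _ _

theorem kerSum_top_entryMean (hX : HasAllMoments P X) (hZ : HasAllMoments P Z) :
    kerSum (entryMean P X Z) ⊤ = ∫ ω, (X ω ⊙ Z ω).trace ∂P := by
  have h := leSum_eq (entryMean P X Z) ⊤
  rw [sum_eq_zero (by simp), add_zero, leSum_entryMean hX hZ] at h
  simp only [← h, leSum_top_mul]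

end

section

variable
  [∀ N, IsProbabilityMeasure (P N)]

theorem not_asympStarFree_of_decorrelation (A A' U : MatrixSeq Ω)
    (hA : Moments P A) (hd : Decorrelation P A)
    (hκ : ∃ (p q : StarPoly Unit) (a : ℂ), HasKappa P (polySeq p A) (polySeq q A) a ∧ a ≠ 0)
    (hid : ∀ N, IdentDistrib (A' N) (A N) (P N) (P N))
    (hU : ∀ N, IsUniformPermMatrix (P N) (U N)) (hind : ∀ N, iIndepFun ![A N, A' N, U N] (P N)) :
    ¬ AsympStarFree P (two (single A) (single fun N ω => U N ω * A' N ω * (U N ω)ᴴ)) := by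
  intro hsf
  obtain ⟨p₀, q₀, a, ha, ha0⟩ := hκ
  obtain ⟨l, hl⟩ := hsf.exists_tendsto false p₀
  obtain ⟨m, hm⟩ := hsf.exists_tendsto false q₀
  have hhad := tendsto_meanTrace_hadamard (A := single A) (fun _ N => hA N) p₀ q₀ hl hm ha
  have hp := tendsto_meanTrace_centered (A := single A) (fun _ N => hA N) p₀ hl
  have hq := tendsto_meanTrace_centered (A := single A) (fun _ N => hA N) q₀ hm
  generalize p₀ - algebraMap ℂ _ l = p at hhad hp
  generalize q₀ - algebraMap ℂ _ m = q at hhad hq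
  have mp := fun N => (hA N).eval p
  have mq := fun N => (hA N).eval q
  have hconj := fun p N => meanTrace_eval_conj (hU N).isRandomPermMatrix (hid N) p
  have hfree := hsf.2 [⟨false, p⟩, ⟨true, p⟩, ⟨false, q⟩, ⟨true, q⟩] (by simp) (by simp) (by
    simp only [List.mem_cons, List.not_mem_nil, or_false, forall_eq_or_imp, forall_eq]
    exact ⟨hp, hp.congr fun N => (hconj p N).symm, hq, hq.congr fun N => (hconj q N).symm⟩)
  simp only [List.map_cons, List.map_nil, List.prod_cons, List.prod_nil, mul_one] at hfree
  replace hfree := hfree.congr fun N => meanTrace_conj_uniform (hA N) (hid N) (hU N) (hind N) p q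
  set f := fun N => entryMean (P N) (fun ω => p.eval fun _ => A N ω) fun ω => q.eval fun _ => A N ω
    with hf
  refine pow_ne_zero 2 ha0 (tendsto_nhds_unique (tendsto_sum_kerSum (f := f)
    (v := fun N => √√(N : ℝ)) ?_ (fun ρ => ?_) ?_ ?_ ?_) hfree)
  · have h1 : Tendsto (fun N : ℕ => (√(N : ℝ))⁻¹) atTop (𝓝 0) :=
      (Real.tendsto_sqrt_atTop.comp tendsto_natCast_atTop_atTop).inv_tendsto_atTop
    refine h1.congr fun N => ?_
    rw [Real.sq_sqrt (Real.sqrt_nonneg _), Real.sqrt_div_self', one_div]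
  · obtain ⟨s, hs⟩ := exists_edgeNorm_eval_le p
    obtain ⟨t, ht⟩ := exists_edgeNorm_eval_le q
    obtain ⟨u, hu⟩ := hsf.exists_tendsto false (s + t)
    have hb := ((Complex.continuous_re.tendsto u).comp hu).const_add 4
    refine Asymptotics.IsBigO.of_bound (4 + u.re + 1) ?_
    filter_upwards [hb.eventually_le_const (lt_add_one _), eventually_gt_atTop 0] with N hN hN0
    have hN' : (0 : ℝ) < N := by exact_mod_cast hN0
    have i1 := (((hA N).eval (s + t)).trace.div_const (N : ℂ)).integrable
    set c : ℝ := √√N * N ^ edgeComps ρ with hc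
    have hc0 : 0 ≤ c := by positivity
    rw [leSum_entryMean (mp N) (mq N), Real.norm_of_nonneg hc0]
    refine (norm_integral_le_of_norm_le (((integrable_const 4).add i1.re).const_mul c)
      (ae_of_all _ fun ω => ?_)).trans ?_
    · have h1 := norm_leSum_le ρ (p.eval fun _ => A N ω) (q.eval fun _ => A N ω)
      have h2 := mul_le_mul_of_nonneg_right (add_le_add (hs N hN0 (A N ω)) (ht N hN0 (A N ω)))
        (by positivity : (0 : ℝ) ≤ N ^ edgeComps ρ)
      have h3 : StarPoly.eval (s + t) (fun _ => A N ω) = s.eval (fun _ => A N ω) +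
        t.eval fun _ => A N ω := map_add _ _ _
      refine le_of_mul_le_mul_left (h1.trans (h2.trans (le_of_eq ?_))) hN'
      simp only [Pi.add_apply, h3, trace_add, add_div, hc, RCLike.re_eq_complex_re, add_re]
      ring
    · rw [integral_const_mul, mul_comm]
      refine mul_le_mul_of_nonneg_right (le_trans (le_of_eq ?_) hN) hc0
      have h4 := integral_add (integrable_const (4 : ℝ)) i1.re
      refine h4.trans ?_
      simp only [integral_const, probReal_univ, one_smul, RCLike.re_eq_complex_re]
      rw [← re_integral i1]
      rfl
  · refine hhad.congr fun N => ?_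
    rw [kerSum_top_entryMean (mp N) (mq N), ← integral_div]
    rfl
  · have h1 := (hd.tendsto_traceCov hA p q).add (hp.mul hq)
    simp only [mul_zero, add_zero] at h1
    refine h1.congr fun N => ?_
    rw [leSum_entryMean (mp N) (mq N), ← integral_div]
    simp only [leSum_pairing, pow_two, mul_div_mul_comm]
    exact sub_add_cancel _ _
  · obtain ⟨u, hu⟩ := hsf.exists_tendsto false (p * q)
    refine (hu.isBigO_one ℝ).congr_left fun N => ?_
    rw [leSum_entryMean (mp N) (mq N), ← integral_div]
    simp only [leSum_shift_pairing, StarPoly.eval, map_mul]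
    rfl

end

end Traffic

end

theorem mainTheorem3 {Ω : ℕ → Type*} [∀ N, MeasurableSpace (Ω N)] (P : ∀ N, Measure (Ω N))
    [∀ N, IsProbabilityMeasure (P N)] :
    -- 1. the criterion for two traffic-free pairs
    (∀ A B : Fin 2 → MatrixSeq Ω,
      (∀ k N, HasAllMoments (P N) (A k N)) → (∀ k N, HasAllMoments (P N) (B k N)) →
      AsympTrafficFree P (two A B) →
      ∀ a b : ℂ, HasKappa P (A 0) (A 1) a → HasKappa P (B 0) (B 1) b → a ≠ 0 → b ≠ 0 →
        ¬ AsympStarFree P (two A B)) ∧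
    -- 2. diagonal matrices
    (∀ A D : MatrixSeq Ω,
      (∀ N, HasAllMoments (P N) (A N)) → (∀ N, HasAllMoments (P N) (D N)) →
      (∀ N, ∀ᵐ ω ∂(P N), (D N ω).IsDiag) →
      AsympTrafficFree P (two (single A) (single D)) →
      (∃ (p q : StarPoly Unit) (a : ℂ), HasKappa P (polySeq p A) (polySeq q A) a ∧ a ≠ 0) →
      ∀ μ : Measure ℂ, HasLimitingEED P D μ → (∀ z, μ ≠ Measure.dirac z) →
        ¬ AsympStarFree P (two (single A) (single D))) ∧
    -- 3. independent permutation invariant copies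
    (∀ A A' U : MatrixSeq Ω,
      (∀ N, HasAllMoments (P N) (A N)) → Decorrelation P A →
      (∃ (p q : StarPoly Unit) (a : ℂ), HasKappa P (polySeq p A) (polySeq q A) a ∧ a ≠ 0) →
      (∀ N, IdentDistrib (A' N) (A N) (P N) (P N)) →
      (∀ N, IsUniformPermMatrix (P N) (U N)) →
      (∀ N, iIndepFun ![A N, A' N, U N] (P N)) →
        ¬ AsympStarFree P (two (single A) (single fun N ω => U N ω * A' N ω * (U N ω)ᴴ))) ∧
    -- 4. the formula in terms of the entries
    (∀ N : ℕ, 3 ≤ N → ∀ A : Ω N → Mat[N], HasAllMoments (P N) A →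
      (∀ᵐ ω ∂(P N), ∀ i, A ω i i = 0) →
      ∀ i j k : Ω N → Fin N,
      HasLaw (fun ω => (i ω, j ω, k ω))
        (uniformOn {t : Fin N × Fin N × Fin N | t.1 ≠ t.2.1 ∧ t.1 ≠ t.2.2 ∧ t.2.1 ≠ t.2.2})
        (P N) →
      IndepFun (fun ω => (i ω, j ω, k ω)) A (P N) →
        kappaN (P N) (fun ω => A ω * (A ω)ᴴ) (fun ω => A ω * (A ω)ᴴ) =
          ((((N : ℝ) ^ 2 - 3 * (N : ℝ) + 2) *
              cov[fun ω => ‖A ω (i ω) (j ω)‖ ^ 2, fun ω => ‖A ω (i ω) (k ω)‖ ^ 2; P N] +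
            ((N : ℝ) - 1) * Var[fun ω => ‖A ω (i ω) (j ω)‖ ^ 2; P N] : ℝ) : ℂ)) ∧
    -- 5. heavy Wigner matrices
    (∀ A : MatrixSeq Ω, (∀ N, IsWigner (P N) (A N)) →
      ∀ (m : ℕ → ℝ) (a : ℝ),
      (∀ (N : ℕ) (i j : Fin N), i ≠ j → (N : ℝ) * ∫ ω, ‖A N ω i j‖ ^ 4 ∂(P N) = m N) →
      Tendsto m atTop (𝓝 a) → 0 < a →
        (∀ A' U : MatrixSeq Ω,
          (∀ N, IdentDistrib (A' N) (A N) (P N) (P N)) →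
          (∀ N, IsRandomPermMatrix (P N) (U N)) →
          (∀ N, iIndepFun ![A N, A' N, U N] (P N)) →
            ¬ AsympStarFree P (two (single A) (single fun N ω => U N ω * A' N ω * (U N ω)ᴴ))) ∧
        (∀ D : MatrixSeq Ω, (∀ N, HasAllMoments (P N) (D N)) →
          (∀ N, ∀ᵐ ω ∂(P N), (D N ω).IsDiag) → (∀ N, IndepFun (A N) (D N) (P N)) →
          ∀ μ : Measure ℂ, HasLimitingEED P D μ → (∀ z, μ ≠ Measure.dirac z) →
            ¬ AsympStarFree P (two (single A) (single D)))) ∧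
    -- 6. graphs with bounded degree
    (∀ A B : MatrixSeq Ω,
      (∀ N, HasAllMoments (P N) (A N)) → (∀ N, HasAllMoments (P N) (B N)) →
      IsBoundedZeroOne P A → IsBoundedZeroOne P B →
      AsympTrafficFree P (two (single A) (single B)) →
      AsympStarFree P (two (single A) (single B)) →
        (¬ AsympScalar P B → ConvergesLocallyToRegular P A) ∧
        (¬ AsympScalar P A → ConvergesLocallyToRegular P B)) := by
  refine ⟨not_asympStarFree_of_pairs, not_asympStarFree_of_diagonal, ?_, ?_, ?_, ?_⟩
  · exact not_asympStarFree_of_decorrelation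
  · intro N hN A hA hd i j k hlaw hind
    exact kappaN_mul_conjTranspose hN hA hd hlaw hind
  · intro A hW m a hm hma ha
    exact ⟨not_asympStarFree_wigner_conj hW hm hma ha, not_asympStarFree_wigner_diagonal hW hm hma ha⟩
  · intro A B hA hB h01A h01B htf hsf
    have hm := hasAllMoments_two_single hA hB
    have h01 : ∀ i, IsBoundedZeroOne P (two (single A) (single B) i ()) := by
      rintro (_ | _)
      exacts [h01A, h01B]
    exact ⟨fun h => convergesLocallyToRegular_of_not_asympScalar hm h01 htf hsf
        (i := false) (j := true) (by decide) h,
      fun h => convergesLocallyToRegular_of_not_asympScalar hm h01 htf hsf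
        (i := true) (j := false) (by decide) h⟩
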